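/- **Setting.** Let $(\mathcal X,d)$ be a metric space, $P\subseteq\mathcal X$ a dataset of $n$ points (repetitions allowed), $k\ge 1$ an integer, $z\ge 1$ real, $\varepsilon\in(0,1)$. For $C\in\mathcal X^k$ put $d(x,C)=\min_{c\in C}d(x,c)$ and $\mathrm{cost}_z(S,C)=\sum_{p\in S}d^z(p,C)$. A finite multiset $S$ of points with weights $w\ge 0$ is a $\delta$-coreset of $P$ if $\bigl|\sum_{x\in S}w(x)d^z(x,C)-\mathrm{cost}_z(P,C)\bigr|\le\delta\,\mathrm{cost}_z(P,C)$ for all $C\in\mathcal X^k$. Let $A^\star=(a_1^\star,\dots,a_k^\star)\in\mathcal X^k$ be a $c$-approximate solution, i.e. $\mathrm{cost}_z(P,A^\star)\le c\cdot\mathrm{cost}_z(P,C)$ for all $C\in\mathcal X^k$, and $P_1,\dots,P_k$ the partition of $P$ by nearest centers of $A^\star$ (ties broken arbitrarily). **Rings and groups** (logarithms to base 2). Let $\Delta_i=\mathrm{cost}_z(P_i,A^\star)/|P_i|$, $R_{ij}=\{p\in P_i:2^j\Delta_i\le d^z(p,A^\star)<2^{j+1}\Delta_i\}$ $(j\in\mathbb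 Z)$, $R(j)=\bigcup_iR_{ij}$, $R^{(o)}_i=\bigcup_{j\ge 2z\log(z/\varepsilon)}R_{ij}$, $R^{(o)}=\bigcup_iR_i^{(o)}$. For integers $z\log(\varepsilon/z)<j<2z\log(z/\varepsilon)$ and $z\log(\varepsilon/4z)-\log k<b\le0$, the main group $G^{(m)}(j,b)$ is the union of the $R_{ij}$ with $2^b\mathrm{cost}_z(R(j),A^\star)\le\mathrm{cost}_z(R_{ij},A^\star)<2^{b+1}\mathrm{cost}_z(R(j),A^\star)$, and the outer group $G^{(o)}(b)$ is the union of the $R^{(o)}_i$ with $2^b\mathrm{cost}_z(R^{(o)},A^\star)\le\mathrm{cost}_z(R^{(o)}_i,A^\star)<2^{b+1}\mathrm{cost}_z(R^{(o)},A^\star)$. Let $\mathcal G$ be the collection of all nonempty main and outer groups. **Covering numbers.** For a main group $G=G^{(m)}(j,b)$ let $H(G,C)$ consist of the $p\in R_{ij}\cap G$, $i\in[k]$, with $d(a_i^\star,C)\ge 8z\varepsilon^{-1}(2^j\Delta_i)^{1/z}$, and let $$\mathsf{err}(p,C)=\Bigl(\sqrt{d^z(p,C)\,d^z(p,A^\star)}+d^z(p,A^\star)\Bigr)\sqrt{\frac{\mathrm{cost}_z(G,C)+\mathrm{cost}_z(G,A^\star)}{\mathrm{cost}_z(G,A^\star)}}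 .$$ A set $V\subseteq\mathbb R^S$ is an $\alpha$-covering of $S\subseteq G$ if for every $C\in\mathcal X^k$ there is $v\in V$ with $|d^z(p,C)-d^z(a_i^\star,C)-v_p|\le\alpha\,\mathsf{err}(p,C)$ for all $i$ and all $p\in P_i\cap S\setminus H(G,C)$. For an outer group $G$ let $F(G,C)$ consist of the $p\in R_i^{(o)}\cap G$, $i\in[k]$, such that some $q\in R_i^{(o)}\cap G$ has $d^z(q,C)\ge4d^z(q,A^\star)$; here $V$ is an $\alpha$-covering of $S\subseteq G$ if for every $C$ there is $v\in V$ with $|d^z(p,C)-v_p|\le\alpha(d^z(p,C)+d^z(p,A^\star))$ for all $p\in S\setminus F(G,C)$. In both cases let $\mathcal N_G(\Gamma,\alpha)$ be the maximum, over $S\subseteq G$ with $|S|\le\Gamma$, of the minimum cardinality of an $\alpha$-covering of $S$. For a constant $C_0>0$ let $\Gamma_G$ be the smallest integer with $$\Gamma_G\ \ge\ C_0\Bigl(\varepsilon^{-2}\Bigl(\int_0^{\infty}\sqrt{\log\mathcal N_G(\Gamma_G,\alpha)}\,d\alpha\Bigr)^2+k\varepsilon^{-2}\log(k\varepsilon^{-1})\Bigr).$$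 **Algorithm.** Independently for each $G\in\mathcal G$, draw $m_G=\lfloor 2^{Bz}\rfloor\,\Gamma_G$ independent samples from $G$, each equal to $p\in G$ with probability $d^z(p,A^\star)/\mathrm{cost}_z(G,A^\star)$ and then given the weight $\mathrm{cost}_z(G,A^\star)/(m_G\,d^z(p,A^\star))$. Give each $a_i^\star$ the weight $|P_i\setminus\bigcup_{G\in\mathcal G}G|$. Return all the samples (with multiplicity) and $a_1^\star,\dots,a_k^\star$. **Theorem.** There are absolute constants $C_0>0$, $B,T\in\mathbb N$ and, for every $c\ge1$, a constant $K=K(c)$ such that in every metric space, for all $P,k,z,\varepsilon$ and every $c$-approximate $A^\star$ as above, the integers $\Gamma_G$ exist and 1. with probability at least $0.9$, the algorithm outputs a $K\varepsilon$-coreset of $P$ for $(k,z)$-Clustering; 2. the output always has size $k+\sum_{G\in\mathcal G} m_G\le k+2^{Bz}\sum_{G\in\mathcal G}\Gamma_G$; 3. the running time is $O(nk)$ plus the size of the output (so it is $O(nk)$ whenever the output has size at most $nk$): there is one program for a real RAM with unit-cost arithmetic on integers and reals (including powers, logarithms and rounding down), a unit-cost distance oracle and unit-cost uniform random numbers of $[0,1]$,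 which, given $P,A^\star,k,z,\varepsilon$ and the numbers $m_G$, always halts within $T\,(nk+k+\sum_{G\in\mathcal G}m_G)$ steps and whose output has exactly the distribution of the output of the algorithm (for the partition $P_1,\dots,P_k$ with ties broken in favour of the smallest index). -/

import Mathlib

open scoped ENNReal

namespace KZCoreset

noncomputable section

/-! ### The clustering problem -/

/-- `d(x, C) = min_i d(x, C i)`, the distance from a point to a (nonempty, finite) tuple of
centers. -/
def distTo {X : Type*} [MetricSpace X] {k : ℕ} (x : X) (C : Fin k → X) : ℝ :=
  ⨅ i, dist x (C i)

/-- The input data: a dataset `P` of `n` points of `X` (repetitions are allowed), a tuple `A` of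
`k ≥ 1` centers, the exponent `z ≥ 1`, the precision `ε ∈ (0,1)`, and a partition of the dataset
into clusters (`σ p` is the index of the cluster of `p`) that assigns every point to a nearest
center, ties being broken in an arbitrary way. -/
structure Setup (X : Type*) [MetricSpace X] where
  n : ℕ
  k : ℕ
  P : Fin n → X
  A : Fin k → X
  z : ℝ
  ε : ℝ
  σ : Fin n → Fin k
  one_le_k : 1 ≤ k
  one_le_z : 1 ≤ z
  ε_pos : 0 < ε
  ε_lt_one : ε < 1
  nearest : ∀ (p : Fin n) (i : Fin k), dist (P p) (A (σ p)) ≤ dist (P p) (A i)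

/-- Names of groups: `main j b` for the main group of level `j` and band `b`, and `outer b` for
the outer group of band `b`. -/
inductive Label where
  | main (j b : ℤ) : Label
  | outer (b : ℤ) : Label

/-- `√(log N)` for an extended natural number `N`, with the value `∞` at `N = ∞`. -/
def sqrtLog (N : ℕ∞) : ℝ≥0∞ :=
  if N = ⊤ then ⊤ else ENNReal.ofReal (Real.sqrt (Real.log (N.toNat : ℝ)))

/-- The entropy integral `∫_0^∞ √(log N(α)) dα`. -/
def entropyIntegral (N : ℝ → ℕ∞) : ℝ≥0∞ :=
  ∫⁻ α in Set.Ioi (0 : ℝ), sqrtLog (N α)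

namespace Setup

open scoped Classical

variable {X : Type*} [MetricSpace X] (I : Setup X)

/-- `d^z(p, C)` for a point `p` of the dataset. -/
def dz (p : Fin I.n) (C : Fin I.k → X) : ℝ := distTo (I.P p) C ^ I.z

/-- `cost_z(S, C)` for a subset `S` of the dataset. -/
def cost (S : Finset (Fin I.n)) (C : Fin I.k → X) : ℝ := ∑ p ∈ S, I.dz p C

/-- `A` is a `c`-approximate solution of `(k,z)`-clustering on the whole dataset. -/
def IsApprox (c : ℝ) : Prop :=
  ∀ C : Fin I.k → X, I.cost Finset.univ I.A ≤ c * I.cost Finset.univ C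

/-! ### Rings and groups -/

/-- The `i`-th cluster `P_i`. -/
def cluster (i : Fin I.k) : Finset (Fin I.n) := Finset.univ.filter fun p => I.σ p = i

/-- The average cost `Δ_i = cost_z(P_i, A) / |P_i|`. -/
def Δ (i : Fin I.k) : ℝ := I.cost (I.cluster i) I.A / ((I.cluster i).card : ℝ)

/-- The ring `R_ij = {p ∈ P_i : 2^j Δ_i ≤ d^z(p, A) < 2^(j+1) Δ_i}`. -/
def ring (i : Fin I.k) (j : ℤ) : Finset (Fin I.n) :=
  (I.cluster i).filter fun p =>
    (2 : ℝ) ^ j * I.Δ i ≤ I.dz p I.A ∧ I.dz p I.A < (2 : ℝ) ^ (j + 1) * I.Δ i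

/-- `R(j)`, the union over `i` of the rings `R_ij`. -/
def level (j : ℤ) : Finset (Fin I.n) := Finset.univ.filter fun p => p ∈ I.ring (I.σ p) j

/-- Lower end `z log₂(ε/z)` of the main levels. -/
def mainLo : ℝ := I.z * Real.logb 2 (I.ε / I.z)

/-- Upper end `2 z log₂(z/ε)` of the main levels. -/
def mainHi : ℝ := 2 * I.z * Real.logb 2 (I.z / I.ε)

/-- The outer ring of the `i`-th cluster, the union of the `R_ij` with `j ≥ 2 z log₂(z/ε)`. -/
def outerRing (i : Fin I.k) : Finset (Fin I.n) :=
  (I.cluster i).filter fun p => ∃ j : ℤ, I.mainHi ≤ (j : ℝ) ∧ p ∈ I.ring i j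

/-- The union of all outer rings. -/
def outerAll : Finset (Fin I.n) := Finset.univ.filter fun p => p ∈ I.outerRing (I.σ p)

/-- Lower end `z log₂(ε/(4z)) - log₂ k` of the bands. -/
def bandLo : ℝ := I.z * Real.logb 2 (I.ε / (4 * I.z)) - Real.logb 2 (I.k : ℝ)

/-- The set of points of a group: the union of all rings (of the given level, or outer) whose cost
lies in the interval `[2^b, 2^(b+1))` times the total cost of all these rings. -/
def group : Label → Finset (Fin I.n)
  | .main j b => Finset.univ.filter fun p =>
      p ∈ I.ring (I.σ p) j ∧
      (2 : ℝ) ^ b * I.cost (I.level j) I.A ≤ I.cost (I.ring (I.σ p) j) I.A ∧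
      I.cost (I.ring (I.σ p) j) I.A < (2 : ℝ) ^ (b + 1) * I.cost (I.level j) I.A
  | .outer b => Finset.univ.filter fun p =>
      p ∈ I.outerRing (I.σ p) ∧
      (2 : ℝ) ^ b * I.cost I.outerAll I.A ≤ I.cost (I.outerRing (I.σ p)) I.A ∧
      I.cost (I.outerRing (I.σ p)) I.A < (2 : ℝ) ^ (b + 1) * I.cost I.outerAll I.A

/-- The bands: integers `b` with `z log₂(ε/(4z)) - log₂ k < b ≤ 0`. -/
def bands : Finset ℤ := (Finset.Icc ⌊I.bandLo⌋ 0).filter fun b => I.bandLo < (b : ℝ)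

/-- The main levels: integers `j` with `z log₂(ε/z) < j < 2 z log₂(z/ε)`. -/
def mainLevels : Finset ℤ :=
  (Finset.Icc ⌊I.mainLo⌋ ⌈I.mainHi⌉).filter fun j => I.mainLo < (j : ℝ) ∧ (j : ℝ) < I.mainHi

/-- The collection of all (nonempty) main and outer groups. -/
def groups : Finset Label :=
  (((I.mainLevels ×ˢ I.bands).image fun jb => Label.main jb.1 jb.2) ∪
    I.bands.image Label.outer).filter fun g => (I.group g).Nonempty

/-! ### Coverings and covering numbers -/

/-- `p ∈ H(G, C)` for a point `p` of a main group `G` of level `j`: the center of the cluster of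
`p` is at distance at least `8 z ε⁻¹ (2^j Δ_i)^(1/z)` from `C`. -/
def Huge (j : ℤ) (C : Fin I.k → X) (p : Fin I.n) : Prop :=
  8 * I.z / I.ε * ((2 : ℝ) ^ j * I.Δ (I.σ p)) ^ (1 / I.z) ≤ distTo (I.A (I.σ p)) C

/-- `p ∈ F(G, C)` for a point `p` of an outer group `G`: the part of the outer ring of `p` in `G`
has a point `q` with `d^z(q, C) ≥ 4 d^z(q, A)`. -/
def Far (G : Finset (Fin I.n)) (C : Fin I.k → X) (p : Fin I.n) : Prop :=
  ∃ q ∈ G, I.σ q = I.σ p ∧ 4 * I.dz q I.A ≤ I.dz q C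

/-- The relative covering error `err(p, C)` in the group `G`. -/
def err (G : Finset (Fin I.n)) (p : Fin I.n) (C : Fin I.k → X) : ℝ :=
  (Real.sqrt (I.dz p C * I.dz p I.A) + I.dz p I.A) *
    Real.sqrt ((I.cost G C + I.cost G I.A) / I.cost G I.A)

/-- `V ⊆ ℝ^S` is an `α`-covering of the subset `S` of the group `g`. -/
def IsCovering (g : Label) (S : Finset (Fin I.n)) (α : ℝ) (V : Set (S → ℝ)) : Prop :=
  match g with
  | .main j b => ∀ C : Fin I.k → X, ∃ v ∈ V, ∀ p : S, ¬ I.Huge j C p →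
      |I.dz p C - distTo (I.A (I.σ p)) C ^ I.z - v p| ≤ α * I.err (I.group (.main j b)) p C
  | .outer b => ∀ C : Fin I.k → X, ∃ v ∈ V, ∀ p : S, ¬ I.Far (I.group (.outer b)) C p →
      |I.dz p C - v p| ≤ α * (I.dz p C + I.dz p I.A)

/-- The minimum cardinality of an `α`-covering of `S`. -/
def coverNum (g : Label) (S : Finset (Fin I.n)) (α : ℝ) : ℕ∞ :=
  ⨅ (V : Set (S → ℝ)) (_ : I.IsCovering g S α V), V.encard

/-- The `(m, α)`-covering number of the group `g`: the maximum of the covering numbers of its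
subsets of size at most `m`. -/
def groupCoverNum (g : Label) (m : ℕ) (α : ℝ) : ℕ∞ :=
  ⨆ (S : Finset (Fin I.n)) (_ : S ⊆ I.group g ∧ S.card ≤ m), I.coverNum g S α

/-- `m ≥ C₀ (ε⁻² (∫_0^∞ √(log N_g(m, α)) dα)² + k ε⁻² log(k ε⁻¹))`. -/
def Adequate (C₀ : ℝ) (g : Label) (m : ℕ) : Prop :=
  ENNReal.ofReal C₀ *
      (ENNReal.ofReal (1 / I.ε ^ 2) * entropyIntegral (fun α => I.groupCoverNum g m α) ^ 2 +
        ENNReal.ofReal ((I.k : ℝ) / I.ε ^ 2 * Real.log ((I.k : ℝ) / I.ε))) ≤ (m : ℝ≥0∞)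

/-- `Γ_g`, the smallest integer that is adequate for the group `g`. -/
def Γ (C₀ : ℝ) (g : Label) : ℕ := sInf {m : ℕ | I.Adequate C₀ g m}

/-- The number of samples drawn from the group `g`, namely `⌊2^(B z)⌋ Γ_g`. -/
def quota (C₀ : ℝ) (B : ℕ) (g : Label) : ℕ := ⌊(2 : ℝ) ^ ((B : ℝ) * I.z)⌋₊ * I.Γ C₀ g

/-! ### The sampling algorithm -/

/-- One slot for each sample to be drawn, when `m g` samples are drawn from each group `g`. -/
abbrev Slot (m : Label → ℕ) : Type := (g : {g : Label // g ∈ I.groups}) × Fin (m g.1)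

/-- Probability that one sample from the group `g` is the point `p`. -/
def sampleProb (g : Label) (p : Fin I.n) : ℝ :=
  if p ∈ I.group g then I.dz p I.A / I.cost (I.group g) I.A else 0

/-- Probability of an outcome of the sampling, all samples being independent. -/
def weight (m : Label → ℕ) (ω : I.Slot m → Fin I.n) : ℝ :=
  ∏ s : I.Slot m, I.sampleProb s.1.1 (ω s)

/-- Number of points of the `i`-th cluster that lie in no group. -/
def restCount (i : Fin I.k) : ℕ :=
  ((I.cluster i).filter fun p => ∀ g ∈ I.groups, p ∉ I.group g).card

/-- The weighted points returned for the outcome `ω`, counted with multiplicity: every center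
(`Sum.inr i`) with weight `|P_i \ ⋃ groups|`, and every sampled point (`Sum.inl p`) with weight
`cost_z(G, A) / (m_G d^z(p, A))`. -/
def output (m : Label → ℕ) (ω : I.Slot m → Fin I.n) : Multiset ((Fin I.n ⊕ Fin I.k) × ℝ) :=
  (Finset.univ : Finset (Fin I.k)).val.map (fun i => (Sum.inr i, (I.restCount i : ℝ))) +
  (Finset.univ : Finset (I.Slot m)).val.map (fun s =>
    (Sum.inl (ω s), I.cost (I.group s.1.1) I.A / ((m s.1.1 : ℝ) * I.dz (ω s) I.A)))

/-- Probability that the returned weighted multiset has the property `E`. -/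
def prob (m : Label → ℕ) (E : Multiset ((Fin I.n ⊕ Fin I.k) × ℝ) → Prop) : ℝ :=
  ∑ ω : I.Slot m → Fin I.n, if E (I.output m ω) then I.weight m ω else 0

/-- The point of `X` named by `Sum.inl p` (dataset) or `Sum.inr i` (centers). -/
def loc : Fin I.n ⊕ Fin I.k → X := Sum.elim I.P I.A

/-- The weighted multiset `S` is a `δ`-coreset of the dataset for `(k,z)`-clustering. -/
def IsCoreset (δ : ℝ) (S : Multiset ((Fin I.n ⊕ Fin I.k) × ℝ)) : Prop :=
  (∀ x ∈ S, 0 ≤ x.2) ∧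
  ∀ C : Fin I.k → X,
    |(S.map fun x => x.2 * distTo (I.loc x.1) C ^ I.z).sum - I.cost Finset.univ C| ≤
      δ * I.cost Finset.univ C

end Setup

/-! ### A randomized real RAM with a distance oracle

Programs are terms of a small imperative language over arrays of integers and arrays of reals.
Points are accessible only through integer handles and the distance oracle. An execution counts one
step for every executed assignment, random draw, output and test; since the expressions of a
program have bounded size, this is the number of elementary operations up to a constant that depends
on the program only. -/

/-- The two sorts of values. -/
inductive Ty where
  | int : Ty
  | real : Ty

/-- Values of a sort. -/
abbrev Ty.denote : Ty → Type
  | .int => ℤ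
  | .real => ℝ

/-- Expressions. `geti a i` and `getr a i` read the `i`-th entry of the integer (real) array number
`a`; `dist` calls the distance oracle; `quotaMain` and `quotaOuter` read the prescribed number of
samples of a group. -/
inductive Exp : Ty → Type where
  | const (c : ℤ) : Exp .int
  | geti (a : ℕ) (i : Exp .int) : Exp .int
  | addi (x y : Exp .int) : Exp .int
  | subi (x y : Exp .int) : Exp .int
  | muli (x y : Exp .int) : Exp .int
  | floor (x : Exp .real) : Exp .int
  | quotaMain (j b : Exp .int) : Exp .int
  | quotaOuter (b : Exp .int) : Exp .int
  | cast (x : Exp .int) : Exp .real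
  | getr (a : ℕ) (i : Exp .int) : Exp .real
  | addr (x y : Exp .real) : Exp .real
  | subr (x y : Exp .real) : Exp .real
  | mulr (x y : Exp .real) : Exp .real
  | divr (x y : Exp .real) : Exp .real
  | powr (x y : Exp .real) : Exp .real
  | logr (x : Exp .real) : Exp .real
  | dist (x y : Exp .int) : Exp .real

/-- Tests. -/
inductive Test where
  | lti (x y : Exp .int) : Test
  | ltr (x y : Exp .real) : Test
  | not (t : Test) : Test
  | and (t u : Test) : Test

/-- Commands. `draw a i` stores a fresh uniform random number of `[0,1]` in a real array, and
`emit h w` outputs the point with handle `h` and the weight `w`. -/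
inductive Cmd where
  | skip : Cmd
  | seti (a : ℕ) (i x : Exp .int) : Cmd
  | setr (a : ℕ) (i : Exp .int) (x : Exp .real) : Cmd
  | draw (a : ℕ) (i : Exp .int) : Cmd
  | emit (h : Exp .int) (w : Exp .real) : Cmd
  | seq (c d : Cmd) : Cmd
  | ite (t : Test) (c d : Cmd) : Cmd
  | while (t : Test) (c : Cmd) : Cmd

/-- Input that is accessed by queries. -/
structure Oracle where
  dist : ℤ → ℤ → ℝ
  quota : Label → ℕ

/-- Memory: integer arrays, real arrays, number of random numbers used so far, output so far. -/
structure Mem where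
  ints : ℕ → ℤ → ℤ
  reals : ℕ → ℤ → ℝ
  pos : ℕ
  out : List (ℤ × ℝ)

/-- Value of an expression. -/
def Exp.eval (o : Oracle) (s : Mem) : {τ : Ty} → Exp τ → τ.denote
  | _, .const c => c
  | _, .geti a i => s.ints a (i.eval o s)
  | _, .addi x y => (show ℤ from x.eval o s) + (show ℤ from y.eval o s)
  | _, .subi x y => (show ℤ from x.eval o s) - (show ℤ from y.eval o s)
  | _, .muli x y => (show ℤ from x.eval o s) * (show ℤ from y.eval o s)
  | _, .floor x => ⌊(show ℝ from x.eval o s)⌋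
  | _, .quotaMain j b => (o.quota (.main (j.eval o s) (b.eval o s)) : ℤ)
  | _, .quotaOuter b => (o.quota (.outer (b.eval o s)) : ℤ)
  | _, .cast x => ((show ℤ from x.eval o s : ℤ) : ℝ)
  | _, .getr a i => s.reals a (i.eval o s)
  | _, .addr x y => (show ℝ from x.eval o s) + (show ℝ from y.eval o s)
  | _, .subr x y => (show ℝ from x.eval o s) - (show ℝ from y.eval o s)
  | _, .mulr x y => (show ℝ from x.eval o s) * (show ℝ from y.eval o s)
  | _, .divr x y => (show ℝ from x.eval o s) / (show ℝ from y.eval o s)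
  | _, .powr x y => (show ℝ from x.eval o s) ^ (show ℝ from y.eval o s)
  | _, .logr x => Real.log (show ℝ from x.eval o s)
  | _, .dist x y => o.dist (x.eval o s) (y.eval o s)

/-- Truth of a test. -/
def Test.holds (o : Oracle) (s : Mem) : Test → Prop
  | .lti x y => (show ℤ from x.eval o s) < (show ℤ from y.eval o s)
  | .ltr x y => (show ℝ from x.eval o s) < (show ℝ from y.eval o s)
  | .not t => ¬ t.holds o s
  | .and t u => t.holds o s ∧ u.holds o s

/-- Overwriting one entry of one array. -/
def upd {α : Type} (f : ℕ → ℤ → α) (a : ℕ) (i : ℤ) (x : α) : ℕ → ℤ → α :=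
  Function.update f a (Function.update (f a) i x)

/-- `Exec o ω c s s' t`: with oracle `o` and random tape `ω`, the command `c` started in the memory
`s` halts in the memory `s'` after `t` steps. -/
inductive Exec (o : Oracle) (ω : ℕ → ℝ) : Cmd → Mem → Mem → ℕ → Prop where
  | skip (s : Mem) : Exec o ω .skip s s 1
  | seti (s : Mem) (a : ℕ) (i x : Exp .int) :
      Exec o ω (.seti a i x) s { s with ints := upd s.ints a (i.eval o s) (x.eval o s) } 1
  | setr (s : Mem) (a : ℕ) (i : Exp .int) (x : Exp .real) :
      Exec o ω (.setr a i x) s { s with reals := upd s.reals a (i.eval o s) (x.eval o s) } 1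
  | draw (s : Mem) (a : ℕ) (i : Exp .int) :
      Exec o ω (.draw a i) s
        { s with reals := upd s.reals a (i.eval o s) (ω s.pos), pos := s.pos + 1 } 1
  | emit (s : Mem) (h : Exp .int) (w : Exp .real) :
      Exec o ω (.emit h w) s { s with out := (h.eval o s, w.eval o s) :: s.out } 1
  | seq {c d : Cmd} {s s' s'' : Mem} {t t' : ℕ} :
      Exec o ω c s s' t → Exec o ω d s' s'' t' → Exec o ω (.seq c d) s s'' (t + t')
  | ite_true {b : Test} {c d : Cmd} {s s' : Mem} {t : ℕ} :
      b.holds o s → Exec o ω c s s' t → Exec o ω (.ite b c d) s s' (t + 1)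
  | ite_false {b : Test} {c d : Cmd} {s s' : Mem} {t : ℕ} :
      ¬ b.holds o s → Exec o ω d s s' t → Exec o ω (.ite b c d) s s' (t + 1)
  | while_true {b : Test} {c : Cmd} {s s' s'' : Mem} {t t' : ℕ} :
      b.holds o s → Exec o ω c s s' t → Exec o ω (.while b c) s' s'' t' →
      Exec o ω (.while b c) s s'' (t + t' + 1)
  | while_false {b : Test} {c : Cmd} {s : Mem} :
      ¬ b.holds o s → Exec o ω (.while b c) s s 1

/-- The law of a tape of independent uniform random numbers of `[0,1]`. -/
def tapeLaw : MeasureTheory.Measure (ℕ → ℝ) :=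
  MeasureTheory.Measure.infinitePi fun _ : ℕ =>
    (MeasureTheory.volume : MeasureTheory.Measure ℝ).restrict (Set.Icc 0 1)

namespace Setup

open scoped Classical

variable {X : Type*} [MetricSpace X] (I : Setup X)

/-- The handle of a point: `0, …, n-1` for the dataset and `n, …, n+k-1` for the centers. -/
def handle : Fin I.n ⊕ Fin I.k → ℤ :=
  Sum.elim (fun p => (p.val : ℤ)) (fun i => (I.n : ℤ) + (i.val : ℤ))

/-- The point with a given handle, if there is one. -/
def pointAt (h : ℤ) : Option X :=
  if h₁ : 0 ≤ h ∧ h.toNat < I.n then some (I.P ⟨h.toNat, h₁.2⟩)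
  else if h₂ : (I.n : ℤ) ≤ h ∧ (h - I.n).toNat < I.k then some (I.A ⟨(h - I.n).toNat, h₂.2⟩)
  else none

/-- The oracle: distances between points given by handles, and the numbers of samples. -/
def oracle (m : Label → ℕ) : Oracle where
  dist a b :=
    match I.pointAt a, I.pointAt b with
    | some x, some y => dist x y
    | _, _ => 0
  quota := m

/-- The initial memory: `n` and `k` are in the integer array `0`, `z` and `ε` in the real array
`0`, and all other entries are `0`. -/
def initMem : Mem where
  ints := upd (upd (fun _ _ => 0) 0 0 (I.n : ℤ)) 0 1 (I.k : ℤ)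
  reals := upd (upd (fun _ _ => 0) 0 0 I.z) 0 1 I.ε
  pos := 0
  out := []

/-- Ties in the choice of a nearest center are broken in favour of the smallest index. -/
def TiesToFirst : Prop :=
  ∀ (p : Fin I.n) (i : Fin I.k), i < I.σ p → dist (I.P p) (I.A (I.σ p)) < dist (I.P p) (I.A i)

/-- The program `c`, which is given `P`, `A`, `z`, `ε` and the numbers of samples `m`, halts within
`t` steps on every tape, and its random output has the same distribution as the output of the
sampling algorithm. -/
def ImplementedWithin (m : Label → ℕ) (c : Cmd) (t : ℕ) : Prop :=
  (∀ ω : ℕ → ℝ, (∀ i, ω i ∈ Set.Icc (0 : ℝ) 1) →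
    ∃ s' t', Exec (I.oracle m) ω c I.initMem s' t' ∧ t' ≤ t) ∧
  ∀ S : Multiset ((Fin I.n ⊕ Fin I.k) × ℝ),
    tapeLaw {ω | ∃ s' t', Exec (I.oracle m) ω c I.initMem s' t' ∧
      (s'.out : Multiset (ℤ × ℝ)) = S.map fun x => (I.handle x.1, x.2)} =
    ENNReal.ofReal (I.prob m fun S' => S' = S)

end Setup

end

end KZCoreset

/-! ### Finite weighted probability spaces: tail bounds and symmetrization -/

namespace KZCoreset
noncomputable section

set_option linter.unusedSectionVars false
set_option linter.unusedDecidableInType false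

section FiniteProbability
open scoped Classical

/-! Each group is estimated without bias, so the coreset property is a statement about deviations
that has to hold for all `C` at once. Three errors are added up.

Points outside all groups are moved to their centers. They lie very close to the center or in very
cheap rings, so `cost_rest_le` bounds their cost by `4 (ε/z)^z` times the cost of `A`. This cancels
the factor `(z/ε)^z` that a triangle inequality with relative loss of order `ε` costs (`rpow_snap`),
and `rest_error_le` follows.

In a main group the cost of a point is the cost of its center plus a residual. The center part is
constant on clusters, so it suffices that the weight of every ring is estimated well (`Typical`, by
Chernoff's inequality and a union bound over clusters). Some clusters are masked, that is, exempt
from the coverings. In a main group a masked center is so far from `C` that the residual is at most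
`ε` times the center part (`dz_near_of_masked`). In an outer group the cost of a masked ring is
charged to its whole cluster, most of which sits near the center and pays far more
(`far_cluster_le`); a cluster is charged by one group only (`outerTouch_disjoint`).

What remains is the residual on unmasked clusters, treated by `deviation`. A ghost sample and random
exchanges reduce it to signed sums over at most `2m` points, and `chaining` bounds these by a sum
over dyadic scales, which is at most twice the entropy integral (`sum_le_entropy`). Sets of `2m`
points are cut into pieces of size `Γ` (`exists_net`); this multiplies the logarithms of the net
sizes by the factor `2m/Γ`, so `ε √Γ` turns into `ε √m` up to a constant.

Two features go beyond standard chaining. First, the variance proxy `N (W d + T)` contains the cost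
of the sample, which has no a priori bound. It is at most the deviation plus `10 m N`
(`samp_cluster_le`), so the deviation is bounded through its own square root, and `self_bound`
closes the argument. Second, the mask depends on `C`, and a union bound over the `choose k s` masks
of size `s` is needed. It is paid for by the exponent `(s + 1) expo`. This is affordable because `s`
masked rings make `C` expensive: each carries about a `1/k` share of the weighted cost of any
unmasked point (`dz_le_fiber_cost`), so the squared range `spread s ^ 2` is proportional to `k / (s
+ 1)`, and its product with the exponent does not depend on `s` (`spread_mul_sqrt_le`).

A group fails with probability at most `26 k exp (-expo)`, where `expo = 40 z log (2k/ε)`, while the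
number of groups is polynomial in `z` and `k/ε` (`failure_le`). The numbers `Γ` exist because grids
bound the entropy integral uniformly in the number of points (`exists_entropy_bound`).

The program finds levels and bands in `O(nk)` steps, encodes each group by an integer key, and
builds for each group an alias table in time linear in its size. One uniform number then yields one
sample in constant time (`exists_alias`, `volume_piece`). Different samples read different entries
of the tape, so the output has the required law (`law_of_samples`, `implementedWithin_cMain`). -/

/-- The total weight of an event on a finite set. -/
def pr {Ω : Type*} [Fintype Ω] (W : Ω → ℝ) (E : Ω → Prop) : ℝ := ∑ ω, if E ω then W ω else 0

/-- The weight of a tuple of independent draws from `q`. -/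
def prodW {ι α : Type*} [Fintype ι] (q : α → ℝ) (x : ι → α) : ℝ := ∏ i, q (x i)

variable {Ω : Type*} [Fintype Ω] {W : Ω → ℝ} {E F : Ω → Prop}

theorem pr_nonneg (hW : ∀ ω, 0 ≤ W ω) : 0 ≤ pr W E :=
  Finset.sum_nonneg fun ω _ => by split_ifs <;> simp [hW]

/-- Outcomes of weight zero may be ignored. Later this is what allows the assumption that all
samples lie in their group. -/
theorem pr_mono_of_ne (hW : ∀ ω, 0 ≤ W ω) (h : ∀ ω, W ω ≠ 0 → E ω → F ω) : pr W E ≤ pr W F := by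
  refine Finset.sum_le_sum fun ω _ => ?_
  by_cases hE : E ω
  · by_cases h0 : W ω = 0
    · simp [h0]
    · simp [hE, h ω h0 hE]
  · simp only [hE, if_false]; split_ifs <;> simp [hW]

theorem pr_mono (hW : ∀ ω, 0 ≤ W ω) (h : ∀ ω, E ω → F ω) : pr W E ≤ pr W F :=
  pr_mono_of_ne hW fun ω _ => h ω

theorem pr_or_le (hW : ∀ ω, 0 ≤ W ω) : pr W (fun ω => E ω ∨ F ω) ≤ pr W E + pr W F := by
  unfold pr
  rw [← Finset.sum_add_distrib]
  refine Finset.sum_le_sum fun ω _ => ?_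
  have := hW ω
  by_cases hE : E ω <;> by_cases hF : F ω <;> simp [hE, hF, this]

theorem pr_exists_le {κ : Type*} (hW : ∀ ω, 0 ≤ W ω) (s : Finset κ) (D : κ → Ω → Prop) :
    pr W (fun ω => ∃ i ∈ s, D i ω) ≤ ∑ i ∈ s, pr W (D i) := by
  induction s using Finset.induction_on with
  | empty => simp [pr]
  | insert a s ha ih =>
    rw [Finset.sum_insert ha]
    refine le_trans (le_trans (pr_mono hW ?_) (pr_or_le (E := D a)
      (F := fun ω => ∃ i ∈ s, D i ω) hW)) (by gcongr)
    intro ω h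
    obtain ⟨i, hi, h⟩ := h
    rcases Finset.mem_insert.1 hi with rfl | hi
    · exact Or.inl h
    · exact Or.inr ⟨i, hi, h⟩

theorem pr_add_pr_not : pr W E + pr W (fun ω => ¬ E ω) = ∑ ω, W ω := by
  unfold pr
  rw [← Finset.sum_add_distrib]
  refine Finset.sum_congr rfl fun ω _ => ?_
  by_cases hE : E ω <;> simp [hE]

theorem pr_mul_le_sum (hW : ∀ ω, 0 ≤ W ω) (f : Ω → ℝ) (hf : ∀ ω, 0 ≤ f ω) (t : ℝ)
    (h : ∀ ω, E ω → t ≤ f ω) : pr W E * t ≤ ∑ ω, W ω * f ω := by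
  unfold pr
  rw [Finset.sum_mul]
  refine Finset.sum_le_sum fun ω _ => ?_
  by_cases hE : E ω
  · simp only [hE, if_true]; exact mul_le_mul_of_nonneg_left (h ω hE) (hW ω)
  · simp only [hE, if_false, zero_mul]; exact mul_nonneg (hW ω) (hf ω)

theorem pr_le_exp (hW : ∀ ω, 0 ≤ W ω) (f : Ω → ℝ) (t : ℝ) (h : ∀ ω, E ω → t ≤ f ω) :
    pr W E ≤ Real.exp (-t) * ∑ ω, W ω * Real.exp (f ω) := by
  have := pr_mul_le_sum (E := E) hW (fun ω => Real.exp (f ω)) (fun ω => (Real.exp_pos _).le)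
    (Real.exp t) fun ω hω => Real.exp_le_exp.2 (h ω hω)
  rw [Real.exp_neg, ← div_eq_inv_mul, le_div_iff₀ (Real.exp_pos _)]
  exact this

section Product
variable {ι α : Type*} [Fintype ι] [DecidableEq ι] [Fintype α] {q : α → ℝ}

theorem sum_prod_eq (f : ι → α → ℝ) : ∑ x : ι → α, ∏ i, f i (x i) = ∏ i, ∑ a, f i a := by
  rw [Finset.prod_univ_sum, Fintype.piFinset_univ]

theorem prodW_nonneg (hq : ∀ a, 0 ≤ q a) (x : ι → α) : 0 ≤ prodW q x :=
  Finset.prod_nonneg fun _ _ => hq _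

theorem sum_prodW_mul_prod (f : ι → α → ℝ) :
    ∑ x : ι → α, prodW q x * ∏ i, f i (x i) = ∏ i, ∑ a, q a * f i a := by
  rw [← sum_prod_eq]
  exact Finset.sum_congr rfl fun x _ => by rw [prodW, Finset.prod_mul_distrib]

theorem sum_prodW (h1 : ∑ a, q a = 1) : ∑ x : ι → α, prodW q x = 1 := by
  have := sum_prod_eq (ι := ι) fun _ a => q a
  simpa [h1, prodW] using this

theorem sum_prodW_exp (f : α → ℝ) :
    ∑ x : ι → α, prodW q x * Real.exp (∑ i, f (x i)) =
      (∑ a, q a * Real.exp (f a)) ^ Fintype.card ι := by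
  have := sum_prodW_mul_prod (q := q) (ι := ι) fun _ a => Real.exp (f a)
  simpa [Real.exp_sum] using this

/-- `exp x ≤ 1 + x + x²` for `|x| ≤ 1`, and `Z² ≤ Z` replaces the second moment by the mean. The
exponent is therefore proportional to the mean, which is what a multiplicative tail bound needs. -/
theorem sum_mul_exp_le (hq : ∀ a, 0 ≤ q a) (h1 : ∑ a, q a = 1) {Z : α → ℝ} (hZ0 : ∀ a, 0 ≤ Z a)
    (hZ1 : ∀ a, Z a ≤ 1) {l : ℝ} (hl : |l| ≤ 1) :
    ∑ a, q a * Real.exp (l * Z a) ≤ Real.exp ((l + l ^ 2) * ∑ a, q a * Z a) := by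
  have h : ∀ a, q a * Real.exp (l * Z a) ≤ q a + (l + l ^ 2) * (q a * Z a) := by
    intro a
    have h2 : |l * Z a| ≤ 1 := by
      rw [abs_mul, abs_of_nonneg (hZ0 a)]
      exact mul_le_one₀ hl (hZ0 a) (hZ1 a)
    have h3 := (abs_le.1 (Real.abs_exp_sub_one_sub_id_le h2)).2
    have h4 : (l * Z a) ^ 2 ≤ l ^ 2 * Z a := by
      rw [mul_pow]
      exact mul_le_mul_of_nonneg_left (by nlinarith [hZ0 a, hZ1 a]) (sq_nonneg _)
    nlinarith [hq a, mul_le_mul_of_nonneg_left (show Real.exp (l * Z a) ≤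
      1 + l * Z a + l ^ 2 * Z a by linarith) (hq a)]
  calc _ ≤ ∑ a, (q a + (l + l ^ 2) * (q a * Z a)) := Finset.sum_le_sum fun a _ => h a
    _ = (l + l ^ 2) * (∑ a, q a * Z a) + 1 := by
      rw [Finset.sum_add_distrib, h1, ← Finset.mul_sum]; ring
    _ ≤ _ := Real.add_one_le_exp _

/-- Multiplicative Chernoff bound for independent draws. -/
theorem chernoff (hq : ∀ a, 0 ≤ q a) (h1 : ∑ a, q a = 1) {Z : α → ℝ} (hZ0 : ∀ a, 0 ≤ Z a)
    (hZ1 : ∀ a, Z a ≤ 1) {η : ℝ} (hη0 : 0 ≤ η) (hη1 : η ≤ 1) :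
    pr (prodW q) (fun x : ι → α => η * (Fintype.card ι * ∑ a, q a * Z a) <
      |∑ i, Z (x i) - Fintype.card ι * ∑ a, q a * Z a|) ≤
      2 * Real.exp (-(Fintype.card ι * (∑ a, q a * Z a) * η ^ 2 / 4)) := by
  set m : ℝ := (Fintype.card ι : ℝ) with hm
  set μ := ∑ a, q a * Z a with hμ
  have hμ0 : 0 ≤ μ := Finset.sum_nonneg fun a _ => mul_nonneg (hq a) (hZ0 a)
  have key : ∀ l : ℝ, |l| ≤ 1 → ∀ t : ℝ,
      pr (prodW q) (fun x : ι → α => t ≤ ∑ i, l * Z (x i)) ≤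
        Real.exp (-t + m * ((l + l ^ 2) * μ)) := by
    intro l hl t
    refine (pr_le_exp (prodW_nonneg hq) (fun x : ι → α => ∑ i, l * Z (x i)) t
      fun _ h => h).trans ?_
    rw [sum_prodW_exp (q := q) (ι := ι) fun a => l * Z a, Real.exp_add]
    gcongr
    rw [hm, Real.exp_nat_mul]
    exact pow_le_pow_left₀ (Finset.sum_nonneg fun a _ => mul_nonneg (hq a) (Real.exp_pos _).le)
      (sum_mul_exp_le hq h1 hZ0 hZ1 hl) _
  -- In units of `m μ` the exponent is `-lη + l²` for the upper tail and `lη + l²` for the lower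
  -- one; the choices `l = ± η / 2` are optimal and give `-η² / 4`.
  have a1 := key (η / 2) (by rw [abs_of_nonneg (by positivity)]; linarith)
    (η / 2 * (m * μ * (1 + η)))
  have a2 := key (-(η / 2)) (by rw [abs_neg, abs_of_nonneg (by positivity)]; linarith)
    (-(η / 2) * (m * μ * (1 - η)))
  have e1 : -(η / 2 * (m * μ * (1 + η))) + m * ((η / 2 + (η / 2) ^ 2) * μ) =
    -(m * μ * η ^ 2 / 4) := by ring
  have e2 : -(-(η / 2) * (m * μ * (1 - η))) + m * ((-(η / 2) + (-(η / 2)) ^ 2) * μ) =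
    -(m * μ * η ^ 2 / 4) := by ring
  rw [e1] at a1
  rw [e2] at a2
  rw [two_mul]
  refine le_trans (le_trans (pr_mono (prodW_nonneg hq) ?_) (pr_or_le (prodW_nonneg hq)))
    (add_le_add a1 a2)
  intro x hx
  simp only [← Finset.mul_sum]
  rcases lt_abs.1 hx with h | h
  · left
    exact mul_le_mul_of_nonneg_left (by linarith) (by positivity)
  · right
    rw [neg_mul, neg_mul, neg_le_neg_iff]
    exact mul_le_mul_of_nonneg_left (by linarith) (by positivity)

/-- After expanding the square, independence factorizes each product, and centering kills the terms
with two different indices. -/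
theorem sum_prodW_sq (h1 : ∑ a, q a = 1) {h : α → ℝ} (h0 : ∑ a, q a * h a = 0) :
    ∑ x : ι → α, prodW q x * (∑ i, h (x i)) ^ 2 = Fintype.card ι * ∑ a, q a * h a ^ 2 := by
  have e : ∀ i j : ι, ∑ x : ι → α, prodW q x * (h (x i) * h (x j)) =
      if i = j then ∑ a, q a * h a ^ 2 else 0 := by
    intro i j
    have := sum_prodW_mul_prod (q := q) (ι := ι) fun l a =>
      (if l = i then h a else 1) * (if l = j then h a else 1)
    simp only [Finset.prod_mul_distrib, Finset.prod_ite_eq', Finset.mem_univ, if_true] at this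
    rw [this]
    split_ifs with hij
    · subst hij
      rw [Finset.prod_eq_single i]
      · simp [sq]
      · intro b _ hb; simp [hb, h1]
      · simp
    · refine Finset.prod_eq_zero (Finset.mem_univ i) ?_
      simp [hij, h0]
  calc _ = ∑ x : ι → α, ∑ i, ∑ j, prodW q x * (h (x i) * h (x j)) := by
        refine Finset.sum_congr rfl fun x _ => ?_
        rw [sq, Finset.sum_mul_sum, Finset.mul_sum]
        simp_rw [Finset.mul_sum]
    _ = ∑ i, ∑ j, ∑ x : ι → α, prodW q x * (h (x i) * h (x j)) := by
        rw [Finset.sum_comm]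
        refine Finset.sum_congr rfl fun i _ => ?_
        rw [Finset.sum_comm]
    _ = _ := by simp [e]

/-- Chebyshev's inequality for a sum of independent draws. -/
theorem chebyshev (hq : ∀ a, 0 ≤ q a) (h1 : ∑ a, q a = 1) (g : α → ℝ) {t : ℝ} (ht : 0 ≤ t) :
    pr (prodW q) (fun x : ι → α => t ≤ |∑ i, g (x i) - Fintype.card ι * ∑ a, q a * g a|) * t ^ 2 ≤
      Fintype.card ι * ∑ a, q a * g a ^ 2 := by
  set μ := ∑ a, q a * g a with hμ
  have h0 : ∑ a, q a * (g a - μ) = 0 := by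
    simp_rw [mul_sub]
    rw [Finset.sum_sub_distrib, ← Finset.sum_mul, h1, ← hμ]; ring
  have h2 := sum_prodW_sq (ι := ι) h1 h0
  refine (pr_mul_le_sum (prodW_nonneg hq) (fun x : ι → α => (∑ i, (g (x i) - μ)) ^ 2)
    (fun _ => sq_nonneg _) (t ^ 2) ?_).trans ?_
  · intro x hx
    rw [← sq_abs (∑ i, (g (x i) - μ))]
    refine pow_le_pow_left₀ ht ?_ 2
    simpa [Finset.sum_sub_distrib] using hx
  · rw [h2]
    refine mul_le_mul_of_nonneg_left ?_ (Nat.cast_nonneg _)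
    have : ∑ a, q a * (g a - μ) ^ 2 = ∑ a, q a * g a ^ 2 - μ ^ 2 := by
      have : ∀ a, q a * (g a - μ) ^ 2 = q a * g a ^ 2 - 2 * μ * (q a * g a) + μ ^ 2 * q a :=
        fun a => by ring
      simp_rw [this]
      rw [Finset.sum_add_distrib, Finset.sum_sub_distrib, ← Finset.mul_sum, ← Finset.mul_sum, h1,
        ← hμ]
      ring
    rw [this]
    nlinarith [sq_nonneg μ]

/-- The sign attached to a bit. -/
def sgn (b : Bool) : ℝ := if b then 1 else -1

/-- The uniform distribution on bits. -/
def coin : Bool → ℝ := fun _ => 1 / 2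

theorem coin_nonneg (b : Bool) : 0 ≤ coin b := by simp [coin]

theorem sum_coin : ∑ b, coin b = 1 := by simp [coin]

/-- The exponential moment factorizes, and every factor is `cosh (a i) ≤ exp (a i ^ 2 / 2)`. -/
theorem rademacher_exp (a : ι → ℝ) :
    ∑ σ : ι → Bool, prodW coin σ * Real.exp (∑ i, sgn (σ i) * a i) ≤
      Real.exp ((∑ i, a i ^ 2) / 2) := by
  have := sum_prodW_mul_prod (q := coin) (ι := ι) fun i b => Real.exp (sgn b * a i)
  simp only [← Real.exp_sum] at this
  rw [this, Finset.sum_div, Real.exp_sum]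
  refine Finset.prod_le_prod (fun i _ => Finset.sum_nonneg fun b _ =>
    mul_nonneg (coin_nonneg b) (Real.exp_pos _).le) fun i _ => ?_
  refine le_trans (le_of_eq ?_) (Real.cosh_le_exp_half_sq (a i))
  rw [Real.cosh_eq]
  simp [coin, sgn]
  ring

/-- Hoeffding's inequality for signed sums. -/
theorem rademacher_tail (a : ι → ℝ) {l V : ℝ} (hl : 0 ≤ l) (hV : ∑ i, a i ^ 2 ≤ V) :
    pr (prodW coin) (fun σ : ι → Bool => Real.sqrt (2 * l * V) < |∑ i, sgn (σ i) * a i|) ≤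
      2 * Real.exp (-l) := by
  have hS0 : 0 ≤ ∑ i, a i ^ 2 := Finset.sum_nonneg fun i _ => sq_nonneg _
  -- If `V = 0`, all coefficients vanish and the strict inequality never holds; otherwise one may
  -- divide by `V`.
  rcases eq_or_lt_of_le (hS0.trans hV) with h0 | h0
  · have hz : ∀ i, a i = 0 := by
      intro i
      have h3 : ∑ i, a i ^ 2 = 0 := le_antisymm (by linarith) hS0
      have := (Finset.sum_eq_zero_iff_of_nonneg fun i _ => sq_nonneg (a i)).1 h3 i
        (Finset.mem_univ i)
      exact pow_eq_zero_iff (two_ne_zero) |>.1 this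
    have : pr (prodW coin) (fun σ : ι → Bool =>
        Real.sqrt (2 * l * V) < |∑ i, sgn (σ i) * a i|) = 0 := by
      unfold pr
      refine Finset.sum_eq_zero fun σ _ => if_neg ?_
      simp [hz]
    rw [this]; positivity
  -- The minimizer of `-θ t + θ² V / 2` for the threshold `t = √(2 l V)`.
  set θ := Real.sqrt (2 * l / V) with hθ
  have hθ2 : θ ^ 2 * V = 2 * l := by
    rw [hθ, Real.sq_sqrt (by positivity)]; field_simp
  have hθs : θ * Real.sqrt (2 * l * V) = 2 * l := by
    rw [hθ, ← Real.sqrt_mul (by positivity)]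
    have : 2 * l / V * (2 * l * V) = (2 * l) ^ 2 := by field_simp
    rw [this, Real.sqrt_sq (by positivity)]
  have key : ∀ s : ℝ, s ^ 2 = 1 →
      pr (prodW coin) (fun σ : ι → Bool => 2 * l ≤ ∑ i, sgn (σ i) * (s * θ * a i)) ≤
        Real.exp (-l) := by
    intro s hs
    refine (pr_le_exp (prodW_nonneg coin_nonneg) _ (2 * l) fun _ h => h).trans ?_
    calc _ ≤ Real.exp (-(2 * l)) * Real.exp ((∑ i, (s * θ * a i) ^ 2) / 2) := by
          gcongr; exact rademacher_exp _
      _ ≤ _ := by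
          rw [← Real.exp_add, Real.exp_le_exp]
          have : ∑ i, (s * θ * a i) ^ 2 = θ ^ 2 * ∑ i, a i ^ 2 := by
            rw [Finset.mul_sum]
            refine Finset.sum_congr rfl fun i _ => ?_
            rw [mul_pow, mul_pow, hs]; ring
          rw [this]
          nlinarith [mul_le_mul_of_nonneg_left hV (sq_nonneg θ)]
  rw [two_mul (Real.exp (-l))]
  refine le_trans (le_trans (pr_mono (prodW_nonneg coin_nonneg) ?_)
    (pr_or_le (prodW_nonneg coin_nonneg)))
    (add_le_add (key 1 (by norm_num)) (key (-1) (by norm_num)))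
  intro σ hσ
  have e : ∀ s : ℝ, ∑ i, sgn (σ i) * (s * θ * a i) = s * (θ * ∑ i, sgn (σ i) * a i) := by
    intro s
    rw [Finset.mul_sum, Finset.mul_sum]
    exact Finset.sum_congr rfl fun i _ => by ring
  simp only [e]
  have hθ0 : 0 ≤ θ := Real.sqrt_nonneg _
  rw [← hθs]
  rcases lt_abs.1 hσ with h | h
  · left; rw [one_mul]; exact mul_le_mul_of_nonneg_left h.le hθ0
  · right; nlinarith [mul_le_mul_of_nonneg_left h.le hθ0]

/-- Exchanging the two coordinates at the places where `σ` is `false`. -/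
def swapAt (σ : ι → Bool) (z : ι → α × α) : ι → α × α :=
  fun i => if σ i then z i else (z i).swap

/-- The weight of a pair of independent draws. -/
def pairW (q : α → ℝ) (z : α × α) : ℝ := q z.1 * q z.2

theorem pairW_nonneg (hq : ∀ a, 0 ≤ q a) (z : α × α) : 0 ≤ pairW q z := mul_nonneg (hq _) (hq _)

theorem sum_pairW (h1 : ∑ a, q a = 1) : ∑ z, pairW q z = 1 := by
  simp only [pairW, Fintype.sum_prod_type, ← Finset.mul_sum, h1, mul_one]

theorem swapAt_swapAt (σ : ι → Bool) (z : ι → α × α) : swapAt σ (swapAt σ z) = z := by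
  funext i
  by_cases h : σ i <;> simp [swapAt, h]

theorem prodW_swapAt (σ : ι → Bool) (z : ι → α × α) :
    prodW (pairW q) (swapAt σ z) = prodW (pairW q) z := by
  refine Finset.prod_congr rfl fun i _ => ?_
  by_cases h : σ i
  · simp [swapAt, h]
  · simp [swapAt, h, pairW, mul_comm]

/-- An event on pairs of samples has small probability as soon as this holds for random exchanges,
conditionally on the pairs. -/
theorem pr_le_of_swap (hq : ∀ a, 0 ≤ q a) (h1 : ∑ a, q a = 1) {B : (ι → α × α) → Prop} {δ : ℝ}
    (hB : ∀ z, (∀ i, pairW q (z i) ≠ 0) → pr (prodW coin) (fun σ => B (swapAt σ z)) ≤ δ) :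
    pr (prodW (pairW q)) B ≤ δ := by
  -- Each exchange is a weight-preserving involution of the pairs, so the probability equals its
  -- average over all `σ`; after changing the order of summation the pairs are fixed and only `σ` is
  -- random.
  have hinv : ∀ σ : ι → Bool, pr (prodW (pairW q)) B =
      pr (prodW (pairW q)) fun z => B (swapAt σ z) := by
    intro σ
    unfold pr
    refine (Fintype.sum_equiv (Function.Involutive.toPerm (swapAt σ) (swapAt_swapAt σ)) _ _
      fun z => ?_).symm
    simp [Function.Involutive.toPerm, prodW_swapAt]
  have hs := sum_prodW (ι := ι) sum_coin
  calc pr (prodW (pairW q)) B = ∑ σ : ι → Bool, prodW coin σ * pr (prodW (pairW q)) B := by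
        rw [← Finset.sum_mul, hs, one_mul]
    _ = ∑ σ : ι → Bool, prodW coin σ * pr (prodW (pairW q)) fun z => B (swapAt σ z) :=
        Finset.sum_congr rfl fun σ _ => by rw [hinv σ]
    _ = ∑ z, prodW (pairW q) z * pr (prodW coin) (fun σ : ι → Bool => B (swapAt σ z)) := by
        unfold pr
        simp_rw [Finset.mul_sum]
        rw [Finset.sum_comm]
        refine Finset.sum_congr rfl fun z _ => Finset.sum_congr rfl fun σ _ => ?_
        split_ifs <;> ring
    _ ≤ ∑ z, prodW (pairW q) z * δ := by
        refine Finset.sum_le_sum fun z _ => ?_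
        by_cases hz : ∀ i, pairW q (z i) ≠ 0
        · exact mul_le_mul_of_nonneg_left (hB z hz) (prodW_nonneg (pairW_nonneg hq) z)
        · push Not at hz
          obtain ⟨i, hi⟩ := hz
          have : prodW (pairW q) z = 0 := Finset.prod_eq_zero (Finset.mem_univ i) hi
          simp [this]
    _ = δ := by rw [← Finset.sum_mul, sum_prodW (sum_pairW h1), one_mul]

/-- Passing to a ghost sample. -/
theorem pr_le_two_mul_ghost (hq : ∀ a, 0 ≤ q a) {A : (ι → α) → Prop} {B : (ι → α × α) → Prop}
    (hAB : ∀ x, (∀ i, q (x i) ≠ 0) → A x →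
      1 / 2 ≤ pr (prodW q) fun y => B fun i => (x i, y i)) :
    pr (prodW q) A ≤ 2 * pr (prodW (pairW q)) B := by
  have e : pr (prodW (pairW q)) B =
      ∑ x : ι → α, prodW q x * pr (prodW q) fun y => B fun i => (x i, y i) := by
    unfold pr
    simp_rw [Finset.mul_sum]
    rw [← Fintype.sum_prod_type']
    refine Fintype.sum_equiv (Equiv.arrowProdEquivProdArrow ι (fun _ => α) (fun _ => α)) _ _
      fun z => ?_
    have : prodW (pairW q) z = prodW q (fun i => (z i).1) * prodW q fun i => (z i).2 := by
      simp [prodW, pairW, Finset.prod_mul_distrib]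
    by_cases hB : B z
    · exact (if_pos hB).trans (this.trans (congrArg (fun t => prodW q (fun i => (z i).1) * t)
        (if_pos (show B fun i => ((z i).1, (z i).2) from hB)).symm))
    · exact (if_neg hB).trans ((mul_zero _).symm.trans (congrArg
        (fun t => prodW q (fun i => (z i).1) * t)
        (if_neg (show ¬ B fun i => ((z i).1, (z i).2) from hB)).symm))
  rw [e, Finset.mul_sum]
  refine Finset.sum_le_sum fun x _ => ?_
  have hx := prodW_nonneg hq x
  by_cases hA : A x
  · simp only [hA, if_true]
    by_cases h0 : ∀ i, q (x i) ≠ 0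
    · nlinarith [mul_le_mul_of_nonneg_left (hAB x h0 hA) hx]
    · push Not at h0
      obtain ⟨i, hi⟩ := h0
      have : prodW q x = 0 := Finset.prod_eq_zero (Finset.mem_univ i) hi
      simp [this]
  · simp only [hA, if_false]
    have := pr_nonneg (E := fun y : ι → α => B fun i => (x i, y i)) (prodW_nonneg hq)
    positivity

end Product

/-- The law of one block of an independent family of blocks. -/
theorem pr_block {γ α : Type*} [Fintype γ] [DecidableEq γ] [Fintype α] {ι : γ → Type*}
    [∀ g, Fintype (ι g)] [∀ g, DecidableEq (ι g)]
    {q : γ → α → ℝ} (h1 : ∀ g, ∑ a, q g a = 1) (E : ∀ g, (ι g → α) → Prop) (g₀ : γ) :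
    pr (fun ω : (Σ g, ι g) → α => ∏ s, q s.1 (ω s)) (fun ω => E g₀ fun i => ω ⟨g₀, i⟩) =
      pr (prodW (q g₀)) (E g₀) := by
  -- The event is absorbed into the factor of the block `g₀`. The sum over all families becomes a
  -- product of sums over blocks, and all other factors are one.
  let f : ∀ g, (ι g → α) → ℝ := fun g y => if g = g₀ ∧ ¬ E g y then 0 else prodW (q g) y
  have e : pr (fun ω : (Σ g, ι g) → α => ∏ s, q s.1 (ω s)) (fun ω => E g₀ fun i => ω ⟨g₀, i⟩) =
      ∑ x : ∀ g, ι g → α, ∏ g, f g (x g) := by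
    unfold pr
    refine Fintype.sum_equiv (Equiv.piCurry fun g (_ : ι g) => α) _ _ fun ω => ?_
    have hc : ∀ g, (Equiv.piCurry (fun g (_ : ι g) => α)) ω g = fun i => ω ⟨g, i⟩ := fun g => rfl
    simp only [hc, f]
    split_ifs with hE
    · rw [Fintype.prod_sigma]
      refine Finset.prod_congr rfl fun g _ => ?_
      rw [if_neg]
      · rfl
      · rintro ⟨rfl, h⟩; exact h hE
    · symm
      exact Finset.prod_eq_zero (Finset.mem_univ g₀) (by simp [hE])
  rw [e]
  have := (Finset.prod_univ_sum (fun g => (Finset.univ : Finset (ι g → α))) f)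
  rw [Fintype.piFinset_univ] at this
  rw [← this, Finset.prod_eq_single g₀]
  · unfold pr
    refine Finset.sum_congr rfl fun y _ => ?_
    by_cases h : E g₀ y <;> simp [f, h]
  · intro g _ hg
    simp only [f, hg, false_and, if_false]
    exact sum_prodW (h1 g)
  · simp

end FiniteProbability

end
end KZCoreset

/-! ### Chaining for signed sums over pairs -/

namespace KZCoreset
noncomputable section

set_option linter.unusedSectionVars false
set_option linter.unusedDecidableInType false

section Chaining
open scoped Classical

variable {ι α 𝒞 μ : Type*} [Fintype ι] [DecidableEq ι]

/-- The signed sum of the differences of `u` over pairs of points. -/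
def signed (σ : ι → Bool) (z : ι → α × α) (u : α → ℝ) : ℝ :=
  ∑ i, sgn (σ i) * (u (z i).1 - u (z i).2)

/-- The sum of `f` over all points of a family of pairs. -/
def both (z : ι → α × α) (f : α → ℝ) : ℝ := ∑ i, (f (z i).1 + f (z i).2)

theorem both_le_both {z : ι → α × α} {S : Set α} (hz : ∀ i, (z i).1 ∈ S ∧ (z i).2 ∈ S)
    {f g : α → ℝ} (h : ∀ p ∈ S, f p ≤ g p) : both z f ≤ both z g :=
  Finset.sum_le_sum fun i _ => add_le_add (h _ (hz i).1) (h _ (hz i).2)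

theorem both_nonneg {z : ι → α × α} {S : Set α} (hz : ∀ i, (z i).1 ∈ S ∧ (z i).2 ∈ S)
    {f : α → ℝ} (h : ∀ p ∈ S, 0 ≤ f p) : 0 ≤ both z f :=
  Finset.sum_nonneg fun i _ => add_nonneg (h _ (hz i).1) (h _ (hz i).2)

theorem both_const_mul (z : ι → α × α) (c : ℝ) (f : α → ℝ) :
    both z (fun p => c * f p) = c * both z f := by
  simp only [both, Finset.mul_sum, mul_add]

theorem signed_sub (σ : ι → Bool) (z : ι → α × α) (u v : α → ℝ) :
    signed σ z (fun p => u p - v p) = signed σ z u - signed σ z v := by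
  simp only [signed, ← Finset.sum_sub_distrib]
  exact Finset.sum_congr rfl fun i _ => by ring

theorem abs_signed_le (σ : ι → Bool) (z : ι → α × α) (u : α → ℝ) :
    |signed σ z u| ≤ both z fun p => |u p| := by
  refine (Finset.abs_sum_le_sum_abs _ _).trans (Finset.sum_le_sum fun i _ => ?_)
  rw [abs_mul]
  have : |sgn (σ i)| = 1 := by unfold sgn; split_ifs <;> simp
  rw [this, one_mul]
  exact abs_sub _ _

theorem both_sq_le (z : ι → α × α) (f : α → ℝ) :
    both z f ^ 2 ≤ 2 * Fintype.card ι * both z fun p => f p ^ 2 := by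
  have := sq_sum_le_card_mul_sum_sq (s := (Finset.univ : Finset ι))
    (f := fun i => f (z i).1 + f (z i).2)
  rw [Finset.card_univ] at this
  refine this.trans ?_
  rw [mul_comm 2, mul_assoc]
  refine mul_le_mul_of_nonneg_left ?_ (Nat.cast_nonneg _)
  rw [both, Finset.mul_sum]
  exact Finset.sum_le_sum fun i _ => by nlinarith [sq_nonneg (f (z i).1 - f (z i).2)]

/-- Hoeffding's inequality for the differences. The bound `(x - y)² ≤ 2 (x² + y²)` replaces their
squares by a proxy that is invariant under exchanges. -/
theorem signed_tail (z : ι → α × α) (u : α → ℝ) {l V : ℝ} (hl : 0 ≤ l)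
    (hV : both z (fun p => u p ^ 2) ≤ V) :
    pr (prodW coin) (fun σ : ι → Bool => Real.sqrt (4 * l * V) < |signed σ z u|) ≤
      2 * Real.exp (-l) := by
  have := rademacher_tail (fun i => u (z i).1 - u (z i).2) (V := 2 * V) hl ?_
  · rwa [show 2 * l * (2 * V) = 4 * l * V by ring] at this
  · refine le_trans ?_ (mul_le_mul_of_nonneg_left hV zero_le_two)
    rw [both, Finset.mul_sum]
    exact Finset.sum_le_sum fun i _ => by nlinarith [sq_nonneg (u (z i).1 + u (z i).2)]

/-- The links of level `h` carry the additional exponent `u (h + 2)`. Its root costs at most the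
factor `(h + 3) / 2`, which is summable against the scales `2 ^ (-h)`. -/
theorem sum_levels_le (L : ℕ) :
    ∑ h ∈ Finset.range L, ((h : ℝ) + 3) / 2 ^ (h + 1) ≤ 4 := by
  have : ∑ h ∈ Finset.range L, ((h : ℝ) + 3) / 2 ^ (h + 1) = 4 - (L + 4) / 2 ^ L := by
    induction L with
    | zero => norm_num
    | succ L ih =>
      rw [Finset.sum_range_succ, ih]
      push_cast
      field_simp
      ring
  rw [this]
  have : (0 : ℝ) ≤ (L + 4) / 2 ^ L := by positivity
  linarith

theorem sqrt_add_le (a b : ℝ) (ha : 0 ≤ a) (hb : 0 ≤ b) :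
    Real.sqrt (a + b) ≤ Real.sqrt a + Real.sqrt b := by
  rw [Real.sqrt_le_left (by positivity)]
  nlinarith [Real.sq_sqrt ha, Real.sq_sqrt hb, Real.sqrt_nonneg a, Real.sqrt_nonneg b,
    mul_nonneg (Real.sqrt_nonneg a) (Real.sqrt_nonneg b)]

/-- Since `exp (-u) ≤ 1/2`, exponents growing linearly with the level make the failure probabilities
of all links a geometric series, with no loss in `L`. -/
theorem sum_exp_levels_le {u : ℝ} (hu : Real.log 2 ≤ u) (L : ℕ) :
    ∑ h ∈ Finset.range L, Real.exp (-(u * (h + 2))) ≤ Real.exp (-u) := by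
  have hx : Real.exp (-u) ≤ 1 / 2 := by
    rw [Real.exp_neg, one_div]
    refine inv_anti₀ two_pos ?_
    rw [← Real.exp_log two_pos]
    exact Real.exp_le_exp.2 hu
  have e : ∀ h : ℕ, Real.exp (-(u * (h + 2))) ≤ Real.exp (-u) * ((1 / 2) ^ (h + 1)) := by
    intro h
    have : -(u * ((h : ℝ) + 2)) = -u + ((h + 1 : ℕ) : ℝ) * (-u) := by push_cast; ring
    rw [this, Real.exp_add, Real.exp_nat_mul]
    gcongr
  refine (Finset.sum_le_sum fun h _ => e h).trans ?_
  rw [← Finset.mul_sum]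
  refine mul_le_of_le_one_right (Real.exp_pos _).le ?_
  have : ∑ h ∈ Finset.range L, ((1 : ℝ) / 2) ^ (h + 1) = 1 - (1 / 2) ^ L := by
    induction L with
    | zero => simp
    | succ L ih => rw [Finset.sum_range_succ, ih]; ring
  rw [this]
  have : (0 : ℝ) ≤ (1 / 2) ^ L := by positivity
  linarith

/-- Masked and weighted version of a vector. -/
def maskW (W : α → ℝ) (c : α → Prop) (w : α → ℝ) : α → ℝ := fun p => if c p then W p * w p else 0

theorem both_maskW_sq_le {z : ι → α × α} {S : Set α} (hz : ∀ i, (z i).1 ∈ S ∧ (z i).2 ∈ S)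
    {W : α → ℝ} {c : α → Prop} {w R : α → ℝ} {K : ℝ}
    (h : ∀ p ∈ S, c p → (W p * w p) ^ 2 ≤ K * R p) :
    both z (fun p => maskW W c w p ^ 2) ≤ K * both z fun p => if c p then R p else 0 := by
  rw [← both_const_mul]
  refine both_le_both hz fun p hp => ?_
  unfold maskW
  by_cases hc : c p
  · simpa [hc] using h p hp hc
  · simp [hc]

theorem sqrt_tail_le {a ν u B K : ℝ} (ha : 0 ≤ a) (hν : 0 ≤ ν) (hu : 0 ≤ u) (hB : 0 ≤ B)
    (hK : 0 ≤ K) (k : ℝ) (hk : 4 * K ≤ k ^ 2) (hk0 : 0 ≤ k) :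
    Real.sqrt (4 * (ν + u) * (K * a ^ 2 * B)) ≤
      Real.sqrt B * (k * a * (Real.sqrt ν + Real.sqrt u)) := by
  have h1 : 4 * (ν + u) * (K * a ^ 2 * B) = (4 * K) * a ^ 2 * B * (ν + u) := by ring
  rw [h1, Real.sqrt_mul (by positivity), Real.sqrt_mul (by positivity),
    Real.sqrt_mul (by positivity), Real.sqrt_sq ha]
  have h2 : Real.sqrt (4 * K) ≤ k := by
    rw [Real.sqrt_le_left hk0]; exact hk
  have h3 := sqrt_add_le ν u hν hu
  calc _ ≤ k * a * Real.sqrt B * (Real.sqrt ν + Real.sqrt u) := by gcongr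
    _ = _ := by ring

/-- Chaining for signed sums, relative to the error scale `E`, with masked coordinates. -/
theorem chaining (z : ι → α × α) {S : Set α} (hz : ∀ i, (z i).1 ∈ S ∧ (z i).2 ∈ S)
    (Ms : Finset μ) (msk : 𝒞 → μ) (hmsk : ∀ C, msk C ∈ Ms) (unm : μ → α → Prop)
    (F E R : 𝒞 → α → ℝ) (W : α → ℝ) (hW : ∀ p ∈ S, 0 ≤ W p)
    (hR : ∀ C, ∀ p ∈ S, 0 ≤ R C p) {a u : ℝ} (ha : 0 ≤ a) (hu : Real.log 2 ≤ u) (L : ℕ)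
    (V : ℕ → Finset (α → ℝ)) (ν : ℕ → ℝ) (hV : ∀ h, ((V h).card : ℝ) ≤ Real.exp (ν h))
    (hν0 : ∀ h, 0 ≤ ν h) (hν : ∀ h, ν h ≤ ν (h + 1))
    (hcov : ∀ h C, ∃ v ∈ V h, ∀ p ∈ S, unm (msk C) p → |F C p - v p| ≤ a / 2 ^ h * E C p)
    (hWE : ∀ C, ∀ p ∈ S, unm (msk C) p → (W p * E C p) ^ 2 ≤ 5 * R C p)
    (hWF : ∀ C, ∀ p ∈ S, unm (msk C) p → (W p * F C p) ^ 2 ≤ a ^ 2 * R C p) :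
    pr (prodW coin) (fun σ : ι → Bool => ∃ C,
      Real.sqrt (both z fun p => if unm (msk C) p then R C p else 0) *
        (20 * ∑ h ∈ Finset.range (L + 1), a / 2 ^ h * Real.sqrt (ν h) + 48 * a * Real.sqrt u +
          a / 2 ^ L * Real.sqrt (10 * Fintype.card ι)) <
      |signed σ z (maskW W (unm (msk C)) (F C))|) ≤ 4 * Ms.card * Real.exp (-u) := by
  have hu0 : 0 ≤ u := (Real.log_nonneg one_le_two).trans hu
  -- In the union bound the exponents `ν` pay for the number of net vectors, respectively of pairs
  -- from consecutive nets. The surplus `u` or `u (h + 2)` is the failure probability, and the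
  -- number of masks remains as a factor.
  let top : μ × (α → ℝ) → (ι → Bool) → Prop := fun x σ =>
    Real.sqrt (4 * (ν 0 + u) * both z fun p => maskW W (unm x.1) x.2 p ^ 2) <
      |signed σ z (maskW W (unm x.1) x.2)|
  let link : ℕ → μ × (α → ℝ) × (α → ℝ) → (ι → Bool) → Prop := fun h x σ =>
    Real.sqrt (4 * (ν h + ν (h + 1) + u * (h + 2)) *
      both z fun p => maskW W (unm x.1) (fun p => x.2.2 p - x.2.1 p) p ^ 2) <
      |signed σ z (maskW W (unm x.1) fun p => x.2.2 p - x.2.1 p)|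
  have hc0 := prodW_nonneg (ι := ι) coin_nonneg
  have ptop : pr (prodW coin) (fun σ => ∃ x ∈ Ms ×ˢ V 0, top x σ) ≤
      2 * Ms.card * Real.exp (-u) := by
    refine (pr_exists_le hc0 _ top).trans ?_
    refine (Finset.sum_le_card_nsmul _ _ _ fun x _ =>
      signed_tail z _ (add_nonneg (hν0 0) hu0) le_rfl).trans ?_
    rw [nsmul_eq_mul, Finset.card_product, Nat.cast_mul, neg_add, Real.exp_add]
    calc _ ≤ (Ms.card : ℝ) * Real.exp (ν 0) * (2 * (Real.exp (-ν 0) * Real.exp (-u))) := by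
          gcongr; exact hV 0
      _ = 2 * Ms.card * Real.exp (-u) * (Real.exp (ν 0) * Real.exp (-ν 0)) := by ring
      _ = _ := by rw [← Real.exp_add, add_neg_cancel, Real.exp_zero, mul_one]
  have plink : ∀ h, pr (prodW coin) (fun σ => ∃ x ∈ Ms ×ˢ (V h ×ˢ V (h + 1)), link h x σ) ≤
      2 * Ms.card * Real.exp (-(u * (h + 2))) := by
    intro h
    refine (pr_exists_le hc0 _ (link h)).trans ?_
    refine (Finset.sum_le_card_nsmul _ _ _ fun x _ => signed_tail z _
      (add_nonneg (add_nonneg (hν0 h) (hν0 (h + 1))) (by positivity)) le_rfl).trans ?_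
    rw [nsmul_eq_mul, Finset.card_product, Finset.card_product, Nat.cast_mul, Nat.cast_mul,
      neg_add, neg_add, Real.exp_add, Real.exp_add]
    calc _ ≤ (Ms.card : ℝ) * (Real.exp (ν h) * Real.exp (ν (h + 1))) *
          (2 * (Real.exp (-ν h) * Real.exp (-ν (h + 1)) * Real.exp (-(u * (h + 2))))) := by
          gcongr
          · exact hV h
          · exact hV (h + 1)
      _ = 2 * Ms.card * Real.exp (-(u * (h + 2))) * (Real.exp (ν h) * Real.exp (-ν h)) *
          (Real.exp (ν (h + 1)) * Real.exp (-ν (h + 1))) := by ring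
      _ = _ := by
        rw [← Real.exp_add, ← Real.exp_add, add_neg_cancel, add_neg_cancel, Real.exp_zero,
          mul_one, mul_one]
  have pall : pr (prodW coin) (fun σ => (∃ x ∈ Ms ×ˢ V 0, top x σ) ∨
      ∃ h ∈ Finset.range L, ∃ x ∈ Ms ×ˢ (V h ×ˢ V (h + 1)), link h x σ) ≤
      4 * Ms.card * Real.exp (-u) := by
    refine (pr_or_le hc0).trans ?_
    have := (pr_exists_le hc0 (Finset.range L) fun h σ =>
      ∃ x ∈ Ms ×ˢ (V h ×ˢ V (h + 1)), link h x σ).trans (Finset.sum_le_sum fun h _ => plink h)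
    rw [← Finset.mul_sum] at this
    have h2 := mul_le_mul_of_nonneg_left (sum_exp_levels_le hu L)
      (show (0 : ℝ) ≤ 2 * Ms.card by positivity)
    linarith
  refine le_trans (pr_mono hc0 ?_) pall
  rintro σ ⟨C, hC⟩
  by_contra hno
  push Not at hno
  obtain ⟨hno1, hno2⟩ := hno
  refine absurd hC (not_lt.2 ?_)
  choose v hv hvE using fun h => hcov h C
  set c := unm (msk C) with hc
  set B := both z fun p => if c p then R C p else 0 with hB
  have hB0 : 0 ≤ B := both_nonneg hz fun p hp => by
    split_ifs
    · exact hR C p hp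
    · exact le_rfl
  -- decomposition
  have hsub : ∀ w w' : α → ℝ, signed σ z (maskW W c fun p => w p - w' p) =
      signed σ z (maskW W c w) - signed σ z (maskW W c w') := by
    intro w w'
    rw [← signed_sub]
    congr 1
    funext p
    unfold maskW
    split_ifs <;> ring
  have hdec : signed σ z (maskW W c (F C)) = signed σ z (maskW W c (v 0)) +
      ∑ h ∈ Finset.range L, signed σ z (maskW W c fun p => v (h + 1) p - v h p) +
      signed σ z (maskW W c fun p => F C p - v L p) := by
    simp_rw [hsub]
    rw [Finset.sum_range_sub (fun h => signed σ z (maskW W c (v h)))]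
    ring
  -- top level
  have htop : |signed σ z (maskW W c (v 0))| ≤
      Real.sqrt B * (7 * a * (Real.sqrt (ν 0) + Real.sqrt u)) := by
    have h1 := hno1 (msk C, v 0) (Finset.mem_product.2 ⟨hmsk C, hv 0⟩)
    refine (not_lt.1 h1).trans ?_
    -- From `|v 0| ≤ |F| + a E` the squares are at most `2 a² R + 2 a² · 5 R = 12 a² R`, and `4 · 12
    -- ≤ 7²`.
    refine le_trans (Real.sqrt_le_sqrt ?_)
      (sqrt_tail_le ha (hν0 0) hu0 hB0 (K := 12) (by norm_num) 7 (by norm_num) (by norm_num))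
    refine mul_le_mul_of_nonneg_left ?_
      (mul_nonneg (by norm_num) (add_nonneg (hν0 0) hu0))
    refine both_maskW_sq_le hz fun p hp hcp => ?_
    have e1 := hvE 0 p hp hcp
    rw [pow_zero, div_one] at e1
    have e2 : |v 0 p| ≤ |F C p| + a * E C p := by
      have := abs_sub_abs_le_abs_sub (v 0 p) (F C p)
      rw [abs_sub_comm] at this
      linarith
    have e3 : |W p * v 0 p| ≤ |W p * F C p| + a * (W p * E C p) := by
      rw [abs_mul, abs_mul, abs_of_nonneg (hW p hp)]
      nlinarith [mul_le_mul_of_nonneg_left e2 (hW p hp)]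
    have e4 := pow_le_pow_left₀ (abs_nonneg _) e3 2
    rw [sq_abs] at e4
    have e5 := hWE C p hp hcp
    have e6 := hWF C p hp hcp
    rw [← sq_abs] at e6
    nlinarith [sq_nonneg (|W p * F C p| - a * (W p * E C p)),
      mul_le_mul_of_nonneg_left e5 (sq_nonneg a)]
  -- links
  have hlink : ∀ h ∈ Finset.range L, |signed σ z (maskW W c fun p => v (h + 1) p - v h p)| ≤
      Real.sqrt B * (20 * (a / 2 ^ (h + 1) * Real.sqrt (ν (h + 1))) +
        7 * a * Real.sqrt u * ((h + 3) / 2 ^ (h + 1))) := by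
    intro h hh
    have h1 := hno2 h hh (msk C, v h, v (h + 1)) (Finset.mem_product.2 ⟨hmsk C,
      Finset.mem_product.2 ⟨hv h, hv (h + 1)⟩⟩)
    refine (not_lt.1 h1).trans ?_
    have hs2 : Real.sqrt (2 * ν (h + 1)) ≤ 1.42 * Real.sqrt (ν (h + 1)) := by
      rw [Real.sqrt_mul zero_le_two]
      refine mul_le_mul_of_nonneg_right ?_ (Real.sqrt_nonneg _)
      rw [Real.sqrt_le_left (by norm_num)]; norm_num
    -- The inequality of arithmetic and geometric means for `h + 2` and `1`.
    have hs3 : Real.sqrt (u * (h + 2)) ≤ Real.sqrt u * ((h + 3) / 2) := by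
      rw [Real.sqrt_mul hu0]
      refine mul_le_mul_of_nonneg_left ?_ (Real.sqrt_nonneg _)
      rw [Real.sqrt_le_left (by positivity)]
      nlinarith [sq_nonneg ((h : ℝ) + 1)]
    have ha' : 0 ≤ a / 2 ^ (h + 1) := by positivity
    -- Consecutive net vectors differ by at most `(a/2^h + a/2^(h+1)) E = 3 (a/2^(h+1)) E`; squaring
    -- gives `9 · 5 = 45`, and `4 · 45 ≤ 14²`.
    calc _ ≤ Real.sqrt (4 * (2 * ν (h + 1) + u * (h + 2)) *
          (45 * (a / 2 ^ (h + 1)) ^ 2 * B)) := by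
          refine Real.sqrt_le_sqrt ?_
          have : 0 ≤ both z fun p => maskW W c (fun p => v (h + 1) p - v h p) p ^ 2 :=
            both_nonneg hz fun p _ => sq_nonneg _
          refine mul_le_mul ?_ ?_ this ?_
          · linarith [hν h]
          · refine both_maskW_sq_le hz fun p hp hcp => ?_
            have e1 := hvE h p hp hcp
            have e2 := hvE (h + 1) p hp hcp
            have e3 : |v (h + 1) p - v h p| ≤ 3 * (a / 2 ^ (h + 1)) * E C p := by
              have e4 := abs_sub_le (v (h + 1) p) (F C p) (v h p)
              rw [abs_sub_comm (v (h + 1) p) (F C p)] at e4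
              have e5 : a / 2 ^ h = 2 * (a / 2 ^ (h + 1)) := by field_simp; ring
              rw [e5] at e1
              linarith
            have e4 : |W p * (v (h + 1) p - v h p)| ≤ 3 * (a / 2 ^ (h + 1)) * (W p * E C p) := by
              rw [abs_mul, abs_of_nonneg (hW p hp)]
              nlinarith [mul_le_mul_of_nonneg_left e3 (hW p hp)]
            have e5 := pow_le_pow_left₀ (abs_nonneg _) e4 2
            rw [sq_abs] at e5
            refine e5.trans ?_
            nlinarith [mul_le_mul_of_nonneg_left (hWE C p hp hcp) (sq_nonneg (a / 2 ^ (h + 1)))]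
          · have := hν0 (h + 1); positivity
      _ ≤ Real.sqrt B * (14 * (a / 2 ^ (h + 1)) *
          (Real.sqrt (2 * ν (h + 1)) + Real.sqrt (u * (h + 2)))) :=
          sqrt_tail_le ha' (by have := hν0 (h + 1); positivity) (by positivity) hB0
            (by norm_num) 14 (by norm_num) (by norm_num)
      _ ≤ Real.sqrt B * (14 * (a / 2 ^ (h + 1)) *
          (1.42 * Real.sqrt (ν (h + 1)) + Real.sqrt u * ((h + 3) / 2))) := by gcongr
      _ ≤ _ := by
          refine mul_le_mul_of_nonneg_left ?_ (Real.sqrt_nonneg _)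
          have e1 : 0 ≤ a / 2 ^ (h + 1) * Real.sqrt (ν (h + 1)) := by positivity
          have e2 : 7 * a * Real.sqrt u * (((h : ℝ) + 3) / 2 ^ (h + 1)) =
            14 * (a / 2 ^ (h + 1)) * (Real.sqrt u * ((h + 3) / 2)) := by ring
          rw [e2]
          nlinarith
  -- bottom
  have hbot : |signed σ z (maskW W c fun p => F C p - v L p)| ≤
      Real.sqrt B * (a / 2 ^ L * Real.sqrt (10 * Fintype.card ι)) := by
    -- No randomness is used at the finest scale: signs are dropped, and Cauchy–Schwarz costs `√(10
    -- m)`, which a large `L` makes harmless.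
    refine (abs_signed_le σ z _).trans ?_
    have h1 : (both z fun p => |maskW W c (fun p => F C p - v L p) p|) ≤
        a / 2 ^ L * both z fun p => maskW W c (E C) p := by
      rw [← both_const_mul]
      refine both_le_both hz fun p hp => ?_
      unfold maskW
      by_cases hcp : c p
      · simp only [hcp, if_true, abs_mul, abs_of_nonneg (hW p hp)]
        nlinarith [mul_le_mul_of_nonneg_left (hvE L p hp hcp) (hW p hp)]
      · simp [hcp]
    refine h1.trans ?_
    have h2 : (both z fun p => maskW W c (E C) p) ≤
        Real.sqrt B * Real.sqrt (10 * Fintype.card ι) := by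
      rw [← Real.sqrt_mul hB0]
      refine Real.le_sqrt_of_sq_le ((both_sq_le z _).trans ?_)
      have := both_maskW_sq_le hz (hWE C)
      rw [← hc, ← hB] at this
      nlinarith [mul_le_mul_of_nonneg_left this
        (show (0 : ℝ) ≤ 2 * Fintype.card ι by positivity)]
    calc _ ≤ a / 2 ^ L * (Real.sqrt B * Real.sqrt (10 * Fintype.card ι)) := by gcongr
      _ = _ := by ring
  rw [hdec]
  refine (abs_add_le _ _).trans ((add_le_add ((abs_add_le _ _).trans (add_le_add htop
    ((Finset.abs_sum_le_sum_abs _ _).trans (Finset.sum_le_sum hlink)))) hbot).trans ?_)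
  rw [← Finset.mul_sum, ← mul_add, ← mul_add]
  refine mul_le_mul_of_nonneg_left ?_ (Real.sqrt_nonneg _)
  rw [Finset.sum_add_distrib, ← Finset.mul_sum, ← Finset.mul_sum,
    Finset.sum_range_succ' (fun h => a / 2 ^ h * Real.sqrt (ν h))]
  -- The coefficient of `a √u` is `7` from the top and `7 · 4` from the links, less than `48`; the
  -- coefficients of the roots of `ν` are `7` and `20`.
  have h1 := mul_le_mul_of_nonneg_left (sum_levels_le L)
    (show 0 ≤ 7 * a * Real.sqrt u by positivity)
  have h2 : 0 ≤ a * Real.sqrt (ν 0) := by positivity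
  have h3 : 0 ≤ a * Real.sqrt u := by positivity
  simp only [pow_zero, div_one]
  nlinarith

end Chaining

end
end KZCoreset

/-! ### Uniform deviations of importance sampling -/

namespace KZCoreset
noncomputable section

section Deviation
open scoped Classical

theorem both_swapAt {ι α : Type*} [Fintype ι] (σ : ι → Bool) (z : ι → α × α) (f : α → ℝ) :
    both (swapAt σ z) f = both z f := by
  refine Finset.sum_congr rfl fun i _ => ?_
  by_cases h : σ i
  · simp [swapAt, h]
  · simp [swapAt, h, add_comm]

theorem sum_sub_swapAt {ι α : Type*} [Fintype ι] (σ : ι → Bool) (z : ι → α × α) (f : α → ℝ) :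
    ∑ i, (f (swapAt σ z i).1 - f (swapAt σ z i).2) = signed σ z f := by
  refine Finset.sum_congr rfl fun i _ => ?_
  by_cases h : σ i
  · simp [swapAt, h, sgn]
  · simp [swapAt, h, sgn]

/-- Here `x` stands for the deviation in units of `m N`, which occurs in its own variance bound. By
`√(x + 16) ≤ √x + 4` and `2 β √x ≤ β² + x`, the claim reduces to the hypothesis. -/
theorem self_bound {β x : ℝ} (hβ : 0 ≤ β) (hx : 10 * β + β ^ 2 < x) :
    β * Real.sqrt (x + 16) < x - β := by
  have hx0 : 0 < x := by nlinarith
  have h1 : Real.sqrt (x + 16) ≤ Real.sqrt x + 4 := by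
    refine (sqrt_add_le x 16 hx0.le (by norm_num)).trans (le_of_eq ?_)
    rw [show (16 : ℝ) = 4 ^ 2 by norm_num, Real.sqrt_sq (by norm_num)]
  have h2 := Real.sq_sqrt hx0.le
  nlinarith [mul_le_mul_of_nonneg_left h1 hβ, sq_nonneg (β - Real.sqrt x)]

/-- Conditionally on a double sample, the signed sums are small for all `C` at once. -/
theorem symmetrized_deviation {α κ 𝒞 : Type*} [Fintype α] [Fintype κ] {m : ℕ} {q : α → ℝ}
    (hq : ∀ p, 0 ≤ q p) (h1 : ∑ p, q p = 1) (cl : α → κ) (msk : 𝒞 → Finset κ)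
    (F E R : 𝒞 → α → ℝ) (W : α → ℝ) (hW : ∀ p, 0 ≤ W p) (hR : ∀ C p, 0 ≤ R C p)
    (a u : ℕ → ℝ) (ha : ∀ s, 0 ≤ a s) (hu : ∀ s, Real.log 2 ≤ u s) {β : ℝ}
    (hWE : ∀ C p, q p ≠ 0 → cl p ∉ msk C → (W p * E C p) ^ 2 ≤ 5 * R C p)
    (hWF : ∀ C p, q p ≠ 0 → cl p ∉ msk C → (W p * F C p) ^ 2 ≤ a (msk C).card ^ 2 * R C p)
    (hnet : ∀ S₀ : Finset α, (∀ p ∈ S₀, q p ≠ 0) → S₀.card ≤ 2 * m → ∀ s ≤ Fintype.card κ,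
      ∃ (L : ℕ) (V : ℕ → Finset (α → ℝ)) (ν : ℕ → ℝ),
        (∀ h, ((V h).card : ℝ) ≤ Real.exp (ν h)) ∧ (∀ h, 0 ≤ ν h) ∧ (∀ h, ν h ≤ ν (h + 1)) ∧
        (∀ h C, (msk C).card = s → ∃ v ∈ V h, ∀ p ∈ S₀, cl p ∉ msk C →
          |F C p - v p| ≤ a s / 2 ^ h * E C p) ∧
        20 * ∑ h ∈ Finset.range (L + 1), a s / 2 ^ h * Real.sqrt (ν h) + 48 * a s * Real.sqrt (u s)
          + a s / 2 ^ L * Real.sqrt (10 * m) ≤ β * Real.sqrt m) :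
    pr (prodW (pairW q)) (fun z : Fin m → α × α => ∃ C,
      Real.sqrt (both z fun p => if cl p ∉ msk C then R C p else 0) * (β * Real.sqrt m) <
        |∑ i, (maskW W (fun p => cl p ∉ msk C) (F C) (z i).1 -
          maskW W (fun p => cl p ∉ msk C) (F C) (z i).2)|) ≤
      ∑ s ∈ Finset.range (Fintype.card κ + 1),
        4 * (Nat.choose (Fintype.card κ) s : ℝ) * Real.exp (-u s) := by
  have hc0 := prodW_nonneg (ι := Fin m) coin_nonneg
  refine pr_le_of_swap hq h1 fun z hz => ?_
  -- Once the pairs are fixed, only the at most `2 m` points occurring in them matter, so nets for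
  -- this finite set suffice. This is why covering numbers of small subsets appear.
  let S₀ : Finset α := (Finset.univ : Finset (Fin m)).image (fun i => (z i).1) ∪
    (Finset.univ : Finset (Fin m)).image fun i => (z i).2
  have hS : ∀ i, (z i).1 ∈ (S₀ : Set α) ∧ (z i).2 ∈ (S₀ : Set α) := fun i => by
    simp only [S₀, Finset.coe_union, Finset.coe_image]
    exact ⟨Or.inl ⟨i, by simp, rfl⟩, Or.inr ⟨i, by simp, rfl⟩⟩
  have hSq : ∀ p ∈ S₀, q p ≠ 0 := by
    intro p hp
    simp only [S₀, Finset.mem_union, Finset.mem_image, Finset.mem_univ, true_and] at hp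
    rcases hp with ⟨i, rfl⟩ | ⟨i, rfl⟩
    · exact left_ne_zero_of_mul (hz i)
    · exact right_ne_zero_of_mul (hz i)
  have hScard : S₀.card ≤ 2 * m := by
    refine (Finset.card_union_le _ _).trans ?_
    rw [two_mul]
    exact add_le_add (Finset.card_image_le.trans (by simp)) (Finset.card_image_le.trans (by simp))
  -- Solutions are sorted by the size `s` of their mask: scale and exponent may depend on `s`, and
  -- only the masks of that size enter the union bound.
  let D : ℕ → (Fin m → Bool) → Prop := fun s σ => ∃ C : {C // (msk C).card = s},
    Real.sqrt (both z fun p => if cl p ∉ msk C.1 then R C.1 p else 0) * (β * Real.sqrt m) <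
      |signed σ z (maskW W (fun p => cl p ∉ msk C.1) (F C.1))|
  have hD : ∀ s ∈ Finset.range (Fintype.card κ + 1), pr (prodW coin) (D s) ≤
      4 * (Nat.choose (Fintype.card κ) s : ℝ) * Real.exp (-u s) := by
    intro s hs
    have hs' : s ≤ Fintype.card κ := Nat.lt_succ_iff.1 (Finset.mem_range.1 hs)
    obtain ⟨L, V, ν, hV, hν0, hν, hcov, hsum⟩ := hnet S₀ hSq hScard s hs'
    have := chaining (𝒞 := {C // (msk C).card = s}) z hS
      (Finset.univ.powersetCard s) (fun C => msk C.1)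
      (fun C => by simp [Finset.mem_powersetCard, C.2])
      (fun M p => cl p ∉ M) (fun C => F C.1) (fun C => E C.1) (fun C => R C.1) W
      (fun p _ => hW p) (fun C p _ => hR C.1 p) (ha s) (hu s) L V ν hV hν0 hν
      (fun h C => hcov h C.1 C.2) (fun C p hp hc => hWE C.1 p (hSq p hp) hc)
      (fun C p hp hc => by have := hWF C.1 p (hSq p hp) hc; rwa [C.2] at this)
    rw [Finset.card_powersetCard, Finset.card_univ, Fintype.card_fin] at this
    refine le_trans (pr_mono hc0 ?_) this
    rintro σ ⟨C, hC⟩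
    refine ⟨C, ?_⟩
    calc _ ≤ _ := mul_le_mul_of_nonneg_left hsum (Real.sqrt_nonneg _)
      _ < _ := by convert hC
  refine le_trans (pr_mono hc0 (F := fun σ => ∃ s ∈ Finset.range (Fintype.card κ + 1), D s σ) ?_)
    ((pr_exists_le hc0 _ D).trans (Finset.sum_le_sum hD))
  rintro σ ⟨C, hC⟩
  refine ⟨(msk C).card, Finset.mem_range.2 (Nat.lt_succ_of_le (Finset.card_le_univ _)),
    ⟨C, rfl⟩, ?_⟩
  rw [both_swapAt, sum_sub_swapAt] at hC
  exact hC

/-- On an independent copy of the sample the sums are typical with probability at least `1/2`. -/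
theorem ghost_typical {α : Type*} [Fintype α] {m : ℕ} (hm : 0 < m) {q : α → ℝ}
    (hq : ∀ p, 0 ≤ q p) (h1 : ∑ p, q p = 1) {g e : α → ℝ} (he0 : ∀ p, 0 ≤ e p) {β N a : ℝ}
    (hβ : 0 < β) (hN : 0 < N) (hmean : ∑ p, q p * e p ≤ N)
    (hg2 : ∑ p, q p * g p ^ 2 ≤ 2 * a ^ 2 * N ^ 2) (h3 : 8 * a ^ 2 ≤ m * β ^ 2) :
    1 / 2 ≤ pr (prodW q) (fun y : Fin m → α =>
      ¬ (β * (m * N) ≤ |∑ i, g (y i) - m * ∑ p, q p * g p| ∨ 4 * (m * N) ≤ ∑ i, e (y i))) := by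
  have hm' : (0 : ℝ) < m := Nat.cast_pos.2 hm
  have hp0 := prodW_nonneg (ι := Fin m) hq
  -- Chebyshev's inequality for the deviation and Markov's inequality for the cost each fail with
  -- probability at most `1/4`.
  have hcheb : pr (prodW q) (fun y : Fin m → α =>
      β * (m * N) ≤ |∑ i, g (y i) - m * ∑ p, q p * g p|) ≤ 1 / 4 := by
    have h2 := chebyshev (ι := Fin m) hq h1 g (t := β * (m * N))
      (by have := hN.le; positivity)
    rw [Fintype.card_fin] at h2
    have hpos : 0 < (β * (m * N)) ^ 2 := by have := hN; positivity
    rw [← le_div_iff₀ hpos] at h2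
    refine h2.trans ?_
    rw [div_le_iff₀ hpos]
    have hn2 : 0 ≤ m * N ^ 2 := by positivity
    calc (m : ℝ) * ∑ a, q a * g a ^ 2 ≤ m * (2 * a ^ 2 * N ^ 2) := by gcongr
      _ = (8 * a ^ 2) * (m * N ^ 2) / 4 := by ring
      _ ≤ (m * β ^ 2) * (m * N ^ 2) / 4 := by gcongr
      _ = _ := by ring
  have hmark : pr (prodW q) (fun y : Fin m → α => 4 * (m * N) ≤ ∑ i, e (y i)) ≤ 1 / 4 := by
    have h2 := pr_mul_le_sum (W := prodW q) (E := fun y : Fin m → α =>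
      4 * (m * N) ≤ ∑ i, e (y i)) hp0 (fun y => ∑ i, e (y i))
      (fun y => Finset.sum_nonneg fun i _ => he0 _) (4 * (m * N)) fun y hy => hy
    have h3 : ∑ y : Fin m → α, prodW q y * ∑ i, e (y i) = m * ∑ p, q p * e p := by
      simp_rw [Finset.mul_sum]
      rw [Finset.sum_comm]
      have : ∀ i : Fin m, ∑ y : Fin m → α, prodW q y * e (y i) = ∑ p, q p * e p := by
        intro i
        have := sum_prodW_mul_prod (q := q) (ι := Fin m) fun l p => if l = i then e p else 1
        simp only [Finset.prod_ite_eq', Finset.mem_univ, if_true] at this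
        rw [this, Finset.prod_eq_single i]
        · simp
        · intro b _ hb; simp [hb, h1]
        · simp
      simp only [this]
      rw [Finset.sum_const, Finset.card_univ, Fintype.card_fin, nsmul_eq_mul, Finset.mul_sum]
    rw [h3] at h2
    have h4 := mul_le_mul_of_nonneg_left (hmean) hm'.le
    have hpos : 0 < m * N := mul_pos hm' (hN)
    by_contra hlt
    push Not at hlt
    nlinarith
  have hnot : pr (prodW q) (fun y : Fin m → α =>
      β * (m * N) ≤ |∑ i, g (y i) - m * ∑ p, q p * g p| ∨ 4 * (m * N) ≤ ∑ i, e (y i)) ≤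
      1 / 2 := (pr_or_le hp0).trans (by linarith)
  have hsum1 := pr_add_pr_not (W := prodW q) (E := fun y : Fin m → α =>
      β * (m * N) ≤ |∑ i, g (y i) - m * ∑ p, q p * g p| ∨ 4 * (m * N) ≤ ∑ i, e (y i))
  rw [sum_prodW h1] at hsum1
  linarith

/-- Uniform deviation bound for importance sampling: symmetrization with a ghost sample, then
chaining over the nets. -/
theorem deviation {α κ 𝒞 : Type*} [Fintype α] [Fintype κ] {m : ℕ} (hm : 0 < m) {q : α → ℝ}
    (hq : ∀ p, 0 ≤ q p) (h1 : ∑ p, q p = 1) (cl : α → κ) (msk : 𝒞 → Finset κ)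
    (F E cst : 𝒞 → α → ℝ) (W : α → ℝ) (hW : ∀ p, 0 ≤ W p) (N : 𝒞 → ℝ) {T : ℝ} (hT : 0 < T)
    (hTN : ∀ C, T ≤ N C) (hcst : ∀ C p, 0 ≤ cst C p)
    (hmean : ∀ C, ∑ p, q p * maskW W (fun p => cl p ∉ msk C) (cst C) p ≤ N C)
    (a u : ℕ → ℝ) (ha : ∀ s, 0 ≤ a s) (hu : ∀ s, Real.log 2 ≤ u s) {β : ℝ} (hβ : 0 < β)
    (hWE : ∀ C p, q p ≠ 0 → cl p ∉ msk C → (W p * E C p) ^ 2 ≤ 5 * (N C * (W p * cst C p + T)))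
    (hWF : ∀ C p, q p ≠ 0 → cl p ∉ msk C →
      (W p * F C p) ^ 2 ≤ a (msk C).card ^ 2 * (N C * (W p * cst C p + T)))
    (hau : ∀ s ≤ Fintype.card κ, 48 * a s * Real.sqrt (u s) ≤ β * Real.sqrt m)
    (hnet : ∀ S₀ : Finset α, (∀ p ∈ S₀, q p ≠ 0) → S₀.card ≤ 2 * m → ∀ s ≤ Fintype.card κ,
      ∃ (L : ℕ) (V : ℕ → Finset (α → ℝ)) (ν : ℕ → ℝ),
        (∀ h, ((V h).card : ℝ) ≤ Real.exp (ν h)) ∧ (∀ h, 0 ≤ ν h) ∧ (∀ h, ν h ≤ ν (h + 1)) ∧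
        (∀ h C, (msk C).card = s → ∃ v ∈ V h, ∀ p ∈ S₀, cl p ∉ msk C →
          |F C p - v p| ≤ a s / 2 ^ h * E C p) ∧
        20 * ∑ h ∈ Finset.range (L + 1), a s / 2 ^ h * Real.sqrt (ν h) + 48 * a s * Real.sqrt (u s)
          + a s / 2 ^ L * Real.sqrt (10 * m) ≤ β * Real.sqrt m) :
    pr (prodW q) (fun x : Fin m → α =>
      (∀ C, ∑ i, maskW W (fun p => cl p ∉ msk C) (cst C) (x i) ≤
        |∑ i, maskW W (fun p => cl p ∉ msk C) (F C) (x i) -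
          m * ∑ p, q p * maskW W (fun p => cl p ∉ msk C) (F C) p| + 10 * (m * N C)) ∧
      ∃ C, (10 * β + β ^ 2) * (m * N C) <
        |∑ i, maskW W (fun p => cl p ∉ msk C) (F C) (x i) -
          m * ∑ p, q p * maskW W (fun p => cl p ∉ msk C) (F C) p|) ≤
      ∑ s ∈ Finset.range (Fintype.card κ + 1),
        8 * (Nat.choose (Fintype.card κ) s : ℝ) * Real.exp (-u s) := by
  have hm' : (0 : ℝ) < m := Nat.cast_pos.2 hm
  have hN : ∀ C, 0 < N C := fun C => hT.trans_le (hTN C)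
  let R : 𝒞 → α → ℝ := fun C p => N C * (W p * cst C p + T)
  have hR : ∀ C p, 0 ≤ R C p := fun C p =>
    mul_nonneg (hN C).le (add_nonneg (mul_nonneg (hW p) (hcst C p)) hT.le)
  have hB := symmetrized_deviation hq h1 cl msk F E R W hW hR a u ha hu hWE hWF hnet
  refine le_trans (pr_le_two_mul_ghost hq ?_)
    ((mul_le_mul_of_nonneg_left hB zero_le_two).trans (le_of_eq ?_))
  swap
  · rw [Finset.mul_sum]
    exact Finset.sum_congr rfl fun s _ => by ring
  rintro x - ⟨hx, C, hC⟩
  set c : α → Prop := fun p => cl p ∉ msk C with hc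
  set g := maskW W c (F C) with hg
  set e := maskW W c (cst C) with he
  set s := (msk C).card with hs
  have hs' : s ≤ Fintype.card κ := Finset.card_le_univ _
  have he0 : ∀ p, 0 ≤ e p := fun p => by
    simp only [he, maskW]; split_ifs
    · exact mul_nonneg (hW p) (hcst C p)
    · exact le_rfl
  have hp0 := prodW_nonneg (ι := Fin m) hq
  -- the ghost sample has small deviation
  have hg2 : ∑ p, q p * g p ^ 2 ≤ 2 * a s ^ 2 * N C ^ 2 := by
    calc ∑ p, q p * g p ^ 2 ≤ ∑ p, (a s ^ 2 * N C * (q p * e p) + a s ^ 2 * N C * T * q p) := by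
          refine Finset.sum_le_sum fun p _ => ?_
          by_cases hqp : q p = 0
          · simp [hqp]
          have hn : 0 ≤ a s ^ 2 * N C * T := by have := hN C; positivity
          simp only [hg, he, maskW]
          split_ifs with hcp
          · have := mul_le_mul_of_nonneg_left (hWF C p hqp hcp) (hq p)
            rw [← hs] at this
            linarith
          · have := hq p
            simp only [mul_zero, zero_add, ne_eq, OfNat.ofNat_ne_zero, not_false_eq_true, zero_pow]
            positivity
      _ = a s ^ 2 * N C * (∑ p, q p * e p) + a s ^ 2 * N C * T := by
          rw [Finset.sum_add_distrib, ← Finset.mul_sum, ← Finset.mul_sum, h1, mul_one]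
      _ ≤ a s ^ 2 * N C * N C + a s ^ 2 * N C * N C := by
          have := (hN C).le
          gcongr
          · exact hmean C
          · exact hTN C
      _ = _ := by ring
  -- The square of `hau` reads `2304 a² u ≤ β² m`, and `u ≥ log 2`.
  have h3 : 8 * a s ^ 2 ≤ m * β ^ 2 := by
    have h4 := pow_le_pow_left₀ (by have := ha s; positivity) (hau s hs') 2
    rw [mul_pow, mul_pow, mul_pow, Real.sq_sqrt hm'.le,
      Real.sq_sqrt ((Real.log_nonneg one_le_two).trans (hu s))] at h4
    have h5 : (0.6931471803 : ℝ) < u s := Real.log_two_gt_d9.trans_le (hu s)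
    nlinarith [mul_le_mul_of_nonneg_left h5.le (sq_nonneg (a s))]
  have hhalf := ghost_typical (a := a s) hm hq h1 he0 hβ (hN C) (hmean C) hg2 h3
  refine hhalf.trans (pr_mono hp0 ?_)
  intro y hy
  push Not at hy
  obtain ⟨hy1, hy2⟩ := hy
  refine ⟨C, ?_⟩
  change Real.sqrt (both (fun i => (x i, y i)) fun p => if c p then R C p else 0) *
    (β * Real.sqrt m) < |∑ i, (g (x i) - g (y i))|
  set dx := ∑ i, g (x i) - m * ∑ p, q p * g p with hdx
  set dy := ∑ i, g (y i) - m * ∑ p, q p * g p with hdy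
  have hpos : 0 < m * N C := mul_pos hm' (hN C)
  -- The cost of the first sample is at most `|dx| + 10 m N` by assumption, the ghost sample adds `4
  -- m N`, and the constant `T` contributes `2 m T`: altogether `|dx| + 16 m N`.
  have hbR : (both (fun i => (x i, y i)) fun p => if c p then R C p else 0) ≤
      N C * (|dx| + 16 * (m * N C)) := by
    calc _ ≤ N C * both (fun i => (x i, y i)) fun p => e p + T := by
          rw [← both_const_mul]
          refine both_le_both (S := Set.univ) (fun i => ⟨trivial, trivial⟩) fun p _ => ?_
          simp only [he, maskW, R]
          split_ifs with hcp
          · exact le_rfl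
          · have := hN C; positivity
      _ = N C * (∑ i, e (x i) + ∑ i, e (y i) + 2 * (m * T)) := by
          congr 1
          simp only [both, Finset.sum_add_distrib, Finset.sum_const, Finset.card_univ,
            Fintype.card_fin, nsmul_eq_mul]
          ring
      _ ≤ _ := by
          refine mul_le_mul_of_nonneg_left ?_ (hN C).le
          have := hx C
          have := mul_le_mul_of_nonneg_left (hTN C) hm'.le
          linarith
  have hxx : 10 * β + β ^ 2 < |dx| / (m * N C) := by
    rw [lt_div_iff₀ hpos]; exact hC
  have hNne := (hN C).ne'
  have hself := self_bound hβ.le hxx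
  calc _ ≤ Real.sqrt (N C * (|dx| + 16 * (m * N C))) * (β * Real.sqrt m) := by gcongr
    _ = Real.sqrt ((N C * m) ^ 2 * (|dx| / (m * N C) + 16)) * β := by
        have : (N C * m) ^ 2 * (|dx| / (m * N C) + 16) =
          N C * (|dx| + 16 * (m * N C)) * m := by field_simp
        rw [this, Real.sqrt_mul (mul_nonneg (hN C).le (by positivity))]
        ring
    _ = (m * N C) * (β * Real.sqrt (|dx| / (m * N C) + 16)) := by
        rw [Real.sqrt_mul (sq_nonneg _), Real.sqrt_sq (mul_pos (hN C) hm').le]; ring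
    _ < (m * N C) * (|dx| / (m * N C) - β) := by gcongr
    _ = |dx| - β * (m * N C) := by field_simp
    _ ≤ |dx| - |dy| := by linarith
    _ ≤ |dx - dy| := abs_sub_abs_le_abs_sub _ _
    _ = _ := by
        congr 1
        rw [hdx, hdy, Finset.sum_sub_distrib]
        ring

end Deviation

end
end KZCoreset

namespace KZCoreset
noncomputable section

/-! ### Distances to a tuple of centers -/

section DistTo
variable {X : Type*} [MetricSpace X] {k : ℕ}

theorem distTo_nonneg (x : X) (C : Fin k → X) : 0 ≤ distTo x C := Real.iInf_nonneg fun _ => dist_nonneg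

theorem distTo_le (x : X) (C : Fin k → X) (i : Fin k) : distTo x C ≤ dist x (C i) :=
  ciInf_le ⟨0, by rintro _ ⟨i, rfl⟩; exact dist_nonneg⟩ i

theorem exists_distTo_eq (hk : 1 ≤ k) (x : X) (C : Fin k → X) : ∃ i, distTo x C = dist x (C i) := by
  have : Nonempty (Fin k) := ⟨⟨0, hk⟩⟩
  obtain ⟨i, hi⟩ := exists_eq_ciInf_of_finite (f := fun i => dist x (C i))
  exact ⟨i, hi.symm⟩

theorem distTo_le_add (hk : 1 ≤ k) (x y : X) (C : Fin k → X) :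
    distTo x C ≤ distTo y C + dist x y := by
  obtain ⟨i, hi⟩ := exists_distTo_eq hk y C
  rw [hi]
  have := dist_triangle x y (C i)
  linarith [distTo_le x C i]

end DistTo

/-! ### Dyadic sums and the entropy integral -/

section Entropy

theorem sqrtLog_mono {a b : ℕ∞} (ha : 1 ≤ a) (h : a ≤ b) : sqrtLog a ≤ sqrtLog b := by
  unfold sqrtLog
  by_cases hb : b = ⊤
  · simp [hb]
  · have ha' : a ≠ ⊤ := fun h' => hb (top_le_iff.1 (h' ▸ h))
    rw [if_neg ha', if_neg hb]
    lift a to ℕ using ha'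
    lift b to ℕ using hb
    have h1 : 1 ≤ a := by exact_mod_cast ha
    have h2 : a ≤ b := by exact_mod_cast h
    refine ENNReal.ofReal_le_ofReal (Real.sqrt_le_sqrt (Real.log_le_log ?_ ?_))
    · simp only [ENat.toNat_natCast, Nat.cast_pos]; omega
    · simpa using h2

theorem setLIntegral_Ioc_ge {N : ℝ → ℕ∞} (h1 : ∀ α, 0 < α → 1 ≤ N α)
    (hN : ∀ α β, 0 < α → α ≤ β → N β ≤ N α) {a b : ℝ} (ha : 0 ≤ a) (hab : a < b) :
    sqrtLog (N b) * ENNReal.ofReal (b - a) ≤ ∫⁻ α in Set.Ioc a b, sqrtLog (N α) := by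
  calc _ = ∫⁻ _ in Set.Ioc a b, sqrtLog (N b) := by
        rw [MeasureTheory.setLIntegral_const, Real.volume_Ioc]
    _ ≤ _ := MeasureTheory.setLIntegral_mono' measurableSet_Ioc fun α hα =>
        sqrtLog_mono (h1 b (ha.trans_lt hab)) (hN α b (ha.trans_lt hα.1) hα.2)

/-- By monotonicity an infinite value at `α` persists on `(0, α]`, an interval of positive length.
-/
theorem ne_top_of_entropy {N : ℝ → ℕ∞} (h1 : ∀ α, 0 < α → 1 ≤ N α)
    (hN : ∀ α β, 0 < α → α ≤ β → N β ≤ N α) (hfin : entropyIntegral N ≠ ⊤) {α : ℝ} (hα : 0 < α) :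
    N α ≠ ⊤ := by
  intro htop
  apply hfin
  have h2 := setLIntegral_Ioc_ge h1 hN le_rfl hα
  have h3 : ∫⁻ β in Set.Ioc 0 α, sqrtLog (N β) ≤ entropyIntegral N :=
    MeasureTheory.lintegral_mono_set Set.Ioc_subset_Ioi_self
  have h4 := h2.trans h3
  rw [htop] at h4
  have h5 : sqrtLog ⊤ * ENNReal.ofReal (α - 0) = ⊤ := by
    rw [show sqrtLog ⊤ = ⊤ by simp [sqrtLog], ENNReal.top_mul]
    simpa using hα
  rw [h5] at h4
  exact top_le_iff.1 h4

/-- On `(a/2^(h+1), a/2^h]` the integrand is at least its value at the right end, and the length is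
half of `a/2^h`; hence the factor two. The intervals are disjoint. -/
theorem sum_le_entropy {N : ℝ → ℕ∞} (h1 : ∀ α, 0 < α → 1 ≤ N α)
    (hN : ∀ α β, 0 < α → α ≤ β → N β ≤ N α) (hfin : entropyIntegral N ≠ ⊤) {a : ℝ} (ha : 0 < a)
    (L : ℕ) :
    ∑ h ∈ Finset.range (L + 1), a / 2 ^ h * Real.sqrt (Real.log ((N (a / 2 ^ h)).toNat : ℝ)) ≤
      2 * (entropyIntegral N).toReal := by
  have hpos : ∀ h : ℕ, 0 < a / 2 ^ h := fun h => by positivity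
  have hval : ∀ h : ℕ, sqrtLog (N (a / 2 ^ h)) =
      ENNReal.ofReal (Real.sqrt (Real.log ((N (a / 2 ^ h)).toNat : ℝ))) := fun h =>
    if_neg (ne_top_of_entropy h1 hN hfin (hpos h))
  have key : ∀ L : ℕ, ENNReal.ofReal (∑ h ∈ Finset.range L,
      a / 2 ^ (h + 1) * Real.sqrt (Real.log ((N (a / 2 ^ h)).toNat : ℝ))) ≤
      ∫⁻ α in Set.Ioi (a / 2 ^ L), sqrtLog (N α) := by
    intro L
    induction L with
    | zero => simp
    | succ L ih =>
      have hlt : a / 2 ^ (L + 1) < a / 2 ^ L := by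
        refine div_lt_div_of_pos_left ha (by positivity) ?_
        exact pow_lt_pow_right₀ one_lt_two (Nat.lt_succ_self L)
      rw [Finset.sum_range_succ, ENNReal.ofReal_add
        (Finset.sum_nonneg fun h _ => mul_nonneg (hpos _).le (Real.sqrt_nonneg _))
        (mul_nonneg (hpos _).le (Real.sqrt_nonneg _)), ← Set.Ioc_union_Ioi_eq_Ioi hlt.le,
        MeasureTheory.lintegral_union measurableSet_Ioi
          (Set.disjoint_left.2 fun x hx hx' => not_lt.2 hx.2 hx'), add_comm]
      refine add_le_add ?_ ih
      refine le_trans (le_of_eq ?_) (setLIntegral_Ioc_ge h1 hN (hpos _).le hlt)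
      rw [hval, mul_comm, ENNReal.ofReal_mul (Real.sqrt_nonneg _)]
      congr 2
      field_simp
      ring
  have h3 := (key (L + 1)).trans (MeasureTheory.lintegral_mono_set
    (Set.Ioi_subset_Ioi (hpos (L + 1)).le))
  have h4 := ENNReal.toReal_mono hfin h3
  rw [ENNReal.toReal_ofReal (Finset.sum_nonneg fun h _ =>
    mul_nonneg (hpos _).le (Real.sqrt_nonneg _))] at h4
  refine le_trans (le_of_eq ?_) (mul_le_mul_of_nonneg_left h4 zero_le_two)
  rw [Finset.mul_sum]
  refine Finset.sum_congr rfl fun h _ => ?_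
  field_simp
  ring

end Entropy

/-! ### Coverings, nets and existence of the sample sizes -/

namespace Setup
open scoped Classical
variable {X : Type*} [MetricSpace X] (I : Setup X)

theorem z_pos : 0 < I.z := zero_lt_one.trans_le I.one_le_z

theorem dz_nonneg (p : Fin I.n) (C : Fin I.k → X) : 0 ≤ I.dz p C :=
  Real.rpow_nonneg (distTo_nonneg _ _) _

theorem cost_nonneg (S : Finset (Fin I.n)) (C : Fin I.k → X) : 0 ≤ I.cost S C :=
  Finset.sum_nonneg fun p _ => I.dz_nonneg p C

theorem cost_mono {S S' : Finset (Fin I.n)} (h : S ⊆ S') (C : Fin I.k → X) :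
    I.cost S C ≤ I.cost S' C :=
  Finset.sum_le_sum_of_subset_of_nonneg h fun p _ _ => I.dz_nonneg p C

theorem distTo_A (p : Fin I.n) : distTo (I.P p) I.A = dist (I.P p) (I.A (I.σ p)) := by
  refine le_antisymm (distTo_le _ _ _) ?_
  obtain ⟨i, hi⟩ := exists_distTo_eq I.one_le_k (I.P p) I.A
  rw [hi]
  exact I.nearest p i

theorem Δ_nonneg (i : Fin I.k) : 0 ≤ I.Δ i := div_nonneg (I.cost_nonneg _ _) (Nat.cast_nonneg _)

theorem mem_ring {i : Fin I.k} {j : ℤ} {p : Fin I.n} : p ∈ I.ring i j ↔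
    I.σ p = i ∧ (2 : ℝ) ^ j * I.Δ i ≤ I.dz p I.A ∧ I.dz p I.A < (2 : ℝ) ^ (j + 1) * I.Δ i := by
  simp [ring, cluster]

theorem Δ_pos_of_mem_ring {i : Fin I.k} {j : ℤ} {p : Fin I.n} (h : p ∈ I.ring i j) : 0 < I.Δ i := by
  obtain ⟨-, h1, h2⟩ := I.mem_ring.1 h
  rw [zpow_add_one₀ two_ne_zero] at h2
  have : (0 : ℝ) < 2 ^ j := by positivity
  have h3 := I.Δ_nonneg i
  nlinarith

theorem dz_pos_of_mem_ring {i : Fin I.k} {j : ℤ} {p : Fin I.n} (h : p ∈ I.ring i j) :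
    0 < I.dz p I.A := by
  have := I.Δ_pos_of_mem_ring h
  exact lt_of_lt_of_le (by positivity) (I.mem_ring.1 h).2.1

theorem mem_outerRing {i : Fin I.k} {p : Fin I.n} : p ∈ I.outerRing i ↔
    I.σ p = i ∧ ∃ j : ℤ, I.mainHi ≤ (j : ℝ) ∧ p ∈ I.ring i j := by
  simp [outerRing, cluster]

theorem exists_mem_ring_of_mem_group {g : Label} {p : Fin I.n} (h : p ∈ I.group g) :
    ∃ j, p ∈ I.ring (I.σ p) j := by
  cases g with
  | main j b => exact ⟨j, (Finset.mem_filter.1 h).2.1⟩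
  | outer b =>
    obtain ⟨-, j, -, hj⟩ := I.mem_outerRing.1 (Finset.mem_filter.1 h).2.1
    exact ⟨j, hj⟩

theorem dz_pos_of_mem_group {g : Label} {p : Fin I.n} (h : p ∈ I.group g) : 0 < I.dz p I.A := by
  obtain ⟨j, hj⟩ := I.exists_mem_ring_of_mem_group h
  exact I.dz_pos_of_mem_ring hj

theorem cost_group_pos {g : Label} (h : (I.group g).Nonempty) : 0 < I.cost (I.group g) I.A :=
  Finset.sum_pos (fun _ hp => I.dz_pos_of_mem_group hp) h

/-- The clusters whose points are exempt from the coverings of the group `g`. -/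
def Masked : Label → (Fin I.k → X) → Fin I.k → Prop
  | .main j _, C, i => 8 * I.z / I.ε * ((2 : ℝ) ^ j * I.Δ i) ^ (1 / I.z) ≤ distTo (I.A i) C
  | .outer b, C, i => ∃ q ∈ I.group (.outer b), I.σ q = i ∧ 4 * I.dz q I.A ≤ I.dz q C

/-- The cost of the center of a point, as subtracted in main groups. -/
def baseCost : Label → (Fin I.k → X) → Fin I.k → ℝ
  | .main _ _, C, i => distTo (I.A i) C ^ I.z
  | .outer _, _, _ => 0

/-- The error scale of the coverings of `g`. -/
def scale : Label → (Fin I.k → X) → Fin I.n → ℝ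
  | .main j b, C, p => I.err (I.group (.main j b)) p C
  | .outer _, C, p => I.dz p C + I.dz p I.A

/-- Main and outer groups differ only in mask, subtracted cost and error scale, so most of the
argument can treat them alike. The mask sees a point only through its cluster. -/
theorem isCovering_iff {g : Label} {S : Finset (Fin I.n)} {α : ℝ} {V : Set (S → ℝ)} :
    I.IsCovering g S α V ↔ ∀ C, ∃ v ∈ V, ∀ p : S, ¬ I.Masked g C (I.σ p) →
      |I.dz p C - I.baseCost g C (I.σ p) - v p| ≤ α * I.scale g C p := by
  cases g with
  | main j b => rfl
  | outer b => simp only [IsCovering, Masked, baseCost, scale, Far, sub_zero]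

theorem scale_nonneg (g : Label) (C : Fin I.k → X) (p : Fin I.n) : 0 ≤ I.scale g C p := by
  cases g with
  | main j b =>
    exact mul_nonneg (add_nonneg (Real.sqrt_nonneg _) (I.dz_nonneg _ _)) (Real.sqrt_nonneg _)
  | outer b => exact add_nonneg (I.dz_nonneg _ _) (I.dz_nonneg _ _)

/-- A positive lower bound for the scale that does not depend on `C`; it makes fixed grids into
coverings. -/
theorem le_scale {g : Label} {p : Fin I.n} (hp : p ∈ I.group g) (C : Fin I.k → X) :
    I.dz p I.A ≤ I.scale g C p := by
  cases g with
  | main j b =>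
    have hT := I.cost_group_pos ⟨p, hp⟩
    have h1 : 1 ≤ Real.sqrt ((I.cost (I.group (.main j b)) C + I.cost (I.group (.main j b)) I.A) /
        I.cost (I.group (.main j b)) I.A) := by
      rw [Real.one_le_sqrt, le_div_iff₀ hT]
      linarith [I.cost_nonneg (I.group (.main j b)) C]
    have h2 := Real.sqrt_nonneg (I.dz p C * I.dz p I.A)
    have h3 := I.dz_nonneg p I.A
    change _ ≤ (_ + _) * _
    nlinarith
  | outer b => exact le_add_of_nonneg_left (I.dz_nonneg _ _)

theorem coverNum_antitone (g : Label) (S : Finset (Fin I.n)) {α β : ℝ} (h : α ≤ β) :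
    I.coverNum g S β ≤ I.coverNum g S α := by
  refine le_iInf fun V => le_iInf fun hV => iInf₂_le_of_le V ?_ le_rfl
  rw [isCovering_iff] at hV ⊢
  intro C
  obtain ⟨v, hv, h2⟩ := hV C
  exact ⟨v, hv, fun p hp => (h2 p hp).trans (mul_le_mul_of_nonneg_right h (I.scale_nonneg _ _ _))⟩

theorem groupCoverNum_antitone (g : Label) (m : ℕ) {α β : ℝ} (h : α ≤ β) :
    I.groupCoverNum g m β ≤ I.groupCoverNum g m α :=
  iSup₂_mono fun S _ => I.coverNum_antitone g S h

theorem one_le_groupCoverNum (g : Label) (m : ℕ) (α : ℝ) : 1 ≤ I.groupCoverNum g m α := by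
  refine le_iSup₂_of_le (∅ : Finset (Fin I.n)) ⟨Finset.empty_subset _, by simp⟩ ?_
  refine le_iInf fun V => le_iInf fun hV => ?_
  rw [isCovering_iff] at hV
  obtain ⟨v, hv, -⟩ := hV I.A
  exact Set.one_le_encard_iff_nonempty.2 ⟨v, hv⟩

/-- Coverings of large sets are built from coverings of small pieces. -/
theorem exists_net (g : Label) {m : ℕ} {α : ℝ} (hN : I.groupCoverNum g m α ≠ ⊤) (B : ℕ)
    (S : Finset (Fin I.n)) (hS : S ⊆ I.group g) (hcard : S.card ≤ m * B) :
    ∃ V : Finset (Fin I.n → ℝ), V.card ≤ (I.groupCoverNum g m α).toNat ^ B ∧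
      ∀ C, ∃ v ∈ V, ∀ p ∈ S, ¬ I.Masked g C (I.σ p) →
        |I.dz p C - I.baseCost g C (I.σ p) - v p| ≤ α * I.scale g C p := by
  induction B generalizing S with
  | zero =>
    have : S = ∅ := by simpa using hcard
    subst this
    exact ⟨{0}, by simp, fun C => ⟨0, by simp, by simp⟩⟩
  | succ B ih =>
    obtain ⟨S₁, hS₁, hc1, hc2⟩ : ∃ S₁ ⊆ S, S₁.card ≤ m ∧ (S \ S₁).card ≤ m * B := by
      rcases le_total S.card m with h | h
      · exact ⟨S, subset_rfl, h, by simp⟩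
      · obtain ⟨S₁, h1, h2⟩ := Finset.exists_subset_card_eq h
        refine ⟨S₁, h1, h2.le, ?_⟩
        rw [Finset.card_sdiff_of_subset h1, h2]
        rw [Nat.mul_succ] at hcard
        omega
    obtain ⟨V₂, hV₂, hcov₂⟩ := ih (S \ S₁) (Finset.sdiff_subset.trans hS) hc2
    have hle : I.coverNum g S₁ α ≤ I.groupCoverNum g m α :=
      le_iSup₂_of_le S₁ ⟨hS₁.trans hS, hc1⟩ le_rfl
    obtain ⟨V₁, hV₁, hcard₁⟩ : ∃ V₁ : Set (S₁ → ℝ), I.IsCovering g S₁ α V₁ ∧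
        V₁.encard ≤ I.groupCoverNum g m α := by
      -- The covering number is an infimum in `ℕ∞`; a strict inequality is needed to extract an
      -- actual covering.
      have hlt : I.coverNum g S₁ α < I.groupCoverNum g m α + 1 :=
        lt_of_le_of_lt hle (ENat.lt_add_one_iff hN |>.2 le_rfl)
      simp only [coverNum, iInf_lt_iff] at hlt
      obtain ⟨V, hV, hlt⟩ := hlt
      exact ⟨V, hV, (ENat.lt_add_one_iff hN).1 hlt⟩
    have hfin : V₁.Finite := Set.encard_ne_top_iff.1 (fun h => hN (top_le_iff.1 (h ▸ hcard₁)))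
    let glue : (S₁ → ℝ) × (Fin I.n → ℝ) → Fin I.n → ℝ := fun v p =>
      if h : p ∈ S₁ then v.1 ⟨p, h⟩ else v.2 p
    refine ⟨(hfin.toFinset ×ˢ V₂).image glue, ?_, fun C => ?_⟩
    · refine Finset.card_image_le.trans ?_
      rw [Finset.card_product, pow_succ, mul_comm]
      refine Nat.mul_le_mul hV₂ ?_
      rw [← Set.ncard_eq_toFinset_card V₁ hfin]
      exact ENat.toNat_le_toNat hcard₁ hN
    · obtain ⟨v₁, hv₁, h1⟩ := (I.isCovering_iff.1 hV₁) C
      obtain ⟨v₂, hv₂, h2⟩ := hcov₂ C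
      refine ⟨glue (v₁, v₂), Finset.mem_image_of_mem _ (Finset.mem_product.2
        ⟨hfin.mem_toFinset.2 hv₁, hv₂⟩), fun p hp hm => ?_⟩
      by_cases hp1 : p ∈ S₁
      · simpa [glue, hp1] using h1 ⟨p, hp1⟩ hm
      · simpa [glue, hp1] using h2 p (Finset.mem_sdiff.2 ⟨hp, hp1⟩) hm

/-- The functions to be covered are bounded. -/
theorem exists_bound (g : Label) : ∃ M : ℝ, 0 < M ∧ ∀ p ∈ I.group g, ∀ C,
    ¬ I.Masked g C (I.σ p) →
      |I.dz p C - I.baseCost g C (I.σ p)| ≤ M * I.dz p I.A := by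
  have h : ∀ p : Fin I.n, ∃ M : ℝ, 0 ≤ M ∧ (p ∈ I.group g → ∀ C, ¬ I.Masked g C (I.σ p) →
      |I.dz p C - I.baseCost g C (I.σ p)| ≤ M * I.dz p I.A) := by
    intro p
    by_cases hp : p ∈ I.group g
    swap
    · exact ⟨0, le_rfl, fun h => absurd h hp⟩
    have hd := I.dz_pos_of_mem_group hp
    cases g with
    | outer b =>
      refine ⟨4, by norm_num, fun _ C hC => ?_⟩
      simp only [Masked, not_exists, not_and, not_le] at hC
      rw [baseCost, sub_zero, abs_of_nonneg (I.dz_nonneg _ _)]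
      exact (hC p hp rfl).le
    | main j b =>
      set r := 8 * I.z / I.ε * ((2 : ℝ) ^ j * I.Δ (I.σ p)) ^ (1 / I.z) with hr
      have hr0 : 0 ≤ r := by
        have := I.z_pos; have := I.ε_pos; have := I.Δ_nonneg (I.σ p); positivity
      refine ⟨(r + dist (I.P p) (I.A (I.σ p))) ^ I.z / I.dz p I.A,
        div_nonneg (Real.rpow_nonneg (by positivity) _) hd.le, fun _ C hC => ?_⟩
      rw [div_mul_cancel₀ _ hd.ne']
      simp only [Masked, not_le] at hC
      have h1 : I.dz p C ≤ (r + dist (I.P p) (I.A (I.σ p))) ^ I.z := by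
        refine Real.rpow_le_rpow (distTo_nonneg _ _) ?_ I.z_pos.le
        have := distTo_le_add I.one_le_k (I.P p) (I.A (I.σ p)) C
        linarith
      have h2 : I.baseCost (.main j b) C (I.σ p) ≤ (r + dist (I.P p) (I.A (I.σ p))) ^ I.z :=
        Real.rpow_le_rpow (distTo_nonneg _ _)
          (hC.le.trans (le_add_of_nonneg_right dist_nonneg)) I.z_pos.le
      have h3 : 0 ≤ I.baseCost (.main j b) C (I.σ p) := Real.rpow_nonneg (distTo_nonneg _ _) _
      have h4 := I.dz_nonneg p C
      rw [abs_le]; constructor <;> linarith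
  choose M hM0 hM using h
  refine ⟨1 + ∑ p, M p, by have := Finset.sum_nonneg fun p (_ : p ∈ Finset.univ) => hM0 p; linarith,
    fun p hp C hC => ?_⟩
  have h1 : M p ≤ 1 + ∑ p, M p := by
    have := Finset.single_le_sum (fun p _ => hM0 p) (Finset.mem_univ p)
    linarith
  exact (hM p hp C hC).trans (mul_le_mul_of_nonneg_right h1 (I.dz_nonneg _ _))

theorem coverNum_le_one {g : Label} {M : ℝ} (hM : ∀ p ∈ I.group g, ∀ C,
    ¬ I.Masked g C (I.σ p) → |I.dz p C - I.baseCost g C (I.σ p)| ≤ M * I.dz p I.A)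
    {S : Finset (Fin I.n)} (hS : S ⊆ I.group g) {α : ℝ} (hM0 : 0 ≤ M) (hα : M ≤ α) :
    I.coverNum g S α ≤ 1 := by
  refine (iInf₂_le ({0} : Set (S → ℝ)) ?_).trans (by simp)
  rw [isCovering_iff]
  intro C
  refine ⟨0, rfl, fun p hp => ?_⟩
  simpa using (hM p (hS p.2) C hp).trans
    (mul_le_mul hα (I.le_scale (hS p.2) C) (I.dz_nonneg _ _) (hM0.trans hα))

/-- Rounding each coordinate down to a multiple of `α d^z(p, A)` leaves `2 K + 1` possible values
for each of at most `n` points. -/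
theorem coverNum_le_grid {g : Label} {M : ℝ} (hM : ∀ p ∈ I.group g, ∀ C,
    ¬ I.Masked g C (I.σ p) → |I.dz p C - I.baseCost g C (I.σ p)| ≤ M * I.dz p I.A)
    {S : Finset (Fin I.n)} (hS : S ⊆ I.group g) {α : ℝ} (hα : 0 < α) {K : ℕ} (hK : M / α ≤ K) :
    I.coverNum g S α ≤ ((2 * K + 1) ^ I.n : ℕ) := by
  let f : (S → Fin (2 * K + 1)) → S → ℝ := fun t p => ((t p : ℕ) - (K : ℝ)) * (α * I.dz p I.A)
  refine (iInf₂_le (((Finset.univ.image f : Finset (S → ℝ))) : Set (S → ℝ)) ?_).trans ?_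
  · rw [isCovering_iff]
    intro C
    have hx : ∀ p : S, ¬ I.Masked g C (I.σ p) → ∃ t : Fin (2 * K + 1),
        |I.dz p C - I.baseCost g C (I.σ p) - ((t : ℕ) - (K : ℝ)) * (α * I.dz p I.A)| ≤
          α * I.dz p I.A := by
      intro p hp
      have hd : 0 < α * I.dz p I.A := mul_pos hα (I.dz_pos_of_mem_group (hS p.2))
      set x := (I.dz p C - I.baseCost g C (I.σ p)) / (α * I.dz p I.A) with hxdef
      have hxe : I.dz p C - I.baseCost g C (I.σ p) = x * (α * I.dz p I.A) := by
        rw [hxdef, div_mul_cancel₀ _ hd.ne']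
      have hxK : |x| ≤ K := by
        rw [hxdef, abs_div, abs_of_pos hd, div_le_iff₀ hd]
        refine (hM p (hS p.2) C hp).trans ?_
        rw [div_le_iff₀ hα] at hK
        have := mul_le_mul_of_nonneg_right hK (I.dz_nonneg p I.A)
        linarith
      obtain ⟨h1, h2⟩ := abs_le.1 hxK
      have hf1 : -(K : ℤ) ≤ ⌊x⌋ := Int.le_floor.2 (by push_cast; linarith)
      have hf2 : ⌊x⌋ ≤ (K : ℤ) := by
        have := (Int.floor_le x).trans h2
        exact_mod_cast this
      refine ⟨⟨(⌊x⌋ + K).toNat, by omega⟩, ?_⟩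
      have he : (((⌊x⌋ + K).toNat : ℕ) : ℝ) = (⌊x⌋ : ℝ) + K := by
        have : (((⌊x⌋ + K).toNat : ℕ) : ℤ) = ⌊x⌋ + K := Int.toNat_of_nonneg (by omega)
        exact_mod_cast this
      simp only [he]
      rw [hxe, ← sub_mul, abs_mul, abs_of_pos hd]
      refine mul_le_of_le_one_left hd.le ?_
      rw [abs_le]
      constructor <;> linarith [Int.floor_le x, Int.lt_floor_add_one x]
    choose! t ht using hx
    refine ⟨f t, by simp, fun p hp => (ht p hp).trans ?_⟩
    exact mul_le_mul_of_nonneg_left (I.le_scale (hS p.2) C) hα.le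
  · rw [Set.encard_coe_eq_coe_finsetCard]
    refine Nat.cast_le.2 (Finset.card_image_le.trans ?_)
    rw [Finset.card_univ, Fintype.card_fun, Fintype.card_fin, Fintype.card_coe]
    refine Nat.pow_le_pow_right (by omega) ?_
    simpa using Finset.card_le_univ S

/-- Beyond `M` the zero vector is a covering and the integrand vanishes. Below `M` the grid has size
polynomial in `M/α`, and a linear bound on the logarithm leads to the integrable majorant `c
α^(-1/2)`. The uniformity in `m` is what makes some `m` adequate. -/
theorem exists_entropy_bound (g : Label) : ∃ J : ℝ≥0∞, J ≠ ⊤ ∧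
    ∀ m, entropyIntegral (fun α => I.groupCoverNum g m α) ≤ J := by
  obtain ⟨M, hM0, hM⟩ := I.exists_bound g
  let c : ℝ := Real.sqrt (5 * I.n * M)
  refine ⟨∫⁻ α in Set.Ioc 0 M, ENNReal.ofReal (c * α ^ (-(1 / 2) : ℝ)), ?_, fun m => ?_⟩
  · have h1 : MeasureTheory.IntegrableOn (fun α : ℝ => c * α ^ (-(1 / 2) : ℝ)) (Set.Ioc 0 M) := by
      have := (intervalIntegral.intervalIntegrable_rpow' (a := 0) (b := M)
        (show (-1 : ℝ) < -(1 / 2) by norm_num)).const_mul c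
      exact (intervalIntegrable_iff_integrableOn_Ioc_of_le hM0.le).1 this
    exact (MeasureTheory.Integrable.lintegral_lt_top h1).ne
  · unfold entropyIntegral
    rw [← Set.Ioc_union_Ioi_eq_Ioi hM0.le, MeasureTheory.lintegral_union measurableSet_Ioi
      (Set.disjoint_left.2 fun x hx hx' => not_lt.2 hx.2 hx')]
    have h2 : ∫⁻ α in Set.Ioi M, sqrtLog (I.groupCoverNum g m α) = 0 := by
      rw [MeasureTheory.setLIntegral_congr_fun measurableSet_Ioi (g := fun _ => 0)]
      · simp
      · intro α hα
        have : I.groupCoverNum g m α = 1 := le_antisymm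
          (iSup₂_le fun S hS => I.coverNum_le_one hM hS.1 hM0.le (le_of_lt hα))
          (I.one_le_groupCoverNum g m α)
        simp [this, sqrtLog]
    rw [h2, add_zero]
    refine MeasureTheory.setLIntegral_mono' measurableSet_Ioc fun α hα => ?_
    obtain ⟨hα0, hαM⟩ := hα
    have h3 : I.groupCoverNum g m α ≤ ((2 * ⌈M / α⌉₊ + 1) ^ I.n : ℕ) :=
      iSup₂_le fun S hS => I.coverNum_le_grid hM hS.1 hα0 (Nat.le_ceil _)
    refine (sqrtLog_mono (I.one_le_groupCoverNum g m α) h3).trans ?_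
    unfold sqrtLog
    rw [if_neg (ENat.natCast_ne_top _), ENat.toNat_natCast]
    refine ENNReal.ofReal_le_ofReal ?_
    have h4 : Real.log (((2 * ⌈M / α⌉₊ + 1) ^ I.n : ℕ) : ℝ) ≤ 5 * I.n * M * α⁻¹ := by
      push_cast
      rw [Real.log_pow]
      have h5 : (1 : ℝ) ≤ M / α := (one_le_div hα0).2 hαM
      have h6 := (Nat.ceil_lt_add_one (zero_le_one.trans h5)).le
      have h7 : Real.log (2 * (⌈M / α⌉₊ : ℝ) + 1) ≤ 5 * (M / α) := by
        refine (Real.log_le_sub_one_of_pos (by positivity)).trans ?_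
        linarith
      calc _ ≤ (I.n : ℝ) * (5 * (M / α)) := mul_le_mul_of_nonneg_left h7 (Nat.cast_nonneg _)
        _ = _ := by rw [div_eq_mul_inv]; ring
    refine (Real.sqrt_le_sqrt h4).trans (le_of_eq ?_)
    rw [Real.sqrt_mul (by positivity), Real.sqrt_inv, Real.rpow_neg hα0.le, ← Real.sqrt_eq_rpow]

/-- The sample sizes `Γ` exist. -/
theorem isLeast_Γ (C₀ : ℝ) (g : Label) : IsLeast {m : ℕ | I.Adequate C₀ g m} (I.Γ C₀ g) := by
  have hne : {m : ℕ | I.Adequate C₀ g m}.Nonempty := by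
    obtain ⟨J, hJ, hJm⟩ := I.exists_entropy_bound g
    set b := ENNReal.ofReal C₀ * (ENNReal.ofReal (1 / I.ε ^ 2) * J ^ 2 +
        ENNReal.ofReal ((I.k : ℝ) / I.ε ^ 2 * Real.log ((I.k : ℝ) / I.ε))) with hb
    have hbt : b ≠ ⊤ := ENNReal.mul_ne_top ENNReal.ofReal_ne_top (ENNReal.add_ne_top.2
      ⟨ENNReal.mul_ne_top ENNReal.ofReal_ne_top (ENNReal.pow_ne_top hJ), ENNReal.ofReal_ne_top⟩)
    obtain ⟨m, hm⟩ := ENNReal.exists_nat_gt hbt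
    refine ⟨m, le_trans ?_ hm.le⟩
    rw [hb]
    gcongr
    exact hJm m
  exact ⟨Nat.sInf_mem hne, fun m hm => Nat.sInf_le hm⟩

end Setup

end
end KZCoreset

/-! ### Levels, bands and groups as labels of points -/

namespace KZCoreset
noncomputable section

/-- The binary order of magnitude. -/
theorem floor_logb_eq_iff {x y : ℝ} (hx : 0 < x) (hy : 0 < y) (j : ℤ) :
    ⌊Real.logb 2 (x / y)⌋ = j ↔ (2 : ℝ) ^ j * y ≤ x ∧ x < (2 : ℝ) ^ (j + 1) * y := by
  have h : 0 < x / y := div_pos hx hy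
  rw [Int.floor_eq_iff, Real.le_logb_iff_rpow_le one_lt_two h, Real.rpow_intCast, le_div_iff₀ hy]
  have e : ((j : ℝ) + 1) = ((j + 1 : ℤ) : ℝ) := by push_cast; ring
  rw [e, Real.logb_lt_iff_lt_rpow one_lt_two h, Real.rpow_intCast, div_lt_iff₀ hy]

namespace Setup
open scoped Classical
variable {X : Type*} [MetricSpace X] (I : Setup X)

/-- The index of the ring of a point. -/
def rawLvl (p : Fin I.n) : ℤ := ⌊Real.logb 2 (I.dz p I.A / I.Δ (I.σ p))⌋

/-- The least outer level. -/
def topLvl : ℤ := ⌈I.mainHi⌉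

/-- The level of a point, where all outer levels are identified. -/
def lvl (p : Fin I.n) : ℤ := min (I.rawLvl p) I.topLvl

/-- The points of the `i`-th cluster of level `l`. -/
def cell (i : Fin I.k) (l : ℤ) : Finset (Fin I.n) :=
  Finset.univ.filter fun p => 0 < I.dz p I.A ∧ I.σ p = i ∧ I.lvl p = l

/-- The points of level `l`. -/
def layer (l : ℤ) : Finset (Fin I.n) := Finset.univ.filter fun p => 0 < I.dz p I.A ∧ I.lvl p = l

/-- The band of the ring (or outer ring) of a point. -/
def band (p : Fin I.n) : ℤ :=
  ⌊Real.logb 2 (I.cost (I.cell (I.σ p) (I.lvl p)) I.A / I.cost (I.layer (I.lvl p)) I.A)⌋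

/-- The point lies in a group. -/
def Sampled (p : Fin I.n) : Prop :=
  0 < I.dz p I.A ∧ I.mainLo < (I.lvl p : ℝ) ∧ I.bandLo < (I.band p : ℝ)

/-- The group of a sampled point. -/
def labelOf (p : Fin I.n) : Label :=
  if I.lvl p = I.topLvl then .outer (I.band p) else .main (I.lvl p) (I.band p)

theorem Δ_pos_of_dz_pos {p : Fin I.n} (h : 0 < I.dz p I.A) : 0 < I.Δ (I.σ p) := by
  have hp : p ∈ I.cluster (I.σ p) := by simp [cluster]
  refine div_pos (lt_of_lt_of_le h ?_) (Nat.cast_pos.2 (Finset.card_pos.2 ⟨p, hp⟩))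
  exact Finset.single_le_sum (fun p _ => I.dz_nonneg p I.A) hp

/-- A point of cost zero lies in no ring, although the convention `log 0 = 0` gives it a level.
Hence the positivity clause here and in `cell` and `layer`. -/
theorem mem_ring_iff {i : Fin I.k} {j : ℤ} {p : Fin I.n} :
    p ∈ I.ring i j ↔ 0 < I.dz p I.A ∧ I.σ p = i ∧ I.rawLvl p = j := by
  constructor
  · intro h
    have h1 := I.dz_pos_of_mem_ring h
    obtain ⟨rfl, h2⟩ := I.mem_ring.1 h
    exact ⟨h1, rfl, (floor_logb_eq_iff h1 (I.Δ_pos_of_dz_pos h1) j).2 h2⟩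
  · rintro ⟨h1, rfl, h2⟩
    exact I.mem_ring.2 ⟨rfl, (floor_logb_eq_iff h1 (I.Δ_pos_of_dz_pos h1) j).1 h2⟩

theorem lt_topLvl {j : ℤ} : j < I.topLvl ↔ (j : ℝ) < I.mainHi := Int.lt_ceil

theorem topLvl_le {j : ℤ} : I.topLvl ≤ j ↔ I.mainHi ≤ (j : ℝ) := Int.ceil_le

theorem lvl_eq_iff_of_lt {j : ℤ} (hj : j < I.topLvl) (p : Fin I.n) :
    I.lvl p = j ↔ I.rawLvl p = j := by
  unfold lvl
  omega

theorem lvl_eq_topLvl (p : Fin I.n) : I.lvl p = I.topLvl ↔ I.topLvl ≤ I.rawLvl p := by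
  unfold lvl
  omega

theorem lvl_le (p : Fin I.n) : I.lvl p ≤ I.topLvl := min_le_right _ _

theorem ring_eq_cell {j : ℤ} (hj : j < I.topLvl) (i : Fin I.k) : I.ring i j = I.cell i j := by
  ext p
  simp [mem_ring_iff, cell, I.lvl_eq_iff_of_lt hj]

theorem level_eq_layer {j : ℤ} (hj : j < I.topLvl) : I.level j = I.layer j := by
  ext p
  simp [level, mem_ring_iff, layer, I.lvl_eq_iff_of_lt hj]

theorem outerRing_eq_cell (i : Fin I.k) : I.outerRing i = I.cell i I.topLvl := by
  ext p
  rw [mem_outerRing]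
  simp only [mem_ring_iff, cell, Finset.mem_filter, Finset.mem_univ, true_and, lvl_eq_topLvl,
    topLvl_le]
  constructor
  · rintro ⟨h1, j, hj, h2, -, rfl⟩
    exact ⟨h2, h1, hj⟩
  · rintro ⟨h1, h2, h3⟩
    exact ⟨h2, _, h3, h1, h2, rfl⟩

theorem outerAll_eq_layer : I.outerAll = I.layer I.topLvl := by
  ext p
  simp [outerAll, outerRing_eq_cell, cell, layer]

theorem mem_cell_self {p : Fin I.n} (h : 0 < I.dz p I.A) : p ∈ I.cell (I.σ p) (I.lvl p) := by
  simp [cell, h]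

theorem cell_subset_layer (i : Fin I.k) (l : ℤ) : I.cell i l ⊆ I.layer l := by
  intro p hp
  simp only [cell, layer, Finset.mem_filter, Finset.mem_univ, true_and] at hp ⊢
  exact ⟨hp.1, hp.2.2⟩

theorem cost_cell_pos {p : Fin I.n} (h : 0 < I.dz p I.A) :
    0 < I.cost (I.cell (I.σ p) (I.lvl p)) I.A :=
  lt_of_lt_of_le h (Finset.single_le_sum (fun p _ => I.dz_nonneg p I.A) (I.mem_cell_self h))

theorem cost_layer_pos {p : Fin I.n} (h : 0 < I.dz p I.A) : 0 < I.cost (I.layer (I.lvl p)) I.A :=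
  (I.cost_cell_pos h).trans_le (I.cost_mono (I.cell_subset_layer _ _) _)

theorem band_eq_iff {p : Fin I.n} (h : 0 < I.dz p I.A) (b : ℤ) : I.band p = b ↔
    (2 : ℝ) ^ b * I.cost (I.layer (I.lvl p)) I.A ≤ I.cost (I.cell (I.σ p) (I.lvl p)) I.A ∧
      I.cost (I.cell (I.σ p) (I.lvl p)) I.A < (2 : ℝ) ^ (b + 1) * I.cost (I.layer (I.lvl p)) I.A :=
  floor_logb_eq_iff (I.cost_cell_pos h) (I.cost_layer_pos h) b

theorem band_nonpos {p : Fin I.n} (h : 0 < I.dz p I.A) : I.band p ≤ 0 := by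
  have h1 := ((I.band_eq_iff h _).1 rfl).1
  have h2 := h1.trans (I.cost_mono (I.cell_subset_layer _ _) _)
  have h3 := I.cost_layer_pos h
  by_contra hlt
  push Not at hlt
  have h4 : (1 : ℝ) < 2 ^ I.band p := one_lt_zpow₀ one_lt_two hlt
  nlinarith

theorem mem_bands {b : ℤ} : b ∈ I.bands ↔ I.bandLo < (b : ℝ) ∧ b ≤ 0 := by
  simp only [bands, Finset.mem_filter, Finset.mem_Icc]
  constructor
  · rintro ⟨⟨-, h1⟩, h2⟩; exact ⟨h2, h1⟩
  · rintro ⟨h1, h2⟩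
    refine ⟨⟨?_, h2⟩, h1⟩
    exact Int.floor_le_iff.2 (h1.trans (by linarith))

theorem mem_mainLevels {j : ℤ} : j ∈ I.mainLevels ↔ I.mainLo < (j : ℝ) ∧ j < I.topLvl := by
  simp only [mainLevels, Finset.mem_filter, Finset.mem_Icc, lt_topLvl]
  constructor
  · rintro ⟨-, h⟩; exact h
  · rintro ⟨h1, h2⟩
    exact ⟨⟨Int.floor_le_iff.2 (h1.trans (by linarith)), (Int.lt_ceil.2 h2).le⟩, h1, h2⟩

theorem one_lt_z_div_ε : 1 < I.z / I.ε := by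
  rw [one_lt_div I.ε_pos]
  exact I.ε_lt_one.trans_le I.one_le_z

theorem mainHi_pos : 0 < I.mainHi := by
  have := Real.logb_pos one_lt_two I.one_lt_z_div_ε
  have := I.z_pos
  unfold mainHi
  positivity

theorem mainLo_neg : I.mainLo < 0 := by
  refine mul_neg_of_pos_of_neg I.z_pos (Real.logb_neg one_lt_two (div_pos I.ε_pos I.z_pos) ?_)
  rw [div_lt_one I.z_pos]
  exact I.ε_lt_one.trans_le I.one_le_z

theorem mainLo_lt_topLvl : I.mainLo < (I.topLvl : ℝ) :=
  I.mainLo_neg.trans (I.mainHi_pos.trans_le (Int.le_ceil _))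

/-- Description of the groups by the labels of the points. -/
theorem mem_group_iff {g : Label} {p : Fin I.n} :
    g ∈ I.groups ∧ p ∈ I.group g ↔ I.Sampled p ∧ I.labelOf p = g := by
  have hgr : p ∈ I.group g → (g ∈ I.groups ↔ g ∈ ((I.mainLevels ×ˢ I.bands).image
      fun jb => Label.main jb.1 jb.2) ∪ I.bands.image Label.outer) := fun h => by
    rw [groups, Finset.mem_filter]
    exact ⟨fun h => h.1, fun h' => ⟨h', ⟨p, h⟩⟩⟩
  have hmem : g ∈ I.groups ∧ p ∈ I.group g ↔ (g ∈ ((I.mainLevels ×ˢ I.bands).image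
      fun jb => Label.main jb.1 jb.2) ∪ I.bands.image Label.outer) ∧ p ∈ I.group g :=
    and_congr_left hgr
  rw [hmem]
  cases g with
  | main j b =>
    have h1 : Label.main j b ∈ ((I.mainLevels ×ˢ I.bands).image
        fun jb => Label.main jb.1 jb.2) ∪ I.bands.image Label.outer ↔
        j ∈ I.mainLevels ∧ b ∈ I.bands := by
      simp only [Finset.mem_union, Finset.mem_image, Finset.mem_product, reduceCtorEq, and_false,
        exists_false, or_false, Label.main.injEq, Prod.exists]
      exact ⟨by rintro ⟨_, _, h, rfl, rfl⟩; exact h, fun h => ⟨j, b, h, rfl, rfl⟩⟩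
    rw [h1, mem_mainLevels, mem_bands]
    simp only [group, Finset.mem_filter, Finset.mem_univ, true_and]
    constructor
    · rintro ⟨⟨⟨h2, h3⟩, h4, h5⟩, h6, h7, h8⟩
      rw [I.ring_eq_cell h3] at h6 h7 h8
      rw [I.level_eq_layer h3] at h7 h8
      simp only [cell, Finset.mem_filter, Finset.mem_univ, true_and] at h6
      obtain ⟨h9, rfl⟩ := h6
      have hb := (I.band_eq_iff h9 b).2 ⟨h7, h8⟩
      refine ⟨⟨h9, h2, by rw [hb]; exact h4⟩, ?_⟩
      rw [labelOf, if_neg h3.ne, hb]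
    · rintro ⟨⟨h2, h3, h4⟩, h5⟩
      unfold labelOf at h5
      split_ifs at h5 with h6
      simp only [Label.main.injEq] at h5
      obtain ⟨rfl, rfl⟩ := h5
      have h7 : I.lvl p < I.topLvl := lt_of_le_of_ne (I.lvl_le p) h6
      rw [I.ring_eq_cell h7, I.level_eq_layer h7]
      exact ⟨⟨⟨h3, h7⟩, h4, I.band_nonpos h2⟩, I.mem_cell_self h2, (I.band_eq_iff h2 _).1 rfl⟩
  | outer b =>
    have h1 : Label.outer b ∈ ((I.mainLevels ×ˢ I.bands).image
        fun jb => Label.main jb.1 jb.2) ∪ I.bands.image Label.outer ↔ b ∈ I.bands := by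
      simp
    rw [h1, mem_bands]
    simp only [group, Finset.mem_filter, Finset.mem_univ, true_and, outerRing_eq_cell,
      outerAll_eq_layer]
    constructor
    · rintro ⟨⟨h4, h5⟩, h6, h7, h8⟩
      simp only [cell, Finset.mem_filter, Finset.mem_univ, true_and] at h6
      obtain ⟨h9, h10⟩ := h6
      rw [← h10] at h7 h8
      have hb := (I.band_eq_iff h9 b).2 ⟨h7, h8⟩
      refine ⟨⟨h9, by rw [h10]; exact I.mainLo_lt_topLvl, by rw [hb]; exact h4⟩, ?_⟩
      rw [labelOf, if_pos h10, hb]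
    · rintro ⟨⟨h2, h3, h4⟩, h5⟩
      unfold labelOf at h5
      split_ifs at h5 with h6
      simp only [Label.outer.injEq] at h5
      obtain rfl := h5
      rw [← h6]
      exact ⟨⟨h4, I.band_nonpos h2⟩, I.mem_cell_self h2, (I.band_eq_iff h2 _).1 rfl⟩

theorem eq_labelOf {g : Label} (hg : g ∈ I.groups) {p : Fin I.n} (hp : p ∈ I.group g) :
    I.labelOf p = g := (I.mem_group_iff.1 ⟨hg, hp⟩).2

/-- The part of a group in the `i`-th cluster. -/
def fiber (g : Label) (i : Fin I.k) : Finset (Fin I.n) := (I.group g).filter fun p => I.σ p = i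

theorem mem_fiber {g : Label} {i : Fin I.k} {p : Fin I.n} :
    p ∈ I.fiber g i ↔ p ∈ I.group g ∧ I.σ p = i := by simp [fiber]

theorem sum_fiber (g : Label) (f : Fin I.n → ℝ) :
    ∑ i, ∑ p ∈ I.fiber g i, f p = ∑ p ∈ I.group g, f p :=
  Finset.sum_fiberwise _ _ _

/-- The condition defining a group concerns the ring as a whole, so a group contains every ring that
it meets. -/
theorem fiber_main {j b : ℤ} {p : Fin I.n} (hp : p ∈ I.group (.main j b)) :
    I.fiber (.main j b) (I.σ p) = I.ring (I.σ p) j := by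
  ext q
  simp only [mem_fiber, group, Finset.mem_filter, Finset.mem_univ, true_and] at hp ⊢
  constructor
  · rintro ⟨h1, h2⟩; rw [← h2]; exact h1.1
  · intro h
    have hq := (I.mem_ring.1 h).1
    rw [hq]
    exact ⟨⟨h, hp.2⟩, rfl⟩

theorem fiber_outer {b : ℤ} {p : Fin I.n} (hp : p ∈ I.group (.outer b)) :
    I.fiber (.outer b) (I.σ p) = I.outerRing (I.σ p) := by
  ext q
  simp only [mem_fiber, group, Finset.mem_filter, Finset.mem_univ, true_and] at hp ⊢
  constructor
  · rintro ⟨h1, h2⟩; rw [← h2]; exact h1.1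
  · intro h
    have hq := (I.mem_outerRing.1 h).1
    rw [hq]
    exact ⟨⟨h, hp.2⟩, rfl⟩

/-- All rings of a group have about the same cost. -/
theorem exists_fiber_cost (g : Label) : ∃ l : ℝ, ∀ p ∈ I.group g,
    l ≤ I.cost (I.fiber g (I.σ p)) I.A ∧ I.cost (I.fiber g (I.σ p)) I.A ≤ 2 * l := by
  cases g with
  | main j b =>
    refine ⟨(2 : ℝ) ^ b * I.cost (I.level j) I.A, fun p hp => ?_⟩
    rw [I.fiber_main hp]
    simp only [group, Finset.mem_filter, Finset.mem_univ, true_and] at hp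
    rw [zpow_add_one₀ two_ne_zero] at hp
    exact ⟨hp.2.1, by linarith [hp.2.2]⟩
  | outer b =>
    refine ⟨(2 : ℝ) ^ b * I.cost I.outerAll I.A, fun p hp => ?_⟩
    rw [I.fiber_outer hp]
    simp only [group, Finset.mem_filter, Finset.mem_univ, true_and] at hp
    rw [zpow_add_one₀ two_ne_zero] at hp
    exact ⟨hp.2.1, by linarith [hp.2.2]⟩

/-- The group consists of at most `k` rings, and no ring costs more than twice as much as another.
This balance is the purpose of the bands. -/
theorem cost_group_le {g : Label} {p : Fin I.n} (hp : p ∈ I.group g) :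
    I.cost (I.group g) I.A ≤ 2 * I.k * I.cost (I.fiber g (I.σ p)) I.A := by
  obtain ⟨l, hl⟩ := I.exists_fiber_cost g
  have hc := I.cost_nonneg (I.fiber g (I.σ p)) I.A
  have h : ∀ i : Fin I.k, ∑ q ∈ I.fiber g i, I.dz q I.A ≤
      2 * I.cost (I.fiber g (I.σ p)) I.A := by
    intro i
    rcases (I.fiber g i).eq_empty_or_nonempty with h | ⟨q, hq⟩
    · rw [h, Finset.sum_empty]; linarith
    · obtain ⟨hg, rfl⟩ := I.mem_fiber.1 hq
      have h1 := (hl q hg).2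
      have h2 := (hl p hp).1
      unfold cost at h1 h2 ⊢
      linarith
  calc I.cost (I.group g) I.A = ∑ i, ∑ q ∈ I.fiber g i, I.dz q I.A := (I.sum_fiber g _).symm
    _ ≤ ∑ _i : Fin I.k, 2 * I.cost (I.fiber g (I.σ p)) I.A := Finset.sum_le_sum fun i _ => h i
    _ = _ := by simp; ring

end Setup

end
end KZCoreset

/-! ### Inequalities for powers with exponent `z` -/

namespace KZCoreset
noncomputable section

section Powers

theorem rpow_add_le {x y z : ℝ} (hx : 0 ≤ x) (hy : 0 ≤ y) (hz : 0 ≤ z) :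
    (x + y) ^ z ≤ 2 ^ z * (x ^ z + y ^ z) := by
  wlog h : y ≤ x generalizing x y
  · have := this hy hx (le_of_not_ge h)
    rwa [add_comm y x, add_comm (y ^ z)] at this
  calc (x + y) ^ z ≤ (2 * x) ^ z := Real.rpow_le_rpow (by positivity) (by linarith) hz
    _ = 2 ^ z * x ^ z := Real.mul_rpow zero_le_two hx
    _ ≤ _ := by
      have := Real.rpow_nonneg hy z
      gcongr
      linarith

theorem rpow_add_add_le {x y w z : ℝ} (hx : 0 ≤ x) (hy : 0 ≤ y) (hw : 0 ≤ w) (hz : 0 ≤ z) :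
    (x + y + w) ^ z ≤ 3 ^ z * (x ^ z + y ^ z + w ^ z) := by
  have h1 := Real.rpow_nonneg hx z
  have h2 := Real.rpow_nonneg hy z
  have h3 := Real.rpow_nonneg hw z
  have key : ∀ t, 0 ≤ t → x + y + w ≤ 3 * t → t ^ z ≤ x ^ z + y ^ z + w ^ z →
      (x + y + w) ^ z ≤ 3 ^ z * (x ^ z + y ^ z + w ^ z) := by
    intro t ht h4 h5
    calc (x + y + w) ^ z ≤ (3 * t) ^ z := Real.rpow_le_rpow (by positivity) h4 hz
      _ = 3 ^ z * t ^ z := Real.mul_rpow (by norm_num) ht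
      _ ≤ _ := by gcongr
  rcases le_total x y with hxy | hxy <;> rcases le_total y w with hyw | hyw <;>
    rcases le_total x w with hxw | hxw
  · exact key w hw (by linarith) (by linarith)
  · exact key w hw (by linarith) (by linarith)
  · exact key y hy (by linarith) (by linarith)
  · exact key y hy (by linarith) (by linarith)
  · exact key w hw (by linarith) (by linarith)
  · exact key x hx (by linarith) (by linarith)
  · exact key x hx (by linarith) (by linarith)
  · exact key x hx (by linarith) (by linarith)

theorem one_add_rpow_le {t z w : ℝ} (ht : 0 ≤ t) (hz : 0 ≤ z) (hw : t * z = w) (hw1 : w ≤ 1) :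
    (1 + t) ^ z ≤ 1 + 2 * w := by
  have hw0 : 0 ≤ w := hw ▸ mul_nonneg ht hz
  have h1 : (1 + t) ^ z ≤ Real.exp w := by
    rw [← hw, Real.exp_mul]
    exact Real.rpow_le_rpow (by positivity) (by linarith [Real.add_one_le_exp t]) hz
  have h2 := (abs_le.1 (Real.abs_exp_sub_one_sub_id_le (by rwa [abs_of_nonneg hw0]))).2
  nlinarith

/-- Near a point that is far from all centers the cost is almost constant. -/
theorem rpow_near {x y z ε : ℝ} (hx : 0 ≤ x) (hy : 0 ≤ y) (hz : 1 ≤ z) (hε : 0 < ε) (hε1 : ε < 1)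
    (h : |x - y| ≤ ε / (4 * z) * y) : |x ^ z - y ^ z| ≤ ε * y ^ z ∧ y ^ z ≤ 2 * x ^ z := by
  have hz0 : 0 < z := by linarith
  set t := ε / (4 * z) with ht
  have ht0 : 0 < t := by positivity
  have htz : t * z = ε / 4 := by rw [ht]; field_simp
  have ht1 : t ≤ 1 := by nlinarith
  obtain ⟨h1, h2⟩ := abs_le.1 h
  have hyz := Real.rpow_nonneg hy z
  -- The upper bound goes through `(1 + t)^z ≤ exp (t z)`, the lower one is Bernoulli's inequality;
  -- both use `t z = ε / 4`.
  have hup : x ^ z ≤ (1 + ε / 2) * y ^ z := by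
    calc x ^ z ≤ ((1 + t) * y) ^ z := Real.rpow_le_rpow hx (by linarith) hz0.le
      _ = (1 + t) ^ z * y ^ z := Real.mul_rpow (by positivity) hy
      _ ≤ _ := by
        gcongr
        have := one_add_rpow_le ht0.le hz0.le htz (by linarith)
        linarith
  have hlo : (1 - ε / 4) * y ^ z ≤ x ^ z := by
    calc (1 - ε / 4) * y ^ z ≤ (1 + -t) ^ z * y ^ z := by
          gcongr
          have := one_add_mul_self_le_rpow_one_add (s := -t) (by linarith) hz
          linarith
      _ = ((1 + -t) * y) ^ z := (Real.mul_rpow (by linarith) hy).symm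
      _ ≤ _ := Real.rpow_le_rpow (mul_nonneg (by linarith) hy) (by linarith) hz0.le
  refine ⟨abs_le.2 ⟨by nlinarith, by nlinarith⟩, by nlinarith⟩

/-- Convexity of `t ↦ t^z` with weights `1/(1+η)` and `η/(1+η)`, where `η = ε/z`. Then `(1+η)^z ≤ 1
+ 2ε` keeps the relative loss on `x` small, while `d` is multiplied by `η⁻¹ = z/ε` before taking the
power. -/
theorem rpow_add_le_trade {x d z ε : ℝ} (hx : 0 ≤ x) (hd : 0 ≤ d) (hz : 1 ≤ z) (hε : 0 < ε)
    (hε1 : ε < 1) : (x + d) ^ z ≤ (1 + 2 * ε) * x ^ z + 3 * ε * (z / ε) ^ z * d ^ z := by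
  have hz0 : 0 < z := by linarith
  set η := ε / z with hη
  have hη0 : 0 < η := by positivity
  have hηε : η ≤ ε := div_le_self hε.le hz
  have hpow : (1 + η) ^ z ≤ 1 + 2 * ε :=
    one_add_rpow_le hη0.le hz0.le (by rw [hη]; field_simp) hε1.le
  have h := (convexOn_rpow hz).2 (x := x * (1 + η)) (y := d * ((1 + η) * η⁻¹))
    (Set.mem_Ici.2 (by positivity)) (Set.mem_Ici.2 (by positivity))
    (show 0 ≤ 1 / (1 + η) by positivity) (show 0 ≤ η / (1 + η) by positivity) (by field_simp)
  simp only [smul_eq_mul] at h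
  have e1 : 1 / (1 + η) * (x * (1 + η)) + η / (1 + η) * (d * ((1 + η) * η⁻¹)) = x + d := by
    field_simp
  rw [e1, Real.mul_rpow hx (by positivity), Real.mul_rpow hd (by positivity),
    Real.mul_rpow (by positivity) (by positivity)] at h
  have e2 : η⁻¹ = z / ε := by rw [hη, inv_div]
  rw [e2] at h
  refine h.trans ?_
  have hxz := Real.rpow_nonneg hx z
  have hdz := Real.rpow_nonneg hd z
  have hzε : 0 ≤ (z / ε) ^ z := by positivity
  have h0 : 0 ≤ (1 + η) ^ z := by positivity
  have hw1 : 1 / (1 + η) ≤ 1 := by rw [div_le_one (by positivity)]; linarith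
  have hw2 : η / (1 + η) ≤ ε := (div_le_self hη0.le (by linarith)).trans hηε
  refine add_le_add ?_ ?_
  · calc 1 / (1 + η) * (x ^ z * (1 + η) ^ z) ≤ 1 * (x ^ z * (1 + 2 * ε)) := by gcongr
      _ = _ := by ring
  · calc η / (1 + η) * (d ^ z * ((1 + η) ^ z * (z / ε) ^ z)) ≤
        ε * (d ^ z * (3 * (z / ε) ^ z)) := by gcongr; linarith
      _ = _ := by ring

/-- `rpow_add_le_trade` is applied in both directions. When `y` is the smaller number the loss is
relative to `y^z`, which may then be replaced by `x^z`. -/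
theorem rpow_snap {x y d z ε : ℝ} (hx : 0 ≤ x) (hy : 0 ≤ y) (hz : 1 ≤ z) (hε : 0 < ε)
    (hε1 : ε < 1) (h : |x - y| ≤ d) :
    |x ^ z - y ^ z| ≤ 2 * ε * x ^ z + 3 * ε * (z / ε) ^ z * d ^ z := by
  have hd := (abs_nonneg _).trans h
  have hz0 : 0 ≤ z := by linarith
  obtain ⟨h1, h2⟩ := abs_le.1 h
  have a1 := (Real.rpow_le_rpow hy (show y ≤ x + d by linarith) hz0).trans
    (rpow_add_le_trade hx hd hz hε hε1)
  have a2 := (Real.rpow_le_rpow hx (show x ≤ y + d by linarith) hz0).trans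
    (rpow_add_le_trade hy hd hz hε hε1)
  have hxz := Real.rpow_nonneg hx z
  have hM : 0 ≤ 3 * ε * (z / ε) ^ z * d ^ z := by positivity
  rw [abs_le]
  constructor
  · linarith
  · rcases le_total (x ^ z) (y ^ z) with h3 | h3
    · nlinarith
    · nlinarith

/-- `4^u - 1 = 2^u · 2 sinh (u log 2)` and `sinh t ≥ t`, with `2 log 2 > 1.38`. -/
theorem two_rpow_sub_ge {u : ℝ} (hu : 0 ≤ u) : 1.38 * u * 2 ^ u ≤ (4 : ℝ) ^ u - 1 := by
  have h1 : (2 : ℝ) ^ u = Real.exp (u * Real.log 2) := by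
    rw [Real.rpow_def_of_pos two_pos, mul_comm]
  have h2 : (4 : ℝ) ^ u = 2 ^ u * 2 ^ u := by
    rw [← Real.mul_rpow zero_le_two zero_le_two]; norm_num
  have h3 : 0 ≤ u * Real.log 2 := mul_nonneg hu (Real.log_nonneg one_le_two)
  have h4 := Real.self_le_sinh_iff.2 h3
  rw [Real.sinh_eq] at h4
  have h5 : (2 : ℝ) ^ u * Real.exp (-(u * Real.log 2)) = 1 := by
    rw [h1, ← Real.exp_add, add_neg_cancel, Real.exp_zero]
  have h6 : 0 < (2 : ℝ) ^ u := by positivity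
  rw [← h1] at h4
  have h7 := Real.log_two_gt_d9
  have h8 : 1.38 * u ≤ 2 ^ u - Real.exp (-(u * Real.log 2)) := by nlinarith
  nlinarith [mul_le_mul_of_nonneg_left h8 h6.le]

/-- If a point of distance `r` from its center is much farther from `C`, so is the center. -/
theorem far_center {D r x Δ z ε : ℝ} (hΔ : 0 ≤ Δ) (hr : 0 ≤ r) (hx : 0 ≤ x) (hz : 1 ≤ z)
    (hε : 0 < ε) (hε1 : ε < 1) (h1 : (z / ε) ^ (2 * z) * Δ ≤ r ^ z) (h2 : 4 * r ^ z ≤ x ^ z)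
    (h3 : x ≤ D + r) :
    (2 * Δ) ^ (1 / z) ≤ D / 1.38 ∧ 2 * Δ ≤ (ε ^ 2 / z) ^ z * D ^ z ∧ 0 ≤ D := by
  have hz0 : 0 < z := by linarith
  have hu0 : 0 ≤ 1 / z := by positivity
  have hinv : ∀ t : ℝ, 0 ≤ t → (t ^ z) ^ (1 / z) = t := fun t ht => by
    rw [← Real.rpow_mul ht, mul_one_div_cancel hz0.ne', Real.rpow_one]
  have a1 : (4 : ℝ) ^ (1 / z) * r ≤ x := by
    have := Real.rpow_le_rpow (by positivity) h2 hu0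
    rwa [Real.mul_rpow (by norm_num) (by positivity), hinv r hr, hinv x hx] at this
  have a2 : (z / ε) ^ 2 * Δ ^ (1 / z) ≤ r := by
    have := Real.rpow_le_rpow (by positivity) h1 hu0
    rw [Real.mul_rpow (by positivity) hΔ, hinv r hr, ← Real.rpow_mul (by positivity)] at this
    have e : 2 * z * (1 / z) = ((2 : ℕ) : ℝ) := by push_cast; field_simp
    rwa [e, Real.rpow_natCast] at this
  have a3 := two_rpow_sub_ge hu0
  -- `D ≥ x - r ≥ (4^(1/z) - 1) r`, where the first factor is only of order `1/z`. The square in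
  -- `(z/ε)² Δ^(1/z) ≤ r` makes up for this loss, which is why outer levels start at `2 z log
  -- (z/ε)`.
  have a4 : 1.38 * z / ε ^ 2 * (2 * Δ) ^ (1 / z) ≤ D := by
    have hΔz : 0 ≤ Δ ^ (1 / z) := by positivity
    calc 1.38 * z / ε ^ 2 * (2 * Δ) ^ (1 / z)
        = (1.38 * (1 / z) * 2 ^ (1 / z)) * ((z / ε) ^ 2 * Δ ^ (1 / z)) := by
          rw [Real.mul_rpow zero_le_two hΔ]; field_simp
      _ ≤ ((4 : ℝ) ^ (1 / z) - 1) * r := by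
          refine mul_le_mul a3 a2 (by positivity) (le_trans (by positivity) a3)
      _ ≤ D := by linarith
  have hs : 0 ≤ (2 * Δ) ^ (1 / z) := by positivity
  have a5 : (2 * Δ) ^ (1 / z) ≤ ε ^ 2 / z * D := by
    have h5 : 1.38 * z / ε ^ 2 * (2 * Δ) ^ (1 / z) = 1.38 * ((2 * Δ) ^ (1 / z) / (ε ^ 2 / z)) := by
      field_simp
    have h6 : (2 * Δ) ^ (1 / z) / (ε ^ 2 / z) ≤ D := by
      have : 0 ≤ (2 * Δ) ^ (1 / z) / (ε ^ 2 / z) := by positivity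
      linarith
    rw [div_le_iff₀ (by positivity)] at h6
    linarith
  have hD : 0 ≤ D := le_trans (by positivity) a4
  refine ⟨?_, ?_, hD⟩
  · rw [le_div_iff₀ (by norm_num)]
    have : 1 ≤ z / ε ^ 2 := by
      rw [one_le_div (by positivity)]; nlinarith
    have h7 : 1.38 * z / ε ^ 2 * (2 * Δ) ^ (1 / z) = z / ε ^ 2 * ((2 * Δ) ^ (1 / z) * 1.38) := by
      ring
    nlinarith
  · have := Real.rpow_le_rpow hs a5 hz0.le
    rw [← Real.rpow_mul (by positivity), one_div_mul_cancel hz0.ne', Real.rpow_one,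
      Real.mul_rpow (by positivity) hD] at this
    exact this

/-- `log y ≤ y` at `y = 8/z`. The bound is uniform in `z` and keeps the final constants absolute. -/
theorem eight_div_rpow_le {z : ℝ} (hz : 0 < z) : (8 / z) ^ z ≤ Real.exp 8 := by
  rw [Real.rpow_def_of_pos (by positivity)]
  refine Real.exp_le_exp.2 ?_
  have := Real.log_le_self (show (0 : ℝ) ≤ 8 / z by positivity)
  calc _ ≤ 8 / z * z := by gcongr
    _ = 8 := by field_simp

end Powers

end
end KZCoreset

/-! ### Importance weights: range and second moments within a group -/

namespace KZCoreset
noncomputable section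

namespace Setup
open scoped Classical
variable {X : Type*} [MetricSpace X] (I : Setup X)

/-- The importance weight of a point of a group (before division by the number of samples). -/
def iw (g : Label) (p : Fin I.n) : ℝ := I.cost (I.group g) I.A / I.dz p I.A

/-- The masked clusters that meet the group. -/
def msk (g : Label) (C : Fin I.k → X) : Finset (Fin I.k) :=
  Finset.univ.filter fun i => (∃ p ∈ I.group g, I.σ p = i) ∧ I.Masked g C i

/-- The cost scale of a group. -/
def total (g : Label) (C : Fin I.k → X) : ℝ := I.cost (I.group g) C + I.cost (I.group g) I.A

/-- The function to be estimated in a group. -/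
def resid (g : Label) (C : Fin I.k → X) (p : Fin I.n) : ℝ := I.dz p C - I.baseCost g C (I.σ p)

/-- The numbers whose sum over every cluster is estimated well. -/
def base : Label → Fin I.n → ℝ
  | .main _ _, _ => 1
  | .outer _, p => I.dz p I.A

theorem mem_msk {g : Label} {C : Fin I.k → X} {p : Fin I.n} (hp : p ∈ I.group g) :
    I.σ p ∈ I.msk g C ↔ I.Masked g C (I.σ p) := by
  simp only [msk, Finset.mem_filter, Finset.mem_univ, true_and]
  exact ⟨fun h => h.2, fun h => ⟨⟨p, hp, rfl⟩, h⟩⟩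

theorem iw_nonneg (g : Label) (p : Fin I.n) : 0 ≤ I.iw g p :=
  div_nonneg (I.cost_nonneg _ _) (I.dz_nonneg _ _)

theorem cost_le_total (g : Label) (C : Fin I.k → X) : I.cost (I.group g) I.A ≤ I.total g C :=
  le_add_of_nonneg_left (I.cost_nonneg _ _)

theorem total_nonneg (g : Label) (C : Fin I.k → X) : 0 ≤ I.total g C :=
  add_nonneg (I.cost_nonneg _ _) (I.cost_nonneg _ _)

theorem sampleProb_nonneg (g : Label) (p : Fin I.n) : 0 ≤ I.sampleProb g p := by
  unfold sampleProb
  split_ifs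
  · exact div_nonneg (I.dz_nonneg _ _) (I.cost_nonneg _ _)
  · exact le_rfl

theorem mem_group_of_sampleProb_ne {g : Label} {p : Fin I.n} (h : I.sampleProb g p ≠ 0) :
    p ∈ I.group g := by
  by_contra hp
  exact h (if_neg hp)

/-- The weight is the inverse of the sampling probability on the group, so the estimator is
unbiased. -/
theorem sum_sampleProb_mul (g : Label) (f : Fin I.n → ℝ) :
    ∑ p, I.sampleProb g p * (I.iw g p * f p) = ∑ p ∈ I.group g, f p := by
  rw [← Finset.sum_filter_add_sum_filter_not Finset.univ (fun p => p ∈ I.group g)]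
  have h2 : ∑ p ∈ Finset.univ.filter (fun p => p ∉ I.group g),
      I.sampleProb g p * (I.iw g p * f p) = 0 := by
    refine Finset.sum_eq_zero fun p hp => ?_
    rw [sampleProb, if_neg (Finset.mem_filter.1 hp).2, zero_mul]
  rw [h2, add_zero]
  refine Finset.sum_congr (by ext p; simp) fun p hp => ?_
  rw [sampleProb, if_pos hp, iw]
  have h3 := I.dz_pos_of_mem_group hp
  have h4 := I.cost_group_pos ⟨p, hp⟩
  field_simp

theorem sum_sampleProb {g : Label} (hg : (I.group g).Nonempty) : ∑ p, I.sampleProb g p = 1 := by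
  have hT := I.cost_group_pos hg
  unfold sampleProb
  rw [← Finset.sum_filter, ← Finset.sum_div]
  have : Finset.univ.filter (fun p => p ∈ I.group g) = I.group g := by ext p; simp
  rw [this]
  exact div_self hT.ne'

theorem sum_sampleProb_maskW (g : Label) (c : Fin I.n → Prop) (f : Fin I.n → ℝ) :
    ∑ p, I.sampleProb g p * maskW (I.iw g) c f p =
      ∑ p ∈ I.group g, if c p then f p else 0 := by
  rw [← I.sum_sampleProb_mul g]
  refine Finset.sum_congr rfl fun p _ => ?_
  unfold maskW
  split_ifs <;> simp

theorem iw_mul_dz {g : Label} {p : Fin I.n} (hp : p ∈ I.group g) :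
    I.iw g p * I.dz p I.A = I.cost (I.group g) I.A :=
  div_mul_cancel₀ _ (I.dz_pos_of_mem_group hp).ne'

theorem dz_lt_of_not_masked_outer {b : ℤ} {C : Fin I.k → X} {p : Fin I.n}
    (hp : p ∈ I.group (.outer b)) (h : ¬ I.Masked (.outer b) C (I.σ p)) :
    I.dz p C < 4 * I.dz p I.A := by
  simp only [Masked, not_exists, not_and, not_le] at h
  exact h p hp rfl

/-- This explains the form of `err`: by `W d^z(p, A) = T` its weighted square is at most `2 N (W d +
T)`, so it is controlled by the cost of the sample. In an outer group an unmasked point has `W d < 4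
T`, so `(W d + T)² ≤ 5 T (W d + T)`. -/
theorem iw_scale_sq_le {g : Label} {C : Fin I.k → X} {p : Fin I.n} (hp : p ∈ I.group g)
    (h : ¬ I.Masked g C (I.σ p)) : (I.iw g p * I.scale g C p) ^ 2 ≤
      5 * (I.total g C * (I.iw g p * I.dz p C + I.cost (I.group g) I.A)) := by
  have ha := I.dz_pos_of_mem_group hp
  have hT := I.cost_group_pos ⟨p, hp⟩
  have hx := I.dz_nonneg p C
  have hW := I.iw_nonneg g p
  have hWa := I.iw_mul_dz hp
  have hN := I.cost_le_total g C
  have hN0 := I.total_nonneg g C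
  cases g with
  | main j b =>
    set T := I.cost (I.group (.main j b)) I.A with hTdef
    set W := I.iw (.main j b) p with hWdef
    set N := I.total (.main j b) C with hNdef
    have e : I.scale (.main j b) C p =
        (Real.sqrt (I.dz p C * I.dz p I.A) + I.dz p I.A) * Real.sqrt (N / T) := rfl
    rw [e, mul_pow, mul_pow, Real.sq_sqrt (by positivity)]
    have h1 : (Real.sqrt (I.dz p C * I.dz p I.A) + I.dz p I.A) ^ 2 ≤
        2 * (I.dz p C * I.dz p I.A + I.dz p I.A ^ 2) := by
      have := Real.sq_sqrt (show 0 ≤ I.dz p C * I.dz p I.A by positivity)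
      nlinarith [sq_nonneg (Real.sqrt (I.dz p C * I.dz p I.A) - I.dz p I.A)]
    calc _ ≤ W ^ 2 * (2 * (I.dz p C * I.dz p I.A + I.dz p I.A ^ 2) * (N / T)) := by gcongr
      _ = 2 * (W * I.dz p C + W * I.dz p I.A) * (W * I.dz p I.A) * (N / T) := by ring
      _ = 2 * (N * (W * I.dz p C + T)) := by rw [hWa]; field_simp
      _ ≤ _ := by
        have : 0 ≤ N * (W * I.dz p C + T) := by positivity
        linarith
  | outer b =>
    have h4 := I.dz_lt_of_not_masked_outer hp h
    set T := I.cost (I.group (.outer b)) I.A with hTdef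
    set W := I.iw (.outer b) p with hWdef
    set N := I.total (.outer b) C with hNdef
    have e : W * I.scale (.outer b) C p = W * I.dz p C + T := by
      rw [← hWa]; exact mul_add _ _ _
    rw [e]
    have h5 : W * I.dz p C ≤ 4 * T := by
      have := mul_le_mul_of_nonneg_left h4.le hW
      linarith
    have h6 : 0 ≤ W * I.dz p C := by positivity
    nlinarith [mul_le_mul_of_nonneg_right hN (show 0 ≤ W * I.dz p C + T by linarith)]

theorem mem_group_main {j b : ℤ} {p : Fin I.n} (hp : p ∈ I.group (.main j b)) :
    (2 : ℝ) ^ j * I.Δ (I.σ p) ≤ I.dz p I.A ∧ I.dz p I.A ≤ 2 * ((2 : ℝ) ^ j * I.Δ (I.σ p)) ∧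
      0 < (2 : ℝ) ^ j * I.Δ (I.σ p) := by
  have h := (Finset.mem_filter.1 hp).2.1
  have h1 := I.Δ_pos_of_mem_ring h
  obtain ⟨-, h2, h3⟩ := I.mem_ring.1 h
  rw [zpow_add_one₀ two_ne_zero] at h3
  exact ⟨h2, by linarith, by positivity⟩

theorem cost_group_main_le {j b : ℤ} {p : Fin I.n} (hp : p ∈ I.group (.main j b)) :
    I.cost (I.group (.main j b)) I.A ≤
      4 * I.k * ((I.fiber (.main j b) (I.σ p)).card * ((2 : ℝ) ^ j * I.Δ (I.σ p))) := by
  refine (I.cost_group_le hp).trans ?_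
  have h : I.cost (I.fiber (.main j b) (I.σ p)) I.A ≤
      (I.fiber (.main j b) (I.σ p)).card • (2 * ((2 : ℝ) ^ j * I.Δ (I.σ p))) := by
    refine Finset.sum_le_card_nsmul _ _ _ fun q hq => ?_
    obtain ⟨h1, h2⟩ := I.mem_fiber.1 hq
    rw [← h2]
    exact (I.mem_group_main h1).2.1
  rw [nsmul_eq_mul] at h
  calc _ ≤ 2 * (I.k : ℝ) * ((I.fiber (.main j b) (I.σ p)).card *
        (2 * ((2 : ℝ) ^ j * I.Δ (I.σ p)))) := by gcongr
    _ = _ := by ring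

theorem dist_center_rpow (p : Fin I.n) : dist (I.P p) (I.A (I.σ p)) ^ I.z = I.dz p I.A := by
  rw [dz, distTo_A]

theorem dz_le_center (p : Fin I.n) (C : Fin I.k → X) :
    I.dz p C ≤ 2 ^ I.z * (distTo (I.A (I.σ p)) C ^ I.z + I.dz p I.A) := by
  rw [← I.dist_center_rpow]
  refine le_trans (Real.rpow_le_rpow (distTo_nonneg _ _)
    (distTo_le_add I.one_le_k (I.P p) (I.A (I.σ p)) C) I.z_pos.le) ?_
  exact rpow_add_le (distTo_nonneg _ _) dist_nonneg I.z_pos.le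

theorem center_le_dz (p : Fin I.n) (C : Fin I.k → X) :
    distTo (I.A (I.σ p)) C ^ I.z ≤ 2 ^ I.z * (I.dz p C + I.dz p I.A) := by
  rw [← I.dist_center_rpow p]
  refine le_trans (Real.rpow_le_rpow (distTo_nonneg _ _)
    (distTo_le_add I.one_le_k (I.A (I.σ p)) (I.P p) C) I.z_pos.le) ?_
  rw [dist_comm]
  exact rpow_add_le (distTo_nonneg _ _) dist_nonneg I.z_pos.le

set_option maxHeartbeats 800000 in
/-- In a main group, the cost of an unmasked point is small compared with the cost of its own ring
and of every masked ring. -/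
theorem dz_le_fiber_cost {j b : ℤ} {C : Fin I.k → X} {p : Fin I.n}
    (hp : p ∈ I.group (.main j b)) (h : ¬ I.Masked (.main j b) C (I.σ p)) {i : Fin I.k}
    (hi : i = I.σ p ∨ i ∈ I.msk (.main j b) C) :
    I.iw (.main j b) p * I.dz p C ≤ 12 * 4 ^ I.z * I.k *
      ∑ q ∈ I.fiber (.main j b) i, (I.dz q C + I.dz q I.A) := by
  set g := Label.main j b with hg
  obtain ⟨hp1, hp2, hp3⟩ := I.mem_group_main hp
  have ha := I.dz_pos_of_mem_group hp
  have hx := I.dz_nonneg p C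
  have hz := I.z_pos
  have hz1 := I.one_le_z
  have h4 : (4 : ℝ) ^ I.z = 2 ^ I.z * 2 ^ I.z := by
    rw [← Real.mul_rpow zero_le_two zero_le_two]; norm_num
  rcases hi with rfl | hi
  · set τ := (2 : ℝ) ^ j * I.Δ (I.σ p) with hτ
    have hT := I.cost_group_main_le hp
    have h3 : (3 : ℝ) ^ I.z ≤ 4 ^ I.z := Real.rpow_le_rpow (by norm_num) (by norm_num) hz.le
    -- Own ring: every `q` in it satisfies `d^z(p, A) ≤ 2 d^z(q, A)`, so the triangle inequality
    -- through the common center bounds the cost of `p` by that of `q`. Averaging over the ring uses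
    -- that the weight of `p` is at most `4 k` times its size.
    have hq : ∀ q ∈ I.fiber g (I.σ p), I.dz p C ≤ 3 * 3 ^ I.z * (I.dz q C + I.dz q I.A) := by
      intro q hq
      obtain ⟨hq1, hq2⟩ := I.mem_fiber.1 hq
      obtain ⟨hq3, hq4, -⟩ := I.mem_group_main hq1
      rw [hq2, ← hτ] at hq3 hq4
      have hd : distTo (I.P p) C ≤ distTo (I.P q) C + dist (I.P q) (I.A (I.σ q)) +
          dist (I.P p) (I.A (I.σ p)) := by
        have h1 := distTo_le_add I.one_le_k (I.P p) (I.P q) C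
        have h2 := dist_triangle_right (I.P p) (I.P q) (I.A (I.σ p))
        rw [hq2]
        linarith
      have := (Real.rpow_le_rpow (distTo_nonneg _ _) hd hz.le).trans
        (rpow_add_add_le (distTo_nonneg _ _) dist_nonneg dist_nonneg hz.le)
      rw [I.dist_center_rpow, I.dist_center_rpow] at this
      change I.dz p C ≤ 3 ^ I.z * (I.dz q C + I.dz q I.A + I.dz p I.A) at this
      refine this.trans ?_
      have h5 := I.dz_nonneg q C
      have h6 : I.dz q C + I.dz q I.A + I.dz p I.A ≤ 3 * (I.dz q C + I.dz q I.A) := by linarith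
      calc _ ≤ 3 ^ I.z * (3 * (I.dz q C + I.dz q I.A)) := by gcongr
        _ = _ := by ring
    have hsum := Finset.card_nsmul_le_sum _ _ _ hq
    rw [nsmul_eq_mul, ← Finset.mul_sum] at hsum
    set Q := ∑ q ∈ I.fiber g (I.σ p), (I.dz q C + I.dz q I.A) with hQ
    have hQ0 : 0 ≤ Q := Finset.sum_nonneg fun q _ => add_nonneg (I.dz_nonneg _ _) (I.dz_nonneg _ _)
    calc I.iw g p * I.dz p C ≤ 4 * I.k * (I.fiber g (I.σ p)).card * I.dz p C := by
          refine mul_le_mul_of_nonneg_right ?_ hx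
          rw [iw, div_le_iff₀ ha]
          refine hT.trans ?_
          calc _ ≤ 4 * (I.k : ℝ) * ((I.fiber g (I.σ p)).card * I.dz p I.A) := by gcongr
            _ = _ := by ring
      _ = 4 * I.k * ((I.fiber g (I.σ p)).card * I.dz p C) := by ring
      _ ≤ 4 * I.k * (3 * 4 ^ I.z * Q) := by
          refine mul_le_mul_of_nonneg_left (hsum.trans ?_) (by positivity)
          gcongr
      _ = _ := by ring
  · simp only [msk, Finset.mem_filter, Finset.mem_univ, true_and] at hi
    obtain ⟨⟨q₀, hq₀, rfl⟩, hmask⟩ := hi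
    obtain ⟨-, -, hτ'⟩ := I.mem_group_main hq₀
    have hT := I.cost_group_main_le hq₀
    set τ := (2 : ℝ) ^ j * I.Δ (I.σ p) with hτ
    set τ' := (2 : ℝ) ^ j * I.Δ (I.σ q₀) with hτ'def
    set r := 8 * I.z / I.ε with hr
    have hr1 : 1 ≤ r := by
      rw [hr, one_le_div I.ε_pos]
      linarith [I.ε_lt_one]
    have hr0 : 0 < r := by linarith
    have hinv : ∀ t : ℝ, 0 ≤ t → (t ^ (1 / I.z)) ^ I.z = t := fun t ht => by
      rw [← Real.rpow_mul ht, one_div_mul_cancel hz.ne', Real.rpow_one]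
    have hL1 : 1 ≤ r ^ I.z := Real.one_le_rpow hr1 hz.le
    -- Masked ring: the same threshold `r` works in opposite directions. The unmasked `p` costs at
    -- most about `r^z d^z(p, A)`, every point of the masked ring at least about `r^z τ'`. The
    -- powers of `r` cancel, and `T ≤ 4 k |ring| τ'` compares the rest.
    have hx2 : I.dz p C ≤ 2 * 2 ^ I.z * r ^ I.z * I.dz p I.A := by
      simp only [hg, Masked, not_le] at h
      have h1 := Real.rpow_le_rpow (distTo_nonneg _ _) h.le hz.le
      rw [Real.mul_rpow hr0.le (by positivity), hinv _ hp3.le] at h1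
      refine (I.dz_le_center p C).trans ?_
      calc _ ≤ 2 ^ I.z * (r ^ I.z * I.dz p I.A + r ^ I.z * I.dz p I.A) := by
            gcongr
            · exact h1.trans (by gcongr)
            · exact le_mul_of_one_le_left ha.le hL1
        _ = _ := by ring
    have hm := Real.rpow_le_rpow (by positivity) hmask hz.le
    rw [Real.mul_rpow hr0.le (by positivity), hinv _ hτ'.le] at hm
    have hq : ∀ q ∈ I.fiber g (I.σ q₀), r ^ I.z * τ' ≤ 2 ^ I.z * (I.dz q C + I.dz q I.A) := by
      intro q hq
      obtain ⟨hq1, hq2⟩ := I.mem_fiber.1 hq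
      have := I.center_le_dz q C
      rw [hq2] at this
      exact hm.trans this
    have hsum := Finset.card_nsmul_le_sum _ _ _ hq
    rw [nsmul_eq_mul, ← Finset.mul_sum] at hsum
    set Q := ∑ q ∈ I.fiber g (I.σ q₀), (I.dz q C + I.dz q I.A) with hQ
    have hQ0 : 0 ≤ Q := Finset.sum_nonneg fun q _ => add_nonneg (I.dz_nonneg _ _) (I.dz_nonneg _ _)
    calc I.iw g p * I.dz p C ≤ I.iw g p * (2 * 2 ^ I.z * r ^ I.z * I.dz p I.A) :=
          mul_le_mul_of_nonneg_left hx2 (I.iw_nonneg _ _)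
      _ = 2 * 2 ^ I.z * r ^ I.z * I.cost (I.group g) I.A := by rw [← I.iw_mul_dz hp]; ring
      _ ≤ 2 * 2 ^ I.z * r ^ I.z * (4 * I.k * ((I.fiber g (I.σ q₀)).card * τ')) := by gcongr
      _ = 8 * 2 ^ I.z * I.k * ((I.fiber g (I.σ q₀)).card * (r ^ I.z * τ')) := by ring
      _ ≤ 8 * 2 ^ I.z * I.k * (2 ^ I.z * Q) := by gcongr
      _ = 8 * 4 ^ I.z * I.k * Q := by rw [h4]; ring
      _ ≤ _ := by
        have : 0 ≤ 4 ^ I.z * (I.k : ℝ) * Q := by positivity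
        linarith

theorem sum_fiber_le_total (g : Label) (C : Fin I.k → X) (J : Finset (Fin I.k)) :
    ∑ i ∈ J, ∑ q ∈ I.fiber g i, (I.dz q C + I.dz q I.A) ≤ I.total g C := by
  have h0 : ∀ q, 0 ≤ I.dz q C + I.dz q I.A := fun q => add_nonneg (I.dz_nonneg _ _) (I.dz_nonneg _ _)
  refine (Finset.sum_le_sum_of_subset_of_nonneg (Finset.subset_univ J)
    fun i _ _ => Finset.sum_nonneg fun q _ => h0 q).trans (le_of_eq ?_)
  rw [I.sum_fiber g, Finset.sum_add_distrib]
  rfl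

theorem card_msk_lt {g : Label} {C : Fin I.k → X} {p : Fin I.n} (hp : p ∈ I.group g)
    (h : ¬ I.Masked g C (I.σ p)) : (I.msk g C).card + 1 ≤ I.k := by
  have h1 : I.σ p ∉ I.msk g C := by rwa [I.mem_msk hp]
  have := Finset.card_le_univ (insert (I.σ p) (I.msk g C))
  rwa [Finset.card_insert_of_notMem h1, Fintype.card_fin] at this

/-- The range of one term of the estimator. -/
def spread (s : ℕ) : ℝ := Real.sqrt (16 * 16 ^ I.z * I.k / (s + 1))

theorem spread_sq (s : ℕ) : I.spread s ^ 2 = 16 * 16 ^ I.z * I.k / (s + 1) :=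
  Real.sq_sqrt (by positivity)

/-- In a main group the ring of `p` and the `s` masked rings are disjoint, and each has total cost
at least `W d / (12 · 4^z k)`. Summing gives `(s + 1) W d ≤ 12 · 4^z k N`. One factor of the square
is bounded in this way, the other stays as the variance term. In an outer group `W d < 4 T`
suffices, because `s + 1 ≤ k`. -/
theorem iw_resid_sq_le {g : Label} {C : Fin I.k → X} {p : Fin I.n} (hp : p ∈ I.group g)
    (h : ¬ I.Masked g C (I.σ p)) : (I.iw g p * I.resid g C p) ^ 2 ≤
      I.spread (I.msk g C).card ^ 2 *
        (I.total g C * (I.iw g p * I.dz p C + I.cost (I.group g) I.A)) := by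
  have ha := I.dz_pos_of_mem_group hp
  have hT := I.cost_group_pos ⟨p, hp⟩
  have hx := I.dz_nonneg p C
  have hW := I.iw_nonneg g p
  have hWa := I.iw_mul_dz hp
  have hN := I.cost_le_total g C
  have hs := I.card_msk_lt hp h
  have hs' : (((I.msk g C).card : ℝ) + 1) ≤ I.k := by exact_mod_cast hs
  have hs0 : (0 : ℝ) < ((I.msk g C).card : ℝ) + 1 := by positivity
  rw [I.spread_sq]
  have h16 : (1 : ℝ) ≤ 16 ^ I.z := Real.one_le_rpow (by norm_num) I.z_pos.le
  have hratio : 1 ≤ (I.k : ℝ) / ((I.msk g C).card + 1) := (one_le_div hs0).2 hs'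
  cases g with
  | main j b =>
    set g := Label.main j b with hg
    set T := I.cost (I.group g) I.A with hTdef
    set W := I.iw g p with hWdef
    set N := I.total g C with hNdef
    set s := (I.msk g C).card with hsdef
    have h1 : σ I p ∉ I.msk g C := by rwa [I.mem_msk hp]
    have h2 : (s + 1) * (W * I.dz p C) ≤ 12 * 4 ^ I.z * I.k * N := by
      have := Finset.card_nsmul_le_sum (insert (I.σ p) (I.msk g C)) _ _
        fun i hi => I.dz_le_fiber_cost hp h (Finset.mem_insert.1 hi)
      rw [Finset.card_insert_of_notMem h1, nsmul_eq_mul, ← Finset.mul_sum] at this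
      push_cast at this
      refine this.trans (mul_le_mul_of_nonneg_left (I.sum_fiber_le_total g C _) (by positivity))
    have h3 : W * I.dz p C ≤ 12 * 4 ^ I.z * ((I.k : ℝ) / (s + 1)) * N := by
      rw [← mul_div_assoc, div_mul_eq_mul_div, le_div_iff₀ hs0]
      linarith
    have h4 : |I.resid g C p| ≤ 2 ^ I.z * (I.dz p C + I.dz p I.A) := by
      have h5 := I.center_le_dz p C
      have h6 : 0 ≤ distTo (I.A (I.σ p)) C ^ I.z := Real.rpow_nonneg (distTo_nonneg _ _) _
      have h7 : (1 : ℝ) ≤ 2 ^ I.z := Real.one_le_rpow one_le_two I.z_pos.le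
      change |I.dz p C - distTo (I.A (I.σ p)) C ^ I.z| ≤ _
      rw [abs_le]
      constructor <;> nlinarith
    have h5 : |W * I.resid g C p| ≤ 2 ^ I.z * (W * I.dz p C + T) := by
      rw [abs_mul, abs_of_nonneg hW, ← hWa]
      calc _ ≤ W * (2 ^ I.z * (I.dz p C + I.dz p I.A)) := by gcongr
        _ = _ := by ring
    have h6 : W * I.dz p C + T ≤ 16 * 4 ^ I.z * ((I.k : ℝ) / (s + 1)) * N := by
      have h4z : (1 : ℝ) ≤ 4 ^ I.z := Real.one_le_rpow (by norm_num) I.z_pos.le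
      have hNN : 0 ≤ N := I.total_nonneg g C
      have : N ≤ 4 ^ I.z * ((I.k : ℝ) / (s + 1)) * N := by
        refine le_mul_of_one_le_left hNN ?_
        nlinarith
      linarith
    have e16 : (16 : ℝ) ^ I.z = 2 ^ I.z * 2 ^ I.z * 4 ^ I.z := by
      rw [← Real.mul_rpow zero_le_two zero_le_two, ← Real.mul_rpow (by norm_num) (by norm_num)]
      norm_num
    rw [← sq_abs]
    have h7 : 0 ≤ W * I.dz p C + T := by positivity
    calc |W * I.resid g C p| ^ 2 ≤ (2 ^ I.z * (W * I.dz p C + T)) ^ 2 := by gcongr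
      _ = 2 ^ I.z * 2 ^ I.z * (W * I.dz p C + T) * (W * I.dz p C + T) := by ring
      _ ≤ 2 ^ I.z * 2 ^ I.z * (16 * 4 ^ I.z * ((I.k : ℝ) / (s + 1)) * N) * (W * I.dz p C + T) := by
          gcongr
      _ = _ := by rw [e16]; ring
  | outer b =>
    have h4 := I.dz_lt_of_not_masked_outer hp h
    have e : I.resid (.outer b) C p = I.dz p C := sub_zero _
    rw [e]
    set T := I.cost (I.group (.outer b)) I.A with hTdef
    set W := I.iw (.outer b) p with hWdef
    set N := I.total (.outer b) C with hNdef
    have h5 : W * I.dz p C ≤ 4 * T := by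
      have := mul_le_mul_of_nonneg_left h4.le hW
      linarith
    have h6 : 0 ≤ W * I.dz p C := by positivity
    have h7 : 4 ≤ 16 * 16 ^ I.z * (I.k : ℝ) / ((I.msk (.outer b) C).card + 1) := by
      rw [mul_div_assoc]
      nlinarith
    have h8 : 0 ≤ N * (W * I.dz p C + T) := mul_nonneg (I.total_nonneg _ _) (by positivity)
    calc (W * I.dz p C) ^ 2 ≤ 4 * (N * (W * I.dz p C + T)) := by nlinarith
      _ ≤ _ := by gcongr

end Setup

end
end KZCoreset

/-! ### Sample sizes and typical samples -/

namespace KZCoreset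
noncomputable section

namespace Setup
open scoped Classical
variable {X : Type*} [MetricSpace X] (I : Setup X)

theorem two_le_ratio : 2 ≤ 2 * (I.k : ℝ) / I.ε := by
  have hk : (1 : ℝ) ≤ I.k := by exact_mod_cast I.one_le_k
  rw [le_div_iff₀ I.ε_pos]
  nlinarith [I.ε_lt_one]

theorem log_two_le_log_ratio : Real.log 2 ≤ Real.log (2 * I.k / I.ε) :=
  Real.log_le_log two_pos I.two_le_ratio

theorem log_ratio_pos : 0 < Real.log (2 * I.k / I.ε) :=
  (Real.log_pos one_lt_two).trans_le I.log_two_le_log_ratio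

/-- The exponent of the failure probabilities. -/
def expo : ℝ := 40 * I.z * Real.log (2 * I.k / I.ε)

theorem log_ratio_le_expo : Real.log (2 * I.k / I.ε) ≤ I.expo := by
  have := I.log_ratio_pos
  have := I.one_le_z
  unfold expo
  nlinarith

theorem adequate_Γ (g : Label) : I.Adequate 1 g (I.Γ 1 g) := (I.isLeast_Γ 1 g).1

theorem entropy_ne_top (g : Label) :
    entropyIntegral (fun α => I.groupCoverNum g (I.Γ 1 g) α) ≠ ⊤ := by
  obtain ⟨J, hJ, h⟩ := I.exists_entropy_bound g
  exact ne_top_of_le_ne_top hJ (h _)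

theorem entropy_le (g : Label) :
    (entropyIntegral (fun α => I.groupCoverNum g (I.Γ 1 g) α)).toReal ≤
      I.ε * Real.sqrt (I.Γ 1 g) := by
  have h := I.adequate_Γ g
  unfold Adequate at h
  rw [ENNReal.ofReal_one, one_mul] at h
  have h1 := ENNReal.toReal_mono (ENNReal.natCast_ne_top _) (le_self_add.trans h)
  have hε := I.ε_pos
  rw [ENNReal.toReal_mul, ENNReal.toReal_ofReal (by positivity), ENNReal.toReal_pow,
    ENNReal.toReal_natCast, one_div, inv_mul_le_iff₀ (by positivity)] at h1
  have h2 := Real.sqrt_le_sqrt h1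
  rwa [Real.sqrt_sq ENNReal.toReal_nonneg, Real.sqrt_mul (by positivity), Real.sqrt_sq hε.le] at h2

/-- The factor `2` inside the logarithm keeps it at least `log 2`, even when `k = 1` and `ε` is near
`1`. -/
theorem Γ_ge (g : Label) :
    (I.k : ℝ) / I.ε ^ 2 * Real.log (2 * I.k / I.ε) ≤ 6 * (I.Γ 1 g : ℝ) := by
  have h := I.adequate_Γ g
  unfold Adequate at h
  rw [ENNReal.ofReal_one, one_mul] at h
  have h1 := le_add_self.trans h
  rw [← ENNReal.ofReal_natCast, ENNReal.ofReal_le_ofReal_iff (Nat.cast_nonneg _)] at h1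
  have hk : (1 : ℝ) ≤ I.k := by exact_mod_cast I.one_le_k
  have hε := I.ε_pos
  have hε1 := I.ε_lt_one
  have hr : 1 < (I.k : ℝ) / I.ε := by rw [one_lt_div hε]; linarith
  have hlog : Real.log (2 * I.k / I.ε) = Real.log 2 + Real.log (I.k / I.ε) := by
    rw [mul_div_assoc, Real.log_mul two_ne_zero (by positivity)]
  rcases le_or_gt 2 ((I.k : ℝ) / I.ε) with h2 | h2
  · have h3 := Real.log_le_log two_pos h2
    have h4 : (I.k : ℝ) / I.ε ^ 2 * Real.log (2 * I.k / I.ε) ≤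
        (I.k : ℝ) / I.ε ^ 2 * (2 * Real.log (I.k / I.ε)) := by
      rw [hlog]; gcongr; linarith
    have : (0 : ℝ) ≤ I.Γ 1 g := Nat.cast_nonneg _
    linarith
  -- Here `log (k/ε)` may be arbitrarily small, but it is positive, so the integer `Γ` is at least
  -- one. The left side is at most `4 · 1.4 < 6`.
  · have hpos : 0 < (I.k : ℝ) / I.ε ^ 2 * Real.log (I.k / I.ε) :=
      mul_pos (by positivity) (Real.log_pos hr)
    have hΓ : (1 : ℝ) ≤ I.Γ 1 g := by
      have : (0 : ℝ) < I.Γ 1 g := hpos.trans_le h1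
      exact_mod_cast Nat.cast_pos.1 this
    have h3 : Real.log (2 * I.k / I.ε) ≤ 1.4 := by
      have h4 : Real.log (2 * I.k / I.ε) ≤ Real.log (2 ^ 2) := by
        refine Real.log_le_log (by positivity) ?_
        rw [mul_div_assoc]; linarith
      rw [Real.log_pow] at h4
      have := Real.log_two_lt_d9
      push_cast at h4
      linarith
    have h5 : (I.k : ℝ) / I.ε ^ 2 ≤ 4 := by
      have : (I.k : ℝ) / I.ε ^ 2 ≤ ((I.k : ℝ) / I.ε) ^ 2 := by
        rw [div_pow]; gcongr; nlinarith
      nlinarith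
    have h6 := I.log_ratio_pos
    have h7 : 0 ≤ (I.k : ℝ) / I.ε ^ 2 := by positivity
    nlinarith

theorem z_le_two_rpow : I.z ≤ 2 ^ I.z ∧ (2 : ℝ) ≤ 2 ^ I.z := by
  have h1 := one_add_mul_self_le_rpow_one_add (s := (1 : ℝ)) (by norm_num) I.one_le_z
  have h2 : (1 : ℝ) + 1 = 2 := by norm_num
  rw [h2] at h1
  have := I.one_le_z
  constructor <;> linarith

theorem two_rpow_thirty : (2 : ℝ) ^ (((30 : ℕ) : ℝ) * I.z) = ((2 : ℝ) ^ I.z) ^ 30 := by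
  rw [mul_comm, Real.rpow_mul zero_le_two, Real.rpow_natCast]

theorem sixteen_rpow : (16 : ℝ) ^ I.z = ((2 : ℝ) ^ I.z) ^ 4 := by
  rw [← Real.rpow_natCast, ← Real.rpow_mul zero_le_two, mul_comm, Real.rpow_mul zero_le_two]
  norm_num

theorem quota_ge (g : Label) : ((2 : ℝ) ^ I.z) ^ 30 / 12 *
    ((I.k : ℝ) / I.ε ^ 2 * Real.log (2 * I.k / I.ε)) ≤ (I.quota 1 30 g : ℝ) := by
  have h1 := I.Γ_ge g
  unfold quota
  rw [I.two_rpow_thirty]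
  set w := ((2 : ℝ) ^ I.z) ^ 30 with hw
  have hw1 : 1 ≤ w := one_le_pow₀ (by linarith [I.z_le_two_rpow.2])
  have h2 : w / 2 ≤ ⌊w⌋₊ := by
    have := Nat.lt_floor_add_one w
    have h3 : (1 : ℝ) ≤ ⌊w⌋₊ := by exact_mod_cast Nat.le_floor (by simpa using hw1)
    linarith
  push_cast
  have h3 : (0 : ℝ) ≤ I.Γ 1 g := Nat.cast_nonneg _
  calc _ ≤ w / 12 * (6 * (I.Γ 1 g : ℝ)) := by gcongr
    _ = w / 2 * I.Γ 1 g := by ring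
    _ ≤ _ := by gcongr

theorem quota_pos (g : Label) : 0 < I.quota 1 30 g := by
  have h := I.quota_ge g
  have hk : (1 : ℝ) ≤ I.k := by exact_mod_cast I.one_le_k
  have := I.log_ratio_pos
  have := I.ε_pos
  have h2 : (0 : ℝ) < I.quota 1 30 g := lt_of_lt_of_le (by positivity) h
  exact Nat.cast_pos.1 h2

/-- The choice `B = 30` is made for this bound. With `w = 2^z` one has `z ≤ w` and `16^z = w^4`, so
the left constant is at most `60000 · 40 w^5`, and `12 · 60000 · 40 ≤ 2^25 ≤ w^25`. -/
theorem const_mul_expo_le (g : Label) {c : ℝ} (hc : c ≤ 60000) :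
    c * 16 ^ I.z * I.k * I.expo ≤ I.ε ^ 2 * I.quota 1 30 g := by
  have h := I.quota_ge g
  have hk : (1 : ℝ) ≤ I.k := by exact_mod_cast I.one_le_k
  have hl := I.log_ratio_pos
  have hε := I.ε_pos
  obtain ⟨hw1, hw2⟩ := I.z_le_two_rpow
  rw [I.sixteen_rpow]
  set w := (2 : ℝ) ^ I.z with hw
  have hz := I.z_pos
  have h1 : c * w ^ 4 * (40 * I.z) ≤ w ^ 30 / 12 := by
    have h25 : (2 : ℝ) ^ 25 ≤ w ^ 25 := by gcongr
    calc c * w ^ 4 * (40 * I.z) ≤ 60000 * w ^ 4 * (40 * w) := by gcongr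
      _ = 2400000 * w ^ 5 := by ring
      _ ≤ (2 ^ 25 / 12) * w ^ 5 := by gcongr; norm_num
      _ ≤ (w ^ 25 / 12) * w ^ 5 := by gcongr
      _ = _ := by ring
  calc c * w ^ 4 * I.k * I.expo = (c * w ^ 4 * (40 * I.z)) * (I.k * Real.log (2 * I.k / I.ε)) := by
        unfold expo; ring
    _ ≤ w ^ 30 / 12 * (I.k * Real.log (2 * I.k / I.ε)) := by gcongr
    _ = I.ε ^ 2 * (w ^ 30 / 12 * ((I.k : ℝ) / I.ε ^ 2 * Real.log (2 * I.k / I.ε))) := by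
        field_simp
    _ ≤ _ := by gcongr

/-- The estimator of `∑ p ∈ group g, f p`, multiplied by the number of samples. -/
def samp (g : Label) {m : ℕ} (x : Fin m → Fin I.n) (f : Fin I.n → ℝ) : ℝ :=
  ∑ l, I.iw g (x l) * f (x l)

/-- The deviation of the estimator, multiplied by the number of samples. -/
def devn (g : Label) {m : ℕ} (x : Fin m → Fin I.n) (f : Fin I.n → ℝ) : ℝ :=
  I.samp g x f - m * ∑ p ∈ I.group g, f p

/-- The weights of all rings of the group are estimated well. -/
def Typical (g : Label) {m : ℕ} (x : Fin m → Fin I.n) : Prop :=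
  ∀ i, |I.devn g x fun p => if p ∈ I.fiber g i then I.base g p else 0| ≤
    I.ε / 4 ^ I.z * (m * ∑ p ∈ I.fiber g i, I.base g p)

theorem base_nonneg (g : Label) (p : Fin I.n) : 0 ≤ I.base g p := by
  cases g
  · exact zero_le_one
  · exact I.dz_nonneg _ _

theorem fiber_subset (g : Label) (i : Fin I.k) : I.fiber g i ⊆ I.group g := Finset.filter_subset _ _

theorem sum_group_fiber (g : Label) (i : Fin I.k) (f : Fin I.n → ℝ) :
    ∑ p ∈ I.group g, (if p ∈ I.fiber g i then f p else 0) = ∑ p ∈ I.fiber g i, f p := by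
  rw [← Finset.sum_filter, Finset.filter_mem_eq_inter,
    Finset.inter_eq_right.2 (I.fiber_subset g i)]

/-- Chernoff's inequality wants variables in `[0, 1]`. After scaling by `τ/T` in main groups and by
`1/T` in outer groups, the mean is still at least `1/(4k)`, since the rings of a group have
comparable costs. -/
theorem exists_normalization {g : Label} {p : Fin I.n} (hp : p ∈ I.group g) :
    ∃ c : ℝ, 0 < c ∧ (∀ q ∈ I.fiber g (I.σ p), c * (I.iw g q * I.base g q) ≤ 1) ∧
      1 / (4 * I.k) ≤ c * ∑ q ∈ I.fiber g (I.σ p), I.base g q := by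
  have hT := I.cost_group_pos ⟨p, hp⟩
  have hk : (0 : ℝ) < I.k := by exact_mod_cast I.one_le_k
  cases g with
  | main j b =>
    obtain ⟨-, -, hτ⟩ := I.mem_group_main hp
    have hc := I.cost_group_main_le hp
    set τ := (2 : ℝ) ^ j * I.Δ (I.σ p) with hτdef
    refine ⟨τ / I.cost (I.group (.main j b)) I.A, by positivity, fun q hq => ?_, ?_⟩
    · obtain ⟨h1, h2⟩ := I.mem_fiber.1 hq
      have h3 := (I.mem_group_main h1).1
      rw [h2, ← hτdef] at h3
      have h4 := I.dz_pos_of_mem_group h1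
      simp only [base, mul_one, iw]
      rw [div_mul_div_comm, div_le_one (by positivity), mul_comm]
      gcongr
    · simp only [base, Finset.sum_const, nsmul_eq_mul, mul_one]
      rw [div_mul_eq_mul_div, div_le_div_iff₀ (by positivity) hT]
      linarith
  | outer b =>
    have hc := I.cost_group_le hp
    refine ⟨1 / I.cost (I.group (.outer b)) I.A, by positivity, fun q hq => ?_, ?_⟩
    · have h1 := (I.mem_fiber.1 hq).1
      change _ * (_ * I.dz q I.A) ≤ 1
      rw [I.iw_mul_dz h1, one_div_mul_cancel hT.ne']
    · change _ ≤ _ * I.cost (I.fiber (.outer b) (I.σ p)) I.A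
      have h0 := I.cost_nonneg (I.fiber (.outer b) (I.σ p)) I.A
      rw [div_mul_eq_mul_div, one_mul, div_le_div_iff₀ (by positivity) hT]
      nlinarith

theorem pr_not_typical_le {g : Label} (hg : (I.group g).Nonempty) (m : ℕ) :
    pr (prodW (I.sampleProb g)) (fun x : Fin m → Fin I.n => ¬ I.Typical g x) ≤
      I.k * (2 * Real.exp (-(I.ε ^ 2 * m / (16 * 16 ^ I.z * I.k)))) := by
  have hq := I.sampleProb_nonneg g
  have h1 := I.sum_sampleProb hg
  have hp0 := prodW_nonneg (ι := Fin m) hq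
  have hk : (0 : ℝ) < I.k := by exact_mod_cast I.one_le_k
  have hε := I.ε_pos
  let Bad : Fin I.k → (Fin m → Fin I.n) → Prop := fun i x =>
    I.ε / 4 ^ I.z * (m * ∑ p ∈ I.fiber g i, I.base g p) <
      |I.devn g x fun p => if p ∈ I.fiber g i then I.base g p else 0|
  have hbad : ∀ i ∈ (Finset.univ : Finset (Fin I.k)), pr (prodW (I.sampleProb g)) (Bad i) ≤
      2 * Real.exp (-(I.ε ^ 2 * m / (16 * 16 ^ I.z * I.k))) := by
    intro i _
    rcases (I.fiber g i).eq_empty_or_nonempty with hi | ⟨p, hp⟩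
    · have : pr (prodW (I.sampleProb g)) (Bad i) = 0 := by
        refine Finset.sum_eq_zero fun x _ => if_neg ?_
        simp [Bad, hi, devn, samp]
      rw [this]; positivity
    · obtain ⟨hpg, rfl⟩ := I.mem_fiber.1 hp
      obtain ⟨c, hc0, hc1, hc2⟩ := I.exists_normalization hpg
      set f : Fin I.n → ℝ := fun q => if q ∈ I.fiber g (I.σ p) then I.base g q else 0 with hf
      have hf0 : ∀ q, 0 ≤ f q := fun q => by
        simp only [hf]; split_ifs
        · exact I.base_nonneg g q
        · exact le_rfl
      have hsum : ∑ q ∈ I.group g, f q = ∑ q ∈ I.fiber g (I.σ p), I.base g q :=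
        I.sum_group_fiber g _ _
      have hmean : ∑ q, I.sampleProb g q * (c * (I.iw g q * f q)) =
          c * ∑ q ∈ I.fiber g (I.σ p), I.base g q := by
        rw [← hsum, ← I.sum_sampleProb_mul g f, Finset.mul_sum]
        exact Finset.sum_congr rfl fun q _ => by ring
      have h4 : (1 : ℝ) ≤ 4 ^ I.z := Real.one_le_rpow (by norm_num) I.z_pos.le
      have hη1 : I.ε / 4 ^ I.z ≤ 1 := by
        rw [div_le_one (by positivity)]; linarith [I.ε_lt_one]
      have hch := chernoff (ι := Fin m) hq h1 (Z := fun q => c * (I.iw g q * f q))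
        (fun q => mul_nonneg hc0.le (mul_nonneg (I.iw_nonneg g q) (hf0 q)))
        (fun q => by
          simp only [hf]
          split_ifs with h
          · exact hc1 q h
          · simp) (η := I.ε / 4 ^ I.z) (by positivity) hη1
      rw [hmean, Fintype.card_fin] at hch
      refine le_trans (pr_mono hp0 ?_) (hch.trans ?_)
      · intro x hx
        have e : ∑ l, c * (I.iw g (x l) * f (x l)) -
            m * (c * ∑ q ∈ I.fiber g (I.σ p), I.base g q) = c * I.devn g x f := by
          rw [devn, samp, hsum, ← Finset.mul_sum]; ring
        rw [e, abs_mul, abs_of_pos hc0]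
        have := mul_lt_mul_of_pos_left hx hc0
        linarith
      · have e16 : (16 : ℝ) ^ I.z = 4 ^ I.z * 4 ^ I.z := by
          rw [← Real.mul_rpow (by norm_num) (by norm_num)]; norm_num
        -- The mean is at least `1/(4k)` and the tolerance is `η = ε/4^z`; the Chernoff exponent is
        -- `m · mean · η² / 4`.
        have hle : I.ε ^ 2 * m / (16 * 16 ^ I.z * I.k) ≤
            m * (c * ∑ q ∈ I.fiber g (I.σ p), I.base g q) * (I.ε / 4 ^ I.z) ^ 2 / 4 := by
          calc I.ε ^ 2 * m / (16 * 16 ^ I.z * I.k) =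
              m * (1 / (4 * I.k)) * (I.ε / 4 ^ I.z) ^ 2 / 4 := by rw [e16]; field_simp; norm_num
            _ ≤ _ := by gcongr
        refine mul_le_mul_of_nonneg_left (Real.exp_le_exp.2 ?_) zero_le_two
        linarith
  refine le_trans (pr_mono hp0 (F := fun x => ∃ i ∈ Finset.univ, Bad i x) ?_)
    ((pr_exists_le hp0 Finset.univ Bad).trans ?_)
  · intro x hx
    simp only [Typical, not_forall, not_le] at hx
    obtain ⟨i, hi⟩ := hx
    exact ⟨i, Finset.mem_univ _, hi⟩
  · refine (Finset.sum_le_card_nsmul _ _ _ hbad).trans (le_of_eq ?_)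
    rw [nsmul_eq_mul, Finset.card_univ, Fintype.card_fin]

theorem samp_add (g : Label) {m : ℕ} (x : Fin m → Fin I.n) (f h : Fin I.n → ℝ) :
    I.samp g x (fun p => f p + h p) = I.samp g x f + I.samp g x h := by
  simp only [samp, mul_add, Finset.sum_add_distrib]

theorem devn_add (g : Label) {m : ℕ} (x : Fin m → Fin I.n) (f h : Fin I.n → ℝ) :
    I.devn g x (fun p => f p + h p) = I.devn g x f + I.devn g x h := by
  simp only [devn, samp_add, Finset.sum_add_distrib]; ring

theorem samp_congr {g : Label} {m : ℕ} {x : Fin m → Fin I.n} (hx : ∀ l, x l ∈ I.group g)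
    {f h : Fin I.n → ℝ} (hfh : ∀ p ∈ I.group g, f p = h p) : I.samp g x f = I.samp g x h :=
  Finset.sum_congr rfl fun l _ => by rw [hfh _ (hx l)]

theorem devn_congr {g : Label} {m : ℕ} {x : Fin m → Fin I.n} (hx : ∀ l, x l ∈ I.group g)
    {f h : Fin I.n → ℝ} (hfh : ∀ p ∈ I.group g, f p = h p) : I.devn g x f = I.devn g x h := by
  rw [devn, devn, I.samp_congr hx hfh, Finset.sum_congr rfl hfh]

/-- In a typical sample, functions that are constant on clusters are estimated well. -/
theorem abs_devn_cluster_le {g : Label} {m : ℕ} {x : Fin m → Fin I.n}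
    (hx : ∀ l, x l ∈ I.group g) (ht : I.Typical g x) (φ : Fin I.k → ℝ) (hφ : ∀ i, 0 ≤ φ i) :
    |I.devn g x fun p => I.base g p * φ (I.σ p)| ≤
      I.ε / 4 ^ I.z * (m * ∑ p ∈ I.group g, I.base g p * φ (I.σ p)) := by
  set f : Fin I.k → Fin I.n → ℝ := fun i p => if p ∈ I.fiber g i then I.base g p else 0 with hf
  have hdec : ∀ p ∈ I.group g, I.base g p * φ (I.σ p) = ∑ i, φ i * f i p := by
    intro p hp
    rw [Finset.sum_eq_single (I.σ p)]
    · simp only [hf, mem_fiber, hp, true_and, if_true]; ring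
    · intro i _ hi
      simp only [hf, mem_fiber, hp, true_and]
      rw [if_neg (Ne.symm hi), mul_zero]
    · simp
  have hsum : ∑ p ∈ I.group g, I.base g p * φ (I.σ p) =
      ∑ i, φ i * ∑ p ∈ I.fiber g i, I.base g p := by
    rw [Finset.sum_congr rfl hdec, Finset.sum_comm]
    refine Finset.sum_congr rfl fun i _ => ?_
    rw [← Finset.mul_sum, I.sum_group_fiber]
  have hdev : (I.devn g x fun p => I.base g p * φ (I.σ p)) = ∑ i, φ i * I.devn g x (f i) := by
    rw [I.devn_congr hx hdec]
    simp only [devn, samp, Finset.mul_sum, mul_sub, Finset.sum_sub_distrib]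
    congr 1
    · rw [Finset.sum_comm]
      exact Finset.sum_congr rfl fun i _ => Finset.sum_congr rfl fun l _ => by ring
    · rw [Finset.sum_comm]
      exact Finset.sum_congr rfl fun i _ => Finset.sum_congr rfl fun l _ => by ring
  rw [hdev, hsum, Finset.mul_sum, Finset.mul_sum]
  refine (Finset.abs_sum_le_sum_abs _ _).trans (Finset.sum_le_sum fun i _ => ?_)
  rw [abs_mul, abs_of_nonneg (hφ i)]
  calc _ ≤ φ i * (I.ε / 4 ^ I.z * (m * ∑ p ∈ I.fiber g i, I.base g p)) :=
        mul_le_mul_of_nonneg_left (ht i) (hφ i)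
    _ = _ := by ring

theorem baseCost_nonneg (g : Label) (C : Fin I.k → X) (i : Fin I.k) : 0 ≤ I.baseCost g C i := by
  cases g
  · exact Real.rpow_nonneg (distTo_nonneg _ _) _
  · exact le_rfl

theorem sum_baseCost_le (g : Label) (C : Fin I.k → X) :
    ∑ p ∈ I.group g, I.baseCost g C (I.σ p) ≤ 2 ^ I.z * I.total g C := by
  rw [total, cost, cost, ← Finset.sum_add_distrib, Finset.mul_sum]
  refine Finset.sum_le_sum fun p _ => ?_
  cases g with
  | main j b => exact I.center_le_dz p C
  | outer b =>
    have := I.dz_nonneg p C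
    have := I.dz_nonneg p I.A
    simp only [baseCost]
    positivity

theorem abs_devn_baseCost_le {g : Label} {m : ℕ} {x : Fin m → Fin I.n}
    (hx : ∀ l, x l ∈ I.group g) (ht : I.Typical g x) (C : Fin I.k → X) (c : Fin I.k → Prop) :
    |I.devn g x fun p => if c (I.σ p) then I.baseCost g C (I.σ p) else 0| ≤
      I.ε / 4 ^ I.z * (m * ∑ p ∈ I.group g, if c (I.σ p) then I.baseCost g C (I.σ p) else 0) := by
  cases g with
  | main j b =>
    have := I.abs_devn_cluster_le hx ht (fun i => if c i then I.baseCost (.main j b) C i else 0)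
      (fun i => by split_ifs; exacts [I.baseCost_nonneg _ _ _, le_rfl])
    simpa only [base, one_mul] using this
  | outer b => simp [baseCost, devn, samp]

/-- The centers together may cost `2^z N` by the triangle inequality; the tolerance `ε/4^z` in
`Typical` is small enough to absorb this. -/
theorem sum_ite_baseCost_le (g : Label) (C : Fin I.k → X) (c : Fin I.k → Prop) :
    I.ε / 4 ^ I.z * ∑ p ∈ I.group g, (if c (I.σ p) then I.baseCost g C (I.σ p) else 0) ≤
      I.ε * I.total g C := by
  have h1 : ∑ p ∈ I.group g, (if c (I.σ p) then I.baseCost g C (I.σ p) else 0) ≤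
      2 ^ I.z * I.total g C := by
    refine le_trans (Finset.sum_le_sum fun p _ => ?_) (I.sum_baseCost_le g C)
    split_ifs
    · exact le_rfl
    · exact I.baseCost_nonneg _ _ _
  have h2 : (2 : ℝ) ^ I.z ≤ 4 ^ I.z := Real.rpow_le_rpow (by norm_num) (by norm_num) I.z_pos.le
  have h3 := I.total_nonneg g C
  have hε := I.ε_pos
  calc _ ≤ I.ε / 4 ^ I.z * (4 ^ I.z * I.total g C) := by gcongr; exact h1.trans (by gcongr)
    _ = _ := by field_simp

/-- The cost of clusters in a typical sample is controlled by the deviation. -/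
theorem samp_cluster_le {g : Label} {m : ℕ} {x : Fin m → Fin I.n}
    (hx : ∀ l, x l ∈ I.group g) (ht : I.Typical g x) (C : Fin I.k → X)
    (c : Fin I.k → Prop) : (I.samp g x fun p => if c (I.σ p) then I.dz p C else 0) ≤
      |I.devn g x fun p => if c (I.σ p) then I.resid g C p else 0| +
        10 * (m * I.total g C) := by
  set F : Fin I.n → ℝ := fun p => if c (I.σ p) then I.resid g C p else 0 with hF
  set y : Fin I.n → ℝ := fun p => if c (I.σ p) then I.baseCost g C (I.σ p) else 0 with hy
  have hdz : (fun p => if c (I.σ p) then I.dz p C else 0) = fun p => F p + y p := by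
    funext p
    simp only [hF, hy, resid]
    split_ifs <;> ring
  have h1 := (abs_le.1 (I.abs_devn_baseCost_le hx ht C c)).2
  have h2 := I.sum_ite_baseCost_le g C c
  have h3 : ∑ p ∈ I.group g, (F p + y p) ≤ I.total g C := by
    rw [← hdz]
    refine le_trans (Finset.sum_le_sum (g := fun p => I.dz p C) fun p _ => ?_)
      (le_add_of_nonneg_right (I.cost_nonneg _ _))
    split_ifs
    · exact le_rfl
    · exact I.dz_nonneg _ _
  change I.samp g x (fun p => if c (I.σ p) then I.dz p C else 0) ≤ |I.devn g x F| + _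
  rw [hdz, I.samp_add]
  have h4 : I.samp g x F = I.devn g x F + m * ∑ p ∈ I.group g, F p := by rw [devn]; ring
  have h5 : I.samp g x y = I.devn g x y + m * ∑ p ∈ I.group g, y p := by rw [devn]; ring
  rw [Finset.sum_add_distrib] at h3
  have hm : (0 : ℝ) ≤ m := Nat.cast_nonneg _
  have h6 := mul_le_mul_of_nonneg_left h3 hm
  have h7 := mul_le_mul_of_nonneg_left h2 hm
  have h8 := le_abs_self (I.devn g x F)
  have h9 := I.total_nonneg g C
  -- The estimates of `F` and `y` together exceed the deviations by at most `m N`, and `y` deviates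
  -- by at most `ε m N`; the constant `10` leaves ample room.
  have h10 : I.devn g x y ≤ m * (I.ε * I.total g C) := by
    refine h1.trans (le_trans (le_of_eq ?_) h7); ring
  have h11 : m * (I.ε * I.total g C) ≤ m * I.total g C := by
    refine mul_le_mul_of_nonneg_left ?_ hm
    nlinarith [I.ε_lt_one]
  have h12 : 0 ≤ m * I.total g C := by positivity
  rw [h4, h5]
  nlinarith

end Setup

end
end KZCoreset

/-! ### Net sequences and the failure probability of one group -/

namespace KZCoreset
noncomputable section

namespace Setup
open scoped Classical
variable {X : Type*} [MetricSpace X] (I : Setup X)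

theorem one_le_k_real : (1 : ℝ) ≤ I.k := by exact_mod_cast I.one_le_k

theorem spread_pos (s : ℕ) : 0 < I.spread s := by
  have := I.one_le_k_real
  unfold spread
  positivity

theorem expo_pos : 0 < I.expo := I.log_ratio_pos.trans_le I.log_ratio_le_expo

theorem exp_neg_expo_le : Real.exp (-I.expo) ≤ 1 / I.k := by
  have hk := I.one_le_k_real
  have hε := I.ε_pos
  rw [Real.exp_neg, one_div, inv_le_inv₀ (Real.exp_pos _) (by positivity)]
  calc (I.k : ℝ) ≤ 2 * I.k / I.ε := by
        rw [le_div_iff₀ hε]; nlinarith [I.ε_lt_one]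
    _ = Real.exp (Real.log (2 * I.k / I.ε)) := (Real.exp_log (by positivity)).symm
    _ ≤ _ := Real.exp_le_exp.2 I.log_ratio_le_expo

/-- The factor `1/(s + 1)` in the squared spread cancels the one in the exponent, so one sample size
serves all mask sizes. The constant is `48² · 16 = 36864`. -/
theorem spread_mul_sqrt_le (g : Label) (s : ℕ) :
    48 * I.spread s * Real.sqrt ((s + 1) * I.expo) ≤ I.ε * Real.sqrt (I.quota 1 30 g) := by
  have h := I.const_mul_expo_le g (c := 36864) (by norm_num)
  have hs := (I.spread_pos s).le
  have he := I.expo_pos.le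
  refine abs_le_of_sq_le_sq' ?_ (mul_nonneg I.ε_pos.le (Real.sqrt_nonneg _)) |>.2
  rw [mul_pow, mul_pow, mul_pow, Real.sq_sqrt (by positivity), Real.sq_sqrt (by positivity),
    I.spread_sq]
  refine le_trans (le_of_eq ?_) h
  field_simp
  ring

/-- With `t = exp (-expo)` the binomial theorem gives `8 t (1 + t)^k`, and `(1 + t)^k ≤ exp (k t) ≤
e` because `t ≤ 1/k`. -/
theorem sum_choose_exp_le : ∑ s ∈ Finset.range (I.k + 1),
    8 * (Nat.choose I.k s : ℝ) * Real.exp (-((s + 1) * I.expo)) ≤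
      24 * (I.k * Real.exp (-I.expo)) := by
  have hk := I.one_le_k_real
  set t := Real.exp (-I.expo) with ht
  have ht0 : 0 < t := Real.exp_pos _
  have h1 : ∀ s : ℕ, Real.exp (-((s + 1) * I.expo)) = t * t ^ s := by
    intro s
    rw [ht, ← Real.exp_nat_mul, ← Real.exp_add]
    congr 1; ring
  have h2 : ∑ s ∈ Finset.range (I.k + 1),
      8 * (Nat.choose I.k s : ℝ) * Real.exp (-((s + 1) * I.expo)) = 8 * t * (t + 1) ^ I.k := by
    rw [add_pow, Finset.mul_sum]
    refine Finset.sum_congr rfl fun s _ => ?_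
    rw [h1, one_pow]; ring
  have h3 : (t + 1) ^ I.k ≤ 3 := by
    calc (t + 1) ^ I.k ≤ Real.exp t ^ I.k := by
          gcongr; exact Real.add_one_le_exp t
      _ = Real.exp (I.k * t) := (Real.exp_nat_mul _ _).symm
      _ ≤ Real.exp 1 := by
          refine Real.exp_le_exp.2 ?_
          have := mul_le_mul_of_nonneg_left I.exp_neg_expo_le (show (0 : ℝ) ≤ I.k by positivity)
          rwa [mul_one_div_cancel (by positivity)] at this
      _ ≤ 3 := by linarith [Real.exp_one_lt_d9]
  rw [h2]
  have h4 : t ≤ I.k * t := le_mul_of_one_le_left ht0.le hk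
  nlinarith [mul_le_mul_of_nonneg_left h3 ht0.le]

/-- At most `2 m = 2 M Γ` points are cut into `2 M` pieces of size `Γ`, so net sizes have logarithm
`2 M log N`. The dyadic sum is then at most `√(2M) · 2 ε √Γ = 2 √2 ε √m`. Altogether `20 · 2.84 + 1
+ 1 < 60`. -/
theorem exists_net_sequence {g : Label} (s : ℕ) (S₀ : Finset (Fin I.n)) (hS : S₀ ⊆ I.group g)
    (hcard : S₀.card ≤ 2 * I.quota 1 30 g) :
    ∃ (L : ℕ) (V : ℕ → Finset (Fin I.n → ℝ)) (ν : ℕ → ℝ),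
      (∀ h, ((V h).card : ℝ) ≤ Real.exp (ν h)) ∧ (∀ h, 0 ≤ ν h) ∧ (∀ h, ν h ≤ ν (h + 1)) ∧
      (∀ h C, ∃ v ∈ V h, ∀ p ∈ S₀, ¬ I.Masked g C (I.σ p) →
        |I.resid g C p - v p| ≤ I.spread s / 2 ^ h * I.scale g C p) ∧
      20 * ∑ h ∈ Finset.range (L + 1), I.spread s / 2 ^ h * Real.sqrt (ν h) +
        48 * I.spread s * Real.sqrt ((s + 1) * I.expo) +
        I.spread s / 2 ^ L * Real.sqrt (10 * I.quota 1 30 g) ≤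
      60 * I.ε * Real.sqrt (I.quota 1 30 g) := by
  set N : ℝ → ℕ∞ := fun α => I.groupCoverNum g (I.Γ 1 g) α with hN
  set M := ⌊(2 : ℝ) ^ (((30 : ℕ) : ℝ) * I.z)⌋₊ with hM
  set m := I.quota 1 30 g with hm
  have hmM : m = M * I.Γ 1 g := rfl
  have h1 : ∀ α, 0 < α → 1 ≤ N α := fun α _ => I.one_le_groupCoverNum _ _ _
  have hanti : ∀ α β, 0 < α → α ≤ β → N β ≤ N α := fun α β _ h => I.groupCoverNum_antitone _ _ h
  have hfin := I.entropy_ne_top g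
  have hsp := I.spread_pos s
  have hpos : ∀ h : ℕ, 0 < I.spread s / 2 ^ h := fun h => by positivity
  have htop : ∀ h : ℕ, N (I.spread s / 2 ^ h) ≠ ⊤ := fun h => ne_top_of_entropy h1 hanti hfin (hpos h)
  have hc : S₀.card ≤ I.Γ 1 g * (2 * M) := by
    refine hcard.trans (le_of_eq ?_); rw [hmM]; ring
  choose V hV1 hV2 using fun h : ℕ => I.exists_net g (htop h) (2 * M) S₀ hS hc
  set ν : ℕ → ℝ := fun h => 2 * M * Real.log ((N (I.spread s / 2 ^ h)).toNat : ℝ) with hν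
  have hnat1 : ∀ h : ℕ, 1 ≤ (N (I.spread s / 2 ^ h)).toNat := fun h => by
    have := ENat.toNat_le_toNat (h1 _ (hpos h)) (htop h)
    simpa using this
  have hnat1' : ∀ h : ℕ, (1 : ℝ) ≤ (N (I.spread s / 2 ^ h)).toNat := fun h => by
    exact_mod_cast hnat1 h
  have hlog0 : ∀ h : ℕ, 0 ≤ Real.log ((N (I.spread s / 2 ^ h)).toNat : ℝ) :=
    fun h => Real.log_nonneg (hnat1' h)
  -- Since `L ≤ 2^L`, the finest scale is at most `ε/4`, and `√(10 m) ≤ 4 √m` makes the bottom term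
  -- at most `ε √m`.
  obtain ⟨L, hL⟩ := exists_nat_gt (4 * I.spread s / I.ε)
  have hε := I.ε_pos
  have hm0 : 0 ≤ Real.sqrt (m : ℝ) := Real.sqrt_nonneg _
  refine ⟨L, V, ν, fun h => ?_, fun h => ?_, fun h => ?_, hV2, ?_⟩
  · have : ((V h).card : ℝ) ≤ ((N (I.spread s / 2 ^ h)).toNat : ℝ) ^ (2 * M) := by
      exact_mod_cast hV1 h
    refine this.trans (le_of_eq ?_)
    have h0 : (0 : ℝ) < (N (I.spread s / 2 ^ h)).toNat := zero_lt_one.trans_le (hnat1' h)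
    rw [← Real.exp_log (pow_pos h0 _), Real.log_pow]
    simp only [hν]
    push_cast
    rfl
  · exact mul_nonneg (by positivity) (hlog0 h)
  · refine mul_le_mul_of_nonneg_left (Real.log_le_log (by linarith [hnat1' h]) ?_) (by positivity)
    have : N (I.spread s / 2 ^ h) ≤ N (I.spread s / 2 ^ (h + 1)) := by
      refine hanti _ _ (hpos _) ?_
      gcongr
      · norm_num
      · omega
    exact_mod_cast ENat.toNat_le_toNat this (htop _)
  · have e1 : ∑ h ∈ Finset.range (L + 1), I.spread s / 2 ^ h * Real.sqrt (ν h) ≤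
        Real.sqrt (2 * M) * (2 * (I.ε * Real.sqrt (I.Γ 1 g))) := by
      calc _ = Real.sqrt (2 * M) * ∑ h ∈ Finset.range (L + 1), I.spread s / 2 ^ h *
            Real.sqrt (Real.log ((N (I.spread s / 2 ^ h)).toNat : ℝ)) := by
            rw [Finset.mul_sum]
            refine Finset.sum_congr rfl fun h _ => ?_
            simp only [hν]
            rw [Real.sqrt_mul (by positivity)]; ring
        _ ≤ Real.sqrt (2 * M) * (2 * (entropyIntegral N).toReal) := by
            gcongr
            exact sum_le_entropy h1 hanti hfin hsp L
        _ ≤ _ := by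
            gcongr
            exact I.entropy_le g
    have e2 : Real.sqrt (2 * M) * (2 * (I.ε * Real.sqrt (I.Γ 1 g))) =
        2 * Real.sqrt 2 * (I.ε * Real.sqrt m) := by
      rw [hmM, Nat.cast_mul, Real.sqrt_mul zero_le_two, Real.sqrt_mul (Nat.cast_nonneg M)]
      ring
    have e3 : Real.sqrt 2 ≤ 1.42 := by
      rw [Real.sqrt_le_left (by norm_num)]; norm_num
    have e4 := I.spread_mul_sqrt_le g s
    have e5 : I.spread s / 2 ^ L ≤ I.ε / 4 := by
      have h2 : (L : ℝ) ≤ 2 ^ L := by exact_mod_cast Nat.lt_two_pow_self.le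
      rw [div_lt_iff₀ hε] at hL
      rw [div_le_iff₀ (by positivity)]
      nlinarith
    have e6 : Real.sqrt (10 * m) ≤ 4 * Real.sqrt m := by
      rw [Real.sqrt_mul (by norm_num)]
      gcongr
      rw [Real.sqrt_le_left (by norm_num)]; norm_num
    have e7 : I.spread s / 2 ^ L * Real.sqrt (10 * m) ≤ I.ε / 4 * (4 * Real.sqrt m) := by
      gcongr
    have e8 : 2 * Real.sqrt 2 * (I.ε * Real.sqrt m) ≤ 2 * 1.42 * (I.ε * Real.sqrt m) := by
      gcongr
    have e9 : 0 ≤ I.ε * Real.sqrt m := by positivity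
    rw [← hm] at e4
    linarith

/-- The samples from a group have the properties used for the coreset bound. -/
def Good (g : Label) {m : ℕ} (x : Fin m → Fin I.n) : Prop :=
  I.Typical g x ∧ ∀ C, |I.devn g x fun p => if I.σ p ∉ I.msk g C then I.resid g C p else 0| ≤
    4200 * I.ε * (m * I.total g C)

theorem sum_maskW_eq_samp (g : Label) {m : ℕ} (x : Fin m → Fin I.n) (c : Fin I.n → Prop)
    (f : Fin I.n → ℝ) :
    ∑ i, maskW (I.iw g) c f (x i) = I.samp g x fun p => if c p then f p else 0 := by
  unfold samp maskW
  exact Finset.sum_congr rfl fun i _ => by by_cases h : c (x i) <;> simp [h]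

theorem pr_not_good_le {g : Label} (hg : (I.group g).Nonempty) :
    pr (prodW (I.sampleProb g)) (fun x : Fin (I.quota 1 30 g) → Fin I.n => ¬ I.Good g x) ≤
      26 * (I.k * Real.exp (-I.expo)) := by
  have hq := I.sampleProb_nonneg g
  have h1 := I.sum_sampleProb hg
  have hT := I.cost_group_pos hg
  have hk := I.one_le_k_real
  have hε := I.ε_pos
  have hp0 := prodW_nonneg (ι := Fin (I.quota 1 30 g)) hq
  have hmem : ∀ p, I.sampleProb g p ≠ 0 → p ∈ I.group g := fun p h =>
    I.mem_group_of_sampleProb_ne h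
  have hunm : ∀ C p, I.sampleProb g p ≠ 0 → I.σ p ∉ I.msk g C → ¬ I.Masked g C (I.σ p) :=
    fun C p hp h => by rwa [I.mem_msk (hmem p hp)] at h
  have hdev := deviation (I.quota_pos g) hq h1 I.σ (I.msk g) (I.resid g) (I.scale g)
    (fun C p => I.dz p C) (I.iw g) (I.iw_nonneg g) (I.total g) hT (I.cost_le_total g)
    (fun C p => I.dz_nonneg p C)
    (fun C => by
      rw [I.sum_sampleProb_maskW]
      refine le_trans (Finset.sum_le_sum (g := fun p => I.dz p C) fun p _ => ?_)
        (le_add_of_nonneg_right (I.cost_nonneg _ _))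
      split_ifs
      exacts [I.dz_nonneg _ _, le_rfl])
    I.spread (fun s => (s + 1) * I.expo) (fun s => (I.spread_pos s).le)
    (fun s => by
      have h2 := I.log_two_le_log_ratio.trans I.log_ratio_le_expo
      have h3 := I.expo_pos
      have h4 : (0 : ℝ) ≤ s := Nat.cast_nonneg s
      nlinarith)
    (β := 60 * I.ε) (by positivity)
    (fun C p hp h => I.iw_scale_sq_le (hmem p hp) (hunm C p hp h))
    (fun C p hp h => I.iw_resid_sq_le (hmem p hp) (hunm C p hp h))
    (fun s _ => (I.spread_mul_sqrt_le g s).trans (by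
      have := Real.sqrt_nonneg (I.quota 1 30 g : ℝ)
      gcongr
      linarith))
    (fun S₀ hS hcard s _ => by
      obtain ⟨L, V, ν, a1, a2, a3, a4, a5⟩ :=
        I.exists_net_sequence s S₀ (fun p hp => hmem p (hS p hp)) hcard
      refine ⟨L, V, ν, a1, a2, a3, fun h C _ => ?_, a5⟩
      obtain ⟨v, hv, h2⟩ := a4 h C
      exact ⟨v, hv, fun p hp h3 => h2 p hp (hunm C p (hS p hp) h3)⟩)
  rw [Fintype.card_fin] at hdev
  have hdev2 := hdev.trans I.sum_choose_exp_le
  have htyp := I.pr_not_typical_le hg (I.quota 1 30 g)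
  have htyp2 : (I.k : ℝ) * (2 * Real.exp (-(I.ε ^ 2 * (I.quota 1 30 g) / (16 * 16 ^ I.z * I.k)))) ≤
      2 * (I.k * Real.exp (-I.expo)) := by
    have h2 := I.const_mul_expo_le g (c := 16) (by norm_num)
    have h3 : I.expo ≤ I.ε ^ 2 * (I.quota 1 30 g) / (16 * 16 ^ I.z * I.k) := by
      rw [le_div_iff₀ (by positivity)]
      linarith
    have h4 := Real.exp_le_exp.2 (neg_le_neg h3)
    have := mul_le_mul_of_nonneg_left h4 (show (0 : ℝ) ≤ I.k by positivity)
    linarith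
  refine le_trans (pr_mono_of_ne hp0 (F := fun x => ¬ I.Typical g x ∨ _) ?_)
    ((pr_or_le hp0).trans ((add_le_add (htyp.trans htyp2) hdev2).trans (le_of_eq (by ring))))
  intro x hx0 hx
  by_cases ht : I.Typical g x
  swap
  · exact Or.inl ht
  right
  -- Only outcomes of positive weight count, and in these all samples lie in the group.
  have hxg : ∀ l, x l ∈ I.group g := fun l =>
    hmem _ (fun h => hx0 (Finset.prod_eq_zero (Finset.mem_univ l) h))
  have hD : ∀ C, ∑ i, maskW (I.iw g) (fun p => I.σ p ∉ I.msk g C) (I.resid g C) (x i) -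
      (I.quota 1 30 g) * ∑ p, I.sampleProb g p *
        maskW (I.iw g) (fun p => I.σ p ∉ I.msk g C) (I.resid g C) p =
      I.devn g x fun p => if I.σ p ∉ I.msk g C then I.resid g C p else 0 := by
    intro C
    rw [I.sum_maskW_eq_samp, I.sum_sampleProb_maskW]
    simp only [devn]
    congr!
  refine ⟨fun C => ?_, ?_⟩
  · rw [hD, I.sum_maskW_eq_samp]
    convert I.samp_cluster_le hxg ht C (fun i => i ∉ I.msk g C)
  · simp only [Good, not_and, not_forall, not_le] at hx
    obtain ⟨C, hC⟩ := hx ht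
    refine ⟨C, ?_⟩
    rw [hD]
    refine lt_of_le_of_lt ?_ hC
    refine mul_le_mul_of_nonneg_right ?_
      (mul_nonneg (Nat.cast_nonneg _) (I.total_nonneg g C))
    -- With `β = 60 ε`: `10 β + β² = 600 ε + 3600 ε² ≤ 4200 ε`.
    nlinarith [I.ε_lt_one]

end Setup

end
end KZCoreset

/-! ### Error of a well-sampled group -/

namespace KZCoreset
noncomputable section

namespace Setup
open scoped Classical
variable {X : Type*} [MetricSpace X] (I : Setup X)

theorem abs_samp_le {g : Label} {m : ℕ} {x : Fin m → Fin I.n} (hx : ∀ l, x l ∈ I.group g)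
    {f h : Fin I.n → ℝ} (hfh : ∀ p ∈ I.group g, |f p| ≤ h p) :
    |I.samp g x f| ≤ I.samp g x h := by
  refine (Finset.abs_sum_le_sum_abs _ _).trans (Finset.sum_le_sum fun l _ => ?_)
  rw [abs_mul, abs_of_nonneg (I.iw_nonneg _ _)]
  exact mul_le_mul_of_nonneg_left (hfh _ (hx l)) (I.iw_nonneg _ _)

/-- For functions that are small instead of concentrated: estimate and true sum are bounded
separately by those of a majorant whose estimate is controlled. -/
theorem abs_devn_le {g : Label} {m : ℕ} {x : Fin m → Fin I.n} (hx : ∀ l, x l ∈ I.group g)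
    {f h : Fin I.n → ℝ} (hfh : ∀ p ∈ I.group g, |f p| ≤ h p) :
    |I.devn g x f| ≤ I.devn g x h + 2 * (m * ∑ p ∈ I.group g, h p) := by
  have h1 := I.abs_samp_le hx hfh
  have h2 : |∑ p ∈ I.group g, f p| ≤ ∑ p ∈ I.group g, h p :=
    (Finset.abs_sum_le_sum_abs _ _).trans (Finset.sum_le_sum hfh)
  have h3 := mul_le_mul_of_nonneg_left h2 (Nat.cast_nonneg (α := ℝ) m)
  calc |I.devn g x f| ≤ |I.samp g x f| + |(m : ℝ) * ∑ p ∈ I.group g, f p| := abs_sub _ _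
    _ = |I.samp g x f| + m * |∑ p ∈ I.group g, f p| := by rw [abs_mul, Nat.abs_cast]
    _ ≤ I.samp g x h + m * ∑ p ∈ I.group g, h p := add_le_add h1 h3
    _ = _ := by unfold devn; ring

theorem abs_distTo_sub_le (p : Fin I.n) (C : Fin I.k → X) :
    |distTo (I.P p) C - distTo (I.A (I.σ p)) C| ≤ dist (I.P p) (I.A (I.σ p)) := by
  have h1 := distTo_le_add I.one_le_k (I.P p) (I.A (I.σ p)) C
  have h2 := distTo_le_add I.one_le_k (I.A (I.σ p)) (I.P p) C
  rw [dist_comm (I.A _)] at h2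
  rw [abs_le]
  constructor <;> linarith

theorem rpow_inv_rpow {t : ℝ} (ht : 0 ≤ t) : (t ^ I.z) ^ (1 / I.z) = t := by
  rw [← Real.rpow_mul ht, mul_one_div_cancel I.z_pos.ne', Real.rpow_one]

/-- Points of masked clusters of a main group cost about as much as their centers. -/
theorem dz_near_of_masked {j b : ℤ} {C : Fin I.k → X} {p : Fin I.n} (hp : p ∈ I.group (.main j b))
    (h : I.Masked (.main j b) C (I.σ p)) :
    |I.dz p C - I.baseCost (.main j b) C (I.σ p)| ≤ I.ε * I.baseCost (.main j b) C (I.σ p) ∧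
      I.baseCost (.main j b) C (I.σ p) ≤ 2 * I.dz p C := by
  obtain ⟨-, h2, h3⟩ := I.mem_group_main hp
  have hz := I.z_pos
  have hε := I.ε_pos
  simp only [Masked] at h
  set τ := (2 : ℝ) ^ j * I.Δ (I.σ p) with hτ
  have hd : dist (I.P p) (I.A (I.σ p)) ≤ 2 * τ ^ (1 / I.z) := by
    have h4 := Real.rpow_le_rpow (I.dz_nonneg p I.A) h2 (show 0 ≤ 1 / I.z by positivity)
    rw [← I.dist_center_rpow, I.rpow_inv_rpow dist_nonneg, Real.mul_rpow zero_le_two h3.le] at h4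
    have h5 : (2 : ℝ) ^ (1 / I.z) ≤ 2 ^ (1 : ℝ) :=
      Real.rpow_le_rpow_of_exponent_le one_le_two (by rw [div_le_one hz]; exact I.one_le_z)
    rw [Real.rpow_one] at h5
    exact h4.trans (by gcongr)
  -- The threshold `8 z/ε` of the mask against the radius `2 τ^(1/z)` of the ring gives precisely
  -- the ratio required by `rpow_near`.
  have h6 : dist (I.P p) (I.A (I.σ p)) ≤ I.ε / (4 * I.z) * distTo (I.A (I.σ p)) C := by
    refine hd.trans (le_trans (le_of_eq ?_)
      (mul_le_mul_of_nonneg_left h (show 0 ≤ I.ε / (4 * I.z) by positivity)))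
    field_simp
    norm_num
  exact rpow_near (distTo_nonneg _ _) (distTo_nonneg _ _) I.one_le_z hε I.ε_lt_one
    ((I.abs_distTo_sub_le p C).trans h6)

theorem abs_devn_main_le {j b : ℤ} {m : ℕ} {x : Fin m → Fin I.n}
    (hx : ∀ l, x l ∈ I.group (.main j b)) (hg : I.Good (.main j b) x) (C : Fin I.k → X) :
    |I.devn (.main j b) x fun p => I.dz p C| ≤
      4210 * I.ε * (m * I.total (.main j b) C) := by
  set g := Label.main j b with hgdef
  have hε := I.ε_pos
  have hm : (0 : ℝ) ≤ m := Nat.cast_nonneg m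
  set f₁ : Fin I.n → ℝ := fun p => if I.σ p ∉ I.msk g C then I.resid g C p else 0 with hf₁
  set y : Fin I.n → ℝ := fun p => I.baseCost g C (I.σ p) with hy
  set r : Fin I.n → ℝ := fun p => if I.σ p ∈ I.msk g C then I.resid g C p else 0 with hr
  set e : Fin I.n → ℝ := fun p => I.ε * if I.σ p ∈ I.msk g C then I.baseCost g C (I.σ p) else 0
    with he
  -- Three parts: the residual of unmasked clusters (uniform deviation bound), the cost of the
  -- centers (typical ring weights), and the residual of masked clusters, which is small pointwise.
  have hdec : (fun p => I.dz p C) = fun p => (f₁ p + y p) + r p := by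
    funext p
    simp only [hf₁, hy, hr, resid]
    split_ifs <;> ring
  have h1 : |I.devn g x f₁| ≤ 4200 * I.ε * (m * I.total g C) := by
    have := hg.2 C
    convert this
  have h2 : |I.devn g x y| ≤ I.ε * (m * I.total g C) := by
    have a1 := I.abs_devn_baseCost_le hx hg.1 C (fun _ => True)
    have a2 := mul_le_mul_of_nonneg_left (I.sum_ite_baseCost_le g C (fun _ => True)) hm
    simp only [if_true] at a1 a2
    refine a1.trans (le_trans (le_of_eq ?_) (a2.trans (le_of_eq ?_))) <;> ring
  have h3 : |I.devn g x r| ≤ 6 * I.ε * (m * I.total g C) := by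
    have b1 : ∀ p ∈ I.group g, |r p| ≤ e p := by
      intro p hp
      simp only [hr, he]
      split_ifs with h
      · exact (I.dz_near_of_masked hp ((I.mem_msk hp).1 h)).1
      · simp
    have b2 := I.abs_devn_le hx b1
    have b3 : ∑ p ∈ I.group g, e p ≤ 2 * I.ε * I.total g C := by
      have : ∑ p ∈ I.group g, e p ≤ ∑ p ∈ I.group g, 2 * I.ε * I.dz p C := by
        refine Finset.sum_le_sum fun p hp => ?_
        have h0 := I.dz_nonneg p C
        simp only [he]
        split_ifs with h
        · have := (I.dz_near_of_masked hp ((I.mem_msk hp).1 h)).2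
          nlinarith
        · rw [mul_zero]; positivity
      refine this.trans ((Finset.mul_sum _ _ _).symm.trans_le ?_)
      gcongr
      exact le_add_of_nonneg_right (I.cost_nonneg _ _)
    have b4 : I.devn g x e ≤ I.ε * (m * I.total g C) := by
      have a1 := (abs_le.1 (I.abs_devn_baseCost_le hx hg.1 C (fun i => i ∈ I.msk g C))).2
      have a2 := mul_le_mul_of_nonneg_left (I.sum_ite_baseCost_le g C (fun i => i ∈ I.msk g C)) hm
      have a3 : I.devn g x e = I.ε * I.devn g x fun p =>
          if I.σ p ∈ I.msk g C then I.baseCost g C (I.σ p) else 0 := by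
        simp only [devn, samp, he, Finset.mul_sum, mul_sub]
        congr 1 <;> exact Finset.sum_congr rfl fun _ _ => by ring
      have a4 : I.devn g x (fun p => if I.σ p ∈ I.msk g C then I.baseCost g C (I.σ p) else 0) ≤
          m * (I.ε * I.total g C) := by
        refine le_trans ?_ (a1.trans (le_trans (le_of_eq ?_) a2))
        · apply le_of_eq; congr!
        · ring
      have a5 : 0 ≤ m * (I.ε * I.total g C) :=
        mul_nonneg hm (mul_nonneg hε.le (I.total_nonneg _ _))
      rw [a3]
      nlinarith [I.ε_lt_one]
    -- The majorant deviates by at most `ε m N` and its sum is at most `2 ε N`; by `abs_devn_le`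
    -- this makes `5 ε m N`.
    have b5 := mul_le_mul_of_nonneg_left b3 hm
    have b6 : 0 ≤ I.ε * (m * I.total g C) :=
      mul_nonneg hε.le (mul_nonneg hm (I.total_nonneg _ _))
    nlinarith
  rw [hdec, I.devn_add, I.devn_add]
  have h4 := abs_add_le (I.devn g x f₁ + I.devn g x y) (I.devn g x r)
  have h5 := abs_add_le (I.devn g x f₁) (I.devn g x y)
  have h6 : 0 ≤ I.ε * (m * I.total g C) := mul_nonneg hε.le (mul_nonneg hm (I.total_nonneg _ _))
  linarith

/-- The total cost of a cluster. -/
def clusterCost (i : Fin I.k) (C : Fin I.k → X) : ℝ :=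
  I.cost (I.cluster i) C + I.cost (I.cluster i) I.A

theorem clusterCost_nonneg (i : Fin I.k) (C : Fin I.k → X) : 0 ≤ I.clusterCost i C :=
  add_nonneg (I.cost_nonneg _ _) (I.cost_nonneg _ _)

/-- The clusters that meet the group. -/
def touch (g : Label) : Finset (Fin I.k) := Finset.univ.filter fun i => ∃ p ∈ I.group g, I.σ p = i

theorem card_mul_Δ (i : Fin I.k) : (I.cluster i).card * I.Δ i = I.cost (I.cluster i) I.A := by
  unfold Δ
  rcases (I.cluster i).eq_empty_or_nonempty with h | h
  · simp [h, cost]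
  · have : ((I.cluster i).card : ℝ) ≠ 0 := by
      exact_mod_cast (Finset.card_pos.2 h).ne'
    field_simp

theorem card_mul_center_le (i : Fin I.k) (C : Fin I.k → X) :
    (I.cluster i).card * distTo (I.A i) C ^ I.z ≤ 2 ^ I.z * I.clusterCost i C := by
  have := Finset.card_nsmul_le_sum (I.cluster i) (fun p => 2 ^ I.z * (I.dz p C + I.dz p I.A))
    (distTo (I.A i) C ^ I.z) (fun p hp => by
      have h : I.σ p = i := (Finset.mem_filter.1 hp).2
      rw [← h]; exact I.center_le_dz p C)
  rw [nsmul_eq_mul, ← Finset.mul_sum, Finset.sum_add_distrib] at this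
  exact this

theorem mem_group_outer {b : ℤ} {p : Fin I.n} (hp : p ∈ I.group (.outer b)) :
    (I.z / I.ε) ^ (2 * I.z) * I.Δ (I.σ p) ≤ I.dz p I.A ∧ 0 < I.Δ (I.σ p) := by
  obtain ⟨-, j, hj, hr⟩ := I.mem_outerRing.1 (Finset.mem_filter.1 hp).2.1
  have hΔ := I.Δ_pos_of_mem_ring hr
  refine ⟨le_trans ?_ (I.mem_ring.1 hr).2.1, hΔ⟩
  have hr0 : 0 < I.z / I.ε := div_pos I.z_pos I.ε_pos
  gcongr
  have : (2 : ℝ) ^ I.mainHi = (I.z / I.ε) ^ (2 * I.z) := by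
    unfold mainHi
    rw [mul_comm, Real.rpow_mul zero_le_two, Real.rpow_logb two_pos (by norm_num) hr0]
  rw [← this, ← Real.rpow_intCast]
  exact Real.rpow_le_rpow_of_exponent_le one_le_two hj

/-- The estimate of a cost in a far cluster of an outer group. -/
def farFactor (C : Fin I.k → X) (i : Fin I.k) : ℝ :=
  2 ^ I.z * (1 + distTo (I.A i) C ^ I.z / ((I.z / I.ε) ^ (2 * I.z) * I.Δ i))

theorem farFactor_nonneg (C : Fin I.k → X) (i : Fin I.k) : 0 ≤ I.farFactor C i := by
  have h1 : 0 ≤ distTo (I.A i) C ^ I.z := Real.rpow_nonneg (distTo_nonneg _ _) _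
  have h2 := I.Δ_nonneg i
  have h3 := I.z_pos
  have h4 := I.ε_pos
  unfold farFactor
  positivity

/-- Relative to `d^z(p, A)` the bound is constant on the cluster. In outer groups `Typical` controls
exactly the sums of `d^z(p, A)` over rings, so `abs_devn_cluster_le` applies to this majorant. -/
theorem dz_le_farFactor {b : ℤ} {p : Fin I.n} (hp : p ∈ I.group (.outer b)) (C : Fin I.k → X) :
    I.dz p C ≤ I.dz p I.A * I.farFactor C (I.σ p) := by
  obtain ⟨h1, h2⟩ := I.mem_group_outer hp
  refine (I.dz_le_center p C).trans ?_
  have hr0 : 0 < I.z / I.ε := div_pos I.z_pos I.ε_pos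
  have h3 : 0 < (I.z / I.ε) ^ (2 * I.z) * I.Δ (I.σ p) := by positivity
  have h4 : 0 ≤ distTo (I.A (I.σ p)) C ^ I.z := Real.rpow_nonneg (distTo_nonneg _ _) _
  have h5 : distTo (I.A (I.σ p)) C ^ I.z ≤ I.dz p I.A *
      (distTo (I.A (I.σ p)) C ^ I.z / ((I.z / I.ε) ^ (2 * I.z) * I.Δ (I.σ p))) := by
    rw [mul_div_assoc', le_div_iff₀ h3, mul_comm]
    gcongr
  unfold farFactor
  have h6 : (0 : ℝ) < 2 ^ I.z := by positivity
  nlinarith [mul_le_mul_of_nonneg_left h5 h6.le]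

theorem exp_eight_le : Real.exp 8 ≤ 3000 := by
  have h := Real.exp_one_lt_d9
  have h1 : Real.exp 8 = Real.exp 1 ^ 8 := by rw [← Real.exp_nat_mul]; norm_num
  rw [h1]
  calc Real.exp 1 ^ 8 ≤ 2.7182818286 ^ 8 := by gcongr
    _ ≤ 3000 := by norm_num

/-- The product is `(4/z)^z (ε²)^z`; the first factor is at most `exp 8` for all `z`, the second at
most `ε`. -/
theorem four_div_rpow_le : (4 : ℝ) ^ I.z * (I.ε ^ 2 / I.z) ^ I.z ≤ 3000 * I.ε := by
  have hz := I.z_pos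
  have hε := I.ε_pos
  have h1 : (4 : ℝ) ^ I.z * (I.ε ^ 2 / I.z) ^ I.z = (4 / I.z) ^ I.z * (I.ε ^ 2) ^ I.z := by
    rw [← Real.mul_rpow (by norm_num) (by positivity),
      ← Real.mul_rpow (by positivity) (by positivity)]
    congr 1; field_simp
  have h2 : (4 / I.z) ^ I.z ≤ 3000 := by
    refine le_trans ?_ ((eight_div_rpow_le hz).trans exp_eight_le)
    gcongr
    norm_num
  have h3 : (I.ε ^ 2) ^ I.z ≤ I.ε := by
    calc (I.ε ^ 2) ^ I.z ≤ (I.ε ^ 2) ^ (1 : ℝ) := by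
          refine Real.rpow_le_rpow_of_exponent_ge (by positivity) ?_ I.one_le_z
          nlinarith [I.ε_lt_one]
      _ = I.ε ^ 2 := Real.rpow_one _
      _ ≤ I.ε := by nlinarith [I.ε_lt_one]
  rw [h1]
  gcongr

theorem four_div_rpow_two_mul_le : (4 : ℝ) ^ I.z / (I.z / I.ε) ^ (2 * I.z) ≤ 3000 * I.ε := by
  have hz := I.z_pos
  have hε := I.ε_pos
  refine le_trans ?_ I.four_div_rpow_le
  rw [div_eq_mul_inv, ← Real.inv_rpow (by positivity), Real.rpow_mul (by positivity)]
  gcongr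
  have h := I.one_le_z
  rw [inv_div, show (2 : ℝ) = ((2 : ℕ) : ℝ) by norm_num, Real.rpow_natCast, div_pow]
  gcongr
  nlinarith

/-- One outer point that is far from `C` forces the center to be far from `C` on the scale of the
average cost `Δ`: `2 Δ ≤ (ε²/z)^z D`. The cluster as a whole then pays at least about `|P_i| D`,
compared with which both its cost for `A` and the share `1/(z/ε)^(2z)` of the outer ring are of
order `ε`. -/
theorem far_cluster_le {b : ℤ} {C : Fin I.k → X} {i : Fin I.k} (h : I.Masked (.outer b) C i) :
    I.farFactor C i * I.cost (I.cluster i) I.A ≤ 4500 * I.ε * I.clusterCost i C := by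
  obtain ⟨q, hq, rfl, hfar⟩ := h
  obtain ⟨h1, hΔ⟩ := I.mem_group_outer hq
  set i := I.σ q with hi
  have hr0 : 0 < I.z / I.ε := div_pos I.z_pos I.ε_pos
  have hz := I.z_pos
  have hε := I.ε_pos
  have h2 := distTo_le_add I.one_le_k (I.P q) (I.A i) C
  rw [← I.dist_center_rpow] at h1 hfar
  obtain ⟨-, h3, -⟩ := far_center hΔ.le dist_nonneg (distTo_nonneg _ _) I.one_le_z hε I.ε_lt_one
    h1 hfar h2
  set D := distTo (I.A i) C ^ I.z with hD
  have hD0 : 0 ≤ D := Real.rpow_nonneg (distTo_nonneg _ _) _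
  have h4 := I.card_mul_center_le i C
  rw [← hD] at h4
  set Λ := (I.z / I.ε) ^ (2 * I.z) with hΛ
  have hΛ0 : 0 < Λ := by positivity
  set N : ℝ := ((I.cluster i).card : ℝ) with hN
  have hN0 : 0 ≤ N := Nat.cast_nonneg _
  have hQ := I.clusterCost_nonneg i C
  set Q := I.clusterCost i C with hQdef
  have e4 : (4 : ℝ) ^ I.z = 2 ^ I.z * 2 ^ I.z := by
    rw [← Real.mul_rpow zero_le_two zero_le_two]; norm_num
  have e1 : I.farFactor C i * I.cost (I.cluster i) I.A =
      2 ^ I.z * (N * I.Δ i) + 2 ^ I.z * (N * D) / Λ := by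
    rw [← I.card_mul_Δ, farFactor, ← hD, ← hΛ, ← hN]
    field_simp
  have f1 : 2 ^ I.z * (N * I.Δ i) ≤ 1500 * I.ε * Q := by
    have : N * (2 * I.Δ i) ≤ (I.ε ^ 2 / I.z) ^ I.z * (2 ^ I.z * Q) := by
      calc N * (2 * I.Δ i) ≤ N * ((I.ε ^ 2 / I.z) ^ I.z * D) := by gcongr
        _ = (I.ε ^ 2 / I.z) ^ I.z * (N * D) := by ring
        _ ≤ _ := by gcongr
    have h5 := mul_le_mul_of_nonneg_left this (show (0 : ℝ) ≤ 2 ^ I.z by positivity)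
    have h6 := mul_le_mul_of_nonneg_right I.four_div_rpow_le hQ
    rw [e4] at h6
    linarith
  have f2 : 2 ^ I.z * (N * D) / Λ ≤ 3000 * I.ε * Q := by
    calc 2 ^ I.z * (N * D) / Λ ≤ 2 ^ I.z * (2 ^ I.z * Q) / Λ := by gcongr
      _ = (4 : ℝ) ^ I.z / Λ * Q := by rw [e4]; ring
      _ ≤ _ := mul_le_mul_of_nonneg_right I.four_div_rpow_two_mul_le hQ
  rw [e1]
  linarith

theorem abs_devn_outer_le {b : ℤ} {m : ℕ} {x : Fin m → Fin I.n}
    (hx : ∀ l, x l ∈ I.group (.outer b)) (hg : I.Good (.outer b) x) (C : Fin I.k → X) :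
    |I.devn (.outer b) x fun p => I.dz p C| ≤ 4210 * I.ε * (m * I.total (.outer b) C) +
      15000 * I.ε * (m * ∑ i ∈ I.touch (.outer b), I.clusterCost i C) := by
  set g := Label.outer b with hgdef
  have hε := I.ε_pos
  have hm : (0 : ℝ) ≤ m := Nat.cast_nonneg m
  set f₁ : Fin I.n → ℝ := fun p => if I.σ p ∉ I.msk g C then I.resid g C p else 0 with hf₁
  set f₂ : Fin I.n → ℝ := fun p => if I.σ p ∈ I.msk g C then I.dz p C else 0 with hf₂
  set φ : Fin I.k → ℝ := fun i => if i ∈ I.msk g C then I.farFactor C i else 0 with hφ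
  have hφ0 : ∀ i, 0 ≤ φ i := fun i => by
    simp only [hφ]; split_ifs
    exacts [I.farFactor_nonneg C i, le_rfl]
  have hdec : (fun p => I.dz p C) = fun p => f₁ p + f₂ p := by
    funext p
    have : I.resid g C p = I.dz p C := sub_zero _
    simp only [hf₁, hf₂, this]
    split_ifs <;> ring
  have h1 : |I.devn g x f₁| ≤ 4200 * I.ε * (m * I.total g C) := by
    have := hg.2 C
    convert this
  have h2 : ∀ p ∈ I.group g, |f₂ p| ≤ I.base g p * φ (I.σ p) := by
    intro p hp
    simp only [hf₂, hφ]
    split_ifs with h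
    · rw [abs_of_nonneg (I.dz_nonneg _ _)]
      exact I.dz_le_farFactor hp C
    · simp
  have h3 := I.abs_devn_le hx h2
  have h4 := (abs_le.1 (I.abs_devn_cluster_le hx hg.1 φ hφ0)).2
  set B := ∑ p ∈ I.group g, I.base g p * φ (I.σ p) with hB
  have hB0 : 0 ≤ B := Finset.sum_nonneg fun p _ => mul_nonneg (I.base_nonneg g p) (hφ0 _)
  have h5 : I.ε / 4 ^ I.z * (m * B) ≤ m * B := by
    refine mul_le_of_le_one_left (by positivity) ?_
    have : (1 : ℝ) ≤ 4 ^ I.z := Real.one_le_rpow (by norm_num) I.z_pos.le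
    rw [div_le_one (by positivity)]
    linarith [I.ε_lt_one]
  -- Only masked clusters that meet the group contribute; the part of the cluster in the group is
  -- enlarged to the whole cluster. The deviation is at most `3 m B`, whence the constant `13500 ≤
  -- 15000`.
  have h6 : B ≤ 4500 * I.ε * ∑ i ∈ I.touch g, I.clusterCost i C := by
    rw [hB, ← I.sum_fiber, Finset.mul_sum,
      ← Finset.sum_subset (Finset.subset_univ (I.touch g))]
    · refine Finset.sum_le_sum fun i hi => ?_
      obtain ⟨p, hp, rfl⟩ := (Finset.mem_filter.1 hi).2
      have e : ∑ q ∈ I.fiber g (I.σ p), I.base g q * φ (I.σ q) =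
          φ (I.σ p) * I.cost (I.fiber g (I.σ p)) I.A := by
        rw [cost, Finset.mul_sum]
        refine Finset.sum_congr rfl fun q hq => ?_
        rw [(I.mem_fiber.1 hq).2, mul_comm]
        rfl
      rw [e]
      simp only [hφ]
      split_ifs with h
      · refine le_trans ?_ (I.far_cluster_le ((I.mem_msk hp).1 h))
        refine mul_le_mul_of_nonneg_left (I.cost_mono ?_ _) (I.farFactor_nonneg _ _)
        intro q hq
        simp [cluster, (I.mem_fiber.1 hq).2]
      · rw [zero_mul]
        exact mul_nonneg (by positivity) (I.clusterCost_nonneg _ _)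
    · intro i _ hi
      refine Finset.sum_eq_zero fun q hq => absurd ?_ hi
      exact Finset.mem_filter.2 ⟨Finset.mem_univ _, q, (I.mem_fiber.1 hq).1, (I.mem_fiber.1 hq).2⟩
  have h7 := mul_le_mul_of_nonneg_left h6 hm
  have h8 := abs_add_le (I.devn g x f₁) (I.devn g x f₂)
  have h9 : 0 ≤ I.ε * (m * I.total g C) := mul_nonneg hε.le (mul_nonneg hm (I.total_nonneg _ _))
  have h10 : 0 ≤ I.ε * (m * ∑ i ∈ I.touch g, I.clusterCost i C) :=
    mul_nonneg hε.le (mul_nonneg hm (Finset.sum_nonneg fun i _ => I.clusterCost_nonneg _ _))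
  rw [hdec, I.devn_add]
  linarith

end Setup

end
end KZCoreset

/-! ### Points outside all groups, and the coreset bound -/

namespace KZCoreset
noncomputable section

namespace Setup
open scoped Classical
variable {X : Type*} [MetricSpace X] (I : Setup X)

/-- The points that lie in no group. -/
def rest : Finset (Fin I.n) := Finset.univ.filter fun p => ∀ g ∈ I.groups, p ∉ I.group g

theorem mem_rest {p : Fin I.n} : p ∈ I.rest ↔ ¬ I.Sampled p := by
  simp only [rest, Finset.mem_filter, Finset.mem_univ, true_and]
  constructor
  · intro h hs
    obtain ⟨h1, h2⟩ := I.mem_group_iff.2 ⟨hs, rfl⟩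
    exact h _ h1 h2
  · intro h g hg hp
    exact h (I.mem_group_iff.1 ⟨hg, hp⟩).1

theorem sum_Δ_le : ∑ p, I.Δ (I.σ p) ≤ I.cost Finset.univ I.A := by
  have h1 : ∀ f : Fin I.n → ℝ, ∑ p, f p = ∑ i, ∑ p ∈ I.cluster i, f p := fun f =>
    (Finset.sum_fiberwise _ _ _).symm
  rw [h1, cost, h1]
  refine Finset.sum_le_sum fun i _ => ?_
  have : ∑ p ∈ I.cluster i, I.Δ (I.σ p) = ∑ p ∈ I.cluster i, I.Δ i :=
    Finset.sum_congr rfl fun p hp => by rw [(Finset.mem_filter.1 hp).2]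
  rw [this, Finset.sum_const, nsmul_eq_mul, I.card_mul_Δ]
  rfl

theorem two_rpow_mainLo : (2 : ℝ) ^ I.mainLo = (I.ε / I.z) ^ I.z := by
  have : 0 < I.ε / I.z := div_pos I.ε_pos I.z_pos
  rw [mainLo, mul_comm, Real.rpow_mul zero_le_two, Real.rpow_logb two_pos (by norm_num) this]

theorem two_rpow_bandLo_le : (2 : ℝ) ^ I.bandLo ≤ (I.ε / I.z) ^ I.z / I.k := by
  have hε := I.ε_pos
  have hz := I.z_pos
  have hk := I.one_le_k_real
  rw [bandLo, Real.rpow_sub two_pos, mul_comm, Real.rpow_mul zero_le_two,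
    Real.rpow_logb two_pos (by norm_num) (by positivity),
    Real.rpow_logb two_pos (by norm_num) (by positivity)]
  gcongr
  linarith

theorem dz_le_of_lvl_le {p : Fin I.n} (h0 : 0 < I.dz p I.A) (h : (I.lvl p : ℝ) ≤ I.mainLo) :
    I.dz p I.A ≤ 2 * (I.ε / I.z) ^ I.z * I.Δ (I.σ p) := by
  have h1 : I.lvl p < I.topLvl := by
    have := h.trans_lt I.mainLo_lt_topLvl
    exact_mod_cast this
  have h2 : I.rawLvl p = I.lvl p := (I.lvl_eq_iff_of_lt h1 p).1 rfl
  have hΔ := I.Δ_pos_of_dz_pos h0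
  have h3 := ((floor_logb_eq_iff h0 hΔ _).1 h2).2
  rw [zpow_add_one₀ two_ne_zero, ← Real.rpow_intCast] at h3
  have h4 := Real.rpow_le_rpow_of_exponent_le one_le_two h
  rw [I.two_rpow_mainLo] at h4
  refine h3.le.trans ?_
  rw [mul_comm (2 : ℝ)]
  gcongr

theorem cost_cell_le_of_band_le {p : Fin I.n} (h0 : 0 < I.dz p I.A)
    (h : (I.band p : ℝ) ≤ I.bandLo) : I.cost (I.cell (I.σ p) (I.lvl p)) I.A ≤
      2 * (I.ε / I.z) ^ I.z / I.k * I.cost (I.layer (I.lvl p)) I.A := by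
  have h3 := ((I.band_eq_iff h0 _).1 rfl).2
  rw [zpow_add_one₀ two_ne_zero, ← Real.rpow_intCast] at h3
  have h4 := (Real.rpow_le_rpow_of_exponent_le one_le_two h).trans I.two_rpow_bandLo_le
  have hc := I.cost_nonneg (I.layer (I.lvl p)) I.A
  refine h3.le.trans ?_
  calc _ ≤ (I.ε / I.z) ^ I.z / I.k * 2 * I.cost (I.layer (I.lvl p)) I.A := by gcongr
    _ = _ := by ring

/-- A cell below the lowest band costs at most `2 (ε/z)^z / k` times its layer. A layer has at most
`k` cells, and the layers are disjoint. -/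
theorem sum_small_cells_le : ∑ p ∈ Finset.univ.filter (fun p : Fin I.n => 0 < I.dz p I.A ∧
    (I.band p : ℝ) ≤ I.bandLo), I.dz p I.A ≤ 2 * (I.ε / I.z) ^ I.z * I.cost Finset.univ I.A := by
  have hε := I.ε_pos
  have hz := I.z_pos
  have hk := I.one_le_k_real
  set S := Finset.univ.filter (fun p : Fin I.n => 0 < I.dz p I.A ∧ (I.band p : ℝ) ≤ I.bandLo) with hS
  set L := (Finset.univ : Finset (Fin I.n)).image I.lvl with hL
  set δ := 2 * (I.ε / I.z) ^ I.z with hδ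
  have hδ0 : 0 ≤ δ := by positivity
  rw [← Finset.sum_fiberwise_of_maps_to (s := S) (t := L ×ˢ (Finset.univ : Finset (Fin I.k)))
    (g := fun p => (I.lvl p, I.σ p)) (fun p _ => Finset.mem_product.2
      ⟨Finset.mem_image_of_mem _ (Finset.mem_univ _), Finset.mem_univ _⟩)]
  have h1 : ∀ li ∈ L ×ˢ (Finset.univ : Finset (Fin I.k)),
      ∑ p ∈ S with (I.lvl p, I.σ p) = li, I.dz p I.A ≤ δ / I.k * I.cost (I.layer li.1) I.A := by
    rintro ⟨l, i⟩ -
    rcases (S.filter fun p => (I.lvl p, I.σ p) = (l, i)).eq_empty_or_nonempty with h | ⟨p, hp⟩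
    · rw [h, Finset.sum_empty]
      exact mul_nonneg (by positivity) (I.cost_nonneg _ _)
    · obtain ⟨h2, h3⟩ := Finset.mem_filter.1 hp
      obtain ⟨-, h4, h5⟩ := Finset.mem_filter.1 h2
      simp only [Prod.mk.injEq] at h3
      obtain ⟨rfl, rfl⟩ := h3
      refine le_trans (I.cost_mono ?_ I.A) (I.cost_cell_le_of_band_le h4 h5)
      intro q hq
      obtain ⟨h6, h7⟩ := Finset.mem_filter.1 hq
      obtain ⟨-, h8, -⟩ := Finset.mem_filter.1 h6
      simp only [Prod.mk.injEq] at h7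
      simp [cell, h8, h7]
  refine (Finset.sum_le_sum h1).trans ?_
  rw [Finset.sum_product]
  simp only [Finset.sum_const, Finset.card_univ, Fintype.card_fin, nsmul_eq_mul]
  have h2 : ∀ l, (I.k : ℝ) * (δ / I.k * I.cost (I.layer l) I.A) = δ * I.cost (I.layer l) I.A := by
    intro l; field_simp
  simp only [h2]
  rw [← Finset.mul_sum]
  gcongr
  have h3 : ∀ l, I.cost (I.layer l) I.A ≤ ∑ p with I.lvl p = l, I.dz p I.A := by
    intro l
    refine I.cost_mono ?_ I.A
    intro p hp
    simp only [layer, Finset.mem_filter, Finset.mem_univ, true_and] at hp ⊢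
    exact hp.2
  refine (Finset.sum_le_sum fun l _ => h3 l).trans (le_of_eq ?_)
  exact Finset.sum_fiberwise_of_maps_to (fun p _ => Finset.mem_image_of_mem _ (Finset.mem_univ _)) _

/-- A point misses the groups for one of three reasons: it costs nothing, its level is too low and
it costs at most `2 (ε/z)^z Δ`, or its ring is too cheap. The averages `Δ` sum to at most the total
cost. -/
theorem cost_rest_le : I.cost I.rest I.A ≤ 4 * (I.ε / I.z) ^ I.z * I.cost Finset.univ I.A := by
  have hε := I.ε_pos
  have hz := I.z_pos
  set δ := 2 * (I.ε / I.z) ^ I.z with hδ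
  have hδ0 : 0 ≤ δ := by positivity
  have h1 : I.cost I.rest I.A ≤ ∑ p, (δ * I.Δ (I.σ p) +
      if 0 < I.dz p I.A ∧ (I.band p : ℝ) ≤ I.bandLo then I.dz p I.A else 0) := by
    have h0 : ∀ p, 0 ≤ δ * I.Δ (I.σ p) := fun p => mul_nonneg hδ0 (I.Δ_nonneg _)
    refine le_trans (Finset.sum_le_sum (g := fun p => δ * I.Δ (I.σ p) +
      if 0 < I.dz p I.A ∧ (I.band p : ℝ) ≤ I.bandLo then I.dz p I.A else 0) fun p hp => ?_)
      (Finset.sum_le_sum_of_subset_of_nonneg (Finset.subset_univ _) fun p _ _ => ?_)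
    · rw [mem_rest, Sampled] at hp
      rcases (I.dz_nonneg p I.A).eq_or_lt with h2 | h2
      · rw [← h2, if_neg (by simp)]
        linarith [h0 p]
      by_cases h3 : (I.band p : ℝ) ≤ I.bandLo
      · rw [if_pos ⟨h2, h3⟩]
        linarith [h0 p]
      · rw [if_neg (fun h => h3 h.2), add_zero]
        refine I.dz_le_of_lvl_le h2 (not_lt.1 fun h4 => hp ⟨h2, h4, not_le.1 h3⟩)
    · have := I.dz_nonneg p I.A
      have := h0 p
      split_ifs <;> linarith
  rw [Finset.sum_add_distrib, ← Finset.mul_sum, ← Finset.sum_filter] at h1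
  have h2 := mul_le_mul_of_nonneg_left I.sum_Δ_le hδ0
  have h3 := I.sum_small_cells_le
  rw [← hδ] at h3
  have e : 4 * (I.ε / I.z) ^ I.z = δ + δ := by rw [hδ]; ring
  rw [e, add_mul]
  linarith

/-- Moving a point to its center costs `3 ε (z/ε)^z d^z(p, A)` beyond a relative error `2 ε`; the
cost of the remaining points carries the inverse power, which leaves `3 · 4 = 12`. -/
theorem rest_error_le (C : Fin I.k → X) :
    |∑ p ∈ I.rest, (distTo (I.A (I.σ p)) C ^ I.z - I.dz p C)| ≤
      2 * I.ε * I.cost Finset.univ C + 12 * I.ε * I.cost Finset.univ I.A := by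
  have hε := I.ε_pos
  have hz := I.z_pos
  have h1 : ∀ p ∈ I.rest, |distTo (I.A (I.σ p)) C ^ I.z - I.dz p C| ≤
      2 * I.ε * I.dz p C + 3 * I.ε * (I.z / I.ε) ^ I.z * I.dz p I.A := by
    intro p _
    rw [abs_sub_comm, ← I.dist_center_rpow]
    exact rpow_snap (distTo_nonneg _ _) (distTo_nonneg _ _) I.one_le_z hε I.ε_lt_one
      (I.abs_distTo_sub_le p C)
  refine (Finset.abs_sum_le_sum_abs _ _).trans ((Finset.sum_le_sum h1).trans ?_)
  rw [Finset.sum_add_distrib, ← Finset.mul_sum, ← Finset.mul_sum]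
  have h2 : I.cost I.rest C ≤ I.cost Finset.univ C := I.cost_mono (Finset.subset_univ _) _
  refine add_le_add ?_ ?_
  · exact mul_le_mul_of_nonneg_left h2 (by positivity)
  · have h3 := mul_le_mul_of_nonneg_left I.cost_rest_le
      (show 0 ≤ 3 * I.ε * (I.z / I.ε) ^ I.z by positivity)
    refine h3.trans (le_of_eq ?_)
    have e : (I.z / I.ε) ^ I.z * (I.ε / I.z) ^ I.z = 1 := by
      rw [← Real.mul_rpow (by positivity) (by positivity)]
      field_simp
      exact Real.one_rpow _
    linear_combination 12 * I.ε * I.cost Finset.univ I.A * e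

theorem sum_rest_centers (φ : Fin I.k → ℝ) :
    ∑ i, (I.restCount i : ℝ) * φ i = ∑ p ∈ I.rest, φ (I.σ p) := by
  rw [← Finset.sum_fiberwise I.rest I.σ]
  refine Finset.sum_congr rfl fun i _ => ?_
  have : ∑ p ∈ I.rest with I.σ p = i, φ (I.σ p) = ∑ p ∈ I.rest with I.σ p = i, φ i :=
    Finset.sum_congr rfl fun p hp => by rw [(Finset.mem_filter.1 hp).2]
  rw [this, Finset.sum_const, nsmul_eq_mul]
  congr 2
  unfold restCount
  congr 1
  ext p
  simp [rest, cluster, and_comm]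

/-- Groups are disjoint because a point determines the label of its group. -/
theorem sum_groups_add_rest (f : Fin I.n → ℝ) :
    ∑ g ∈ I.groups, ∑ p ∈ I.group g, f p + ∑ p ∈ I.rest, f p = ∑ p, f p := by
  rw [← Finset.sum_biUnion]
  · rw [← Finset.sum_union]
    · congr 1
      ext p
      simp only [Finset.mem_union, Finset.mem_biUnion, rest, Finset.mem_filter, Finset.mem_univ,
        true_and, iff_true]
      by_cases h : ∃ g ∈ I.groups, p ∈ I.group g
      · exact Or.inl h
      · right
        push Not at h
        exact h
    · rw [Finset.disjoint_left]
      intro p hp hr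
      obtain ⟨g, hg, hp⟩ := Finset.mem_biUnion.1 hp
      exact (Finset.mem_filter.1 hr).2 g hg hp
  · intro g hg g' hg' hne
    refine Finset.disjoint_left.2 fun p hp hp' => hne ?_
    rw [← I.eq_labelOf hg hp, ← I.eq_labelOf hg' hp']

/-- Label of an outer group. -/
def IsOuter : Label → Prop
  | .main _ _ => False
  | .outer _ => True

/-- The clusters whose outer ring is in the group. -/
def outerTouch (g : Label) : Finset (Fin I.k) := if IsOuter g then I.touch g else ∅

theorem abs_devn_le_of_good {g : Label} {m : ℕ} {x : Fin m → Fin I.n}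
    (hx : ∀ l, x l ∈ I.group g) (hg : I.Good g x) (C : Fin I.k → X) :
    |I.devn g x fun p => I.dz p C| ≤
      m * (4210 * I.ε * I.total g C + 15000 * I.ε * ∑ i ∈ I.outerTouch g, I.clusterCost i C) := by
  cases g with
  | main j b =>
    refine (I.abs_devn_main_le hx hg C).trans (le_of_eq ?_)
    simp [outerTouch, IsOuter]; ring
  | outer b =>
    refine (I.abs_devn_outer_le hx hg C).trans (le_of_eq ?_)
    simp [outerTouch, IsOuter]; ring

/-- The outer ring of a cluster is one set with one band, so the cluster costs charged by the outer
groups add up to at most the total cost. Main groups charge nothing to clusters. -/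
theorem outerTouch_disjoint : (I.groups : Set Label).PairwiseDisjoint I.outerTouch := by
  intro g hg g' hg' hne
  refine Finset.disjoint_left.2 fun i hi hi' => hne ?_
  unfold outerTouch at hi hi'
  cases g with
  | main j b => simp [IsOuter] at hi
  | outer b =>
    cases g' with
    | main j b => simp [IsOuter] at hi'
    | outer b' =>
      rw [if_pos (show IsOuter (.outer _) from trivial)] at hi hi'
      simp only [touch, Finset.mem_filter, Finset.mem_univ, true_and] at hi hi'
      obtain ⟨p, hp, rfl⟩ := hi
      obtain ⟨q, hq, hqp⟩ := hi'
      have key : ∀ {b : ℤ} {p}, Label.outer b ∈ I.groups → p ∈ I.group (.outer b) →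
          I.lvl p = I.topLvl ∧ I.band p = b := by
        intro b p hg hp
        have h := I.eq_labelOf hg hp
        unfold labelOf at h
        split_ifs at h with h1
        exact ⟨h1, by simpa using h⟩
      obtain ⟨h1, h2⟩ := key hg hp
      obtain ⟨h3, h4⟩ := key hg' hq
      rw [← h2, ← h4, band, band, hqp, h1, h3]

theorem sum_clusterCost_le (J : Finset (Fin I.k)) (C : Fin I.k → X) :
    ∑ i ∈ J, I.clusterCost i C ≤ I.cost Finset.univ C + I.cost Finset.univ I.A := by
  refine (Finset.sum_le_sum_of_subset_of_nonneg (Finset.subset_univ J)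
    fun i _ _ => I.clusterCost_nonneg i C).trans (le_of_eq ?_)
  unfold clusterCost
  rw [Finset.sum_add_distrib]
  congr 1 <;> exact Finset.sum_fiberwise _ _ _

/-- If all groups are sampled well, the output is a coreset. -/
theorem isCoreset_of_good {m : Label → ℕ} (hm : ∀ g ∈ I.groups, 0 < m g)
    {ω : I.Slot m → Fin I.n} (hω : ∀ s, ω s ∈ I.group s.1.1)
    (hgood : ∀ g : {g // g ∈ I.groups}, I.Good g.1 fun l : Fin (m g.1) => ω ⟨g, l⟩)
    {c : ℝ} (hc : 1 ≤ c) (happ : I.IsApprox c) :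
    I.IsCoreset (40000 * c * I.ε) (I.output m ω) := by
  have hε := I.ε_pos
  constructor
  · intro x hx
    simp only [output, Multiset.mem_add, Multiset.mem_map] at hx
    rcases hx with ⟨i, -, rfl⟩ | ⟨s, -, rfl⟩
    · exact Nat.cast_nonneg _
    · exact div_nonneg (I.cost_nonneg _ _) (mul_nonneg (Nat.cast_nonneg _) (I.dz_nonneg _ _))
  · intro C
    set U := I.cost Finset.univ C with hU
    set V := I.cost Finset.univ I.A with hV
    have hUV : V ≤ c * U := happ C
    have hU0 : 0 ≤ U := I.cost_nonneg _ _
    have hsum : ((I.output m ω).map fun x => x.2 * distTo (I.loc x.1) C ^ I.z).sum =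
        ∑ p ∈ I.rest, distTo (I.A (I.σ p)) C ^ I.z +
        ∑ g : {g // g ∈ I.groups}, (1 / (m g.1 : ℝ)) *
          I.samp g.1 (fun l : Fin (m g.1) => ω ⟨g, l⟩) fun p => I.dz p C := by
      rw [← I.sum_rest_centers fun i => distTo (I.A i) C ^ I.z]
      simp only [output, Multiset.map_add, Multiset.sum_add, Multiset.map_map, Function.comp_def]
      congr 1
      change ∑ s : I.Slot m, _ = _
      rw [Fintype.sum_sigma]
      refine Finset.sum_congr rfl fun g _ => ?_
      rw [samp, Finset.mul_sum]
      refine Finset.sum_congr rfl fun l _ => ?_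
      change _ / (_ * _) * I.dz _ C = _
      rw [iw, div_mul_eq_div_div_swap]
      ring
    have hdec : ((I.output m ω).map fun x => x.2 * distTo (I.loc x.1) C ^ I.z).sum - U =
        ∑ p ∈ I.rest, (distTo (I.A (I.σ p)) C ^ I.z - I.dz p C) +
        ∑ g : {g // g ∈ I.groups}, (1 / (m g.1 : ℝ)) *
          I.devn g.1 (fun l : Fin (m g.1) => ω ⟨g, l⟩) fun p => I.dz p C := by
      have e1 : U = ∑ g : {g // g ∈ I.groups}, ∑ p ∈ I.group g.1, I.dz p C +
          ∑ p ∈ I.rest, I.dz p C := by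
        rw [Finset.sum_coe_sort I.groups fun g => ∑ p ∈ I.group g, I.dz p C]
        exact (I.sum_groups_add_rest _).symm
      rw [hsum, e1, Finset.sum_sub_distrib]
      have e2 : ∑ g : {g // g ∈ I.groups}, (1 / (m g.1 : ℝ)) *
          I.devn g.1 (fun l : Fin (m g.1) => ω ⟨g, l⟩) (fun p => I.dz p C) =
          ∑ g : {g // g ∈ I.groups}, (1 / (m g.1 : ℝ)) *
            I.samp g.1 (fun l : Fin (m g.1) => ω ⟨g, l⟩) (fun p => I.dz p C) -
          ∑ g : {g // g ∈ I.groups}, ∑ p ∈ I.group g.1, I.dz p C := by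
        rw [← Finset.sum_sub_distrib]
        refine Finset.sum_congr rfl fun g _ => ?_
        have : (m g.1 : ℝ) ≠ 0 := by exact_mod_cast (hm g.1 g.2).ne'
        rw [devn]
        field_simp
      rw [e2]
      ring
    have hgr : ∀ g : {g // g ∈ I.groups}, |(1 / (m g.1 : ℝ)) *
        I.devn g.1 (fun l : Fin (m g.1) => ω ⟨g, l⟩) fun p => I.dz p C| ≤
        4210 * I.ε * I.total g.1 C + 15000 * I.ε * ∑ i ∈ I.outerTouch g.1, I.clusterCost i C := by
      intro g
      have h1 := I.abs_devn_le_of_good (fun l => hω ⟨g, l⟩) (hgood g) C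
      have hm0 : (0 : ℝ) < m g.1 := by exact_mod_cast hm g.1 g.2
      rw [abs_mul, abs_of_pos (by positivity), one_div, inv_mul_le_iff₀ hm0]
      exact h1
    have hgr2 := (Finset.abs_sum_le_sum_abs (fun g : {g // g ∈ I.groups} => (1 / (m g.1 : ℝ)) *
        I.devn g.1 (fun l : Fin (m g.1) => ω ⟨g, l⟩) fun p => I.dz p C) Finset.univ).trans
      (Finset.sum_le_sum fun g _ => hgr g)
    rw [Finset.sum_coe_sort I.groups fun g => 4210 * I.ε * I.total g C +
      15000 * I.ε * ∑ i ∈ I.outerTouch g, I.clusterCost i C, Finset.sum_add_distrib,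
      ← Finset.mul_sum, ← Finset.mul_sum, ← Finset.sum_biUnion I.outerTouch_disjoint] at hgr2
    have h2 := I.sum_clusterCost_le (I.groups.biUnion I.outerTouch) C
    have h3 : ∑ g ∈ I.groups, I.total g C ≤ U + V := by
      have : ∑ g ∈ I.groups, I.total g C =
          ∑ g ∈ I.groups, ∑ p ∈ I.group g, (I.dz p C + I.dz p I.A) := by
        refine Finset.sum_congr rfl fun g _ => ?_
        rw [Finset.sum_add_distrib]; rfl
      have h4 := I.sum_groups_add_rest fun p => I.dz p C + I.dz p I.A
      have h5 : 0 ≤ ∑ p ∈ I.rest, (I.dz p C + I.dz p I.A) :=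
        Finset.sum_nonneg fun p _ => add_nonneg (I.dz_nonneg _ _) (I.dz_nonneg _ _)
      have h6 : ∑ p, (I.dz p C + I.dz p I.A) = U + V := Finset.sum_add_distrib
      linarith
    have h4 := I.rest_error_le C
    rw [hdec]
    refine (abs_add_le _ _).trans ((add_le_add h4 hgr2).trans ?_)
    -- The errors add up to `19212 ε U + 19222 ε V`, and `V ≤ c U`.
    have h5 := mul_le_mul_of_nonneg_left h3 (show 0 ≤ 4210 * I.ε by positivity)
    have h6 := mul_le_mul_of_nonneg_left h2 (show 0 ≤ 15000 * I.ε by positivity)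
    have h7 := mul_le_mul_of_nonneg_left hUV hε.le
    have h8 : I.ε * U ≤ c * (I.ε * U) := le_mul_of_one_le_left (mul_nonneg hε.le hU0) hc
    rw [← hU, ← hV] at h6
    have h9 : 0 ≤ c * (I.ε * U) := by positivity
    linarith

end Setup

end
end KZCoreset

/-! ### Number of groups and probability of success -/

namespace KZCoreset
noncomputable section

namespace Setup
open scoped Classical
variable {X : Type*} [MetricSpace X] (I : Setup X)

theorem logb_two_le {x : ℝ} (hx : 0 < x) : Real.logb 2 x ≤ 1.5 * x := by
  have h2 := Real.log_two_gt_d9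
  rw [Real.logb, div_le_iff₀ (by linarith)]
  have := Real.log_le_sub_one_of_pos hx
  nlinarith

theorem card_bands_le : (I.bands.card : ℝ) ≤ 5 * I.z ^ 2 * (2 * I.k / I.ε) := by
  have hz := I.one_le_z
  have hk := I.one_le_k_real
  have hε := I.ε_pos
  have hε1 := I.ε_lt_one
  have h1 : (I.bands.card : ℝ) ≤ -I.bandLo + 2 := by
    have h2 : I.bands.card ≤ (1 - ⌊I.bandLo⌋).toNat := by
      refine (Finset.card_filter_le _ _).trans (le_of_eq ?_)
      rw [Int.card_Icc]; congr 1
    have h3 := Int.lt_floor_add_one I.bandLo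
    rcases le_or_gt 0 (1 - ⌊I.bandLo⌋) with h | h
    · have : ((1 - ⌊I.bandLo⌋).toNat : ℤ) = 1 - ⌊I.bandLo⌋ := Int.toNat_of_nonneg h
      have h4 : ((1 - ⌊I.bandLo⌋).toNat : ℝ) = 1 - ⌊I.bandLo⌋ := by exact_mod_cast this
      have h5 : (I.bands.card : ℝ) ≤ ((1 - ⌊I.bandLo⌋).toNat : ℝ) := by exact_mod_cast h2
      linarith
    · have h4 : (1 - ⌊I.bandLo⌋).toNat = 0 := Int.toNat_of_nonpos h.le
      rw [h4] at h2
      have h5 : I.bands.card = 0 := by omega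
      have h6 : I.bandLo ≤ 0 := by
        have : Real.logb 2 (I.ε / (4 * I.z)) ≤ 0 :=
          (Real.logb_neg one_lt_two (by positivity) (by rw [div_lt_one (by positivity)]; linarith)).le
        have : 0 ≤ Real.logb 2 (I.k : ℝ) := Real.logb_nonneg one_lt_two hk
        unfold bandLo
        nlinarith
      rw [h5]; push_cast; linarith
  have h2 : -I.bandLo ≤ I.z * (1.5 * (4 * I.z / I.ε)) + 1.5 * I.k := by
    have h3 : Real.logb 2 (I.ε / (4 * I.z)) = -Real.logb 2 (4 * I.z / I.ε) := by
      rw [← Real.logb_inv, inv_div]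
    have h4 := logb_two_le (show 0 < 4 * I.z / I.ε by positivity)
    have h5 := logb_two_le (show (0 : ℝ) < I.k by positivity)
    unfold bandLo
    rw [h3]
    have := mul_le_mul_of_nonneg_left h4 (show 0 ≤ I.z by linarith)
    linarith
  have h3 : 1 ≤ 1 / I.ε := by rw [le_div_iff₀ hε]; linarith
  set e := 1 / I.ε with he
  have h4 : I.z * (1.5 * (4 * I.z / I.ε)) = 6 * I.z ^ 2 * e := by rw [he]; ring
  have h5 : 5 * I.z ^ 2 * (2 * I.k / I.ε) = 10 * (I.z ^ 2 * (I.k * e)) := by rw [he]; ring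
  rw [h4] at h2
  rw [h5]
  have h6 : 1 ≤ I.z ^ 2 := by nlinarith
  have h7 : e ≤ I.k * e := le_mul_of_one_le_left (by linarith) hk
  have h8 : (I.k : ℝ) ≤ I.k * e := le_mul_of_one_le_right (by linarith) h3
  have h9 : I.k * e ≤ I.z ^ 2 * (I.k * e) := le_mul_of_one_le_left (by positivity) h6
  have h10 : I.z ^ 2 * e ≤ I.z ^ 2 * (I.k * e) := by gcongr
  linarith

theorem card_mainLevels_le : (I.mainLevels.card : ℝ) + 1 ≤ 5 * I.z ^ 2 * (2 * I.k / I.ε) := by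
  have hz := I.one_le_z
  have hk := I.one_le_k_real
  have hε := I.ε_pos
  have hε1 := I.ε_lt_one
  have h1 : (I.mainLevels.card : ℝ) ≤ I.mainHi - I.mainLo + 3 := by
    have h2 : I.mainLevels.card ≤ (⌈I.mainHi⌉ + 1 - ⌊I.mainLo⌋).toNat := by
      refine (Finset.card_filter_le _ _).trans (le_of_eq ?_)
      rw [Int.card_Icc]
    have h3 := Int.lt_floor_add_one I.mainLo
    have h4 := Int.ceil_lt_add_one I.mainHi
    have h5 : 0 ≤ ⌈I.mainHi⌉ + 1 - ⌊I.mainLo⌋ := by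
      have a1 : 0 ≤ ⌈I.mainHi⌉ := Int.ceil_nonneg I.mainHi_pos.le
      have a2 : ⌊I.mainLo⌋ ≤ 0 := Int.floor_nonpos I.mainLo_neg.le
      linarith
    have h6 : ((⌈I.mainHi⌉ + 1 - ⌊I.mainLo⌋).toNat : ℝ) = ⌈I.mainHi⌉ + 1 - ⌊I.mainLo⌋ := by
      exact_mod_cast Int.toNat_of_nonneg h5
    have h7 : (I.mainLevels.card : ℝ) ≤ ((⌈I.mainHi⌉ + 1 - ⌊I.mainLo⌋).toNat : ℝ) := by
      exact_mod_cast h2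
    linarith
  have h2 : I.mainHi - I.mainLo ≤ 4.5 * I.z ^ 2 * (1 / I.ε) := by
    have h3 : Real.logb 2 (I.ε / I.z) = -Real.logb 2 (I.z / I.ε) := by
      rw [← Real.logb_inv, inv_div]
    have h4 := logb_two_le (show 0 < I.z / I.ε by positivity)
    unfold mainHi mainLo
    rw [h3]
    have := mul_le_mul_of_nonneg_left h4 (show 0 ≤ 3 * I.z by linarith)
    calc _ = 3 * I.z * Real.logb 2 (I.z / I.ε) := by ring
      _ ≤ _ := this
      _ = _ := by ring
  have h3 : 1 ≤ 1 / I.ε := by rw [le_div_iff₀ hε]; linarith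
  set e := 1 / I.ε with he
  have h5 : 5 * I.z ^ 2 * (2 * I.k / I.ε) = 10 * (I.z ^ 2 * (I.k * e)) := by rw [he]; ring
  rw [h5]
  have h6 : 1 ≤ I.z ^ 2 := by nlinarith
  have h7 : e ≤ I.k * e := le_mul_of_one_le_left (by linarith) hk
  have h9 : I.k * e ≤ I.z ^ 2 * (I.k * e) := le_mul_of_one_le_left (by positivity) h6
  have h10 : I.z ^ 2 * e ≤ I.z ^ 2 * (I.k * e) := by gcongr
  linarith

theorem card_groups_le : (I.groups.card : ℝ) ≤ (5 * I.z ^ 2 * (2 * I.k / I.ε)) ^ 2 := by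
  have h1 : I.groups.card ≤ I.mainLevels.card * I.bands.card + I.bands.card := by
    refine (Finset.card_filter_le _ _).trans ((Finset.card_union_le _ _).trans ?_)
    refine Nat.add_le_add (Finset.card_image_le.trans ?_) Finset.card_image_le
    rw [Finset.card_product]
  have h2 : (I.groups.card : ℝ) ≤ (I.mainLevels.card + 1) * I.bands.card := by
    have : (I.groups.card : ℝ) ≤ I.mainLevels.card * I.bands.card + I.bands.card := by
      exact_mod_cast h1
    linarith
  rw [sq]
  exact h2.trans (mul_le_mul I.card_mainLevels_le I.card_bands_le (Nat.cast_nonneg _)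
    ((by positivity : (0 : ℝ) ≤ I.mainLevels.card + 1).trans I.card_mainLevels_le))

/-- All quantities are compared with `w = (2k/ε)^z`, which dominates `z`, `k` and `2k/ε`. There are
at most `25 w^6` groups and each fails with probability at most `26 w · w^(-40)`, while `w ≥ 2`. -/
theorem failure_le : I.groups.card * (26 * (I.k * Real.exp (-I.expo))) ≤ 1 / 10 := by
  have hz := I.one_le_z
  have hk := I.one_le_k_real
  have hε := I.ε_pos
  have h2 := I.two_le_ratio
  set Y := 2 * (I.k : ℝ) / I.ε with hY
  have hY0 : 0 < Y := by linarith
  set w := Real.exp (I.z * Real.log Y) with hw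
  have hwY : w = Y ^ I.z := by rw [hw, Real.rpow_def_of_pos hY0, mul_comm]
  have e1 : Real.exp (-I.expo) = (w ^ 40)⁻¹ := by
    rw [hw, ← Real.exp_nat_mul, ← Real.exp_neg]
    congr 1
    unfold expo
    push_cast
    ring
  have w1 : Y ≤ w := by
    rw [hwY]
    calc Y = Y ^ (1 : ℝ) := (Real.rpow_one _).symm
      _ ≤ _ := Real.rpow_le_rpow_of_exponent_le (by linarith) hz
  have w2 : I.z ≤ w := by
    rw [hwY]
    exact I.z_le_two_rpow.1.trans (Real.rpow_le_rpow zero_le_two h2 (by linarith))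
  have w0 : 2 ≤ w := h2.trans w1
  have hkY : (I.k : ℝ) ≤ w := by
    refine le_trans ?_ w1
    rw [hY, le_div_iff₀ hε]
    nlinarith [I.ε_lt_one]
  rw [e1]
  have h3 : (I.groups.card : ℝ) ≤ (5 * w ^ 2 * w) ^ 2 := by
    refine I.card_groups_le.trans ?_
    gcongr
  calc I.groups.card * (26 * (I.k * (w ^ 40)⁻¹)) ≤
      (5 * w ^ 2 * w) ^ 2 * (26 * (w * (w ^ 40)⁻¹)) := by gcongr
    _ = 650 * (w ^ 33)⁻¹ := by field_simp; norm_num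
    _ ≤ 650 * (2 ^ 33)⁻¹ := by gcongr
    _ ≤ _ := by norm_num

theorem group_nonempty (g : {g // g ∈ I.groups}) : (I.group g.1).Nonempty :=
  (Finset.mem_filter.1 g.2).2

theorem weight_nonneg (m : Label → ℕ) (ω : I.Slot m → Fin I.n) : 0 ≤ I.weight m ω :=
  Finset.prod_nonneg fun _ _ => I.sampleProb_nonneg _ _

theorem sum_weight (m : Label → ℕ) : ∑ ω, I.weight m ω = 1 := by
  have h := Finset.prod_univ_sum (fun _ : I.Slot m => (Finset.univ : Finset (Fin I.n)))
    fun s p => I.sampleProb s.1.1 p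
  rw [Fintype.piFinset_univ] at h
  unfold weight
  rw [← h]
  exact Finset.prod_eq_one fun s _ => I.sum_sampleProb (I.group_nonempty s.1)

/-- With probability at least `0.9` the output is a coreset. -/
theorem prob_isCoreset {c : ℝ} (hc : 1 ≤ c) (happ : I.IsApprox c) :
    9 / 10 ≤ I.prob (I.quota 1 30) (fun S => I.IsCoreset (40000 * c * I.ε) S) := by
  set m := I.quota 1 30 with hm
  let Bad : {g // g ∈ I.groups} → (I.Slot m → Fin I.n) → Prop := fun g ω =>
    ¬ I.Good g.1 fun l : Fin (m g.1) => ω ⟨g, l⟩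
  have h1 : ∀ g : {g // g ∈ I.groups}, pr (I.weight m) (Bad g) ≤
      26 * (I.k * Real.exp (-I.expo)) := by
    intro g
    have := pr_block (γ := {g // g ∈ I.groups}) (ι := fun g => Fin (m g.1))
      (q := fun g => I.sampleProb g.1) (fun g => I.sum_sampleProb (I.group_nonempty g))
      (fun g x => ¬ I.Good g.1 x) g
    exact (le_of_eq this).trans (I.pr_not_good_le (I.group_nonempty g))
  have h2 : pr (I.weight m) (fun ω => ∃ g ∈ Finset.univ, Bad g ω) ≤ 1 / 10 := by
    refine (pr_exists_le (I.weight_nonneg m) _ _).trans ?_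
    refine (Finset.sum_le_card_nsmul _ _ _ fun g _ => h1 g).trans ?_
    rw [nsmul_eq_mul, Finset.card_univ, Fintype.card_coe]
    exact I.failure_le
  have h3 := pr_add_pr_not (W := I.weight m) (E := fun ω => ∃ g ∈ Finset.univ, Bad g ω)
  rw [I.sum_weight] at h3
  have h4 : pr (I.weight m) (fun ω => ¬ ∃ g ∈ Finset.univ, Bad g ω) ≤
      pr (I.weight m) (fun ω => I.IsCoreset (40000 * c * I.ε) (I.output m ω)) := by
    refine pr_mono_of_ne (I.weight_nonneg m) fun ω hω hgood => ?_
    simp only [Bad, Finset.mem_univ, true_and, not_exists, not_not] at hgood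
    refine I.isCoreset_of_good (fun g _ => I.quota_pos g) (fun s => ?_) hgood hc happ
    refine I.mem_group_of_sampleProb_ne fun h => hω ?_
    exact Finset.prod_eq_zero (Finset.mem_univ s) h
  have h5 : pr (I.weight m) (fun ω => I.IsCoreset (40000 * c * I.ε) (I.output m ω)) =
      I.prob m (fun S => I.IsCoreset (40000 * c * I.ε) S) := rfl
  linarith

theorem card_output_le (ω : I.Slot (I.quota 1 30) → Fin I.n) :
    ((I.output (I.quota 1 30) ω).card : ℝ) ≤
      (I.k : ℝ) + (2 : ℝ) ^ (((30 : ℕ) : ℝ) * I.z) * ∑ g ∈ I.groups, (I.Γ 1 g : ℝ) := by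
  have h : (I.output (I.quota 1 30) ω).card = I.k + ∑ g ∈ I.groups, I.quota 1 30 g := by
    simp only [output, Multiset.card_add, Multiset.card_map, Finset.card_val, Finset.card_univ,
      Fintype.card_fin, Fintype.card_sigma]
    rw [Finset.sum_coe_sort I.groups fun g => I.quota 1 30 g]
  rw [h, Nat.cast_add, Nat.cast_sum, Finset.mul_sum]
  gcongr with g
  unfold quota
  rw [Nat.cast_mul]
  gcongr
  exact Nat.floor_le (by positivity)

end Setup

end
end KZCoreset

/-! ### Program logic for the real RAM -/

namespace KZCoreset
noncomputable section

section Machine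

variable {o : Oracle} {ω : ℕ → ℝ}

/-- Value of an integer expression. -/
def iv (o : Oracle) (s : Mem) (e : Exp .int) : ℤ := e.eval o s

/-- Value of a real expression. -/
def rv (o : Oracle) (s : Mem) (e : Exp .real) : ℝ := e.eval o s

section Eval
variable (o : Oracle) (s : Mem)

@[simp] theorem iv_const (c : ℤ) : iv o s (.const c) = c := rfl
@[simp] theorem iv_geti (a : ℕ) (i : Exp .int) : iv o s (.geti a i) = s.ints a (iv o s i) := rfl
@[simp] theorem iv_addi (x y : Exp .int) : iv o s (.addi x y) = iv o s x + iv o s y := rfl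
@[simp] theorem iv_subi (x y : Exp .int) : iv o s (.subi x y) = iv o s x - iv o s y := rfl
@[simp] theorem iv_muli (x y : Exp .int) : iv o s (.muli x y) = iv o s x * iv o s y := rfl
@[simp] theorem iv_floor (x : Exp .real) : iv o s (.floor x) = ⌊rv o s x⌋ := rfl
@[simp] theorem iv_quotaMain (j b : Exp .int) :
    iv o s (.quotaMain j b) = (o.quota (.main (iv o s j) (iv o s b)) : ℤ) := rfl
@[simp] theorem iv_quotaOuter (b : Exp .int) :
    iv o s (.quotaOuter b) = (o.quota (.outer (iv o s b)) : ℤ) := rfl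
@[simp] theorem rv_cast (x : Exp .int) : rv o s (.cast x) = (iv o s x : ℝ) := rfl
@[simp] theorem rv_getr (a : ℕ) (i : Exp .int) : rv o s (.getr a i) = s.reals a (iv o s i) := rfl
@[simp] theorem rv_addr (x y : Exp .real) : rv o s (.addr x y) = rv o s x + rv o s y := rfl
@[simp] theorem rv_subr (x y : Exp .real) : rv o s (.subr x y) = rv o s x - rv o s y := rfl
@[simp] theorem rv_mulr (x y : Exp .real) : rv o s (.mulr x y) = rv o s x * rv o s y := rfl
@[simp] theorem rv_divr (x y : Exp .real) : rv o s (.divr x y) = rv o s x / rv o s y := rfl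
@[simp] theorem rv_powr (x y : Exp .real) : rv o s (.powr x y) = rv o s x ^ rv o s y := rfl
@[simp] theorem rv_logr (x : Exp .real) : rv o s (.logr x) = Real.log (rv o s x) := rfl
@[simp] theorem rv_dist (x y : Exp .int) : rv o s (.dist x y) = o.dist (iv o s x) (iv o s y) := rfl
@[simp] theorem holds_lti (x y : Exp .int) :
    (Test.lti x y).holds o s ↔ iv o s x < iv o s y := Iff.rfl
@[simp] theorem holds_ltr (x y : Exp .real) :
    (Test.ltr x y).holds o s ↔ rv o s x < rv o s y := Iff.rfl
@[simp] theorem holds_not (t : Test) : (Test.not t).holds o s ↔ ¬ t.holds o s := Iff.rfl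
@[simp] theorem holds_and (t u : Test) :
    (Test.and t u).holds o s ↔ t.holds o s ∧ u.holds o s := Iff.rfl

end Eval

theorem upd_apply {α : Type} (f : ℕ → ℤ → α) (a : ℕ) (i : ℤ) (x : α) (b : ℕ) (j : ℤ) :
    upd f a i x b j = if b = a ∧ j = i then x else f b j := by
  unfold upd
  by_cases h : b = a
  · subst h
    by_cases h2 : j = i <;> simp [h2]
  · simp [h]

theorem upd_ne {α : Type} (f : ℕ → ℤ → α) {a b : ℕ} (h : b ≠ a) (i : ℤ) (x : α) :
    upd f a i x b = f b := Function.update_of_ne h _ _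

@[simp] theorem upd_self {α : Type} (f : ℕ → ℤ → α) (a : ℕ) (i : ℤ) (x : α) :
    upd f a i x a i = x := by simp [upd_apply]

/-- The command `c`, started in `s`, halts within `t` steps in a memory satisfying `Q`. -/
def Runs (o : Oracle) (ω : ℕ → ℝ) (c : Cmd) (s : Mem) (t : ℕ) (Q : Mem → Prop) : Prop :=
  ∃ s' t', Exec o ω c s s' t' ∧ t' ≤ t ∧ Q s'

theorem Runs.mono {c : Cmd} {s : Mem} {t t' : ℕ} {Q Q' : Mem → Prop} (h : Runs o ω c s t Q)
    (ht : t ≤ t') (hQ : ∀ s', Q s' → Q' s') : Runs o ω c s t' Q' := by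
  obtain ⟨s', u, h1, h2, h3⟩ := h
  exact ⟨s', u, h1, h2.trans ht, hQ _ h3⟩

theorem runs_skip {s : Mem} {Q : Mem → Prop} (h : Q s) : Runs o ω .skip s 1 Q :=
  ⟨_, _, .skip s, le_rfl, h⟩

theorem runs_seti {s : Mem} {a : ℕ} {i x : Exp .int} {Q : Mem → Prop}
    (h : Q { s with ints := upd s.ints a (iv o s i) (iv o s x) }) :
    Runs o ω (.seti a i x) s 1 Q := ⟨_, _, .seti s a i x, le_rfl, h⟩

theorem runs_setr {s : Mem} {a : ℕ} {i : Exp .int} {x : Exp .real} {Q : Mem → Prop}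
    (h : Q { s with reals := upd s.reals a (iv o s i) (rv o s x) }) :
    Runs o ω (.setr a i x) s 1 Q := ⟨_, _, .setr s a i x, le_rfl, h⟩

theorem runs_draw {s : Mem} {a : ℕ} {i : Exp .int} {Q : Mem → Prop}
    (h : Q { s with reals := upd s.reals a (iv o s i) (ω s.pos), pos := s.pos + 1 }) :
    Runs o ω (.draw a i) s 1 Q := ⟨_, _, .draw s a i, le_rfl, h⟩

theorem runs_emit {s : Mem} {h : Exp .int} {w : Exp .real} {Q : Mem → Prop}
    (hQ : Q { s with out := (iv o s h, rv o s w) :: s.out }) :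
    Runs o ω (.emit h w) s 1 Q := ⟨_, _, .emit s h w, le_rfl, hQ⟩

theorem runs_seq {c d : Cmd} {s : Mem} {t t' : ℕ} {Q : Mem → Prop}
    (h : Runs o ω c s t fun s' => Runs o ω d s' t' Q) : Runs o ω (.seq c d) s (t + t') Q := by
  obtain ⟨s', u, h1, h2, s'', u', h3, h4, h5⟩ := h
  exact ⟨s'', _, .seq h1 h3, by omega, h5⟩

theorem runs_ite {b : Test} {c d : Cmd} {s : Mem} {t : ℕ} {Q : Mem → Prop}
    (hc : b.holds o s → Runs o ω c s t Q) (hd : ¬ b.holds o s → Runs o ω d s t Q) :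
    Runs o ω (.ite b c d) s (t + 1) Q := by
  by_cases h : b.holds o s
  · obtain ⟨s', u, h1, h2, h3⟩ := hc h
    exact ⟨s', _, .ite_true h h1, by omega, h3⟩
  · obtain ⟨s', u, h1, h2, h3⟩ := hd h
    exact ⟨s', _, .ite_false h h1, by omega, h3⟩

theorem runs_while_true {b : Test} {c : Cmd} {s : Mem} {t t' : ℕ} {Q : Mem → Prop}
    (hb : b.holds o s) (h : Runs o ω c s t fun s' => Runs o ω (.while b c) s' t' Q) :
    Runs o ω (.while b c) s (t + t' + 1) Q := by
  obtain ⟨s', u, h1, h2, s'', u', h3, h4, h5⟩ := h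
  exact ⟨s'', _, .while_true hb h1 h3, by omega, h5⟩

theorem runs_while_false {b : Test} {c : Cmd} {s : Mem} {Q : Mem → Prop}
    (hb : ¬ b.holds o s) (h : Q s) : Runs o ω (.while b c) s 1 Q :=
  ⟨s, _, .while_false hb, le_rfl, h⟩

/-- The integer arrays that a command may change. -/
def Cmd.wi : Cmd → List ℕ
  | .skip => []
  | .seti a _ _ => [a]
  | .setr _ _ _ => []
  | .draw _ _ => []
  | .emit _ _ => []
  | .seq c d => c.wi ++ d.wi
  | .ite _ c d => c.wi ++ d.wi
  | .while _ c => c.wi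

/-- The real arrays that a command may change. -/
def Cmd.wr : Cmd → List ℕ
  | .skip => []
  | .seti _ _ _ => []
  | .setr a _ _ => [a]
  | .draw a _ => [a]
  | .emit _ _ => []
  | .seq c d => c.wr ++ d.wr
  | .ite _ c d => c.wr ++ d.wr
  | .while _ c => c.wr

/-- The command contains neither random draws nor outputs. -/
def Cmd.quiet : Cmd → Bool
  | .skip => true
  | .seti _ _ _ => true
  | .setr _ _ _ => true
  | .draw _ _ => false
  | .emit _ _ => false
  | .seq c d => c.quiet && d.quiet
  | .ite _ c d => c.quiet && d.quiet
  | .while _ c => c.quiet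

/-- Two memories agree on all arrays outside the given lists. -/
structure Keeps (wi wr : List ℕ) (s s' : Mem) : Prop where
  ints : ∀ a ∉ wi, s'.ints a = s.ints a
  reals : ∀ a ∉ wr, s'.reals a = s.reals a

theorem Keeps.refl (wi wr : List ℕ) (s : Mem) : Keeps wi wr s s := ⟨fun _ _ => rfl, fun _ _ => rfl⟩

theorem Keeps.trans {wi wr : List ℕ} {s s' s'' : Mem} (h : Keeps wi wr s s')
    (h' : Keeps wi wr s' s'') : Keeps wi wr s s'' :=
  ⟨fun a ha => (h'.ints a ha).trans (h.ints a ha), fun a ha => (h'.reals a ha).trans (h.reals a ha)⟩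

theorem Keeps.mono {wi wr wi' wr' : List ℕ} {s s' : Mem} (h : Keeps wi wr s s') (hi : wi ⊆ wi')
    (hr : wr ⊆ wr') : Keeps wi' wr' s s' :=
  ⟨fun a ha => h.ints a fun h => ha (hi h), fun a ha => h.reals a fun h => ha (hr h)⟩

theorem Exec.keeps {c : Cmd} {s s' : Mem} {t : ℕ} (h : Exec o ω c s s' t) :
    Keeps c.wi c.wr s s' := by
  induction h with
  | skip s => exact .refl _ _ _
  | seti s a i x => exact ⟨fun b hb => upd_ne _ (by simpa [Cmd.wi] using hb) _ _, fun _ _ => rfl⟩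
  | setr s a i x => exact ⟨fun _ _ => rfl, fun b hb => upd_ne _ (by simpa [Cmd.wr] using hb) _ _⟩
  | draw s a i => exact ⟨fun _ _ => rfl, fun b hb => upd_ne _ (by simpa [Cmd.wr] using hb) _ _⟩
  | emit s h w => exact ⟨fun _ _ => rfl, fun _ _ => rfl⟩
  | seq _ _ h1 h2 =>
    exact (h1.mono (List.subset_append_left _ _) (List.subset_append_left _ _)).trans
      (h2.mono (List.subset_append_right _ _) (List.subset_append_right _ _))
  | ite_true _ _ h => exact h.mono (List.subset_append_left _ _) (List.subset_append_left _ _)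
  | ite_false _ _ h => exact h.mono (List.subset_append_right _ _) (List.subset_append_right _ _)
  | while_true _ _ _ h1 h2 => exact Keeps.trans h1 h2
  | while_false _ => exact .refl _ _ _

theorem Exec.out_eq {c : Cmd} {s s' : Mem} {t : ℕ} (h : Exec o ω c s s' t) (hc : c.quiet = true) :
    s'.out = s.out ∧ s'.pos = s.pos := by
  induction h with
  | skip s => exact ⟨rfl, rfl⟩
  | seti s a i x => exact ⟨rfl, rfl⟩
  | setr s a i x => exact ⟨rfl, rfl⟩
  | draw s a i => simp [Cmd.quiet] at hc
  | emit s h w => simp [Cmd.quiet] at hc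
  | seq _ _ h1 h2 =>
    simp only [Cmd.quiet, Bool.and_eq_true] at hc
    exact ⟨(h2 hc.2).1.trans (h1 hc.1).1, (h2 hc.2).2.trans (h1 hc.1).2⟩
  | ite_true _ _ h =>
    simp only [Cmd.quiet, Bool.and_eq_true] at hc
    exact h hc.1
  | ite_false _ _ h =>
    simp only [Cmd.quiet, Bool.and_eq_true] at hc
    exact h hc.2
  | while_true _ _ _ h1 h2 => exact ⟨(h2 hc).1.trans (h1 hc).1, (h2 hc).2.trans (h1 hc).2⟩
  | while_false _ => exact ⟨rfl, rfl⟩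

theorem Runs.keeps {c : Cmd} {s : Mem} {t : ℕ} {Q : Mem → Prop} (h : Runs o ω c s t Q) :
    Runs o ω c s t fun s' => Q s' ∧ Keeps c.wi c.wr s s' := by
  obtain ⟨s', u, h1, h2, h3⟩ := h
  exact ⟨s', u, h1, h2, h3, h1.keeps⟩

/-- The frame rule: which arrays, output and tape position survive is read off the syntax, so each
specification needs to mention only what its command computes. -/
theorem Runs.quiet {c : Cmd} {s : Mem} {t : ℕ} {Q : Mem → Prop} (h : Runs o ω c s t Q)
    (hc : c.quiet = true) :
    Runs o ω c s t fun s' => Q s' ∧ Keeps c.wi c.wr s s' ∧ s'.out = s.out ∧ s'.pos = s.pos := by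
  obtain ⟨s', u, h1, h2, h3⟩ := h
  exact ⟨s', u, h1, h2, h3, h1.keeps, h1.out_eq hc⟩

/-- Executions are deterministic. -/
theorem Exec.unique {c : Cmd} {s s₁ s₂ : Mem} {t₁ t₂ : ℕ} (h₁ : Exec o ω c s s₁ t₁)
    (h₂ : Exec o ω c s s₂ t₂) : s₁ = s₂ := by
  induction h₁ generalizing s₂ t₂ with
  | skip s => cases h₂; rfl
  | seti s a i x => cases h₂; rfl
  | setr s a i x => cases h₂; rfl
  | draw s a i => cases h₂; rfl
  | emit s h w => cases h₂; rfl
  | seq _ _ ih1 ih2 =>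
    cases h₂ with
    | seq h1 h2 =>
      have := ih1 h1
      subst this
      exact ih2 h2
  | ite_true hb _ ih =>
    cases h₂ with
    | ite_true _ h => exact ih h
    | ite_false hb' _ => exact absurd hb hb'
  | ite_false hb _ ih =>
    cases h₂ with
    | ite_true hb' _ => exact absurd hb' hb
    | ite_false _ h => exact ih h
  | while_true hb _ _ ih1 ih2 =>
    cases h₂ with
    | while_true _ h1 h2 =>
      have := ih1 h1
      subst this
      exact ih2 h2
    | while_false hb' => exact absurd hb hb'
  | while_false hb =>
    cases h₂ with
    | while_true hb' _ _ => exact absurd hb' hb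
    | while_false _ => rfl

/-- The scalar stored at the head of an integer array. -/
abbrev ivar (a : ℕ) : Exp .int := .geti a (.const 0)

/-- The scalar stored at the head of a real array. -/
abbrev rvar (a : ℕ) : Exp .real := .getr a (.const 0)

/-- The integer assignment `a[0] := x`. -/
abbrev setv (a : ℕ) (x : Exp .int) : Cmd := .seti a (.const 0) x

/-- The loop `for v = 0, …, N - 1 do body`. -/
def Cmd.for (v : ℕ) (N : Exp .int) (body : Cmd) : Cmd :=
  .seq (setv v (.const 0))
    (.while (.lti (ivar v) N) (.seq body (setv v (.addi (ivar v) (.const 1)))))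

/-- Induction on the number of remaining rounds. The invariant must ignore the loop variable, and
the bound `N` has one value in all reachable memories. Each round adds a test and an increment, and
`2` counts the initial assignment and the last test. -/
theorem runs_for {v : ℕ} {N : Exp .int} {body : Cmd} {s₀ : Mem} (n : ℕ) (hv : v ∉ body.wi)
    (Inv : ℕ → Mem → Prop) (τ : ℕ → ℕ)
    (hInv : ∀ q s x, Inv q s → Inv q { s with ints := upd s.ints v 0 x })
    (hN : ∀ s, Keeps (v :: body.wi) body.wr s₀ s → iv o s N = n) (h0 : Inv 0 s₀)
    (hbody : ∀ q < n, ∀ s, Inv q s → s.ints v 0 = q → Keeps (v :: body.wi) body.wr s₀ s →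
      Runs o ω body s (τ q) (Inv (q + 1))) :
    Runs o ω (.for v N body) s₀ (2 + ∑ q ∈ Finset.range n, (τ q + 2)) (Inv n) := by
  have key : ∀ d q s, q + d = n → Inv q s → s.ints v 0 = q →
      Keeps (v :: body.wi) body.wr s₀ s →
      Runs o ω (.while (.lti (ivar v) N) (.seq body (setv v (.addi (ivar v) (.const 1))))) s
        (1 + ∑ j ∈ Finset.range d, (τ (q + j) + 2)) (Inv n) := by
    intro d
    induction d with
    | zero =>
      intro q s hq h1 h2 h3
      have hq' : q = n := by omega
      subst hq'
      refine (runs_while_false ?_ h1).mono (by simp) fun _ h => h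
      simp [hN s h3, h2]
    | succ d ih =>
      intro q s hq h1 h2 h3
      have ht : 1 + ∑ j ∈ Finset.range (d + 1), (τ (q + j) + 2) =
          (τ q + 1) + (1 + ∑ j ∈ Finset.range d, (τ (q + 1 + j) + 2)) + 1 := by
        rw [Finset.sum_range_succ', add_zero]
        have e : ∑ j ∈ Finset.range d, (τ (q + (j + 1)) + 2) =
            ∑ j ∈ Finset.range d, (τ (q + 1 + j) + 2) :=
          Finset.sum_congr rfl fun j _ => by rw [show q + (j + 1) = q + 1 + j by omega]
        omega
      rw [ht]
      refine runs_while_true ?_ (runs_seq ?_)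
      · simp only [holds_lti, iv_geti, iv_const, hN s h3, h2]
        omega
      · refine (hbody q (by omega) s h1 h2 h3).keeps.mono le_rfl ?_
        rintro s' ⟨h4, h5⟩
        refine runs_seti (ih (q + 1) _ (by omega) (hInv _ _ _ h4) ?_ ?_)
        · simp only [iv_const, iv_addi, iv_geti, upd_self]
          rw [h5.ints v hv, h2]
          push_cast
          rfl
        · refine h3.trans ((h5.mono (List.subset_cons_self _ _) (List.Subset.refl _)).trans
            ⟨fun a ha => upd_ne _ ?_ _ _, fun _ _ => rfl⟩)
          rintro rfl
          exact ha List.mem_cons_self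
  rw [show 2 + ∑ q ∈ Finset.range n, (τ q + 2) =
    1 + (1 + ∑ j ∈ Finset.range n, (τ (0 + j) + 2)) by simp only [zero_add]; omega]
  refine runs_seq (runs_seti (key n 0 _ (by omega) (hInv _ _ _ h0) (by simp) ?_))
  refine ⟨fun a ha => upd_ne _ ?_ _ _, fun _ _ => rfl⟩
  rintro rfl
  exact ha List.mem_cons_self

/-- The sum of the first terms of a sequence indexed by `Fin n`. -/
def sumLt {n : ℕ} {M : Type*} [AddCommMonoid M] (f : Fin n → M) (q : ℕ) : M :=
  ∑ p, if p.val < q then f p else 0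

@[simp] theorem sumLt_zero {n : ℕ} {M : Type*} [AddCommMonoid M] (f : Fin n → M) :
    sumLt f 0 = 0 := by simp [sumLt]

theorem sumLt_all {n : ℕ} {M : Type*} [AddCommMonoid M] (f : Fin n → M) :
    sumLt f n = ∑ p, f p := by simp [sumLt]

theorem sumLt_succ {n : ℕ} {M : Type*} [AddCommMonoid M] (f : Fin n → M) (p : Fin n) :
    sumLt f (p.val + 1) = sumLt f p.val + f p := by
  unfold sumLt
  have h : ∀ r : Fin n, (if r.val < p.val + 1 then f r else 0) =
      (if r.val < p.val then f r else 0) + if r = p then f p else 0 := by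
    intro r
    rcases lt_trichotomy r p with h | h | h
    · have h' : r.val < p.val := h
      simp [h', h.ne, h'.trans (Nat.lt_succ_self _)]
    · simp [h]
    · have h' : p.val < r.val := h
      simp [h.ne', not_lt.2 h'.le, show ¬ r.val < p.val + 1 by omega]
  simp only [h, Finset.sum_add_distrib]
  simp

theorem sumLt_mono {n : ℕ} {f : Fin n → ℤ} (hf : ∀ p, 0 ≤ f p) {q q' : ℕ} (h : q ≤ q') :
    sumLt f q ≤ sumLt f q' := by
  refine Finset.sum_le_sum fun p _ => ?_
  have := hf p
  split_ifs <;> omega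

end Machine

end
end KZCoreset

/-! ### Program: nearest centers, bounds and levels -/

namespace KZCoreset
noncomputable section

section Program

/-- The number of points. -/
abbrev eN : Exp .int := .geti 0 (.const 0)
/-- The number of centers. -/
abbrev eK : Exp .int := .geti 0 (.const 1)
/-- The exponent. -/
abbrev eZ : Exp .real := .getr 0 (.const 0)
/-- The precision. -/
abbrev eE : Exp .real := .getr 0 (.const 1)
/-- An integer as a real constant. -/
abbrev rconst (c : ℤ) : Exp .real := .cast (.const c)
/-- The binary logarithm. -/
abbrev eLog (x : Exp .real) : Exp .real := .divr (.logr x) (.logr (rconst 2))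
/-- The cluster of the current point. -/
abbrev eSig : Exp .int := .geti 3 (ivar 1)
/-- The cost of the current point. -/
abbrev eDz : Exp .real := .getr 2 (ivar 1)
/-- The level of the current point. -/
abbrev eLvl : Exp .int := .geti 4 (ivar 1)
/-- The band of the current point. -/
abbrev eBand : Exp .int := .geti 5 (ivar 1)

/-- Find the nearest center of the current point. -/
def cNearest : Cmd :=
  .seq (.seti 3 (ivar 1) (.const 0)) <|
  .seq (.setr 1 (.const 0) (.dist (ivar 1) eN)) <|
  .for 2 eK <|
    .ite (.ltr (.dist (ivar 1) (.addi eN (ivar 2))) (rvar 1))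
      (.seq (.setr 1 (.const 0) (.dist (ivar 1) (.addi eN (ivar 2)))) (.seti 3 (ivar 1) (ivar 2)))
      .skip

/-- Compute the clusters and their costs. -/
def cAssign : Cmd :=
  .for 1 eN <|
    -- Integer arrays: `1` the current point, `3` clusters, `17` cluster sizes. Real arrays: `2`
    -- point costs, `3` cluster costs.
    .seq cNearest <|
    .seq (.setr 2 (ivar 1) (.powr (rvar 1) eZ)) <|
    .seq (.setr 3 eSig (.addr (.getr 3 eSig) eDz)) <|
    .seti 17 eSig (.addi (.geti 17 eSig) (.const 1))

/-- Compute the bounds for levels and bands. -/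
def cBounds : Cmd :=
  -- The ceiling is computed as `⌈x⌉ = -⌊-x⌋`.
  .seq (.seti 6 (.const 0) (.subi (.const 0) (.floor (.subr (rconst 0)
    (.mulr (.mulr (rconst 2) eZ) (eLog (.divr eZ eE))))))) <|
  .seq (.setr 4 (.const 0) (.mulr eZ (eLog (.divr eE eZ)))) <|
  .seq (.setr 5 (.const 0) (.subr (.mulr eZ (eLog (.divr eE (.mulr (rconst 4) eZ))))
    (eLog (.cast eK)))) <|
  .seti 7 (.const 0) (.addi (.floor (.subr (rconst 0) (rvar 5))) (.const 1))

/-- The index of the ring of the current point. -/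
abbrev eCell : Exp .int := .addi eSig (.muli eK eLvl)

/-- Compute the levels and the costs of rings and levels. -/
def cLevels : Cmd :=
  .for 1 eN <|
    .seq (.seti 4 (ivar 1) (.floor (eLog (.divr eDz (.divr (.getr 3 eSig) (.cast (.geti 17 eSig))))))) <|
    .seq (.ite (.lti (ivar 6) eLvl) (.seti 4 (ivar 1) (ivar 6)) .skip) <|
    .seq (.setr 6 eCell (.addr (.getr 6 eCell) eDz)) <|
    .setr 7 eLvl (.addr (.getr 7 eLvl) eDz)

end Program

namespace Setup
open scoped Classical
variable {X : Type*} [MetricSpace X] (I : Setup X) {m : Label → ℕ} {ω : ℕ → ℝ}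

theorem pointAt_point (p : Fin I.n) : I.pointAt (p.val : ℤ) = some (I.P p) := by
  unfold pointAt
  rw [dif_pos ⟨by omega, by simp⟩]
  rfl

theorem pointAt_center (i : Fin I.k) : I.pointAt ((I.n : ℤ) + i.val) = some (I.A i) := by
  have h : ((I.n : ℤ) + i.val - I.n).toNat = i.val := by omega
  unfold pointAt
  rw [dif_neg (by rintro ⟨-, h⟩; omega), dif_pos ⟨by omega, by rw [h]; exact i.2⟩]
  simp

theorem oracle_dist (p : Fin I.n) (i : Fin I.k) :
    (I.oracle m).dist (p.val : ℤ) ((I.n : ℤ) + i.val) = dist (I.P p) (I.A i) := by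
  simp only [oracle, pointAt_point, pointAt_center]

/-- The input is in its place. -/
structure Input (s : Mem) : Prop where
  n : s.ints 0 0 = I.n
  k : s.ints 0 1 = I.k
  z : s.reals 0 0 = I.z
  ε : s.reals 0 1 = I.ε

variable {I}

theorem Input.keeps {s s' : Mem} {wi wr : List ℕ} (h : I.Input s) (hk : Keeps wi wr s s')
    (hi : 0 ∉ wi) (hr : 0 ∉ wr) : I.Input s' := by
  obtain ⟨h1, h2, h3, h4⟩ := h
  refine ⟨?_, ?_, ?_, ?_⟩
  · rw [hk.ints 0 hi, h1]
  · rw [hk.ints 0 hi, h2]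
  · rw [hk.reals 0 hr, h3]
  · rw [hk.reals 0 hr, h4]

theorem runs_nearest (hties : I.TiesToFirst) {s : Mem} (hI : I.Input s) {p : Fin I.n}
    (hp : s.ints 1 0 = p.val) :
    Runs (I.oracle m) ω cNearest s (4 + 5 * I.k) fun s' => s'.ints 3 p.val = (I.σ p).val ∧
      s'.reals 1 0 = dist (I.P p) (I.A (I.σ p)) ∧ ∀ j : ℤ, j ≠ p.val → s'.ints 3 j = s.ints 3 j := by
  set s₁ : Mem := { s with
    ints := upd s.ints 3 p.val 0
    reals := upd s.reals 1 0 (dist (I.P p) (I.A ⟨0, I.one_le_k⟩)) } with hs₁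
  have hI₁ : s₁.ints 0 0 = I.n ∧ s₁.ints 0 1 = I.k ∧ s₁.ints 1 0 = p.val := by
    simp [hs₁, upd_apply, hI.n, hI.k, hp]
  have hloop := runs_for (o := I.oracle m) (ω := ω) (v := 2) (N := eK) (s₀ := s₁)
    (body := .ite (.ltr (.dist (ivar 1) (.addi eN (ivar 2))) (rvar 1))
      (.seq (.setr 1 (.const 0) (.dist (ivar 1) (.addi eN (ivar 2)))) (.seti 3 (ivar 1) (ivar 2)))
      .skip) I.k (by simp [Cmd.wi])
    -- The best center so far is strictly better than all centers of smaller index; this strictness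
    -- is what identifies it with `σ p` when ties go to the smallest index.
    (fun i t => ∃ c : Fin I.k, t.ints 3 p.val = c.val ∧ t.reals 1 0 = dist (I.P p) (I.A c) ∧
      (∀ j : Fin I.k, j.val < i → dist (I.P p) (I.A c) ≤ dist (I.P p) (I.A j)) ∧
      (∀ j : Fin I.k, j < c → dist (I.P p) (I.A c) < dist (I.P p) (I.A j)) ∧ c.val < max i 1 ∧
      ∀ j : ℤ, j ≠ p.val → t.ints 3 j = s.ints 3 j) (fun _ => 3)
    (fun q t x h => by simpa only [upd_ne _ (show 3 ≠ 2 by norm_num)] using h)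
    (fun t ht => by
      simp only [iv_geti, iv_const]
      rw [ht.ints 0 (by simp [Cmd.wi])]
      exact hI₁.2.1)
    ⟨⟨0, I.one_le_k⟩, by simp [hs₁], by simp [hs₁], by simp,
      fun j hj => absurd hj (by simp [Fin.lt_def]), by simp,
      fun j hj => by simp [hs₁, upd_apply, hj]⟩
    (by
      rintro q hq t ⟨c, h1, h2, h3, h4, h5, h6⟩ h7 h8
      have e0 : t.ints 0 0 = I.n := by rw [h8.ints 0 (by simp [Cmd.wi])]; exact hI₁.1
      have e1 : t.ints 1 0 = p.val := by rw [h8.ints 1 (by simp [Cmd.wi])]; exact hI₁.2.2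
      have ed : (I.oracle m).dist (t.ints 1 0) (t.ints 0 0 + t.ints 2 0) =
          dist (I.P p) (I.A ⟨q, hq⟩) := by
        rw [e0, e1, h7]; exact I.oracle_dist p ⟨q, hq⟩
      refine runs_ite (t := 2) (fun hb => ?_) (fun hb => ?_)
      · simp only [holds_ltr, rv_dist, rv_getr, iv_addi, iv_geti, iv_const, ed, h2] at hb
        refine runs_seq (t := 1) (t' := 1) (runs_setr (runs_seti ?_))
        refine ⟨⟨q, hq⟩, ?_, ?_, ?_, ?_, ?_, ?_⟩
        · simp [e1, h7]
        · simp [ed]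
        · intro j hj
          rcases Nat.lt_succ_iff_lt_or_eq.1 hj with hj | hj
          · exact hb.le.trans (h3 j hj)
          · subst hj; exact le_rfl
        · intro j hj
          exact hb.trans_le (h3 j hj)
        · simp
        · intro j hj
          simp [upd_apply, e1, hj, h6 j hj]
      · simp only [holds_ltr, rv_dist, rv_getr, iv_addi, iv_geti, iv_const, ed, h2, not_lt] at hb
        refine (runs_skip ?_).mono (by norm_num) fun _ h => h
        refine ⟨c, h1, h2, ?_, h4, by omega, h6⟩
        intro j hj
        rcases Nat.lt_succ_iff_lt_or_eq.1 hj with hj | hj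
        · exact h3 j hj
        · subst hj; exact hb)
  rw [show 4 + 5 * I.k = 1 + (1 + (2 + ∑ q ∈ Finset.range I.k, (3 + 2))) by simp; ring]
  refine runs_seq (runs_seti (runs_seq (runs_setr ?_)))
  have e : ({ s with
      ints := upd s.ints 3 (iv (I.oracle m) s (ivar 1)) (iv (I.oracle m) s (.const 0)) } : Mem) =
      { s with ints := upd s.ints 3 p.val 0 } := by simp [hp]
  rw [e]
  have e2 : rv (I.oracle m) { s with ints := upd s.ints 3 p.val 0 } (.dist (ivar 1) eN) =
      dist (I.P p) (I.A ⟨0, I.one_le_k⟩) := by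
    have := I.oracle_dist (m := m) p ⟨0, I.one_le_k⟩
    simp only [Nat.cast_zero, add_zero] at this
    simp [upd_apply, hp, hI.n, this]
  rw [e2]
  refine hloop.mono le_rfl ?_
  rintro t ⟨c, h1, h2, h3, h4, -, h6⟩
  have hc : c = I.σ p := by
    rcases lt_trichotomy c (I.σ p) with h | h | h
    · exact absurd (h3 (I.σ p) (I.σ p).2) (not_le.2 (hties p c h))
    · exact h
    · exact absurd (I.nearest p c) (not_le.2 (h4 _ h))
  rw [← hc]
  exact ⟨h1, h2, h6⟩

variable (I)

/-- Clusters, costs and the costs and sizes of clusters have been computed for the first points. -/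
structure Assigned (q : ℕ) (s : Mem) : Prop where
  sig : ∀ p : Fin I.n, p.val < q → s.ints 3 p.val = (I.σ p).val
  dz : ∀ p : Fin I.n, p.val < q → s.reals 2 p.val = I.dz p I.A
  cost : ∀ i : Fin I.k, s.reals 3 i.val = sumLt (fun p => if I.σ p = i then I.dz p I.A else 0) q
  size : ∀ i : Fin I.k, s.ints 17 i.val = sumLt (fun p => if I.σ p = i then (1 : ℤ) else 0) q

variable {I}

theorem Assigned.keeps {q : ℕ} {s s' : Mem} {wi wr : List ℕ} (h : I.Assigned q s)
    (hk : Keeps wi wr s s') (hi : 3 ∉ wi ∧ 17 ∉ wi) (hr : 2 ∉ wr ∧ 3 ∉ wr) : I.Assigned q s' := by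
  obtain ⟨h1, h2, h3, h4⟩ := h
  refine ⟨fun p hp => ?_, fun p hp => ?_, fun i => ?_, fun i => ?_⟩
  · rw [hk.ints 3 hi.1, h1 p hp]
  · rw [hk.reals 2 hr.1, h2 p hp]
  · rw [hk.reals 3 hr.2, h3 i]
  · rw [hk.ints 17 hi.2, h4 i]

theorem forall_lt_succ_iff {n : ℕ} {q : Fin n} {φ : Fin n → Prop} :
    (∀ p : Fin n, p.val < q.val + 1 → φ p) ↔ (∀ p : Fin n, p.val < q.val → φ p) ∧ φ q := by
  constructor
  · intro h
    exact ⟨fun p hp => h p (by omega), h q (by omega)⟩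
  · rintro ⟨h1, h2⟩ p hp
    rcases Nat.lt_succ_iff_lt_or_eq.1 hp with hp | hp
    · exact h1 p hp
    · rwa [Fin.ext hp]

theorem runs_assign (hties : I.TiesToFirst) {s : Mem} (hI : I.Input s)
    (h0 : ∀ j, s.reals 3 j = 0 ∧ s.ints 17 j = 0) :
    Runs (I.oracle m) ω cAssign s (2 + I.n * (9 + 5 * I.k)) (I.Assigned I.n) := by
  refine Runs.mono (runs_for (v := 1) I.n (by simp [Cmd.wi, cNearest, Cmd.for])
    I.Assigned (fun _ => 7 + 5 * I.k) ?_ ?_ ?_ ?_) (le_of_eq ?_) fun _ h => h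
  · intro q s x h
    exact h.keeps (wi := [1]) (wr := []) ⟨fun a ha => upd_ne _ (by simpa using ha) _ _,
      fun _ _ => rfl⟩ (by simp) (by simp)
  · intro t ht
    simp only [iv_geti, iv_const]
    rw [ht.ints 0 (by simp [Cmd.wi, cNearest, Cmd.for])]
    exact hI.n
  · exact ⟨fun p hp => absurd hp (by simp), fun p hp => absurd hp (by simp),
      fun i => by simp [(h0 i).1], fun i => by simp [(h0 i).2]⟩
  · intro q hq t h1 h2 h3
    have hIt : I.Input t := hI.keeps h3 (by simp [Cmd.wi, cNearest, Cmd.for])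
      (by simp [Cmd.wr, cNearest, Cmd.for])
    lift q to Fin I.n using hq
    rw [show 7 + 5 * I.k = (4 + 5 * I.k) + (1 + (1 + 1)) by ring]
    refine runs_seq ((runs_nearest hties hIt h2).keeps.mono le_rfl ?_)
    rintro t' ⟨⟨h4, h5, h6⟩, h7⟩
    have hIt' : I.Input t' := hIt.keeps h7 (by simp [Cmd.wi, cNearest, Cmd.for])
      (by simp [Cmd.wr, cNearest, Cmd.for])
    have e1 : t'.ints 1 0 = q.val := by
      rw [h7.ints 1 (by simp [Cmd.wi, cNearest, Cmd.for]), h2]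
    have er2 : t'.reals 2 = t.reals 2 := h7.reals 2 (by simp [Cmd.wr, cNearest, Cmd.for])
    have er3 : t'.reals 3 = t.reals 3 := h7.reals 3 (by simp [Cmd.wr, cNearest, Cmd.for])
    have ei17 : t'.ints 17 = t.ints 17 := h7.ints 17 (by simp [Cmd.wi, cNearest, Cmd.for])
    have edz : t'.reals 1 0 ^ t'.reals 0 0 = I.dz q I.A := by
      rw [h5, hIt'.z, I.dist_center_rpow]
    refine runs_seq (runs_setr (runs_seq (runs_setr (runs_seti ?_))))
    refine ⟨forall_lt_succ_iff.2 ⟨fun p hp => ?_, ?_⟩, forall_lt_succ_iff.2 ⟨fun p hp => ?_, ?_⟩,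
      fun i => ?_, fun i => ?_⟩
    · have : (p.val : ℤ) ≠ q.val := by omega
      simp [upd_apply, h6 _ this, h1.sig p hp]
    · simp [upd_apply, h4]
    · have : p.val ≠ q.val := by omega
      simp [upd_apply, e1, this, er2, h1.dz p hp]
    · simp [upd_apply, e1, edz]
    · rw [sumLt_succ]
      by_cases h : I.σ q = i
      · subst h
        simp [upd_apply, e1, h4, er3, h1.cost, edz]
      · have : (i.val : ℤ) ≠ (I.σ q).val := fun h' => h (Fin.ext (by exact_mod_cast h'.symm))
        have h' : i.val ≠ (I.σ q).val := by exact_mod_cast this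
        simp [upd_apply, e1, h4, er3, h1.cost, h, h']
    · rw [sumLt_succ]
      by_cases h : I.σ q = i
      · subst h
        simp [upd_apply, e1, h4, ei17, h1.size]
      · have : (i.val : ℤ) ≠ (I.σ q).val := fun h' => h (Fin.ext (by exact_mod_cast h'.symm))
        have h' : i.val ≠ (I.σ q).val := by exact_mod_cast this
        simp [upd_apply, e1, h4, ei17, h1.size, h, h']
  · rw [Finset.sum_const, Finset.card_range, smul_eq_mul]; ring

end Setup

end
end KZCoreset

/-! ### Program: computation of the groups, and correctness of bounds and levels -/

namespace KZCoreset
noncomputable section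

section Program

/-- The key of the group of the current point. -/
abbrev eKey : Exp .int := .subi (.muli eLvl (ivar 7)) eBand
/-- The key stored for the current point. -/
abbrev eKeyVar : Exp .int := ivar 16

/-- Compute the bands and the groups. -/
def cGroups : Cmd :=
  .for 1 eN <|
    -- Integer arrays: `5` bands, `8` group sizes by key, `9` members at `key * n + rank`, `10`
    -- first points, `11` number of groups, `12` unsampled points per cluster. Real array `8` holds
    -- the group costs. A group is opened when its first member arrives.
    .seq (.seti 5 (ivar 1) (.floor (eLog (.divr (.getr 6 eCell) (.getr 7 eLvl))))) <|
    .ite (.and (.ltr (rconst 0) eDz) (.and (.ltr (rvar 4) (.cast eLvl)) (.ltr (rvar 5) (.cast eBand))))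
      (.seq (setv 16 eKey) <|
       .seq (.ite (.lti (.geti 8 eKeyVar) (.const 1))
          (.seq (.seti 10 (ivar 11) (ivar 1)) (setv 11 (.addi (ivar 11) (.const 1)))) .skip) <|
       .seq (.seti 9 (.addi (.muli eKeyVar eN) (.geti 8 eKeyVar)) (ivar 1)) <|
       .seq (.seti 8 eKeyVar (.addi (.geti 8 eKeyVar) (.const 1))) <|
       .setr 8 eKeyVar (.addr (.getr 8 eKeyVar) eDz))
      (.seti 12 eSig (.addi (.geti 12 eSig) (.const 1)))

end Program

namespace Setup
open scoped Classical
variable {X : Type*} [MetricSpace X] (I : Setup X) {m : Label → ℕ} {ω : ℕ → ℝ}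

/-- The number of possible bands. -/
def width : ℤ := ⌊-I.bandLo⌋ + 1

/-- Bounds for levels and bands have been computed. -/
structure Bounds (s : Mem) : Prop where
  top : s.ints 6 0 = I.topLvl
  lo : s.reals 4 0 = I.mainLo
  band : s.reals 5 0 = I.bandLo
  width : s.ints 7 0 = I.width

variable {I}

theorem Bounds.keeps {s s' : Mem} {wi wr : List ℕ} (h : I.Bounds s) (hk : Keeps wi wr s s')
    (hi : 6 ∉ wi ∧ 7 ∉ wi) (hr : 4 ∉ wr ∧ 5 ∉ wr) : I.Bounds s' := by
  obtain ⟨h1, h2, h3, h4⟩ := h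
  refine ⟨?_, ?_, ?_, ?_⟩
  · rw [hk.ints 6 hi.1, h1]
  · rw [hk.reals 4 hr.1, h2]
  · rw [hk.reals 5 hr.2, h3]
  · rw [hk.ints 7 hi.2, h4]

theorem runs_bounds {s : Mem} (hI : I.Input s) :
    Runs (I.oracle m) ω cBounds s (1 + (1 + (1 + 1))) I.Bounds := by
  refine runs_seq (runs_seti (runs_seq (runs_setr (runs_seq (runs_setr (runs_seti ?_))))))
  refine ⟨?_, ?_, ?_, ?_⟩
  · simp [upd_apply, hI.z, hI.ε, topLvl, mainHi, Int.floor_neg, Real.logb]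
  · simp [upd_apply, hI.z, hI.ε, mainLo, Real.logb]
  · simp [upd_apply, hI.z, hI.ε, hI.k, bandLo, Real.logb]
  · simp [upd_apply, hI.z, hI.ε, hI.k, bandLo, Real.logb, width]

theorem sum_ite_dz_eq_cost (i : Fin I.k) :
    ∑ p, (if I.σ p = i then I.dz p I.A else 0) = I.cost (I.cluster i) I.A := by
  rw [← Finset.sum_filter]; rfl

theorem sum_ite_one_eq_card (i : Fin I.k) :
    ∑ p, (if I.σ p = i then (1 : ℤ) else 0) = (I.cluster i).card := by
  rw [← Finset.sum_filter, Finset.sum_const, nsmul_eq_mul, mul_one]; rfl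

variable (I)

/-- Levels and the costs of rings and levels have been computed for the first points. -/
structure Leveled (q : ℕ) (s : Mem) : Prop where
  lvl : ∀ p : Fin I.n, p.val < q → s.ints 4 p.val = I.lvl p
  cell : ∀ κ : ℤ, s.reals 6 κ =
    sumLt (fun p => if (I.σ p).val + I.k * I.lvl p = κ then I.dz p I.A else 0) q
  layer : ∀ l : ℤ, s.reals 7 l = sumLt (fun p => if I.lvl p = l then I.dz p I.A else 0) q

variable {I}

theorem Leveled.keeps {q : ℕ} {s s' : Mem} {wi wr : List ℕ} (h : I.Leveled q s)
    (hk : Keeps wi wr s s') (hi : 4 ∉ wi) (hr : 6 ∉ wr ∧ 7 ∉ wr) : I.Leveled q s' := by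
  obtain ⟨h1, h2, h3⟩ := h
  refine ⟨fun p hp => ?_, fun κ => ?_, fun l => ?_⟩
  · rw [hk.ints 4 hi, h1 p hp]
  · rw [hk.reals 6 hr.1, h2 κ]
  · rw [hk.reals 7 hr.2, h3 l]

theorem keeps_upd_ints (s : Mem) (v : ℕ) (i x : ℤ) :
    Keeps [v] [] s { s with ints := upd s.ints v i x } :=
  ⟨fun a ha => upd_ne _ (by simpa using ha) _ _, fun _ _ => rfl⟩

theorem runs_levels {s : Mem} (hI : I.Input s) (hA : I.Assigned I.n s) (hB : I.Bounds s)
    (h0 : ∀ j, s.reals 6 j = 0 ∧ s.reals 7 j = 0) :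
    Runs (I.oracle m) ω cLevels s (2 + I.n * 7) (I.Leveled I.n) := by
  refine Runs.mono (runs_for (v := 1) I.n (by simp [Cmd.wi])
    I.Leveled (fun _ => 1 + ((1 + 1) + (1 + 1))) ?_ ?_ ?_ ?_) (le_of_eq ?_) fun _ h => h
  · exact fun q s x h => h.keeps (keeps_upd_ints _ _ _ _) (by simp) (by simp)
  · intro t ht
    simp only [iv_geti, iv_const]
    rw [ht.ints 0 (by simp [Cmd.wi])]
    exact hI.n
  · exact ⟨fun p hp => absurd hp (by simp), fun κ => by simp [(h0 κ).1],
      fun l => by simp [(h0 l).2]⟩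
  · intro q hq t h1 h2 h3
    have hIt : I.Input t := hI.keeps h3 (by simp [Cmd.wi]) (by simp [Cmd.wr])
    have hAt : I.Assigned I.n t := hA.keeps h3 (by simp [Cmd.wi]) (by simp [Cmd.wr])
    have hBt : I.Bounds t := hB.keeps h3 (by simp [Cmd.wi]) (by simp [Cmd.wr])
    lift q to Fin I.n using hq
    have esig := hAt.sig q q.2
    have edz := hAt.dz q q.2
    -- Program and definition use the same total operations, so points of cost zero, with their
    -- conventional values of `log` and division, need no special case.
    have eraw : ⌊Real.log (t.reals 2 q.val / (t.reals 3 (t.ints 3 q.val) /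
        (t.ints 17 (t.ints 3 q.val) : ℝ))) / Real.log 2⌋ = I.rawLvl q := by
      rw [esig, edz, hAt.cost, hAt.size, sumLt_all, sumLt_all, sum_ite_dz_eq_cost,
        sum_ite_one_eq_card]
      simp only [rawLvl, Real.logb, Δ, Int.cast_natCast]
    have hfin : ∀ t' : Mem, t'.ints = upd t.ints 4 q.val (I.lvl q) ∨
        t'.ints = upd (upd t.ints 4 q.val (I.rawLvl q)) 4 q.val (I.lvl q) → t'.reals = t.reals →
        Runs (I.oracle m) ω (.seq (.setr 6 eCell (.addr (.getr 6 eCell) eDz)) <|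
          .setr 7 eLvl (.addr (.getr 7 eLvl) eDz)) t' (1 + 1) (I.Leveled (q.val + 1)) := by
      intro t' hi hr
      have hi' : ∀ a j, t'.ints a j = if a = 4 ∧ j = q.val then I.lvl q else t.ints a j := by
        intro a j
        rcases hi with hi | hi
        · rw [hi, upd_apply]
        · rw [hi, upd_apply, upd_apply]
          split_ifs <;> rfl
      have a1 : t'.ints 1 0 = q.val := by simp [hi', h2]
      have a0 : t'.ints 0 1 = I.k := by simp [hi', hIt.k]
      have a4 : t'.ints 4 q.val = I.lvl q := by simp [hi']
      have a3 : t'.ints 3 q.val = (I.σ q).val := by simp [hi', esig]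
      refine runs_seq (runs_setr (runs_setr ?_))
      refine ⟨forall_lt_succ_iff.2 ⟨fun p hp => ?_, ?_⟩, fun κ => ?_, fun l => ?_⟩
      · have : p.val ≠ q.val := by omega
        simp [hi', this, h1.lvl p hp]
      · exact a4
      · rw [sumLt_succ]
        by_cases h : (I.σ q).val + I.k * I.lvl q = κ
        · subst h
          simp [upd_apply, a0, a1, a3, a4, hr, h1.cell, edz]
        · simp [upd_apply, a0, a1, a3, a4, hr, h1.cell, h, Ne.symm h]
      · rw [sumLt_succ]
        by_cases h : I.lvl q = l
        · subst h
          simp [upd_apply, a1, a4, hr, h1.layer, edz]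
        · simp [upd_apply, a1, a4, hr, h1.layer, h, Ne.symm h]
    refine runs_seq (runs_seti (runs_seq (runs_ite (t := 1) (fun hb => runs_seti ?_)
      fun hb => runs_skip ?_)))
    · refine hfin _ (Or.inr ?_) rfl
      simp [upd_apply, h2, hBt.top] at hb ⊢
      rw [eraw] at hb ⊢
      rw [lvl, min_eq_right hb.le]
    · refine hfin _ (Or.inl ?_) rfl
      simp [upd_apply, h2, hBt.top] at hb ⊢
      rw [eraw] at hb ⊢
      rw [lvl, min_eq_left hb]
  · rw [Finset.sum_const, Finset.card_range, smul_eq_mul]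

end Setup

end
end KZCoreset

/-! ### Ranks, and correctness of the computation of the groups -/

namespace KZCoreset
noncomputable section

/-- Quotient and remainder are unique, also for negative quotients. Pairs such as level and cluster,
level and band, key and rank are stored as single integers in this way. -/
theorem mul_add_inj {n x y a b : ℤ} (ha : 0 ≤ a) (han : a < n) (hb : 0 ≤ b) (hbn : b < n)
    (h : x * n + a = y * n + b) : x = y ∧ a = b := by
  have h1 : (x - y) * n = b - a := by linarith
  have h2 : x - y = 0 := by
    by_contra hne
    rcases lt_or_gt_of_ne hne with h3 | h3
    · nlinarith
    · nlinarith
  have h3 : x = y := by omega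
  subst h3
  exact ⟨rfl, by linarith⟩

theorem sumLt_le {n : ℕ} {f : Fin n → ℤ} (hf : ∀ p, f p ≤ 1) {q : ℕ} (hq : q ≤ n) :
    sumLt f q ≤ q := by
  induction q with
  | zero => simp
  | succ q ih =>
    have h := ih (by omega)
    have h2 := sumLt_succ f ⟨q, by omega⟩
    have h3 := hf ⟨q, by omega⟩
    simp only at h2
    rw [h2]
    push_cast
    linarith

/-- The number of points with a property before a given one. -/
def rankLt {n : ℕ} (P : Fin n → Prop) [DecidablePred P] (q : ℕ) : ℤ :=
  sumLt (fun p => if P p then (1 : ℤ) else 0) q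

section Rank
variable {n : ℕ} (P : Fin n → Prop) [DecidablePred P]

@[simp] theorem rankLt_zero : rankLt P 0 = 0 := sumLt_zero _

theorem rankLt_succ (p : Fin n) : rankLt P (p.val + 1) = rankLt P p.val + if P p then 1 else 0 :=
  sumLt_succ _ _

theorem rankLt_mono {q q' : ℕ} (h : q ≤ q') : rankLt P q ≤ rankLt P q' :=
  sumLt_mono (fun p => by split_ifs <;> norm_num) h

theorem rankLt_nonneg (q : ℕ) : 0 ≤ rankLt P q := by
  have := rankLt_mono P (Nat.zero_le q)
  rwa [rankLt_zero] at this

theorem rankLt_le {q : ℕ} (h : q ≤ n) : rankLt P q ≤ q :=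
  sumLt_le (fun p => by split_ifs <;> norm_num) h

theorem rankLt_lt {p : Fin n} (hp : P p) {q : ℕ} (h : p.val < q) : rankLt P p.val < rankLt P q := by
  have h1 := rankLt_succ P p
  rw [if_pos hp] at h1
  have h2 := rankLt_mono P (show p.val + 1 ≤ q from h)
  omega

theorem rankLt_inj {p p' : Fin n} (hp : P p) (hp' : P p') (h : rankLt P p.val = rankLt P p'.val) :
    p = p' := by
  rcases lt_trichotomy p p' with h1 | h1 | h1
  · exact absurd h (rankLt_lt P hp h1).ne
  · exact h1
  · exact absurd h (rankLt_lt P hp' h1).ne'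

/-- Together with `rankLt_inj` this makes the rank an enumeration of the points with the property,
in order of their index. -/
theorem exists_rankLt_eq {q : ℕ} (hq : q ≤ n) {c : ℤ} (h0 : 0 ≤ c) (hc : c < rankLt P q) :
    ∃ p : Fin n, p.val < q ∧ P p ∧ rankLt P p.val = c := by
  induction q with
  | zero => rw [rankLt_zero] at hc; omega
  | succ q ih =>
    have h1 := rankLt_succ P ⟨q, by omega⟩
    simp only at h1
    by_cases h : c < rankLt P q
    · obtain ⟨p, h2, h3⟩ := ih (by omega) h
      exact ⟨p, by omega, h3⟩
    · by_cases hP : P ⟨q, by omega⟩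
      · rw [if_pos hP] at h1
        exact ⟨⟨q, by omega⟩, by simp, hP, by simp only; omega⟩
      · rw [if_neg hP] at h1
        omega

theorem rankLt_all : rankLt P n = ((Finset.univ.filter P).card : ℤ) := by
  rw [rankLt, sumLt_all, ← Finset.sum_filter]
  simp

end Rank

namespace Setup
open scoped Classical
variable {X : Type*} [MetricSpace X] (I : Setup X) {m : Label → ℕ} {ω : ℕ → ℝ}

/-- The integer that represents the group of a sampled point. -/
def key (p : Fin I.n) : ℤ := I.lvl p * I.width - I.band p

/-- The point is sampled and its group has a given key. -/
def HasKey (κ : ℤ) (p : Fin I.n) : Prop := I.Sampled p ∧ I.key p = κ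

/-- The first point of its group. -/
def First (p : Fin I.n) : Prop := I.Sampled p ∧ rankLt (I.HasKey (I.key p)) p.val = 0

/-- The groups have been computed for the first points. -/
structure Grouped (q : ℕ) (s : Mem) : Prop where
  band : ∀ p : Fin I.n, p.val < q → s.ints 5 p.val = I.band p
  count : ∀ κ : ℤ, s.ints 8 κ = rankLt (I.HasKey κ) q
  cost : ∀ κ : ℤ, s.reals 8 κ = sumLt (fun p => if I.HasKey κ p then I.dz p I.A else 0) q
  mem : ∀ p : Fin I.n, p.val < q → I.Sampled p →
    s.ints 9 (I.key p * I.n + rankLt (I.HasKey (I.key p)) p.val) = p.val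
  num : s.ints 11 0 = rankLt I.First q
  first : ∀ p : Fin I.n, p.val < q → I.First p → s.ints 10 (rankLt I.First p.val) = p.val
  rest : ∀ i : Fin I.k, s.ints 12 i.val = rankLt (fun p => ¬ I.Sampled p ∧ I.σ p = i) q

variable {I}

theorem Grouped.keeps {q : ℕ} {s s' : Mem} {wi wr : List ℕ} (h : I.Grouped q s)
    (hk : Keeps wi wr s s')
    (hi : 5 ∉ wi ∧ 8 ∉ wi ∧ 9 ∉ wi ∧ 10 ∉ wi ∧ 11 ∉ wi ∧ 12 ∉ wi) (hr : 8 ∉ wr) :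
    I.Grouped q s' := by
  obtain ⟨h1, h2, h3, h4, h5, h6, h7⟩ := h
  obtain ⟨i5, i8, i9, i10, i11, i12⟩ := hi
  refine ⟨fun p hp => ?_, fun κ => ?_, fun κ => ?_, fun p hp hs => ?_, ?_, fun p hp hs => ?_,
    fun i => ?_⟩
  · rw [hk.ints 5 i5, h1 p hp]
  · rw [hk.ints 8 i8, h2 κ]
  · rw [hk.reals 8 hr, h3 κ]
  · rw [hk.ints 9 i9, h4 p hp hs]
  · rw [hk.ints 11 i11, h5]
  · rw [hk.ints 10 i10, h6 p hp hs]
  · rw [hk.ints 12 i12, h7 i]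

/-- Clusters have index below `k`, so the code determines cluster and level. Points of cost zero are
counted by the program but not by `cell`; they contribute nothing. -/
theorem sum_cell (i : Fin I.k) (l : ℤ) :
    ∑ p, (if (I.σ p).val + I.k * I.lvl p = i.val + I.k * l then I.dz p I.A else 0) =
      I.cost (I.cell i l) I.A := by
  rw [cost, cell, Finset.sum_filter]
  refine Finset.sum_congr rfl fun p _ => ?_
  by_cases h : I.σ p = i ∧ I.lvl p = l
  · rw [if_pos (by rw [h.1, h.2])]
    rcases (I.dz_nonneg p I.A).eq_or_lt with h0 | h0
    · rw [← h0, ite_self]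
    · rw [if_pos ⟨h0, h⟩]
  · rw [if_neg, if_neg (fun h' => h h'.2)]
    intro h'
    have h2 : I.lvl p * I.k + (I.σ p).val = l * I.k + i.val := by linarith
    have := mul_add_inj (by omega) (by have := (I.σ p).2; omega) (by omega) (by have := i.2; omega) h2
    exact h ⟨Fin.ext (by exact_mod_cast this.2), this.1⟩

theorem sum_layer (l : ℤ) :
    ∑ p, (if I.lvl p = l then I.dz p I.A else 0) = I.cost (I.layer l) I.A := by
  rw [cost, layer, Finset.sum_filter]
  refine Finset.sum_congr rfl fun p _ => ?_
  rcases (I.dz_nonneg p I.A).eq_or_lt with h0 | h0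
  · rw [← h0, ite_self, ite_self]
  · simp [h0]

theorem not_hasKey {κ : ℤ} {p : Fin I.n} (h : ¬ I.Sampled p) : ¬ I.HasKey κ p := fun h' => h h'.1

theorem not_first {p : Fin I.n} (h : ¬ I.Sampled p) : ¬ I.First p := fun h' => h h'.1

set_option maxHeartbeats 1000000 in
theorem runs_groups {s : Mem} (hI : I.Input s) (hA : I.Assigned I.n s) (hB : I.Bounds s)
    (hL : I.Leveled I.n s) (h0 : ∀ j, s.ints 8 j = 0 ∧ s.ints 12 j = 0 ∧ s.reals 8 j = 0)
    (h00 : s.ints 11 0 = 0) :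
    Runs (I.oracle m) ω cGroups s (2 + I.n * 11) (I.Grouped I.n) := by
  refine Runs.mono (runs_for (v := 1) I.n (by simp [Cmd.wi])
    I.Grouped (fun _ => 9) ?_ ?_ ?_ ?_) (le_of_eq ?_) fun _ h => h
  · exact fun q s x h => h.keeps (keeps_upd_ints _ _ _ _) (by simp) (by simp)
  · intro t ht
    simp only [iv_geti, iv_const]
    rw [ht.ints 0 (by simp [Cmd.wi])]
    exact hI.n
  · exact ⟨fun p hp => absurd hp (by simp), fun κ => by simp [(h0 κ).1],
      fun κ => by simp [(h0 κ).2.2], fun p hp => absurd hp (by simp), by simp [h00],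
      fun p hp => absurd hp (by simp), fun i => by simp [(h0 _).2.1]⟩
  · intro q hq t h1 h2 h3
    have hIt : I.Input t := hI.keeps h3 (by simp [Cmd.wi]) (by simp [Cmd.wr])
    have hAt : I.Assigned I.n t := hA.keeps h3 (by simp [Cmd.wi]) (by simp [Cmd.wr])
    have hBt : I.Bounds t := hB.keeps h3 (by simp [Cmd.wi]) (by simp [Cmd.wr])
    have hLt : I.Leveled I.n t := hL.keeps h3 (by simp [Cmd.wi]) (by simp [Cmd.wr])
    lift q to Fin I.n using hq
    have esig := hAt.sig q q.2
    have edz := hAt.dz q q.2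
    have elvl := hLt.lvl q q.2
    have eband : ⌊Real.log (t.reals 6 (t.ints 3 q.val + t.ints 0 1 * I.lvl q) /
        t.reals 7 (I.lvl q)) / Real.log 2⌋ = I.band q := by
      rw [esig, hIt.k, hLt.cell, hLt.layer, sumLt_all, sumLt_all, sum_cell, sum_layer]
      simp only [band, Real.logb]
    refine Runs.mono (t := 1 + ((1 + ((1 + 1 + 1) + (1 + (1 + 1)))) + 1)) ?_ (by norm_num)
      fun _ h => h
    refine runs_seq (runs_seti (runs_ite (fun hb => ?_) (fun hb => ?_)))
    · have hS : I.Sampled q := by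
        simp [upd_apply, h2, hBt.lo, hBt.band, edz, elvl, eband] at hb
        exact hb
      set κ := I.key q with hκ
      set c := rankLt (I.HasKey κ) q.val with hc
      have hkey : I.HasKey κ q := ⟨hS, rfl⟩
      -- The common continuation after the test whether the point opens a new group.
      have hfin : ∀ t' : Mem, t'.ints 0 0 = I.n → t'.ints 1 0 = q.val → t'.ints 16 0 = κ →
          (∀ j, t'.ints 5 j = if j = q.val then I.band q else t.ints 5 j) →
          t'.ints 8 = t.ints 8 → t'.ints 9 = t.ints 9 → t'.ints 12 = t.ints 12 →
          t'.reals = t.reals →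
          t'.ints 11 0 = rankLt I.First (q.val + 1) →
          (∀ p : Fin I.n, p.val < q.val + 1 → I.First p →
            t'.ints 10 (rankLt I.First p.val) = p.val) →
          Runs (I.oracle m) ω
            (.seq (.seti 9 (.addi (.muli eKeyVar eN) (.geti 8 eKeyVar)) (ivar 1)) <|
              .seq (.seti 8 eKeyVar (.addi (.geti 8 eKeyVar) (.const 1))) <|
              .setr 8 eKeyVar (.addr (.getr 8 eKeyVar) eDz)) t' (1 + (1 + 1))
            (I.Grouped (q.val + 1)) := by
        intro t' a0 a1 a16 a5 a8 a9 a12 ar a11 a10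
        refine runs_seq (runs_seti (runs_seq (runs_seti (runs_setr ?_))))
        have e8 : t'.ints 8 κ = c := by rw [a8, h1.count]
        refine ⟨forall_lt_succ_iff.2 ⟨fun p hp => ?_, ?_⟩, fun κ' => ?_, fun κ' => ?_,
          forall_lt_succ_iff.2 ⟨fun p hp hs => ?_, fun _ => ?_⟩, ?_, fun p hp hs => ?_, fun i => ?_⟩
        · have : p.val ≠ q.val := by omega
          simp [upd_apply, a5, this, h1.band p hp]
        · simp [upd_apply, a5]
        · rw [rankLt_succ]
          by_cases h : κ' = κ
          · subst h
            simp [upd_apply, a16, a8, h1.count, hkey]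
          · have hk' : ¬ I.HasKey κ' q := fun h' => h h'.2.symm
            simp [upd_apply, a16, h, a8, h1.count, hk']
        · rw [sumLt_succ]
          by_cases h : κ' = κ
          · subst h
            simp [upd_apply, a16, a1, ar, h1.cost, hkey, edz]
          · have hk' : ¬ I.HasKey κ' q := fun h' => h h'.2.symm
            simp [upd_apply, a16, h, ar, h1.cost, hk']
        -- Ranks before a point are less than `n`, so cells of different groups do not collide, and
        -- within one group the rank increases strictly: no entry is overwritten.
        · have hne : I.key p * I.n + rankLt (I.HasKey (I.key p)) p.val ≠ κ * I.n + c := by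
            intro h
            have hb1 := rankLt_le (I.HasKey (I.key p)) p.2.le
            have hb2 := rankLt_le (I.HasKey κ) q.2.le
            have hpn := p.2
            have hqn := q.2
            obtain ⟨h4, h5⟩ := mul_add_inj (rankLt_nonneg _ _) (by omega) (rankLt_nonneg _ _)
              (by omega) h
            rw [h4] at h5
            exact (rankLt_lt (I.HasKey κ) ⟨hs, h4⟩ hp).ne h5
          simp [upd_apply, a16, a0, e8, hne, a9, h1.mem p hp hs]
        · simp [upd_apply, a16, a0, e8, a1, ← hκ, ← hc]
        · simp [upd_apply, a11]
        · simp [upd_apply, a10 p hp hs]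
        · have := rankLt_succ (fun p => ¬ I.Sampled p ∧ I.σ p = i) q
          rw [if_neg (fun h => h.1 hS), add_zero] at this
          rw [this]
          simp [upd_apply, a12, h1.rest]
      have hkq : I.lvl q * I.width - I.band q = κ := rfl
      refine runs_seq (t := 1) (t' := (1 + 1 + 1) + (1 + (1 + 1))) (runs_seti (runs_seq (t := 1 + 1 + 1)
        (t' := 1 + (1 + 1)) (runs_ite (t := 1 + 1) (fun hb2 => ?_) (fun hb2 => ?_))))
      · simp [upd_apply, h2, hBt.width, elvl, eband, hkq, h1.count] at hb2
        have hc0 : c = 0 := by have := rankLt_nonneg (I.HasKey κ) q.val; omega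
        have hF : I.First q := ⟨hS, hc0⟩
        have hsucc := rankLt_succ I.First q
        rw [if_pos hF] at hsucc
        refine runs_seq (runs_seti (runs_seti (hfin _ ?_ ?_ ?_ ?_ ?_ ?_ ?_ rfl ?_ ?_)))
        · simp [upd_apply, hIt.n]
        · simp [upd_apply, h2]
        · simp [upd_apply, h2, hBt.width, elvl, eband, hkq]
        · intro j; simp [upd_apply, h2, elvl, eband]
        · funext j; simp [upd_apply]
        · funext j; simp [upd_apply]
        · funext j; simp [upd_apply]
        · rw [hsucc]; simp [upd_apply, h1.num]
        · refine forall_lt_succ_iff.2 ⟨fun p hp hs => ?_, fun _ => ?_⟩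
          · have hne := (rankLt_lt I.First hs hp).ne
            simp [upd_apply, h1.num, hne, h1.first p hp hs]
          · simp [upd_apply, h1.num, h2]
      · simp [upd_apply, h2, hBt.width, elvl, eband, hkq, h1.count] at hb2
        have hF : ¬ I.First q := fun h => by have : c = 0 := h.2; omega
        have hsucc := rankLt_succ I.First q
        rw [if_neg hF, add_zero] at hsucc
        refine (runs_skip ?_).mono (by norm_num) fun _ h => h
        refine hfin _ ?_ ?_ ?_ ?_ ?_ ?_ ?_ rfl ?_ ?_
        · simp [upd_apply, hIt.n]
        · simp [upd_apply, h2]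
        · simp [upd_apply, h2, hBt.width, elvl, eband, hkq]
        · intro j; simp [upd_apply, h2, elvl, eband]
        · funext j; simp [upd_apply]
        · funext j; simp [upd_apply]
        · funext j; simp [upd_apply]
        · rw [hsucc]; simp [upd_apply, h1.num]
        · refine forall_lt_succ_iff.2 ⟨fun p hp hs => ?_, fun h => absurd h hF⟩
          simp [upd_apply, h1.first p hp hs]
    · have hS : ¬ I.Sampled q := by
        simp [upd_apply, h2, hBt.lo, hBt.band, edz, elvl, eband] at hb
        rintro ⟨b1, b2, b3⟩
        exact absurd b3 (not_lt.2 (hb b1 b2))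
      refine (runs_seti ?_).mono (by norm_num) fun _ h => h
      refine ⟨forall_lt_succ_iff.2 ⟨fun p hp => ?_, ?_⟩, fun κ' => ?_, fun κ' => ?_,
        forall_lt_succ_iff.2 ⟨fun p hp hs => ?_, fun h => absurd h hS⟩, ?_,
        forall_lt_succ_iff.2 ⟨fun p hp hs => ?_, fun h => absurd h (not_first hS)⟩, fun i => ?_⟩
      · have : p.val ≠ q.val := by omega
        simp [upd_apply, h2, this, h1.band p hp]
      · simp [upd_apply, h2, elvl, eband]
      · rw [rankLt_succ, if_neg (not_hasKey hS)]
        simp [upd_apply, h1.count]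
      · rw [sumLt_succ, if_neg (not_hasKey hS)]
        simp [h1.cost]
      · simp [upd_apply, h1.mem p hp hs]
      · rw [rankLt_succ, if_neg (not_first hS)]
        simp [upd_apply, h1.num]
      · simp [upd_apply, h1.first p hp hs]
      · have := rankLt_succ (fun p => ¬ I.Sampled p ∧ I.σ p = i) q
        rw [this]
        by_cases h : I.σ q = i
        · subst h
          rw [if_pos ⟨hS, rfl⟩]
          simp [upd_apply, h2, esig, h1.rest]
        · have h' : i.val ≠ (I.σ q).val := fun h' => h (Fin.ext h'.symm)
          rw [if_neg (fun h' => h h'.2)]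
          simp [upd_apply, h2, esig, h1.rest, h']
  · rw [Finset.sum_const, Finset.card_range, smul_eq_mul]

end Setup

end
end KZCoreset

namespace KZCoreset
noncomputable section

/-! ### Tables for sampling in constant time -/

/-- The state of the construction of an alias table: the thresholds, the aliases, the first heavy
cell, the current cell and the number of inspected cells. -/
structure AliasState (N : ℕ) where
  r : Fin N → ℝ
  al : Fin N → Option (Fin N)
  y : ℕ
  x : ℕ
  i : ℕ

/-- An alias is stored as its index, and `-1` stands for no alias. -/
def aliasCode {N : ℕ} : Option (Fin N) → ℤ
  | none => -1
  | some p => p.val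

theorem aliasCode_neg {N : ℕ} {a : Option (Fin N)} : aliasCode a < 0 ↔ a = none := by
  cases a with
  | none => simp [aliasCode]
  | some p => simp [aliasCode]

namespace AliasState
variable {N : ℕ}

/-- The invariant of the construction for the masses `w`. -/
structure Valid (w : Fin N → ℝ) (a : AliasState N) : Prop where
  nonneg : ∀ p, 0 ≤ a.r p
  light : ∀ p, a.al p ≠ none → a.r p < 1
  mass : ∀ p, a.r p + ∑ x, (if a.al x = some p then 1 - a.r x else 0) = w p
  y_le : a.y ≤ N
  before : ∀ p : Fin N, p.val < a.y → a.r p < 1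
  seen : ∀ p : Fin N, a.r p < 1 → a.al p = none → p.val = a.x ∨ a.i < p.val
  i_le : a.i ≤ N
  x_lt : a.i < N → a.x < N
  x_eq : a.i = N → a.x = N

/-- The number of remaining steps. -/
def todo (a : AliasState N) : ℕ :=
  (N - a.i) + (N - a.y) + (Finset.univ.filter fun p => a.al p = none).card

/-- The state of the construction is stored in the memory. -/
structure Stored (a : AliasState N) (s : Mem) : Prop where
  r : ∀ p : Fin N, s.reals 9 p.val = a.r p
  al : ∀ p : Fin N, s.ints 13 p.val = aliasCode (a.al p)
  y : s.ints 14 0 = a.y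
  x : s.ints 15 0 = a.x
  i : s.ints 21 0 = a.i
  N : s.ints 22 0 = N

/-- The masses have mean one, and a cell with an alias holds total mass one, shared between its
owner and the alias. Hence the cells without alias have thresholds of mean one. -/
theorem Valid.balance {w : Fin N → ℝ} {a : AliasState N} (h : a.Valid w) (hw : ∑ p, w p = N) :
    ∑ p, (if a.al p = none then a.r p - 1 else 0) = 0 := by
  have h1 : ∑ p, (a.r p + ∑ x, (if a.al x = some p then 1 - a.r x else 0)) = N := by
    rw [← hw]
    exact Finset.sum_congr rfl fun p _ => h.mass p
  rw [Finset.sum_add_distrib, Finset.sum_comm] at h1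
  have h2 : ∀ x, ∑ p, (if a.al x = some p then 1 - a.r x else 0) =
      1 - a.r x + if a.al x = none then a.r x - 1 else 0 := by
    intro x
    cases hx : a.al x with
    | none => simp
    | some q => simp
  simp only [h2, Finset.sum_add_distrib, Finset.sum_sub_distrib] at h1
  simp at h1
  linarith

/-- If all cells were light, the deficits could not balance: a light cell without alias always finds
a donor. -/
theorem Valid.exists_heavy {w : Fin N → ℝ} {a : AliasState N} (h : a.Valid w)
    (hw : ∑ p, w p = N) {x : Fin N} (hx : a.r x < 1) (hx' : a.al x = none) : a.y < N := by
  by_contra hy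
  have h1 : ∑ p, (if a.al p = none then a.r p - 1 else 0) < 0 := by
    refine Finset.sum_neg' (fun p _ => ?_) ⟨x, Finset.mem_univ _, ?_⟩
    · have := h.before p (by omega)
      split_ifs
      · linarith
      · exact le_rfl
    · rw [if_pos hx']; linarith
  rw [h.balance hw] at h1
  exact lt_irrefl _ h1

/-- At the end no light cell lacks an alias, so all summands of `Valid.balance` are nonnegative with
sum zero. -/
theorem Valid.eq_one {w : Fin N → ℝ} {a : AliasState N} (h : a.Valid w) (hw : ∑ p, w p = N)
    (hi : a.i = N) {p : Fin N} (hp : a.al p = none) : a.r p = 1 := by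
  have h0 : ∀ q, 0 ≤ if a.al q = none then a.r q - 1 else 0 := by
    intro q
    split_ifs with hq
    · by_contra hlt
      rcases h.seen q (by linarith) hq with h1 | h1
      · have := h.x_eq hi; have := q.2; omega
      · have := q.2; omega
    · exact le_rfl
  have h1 := (Finset.sum_eq_zero_iff_of_nonneg fun q _ => h0 q).1 (h.balance hw) p
    (Finset.mem_univ _)
  rw [if_pos hp] at h1
  linarith

end AliasState

section Program

/-- The construction of an alias table. -/
def cAlias : Cmd :=
  .while (.lti (ivar 21) (ivar 22)) <|
    .ite (.and (.ltr (.getr 9 (ivar 15)) (rconst 1)) (.lti (.geti 13 (ivar 15)) (.const 0)))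
      (.ite (.ltr (.getr 9 (ivar 14)) (rconst 1))
        (setv 14 (.addi (ivar 14) (.const 1)))
        (.seq (.seti 13 (ivar 15) (ivar 14)) <|
         .seq (.setr 9 (ivar 14) (.subr (.getr 9 (ivar 14)) (.subr (rconst 1) (.getr 9 (ivar 15)))))
          (setv 15 (ivar 14))))
      (.seq (setv 21 (.addi (ivar 21) (.const 1))) (setv 15 (ivar 21)))

end Program

variable {N : ℕ} {o : Oracle}

open AliasState in
theorem exists_alias {w : Fin N → ℝ} (hw : ∑ p, w p = N) (b : ℕ) (a : AliasState N)
    (ha : a.Valid w) (hb : a.todo ≤ b) :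
    ∃ a' : AliasState N, a'.Valid w ∧ a'.i = N ∧ ∀ ω s, a.Stored s →
      Runs o ω cAlias s (6 * b + 1) a'.Stored := by
  induction b generalizing a with
  | zero =>
    have hi : a.i = N := by have := ha.i_le; simp only [todo] at hb; omega
    refine ⟨a, ha, hi, fun ω s hs => runs_while_false ?_ hs⟩
    simp [hs.i, hs.N, hi]
  | succ b ih =>
    by_cases hi : a.i = N
    · refine ⟨a, ha, hi, fun ω s hs => (runs_while_false ?_ hs).mono (by omega) fun _ h => h⟩
      simp [hs.i, hs.N, hi]
    have hiN : a.i < N := lt_of_le_of_ne ha.i_le hi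
    have ht : 6 * (b + 1) + 1 = 5 + (6 * b + 1) + 1 := by ring
    have htest : ∀ s, a.Stored s → Test.holds o s (.lti (ivar 21) (ivar 22)) := by
      intro s hs
      simp [hs.i, hs.N, hiN]
    obtain ⟨x, hx⟩ : ∃ x : Fin N, x.val = a.x := ⟨⟨a.x, ha.x_lt hiN⟩, rfl⟩
    have hex : ∀ s, a.Stored s → s.reals 9 (s.ints 15 0) = a.r x ∧
        s.ints 13 (s.ints 15 0) = aliasCode (a.al x) := by
      intro s hs
      rw [hs.x, ← hx, hs.r, hs.al]
      exact ⟨rfl, rfl⟩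
    by_cases hxl : a.r x < 1 ∧ a.al x = none
    · have hyN := ha.exists_heavy hw hxl.1 hxl.2
      obtain ⟨y, hy⟩ : ∃ y : Fin N, y.val = a.y := ⟨⟨a.y, hyN⟩, rfl⟩
      have hey : ∀ s, a.Stored s → s.reals 9 (s.ints 14 0) = a.r y := by
        intro s hs
        rw [hs.y, ← hy, hs.r]
      by_cases hyl : a.r y < 1
      · obtain ⟨a', h1, h2, h3⟩ := ih { a with y := a.y + 1 }
          ⟨ha.nonneg, ha.light, ha.mass, hyN, fun p hp => by
            rcases Nat.lt_succ_iff_lt_or_eq.1 hp with hp | hp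
            · exact ha.before p hp
            · rwa [show p = y from Fin.ext (hp.trans hy.symm)], ha.seen, ha.i_le, ha.x_lt, ha.x_eq⟩
          (by simp only [todo] at hb ⊢; omega)
        refine ⟨a', h1, h2, fun ω s hs => ?_⟩
        rw [ht]
        refine runs_while_true (htest s hs) (runs_ite (t := 4) (fun _ => ?_) fun hn => ?_)
        · refine runs_ite (t := 3) (fun _ => ?_) fun hn => ?_
          · refine (runs_seti ?_).mono (by norm_num) fun _ h => h
            refine h3 ω _ ⟨hs.r, fun p => ?_, ?_, ?_, ?_, ?_⟩
            · simp [upd_apply, hs.al]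
            · simp [hs.y]
            · simp [upd_apply, hs.x]
            · simp [upd_apply, hs.i]
            · simp [upd_apply, hs.N]
          · exact absurd (by simpa [hey s hs] using hyl) hn
        · exact absurd (by simpa [(hex s hs).1, (hex s hs).2, aliasCode_neg] using hxl) hn
      · have hxy : x ≠ y := fun h => hyl (h ▸ hxl.1)
        have haly : a.al y = none := by
          by_contra h
          exact hyl (ha.light y h)
        -- The heavy cell `y` donates `1 - r x` to the cell `x`. It may thereby become light at a
        -- position that the scan has passed, so it is made the current cell; this preserves `seen`.
        obtain ⟨a', h1, h2, h3⟩ := ih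
          { a with
            r := Function.update a.r y (a.r y - (1 - a.r x))
            al := Function.update a.al x (some y)
            x := a.y }
          (by
            refine ⟨fun p => ?_, fun p hp => ?_, fun p => ?_, ha.y_le, fun p hp => ?_,
              fun p hp hp' => ?_, ha.i_le, fun _ => hyN, fun h => absurd h hi⟩
            · rcases eq_or_ne p y with rfl | h
              · simp only [Function.update_self]
                have := ha.nonneg x
                push Not at hyl
                linarith
              · simpa only [Function.update_of_ne h] using ha.nonneg p
            · have hpy : p ≠ y := by
                rintro rfl
                exact hp (by simpa only [Function.update_of_ne hxy.symm] using haly)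
              simp only [Function.update_of_ne hpy]
              rcases eq_or_ne p x with rfl | h
              · exact hxl.1
              · exact ha.light p (by simpa only [Function.update_of_ne h] using hp)
            · simp only
              have hsum : ∑ z, (if Function.update a.al x (some y) z = some p then
                  1 - Function.update a.r y (a.r y - (1 - a.r x)) z else 0) =
                  ∑ z, ((if a.al z = some p then 1 - a.r z else 0) +
                    if z = x then (if y = p then 1 - a.r x else 0) else 0) := by
                refine Finset.sum_congr rfl fun z _ => ?_
                rcases eq_or_ne z x with rfl | h
                · simp [hxl.2, Function.update_of_ne hxy]
                · rcases eq_or_ne z y with rfl | h'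
                  · simp [haly, h]
                  · simp [h, h']
              rw [hsum, Finset.sum_add_distrib, ← ha.mass p]
              rcases eq_or_ne p y with rfl | h
              · simp
              · simp [h, h.symm]
            · rcases eq_or_ne p y with rfl | h
              · exact absurd (show p.val < a.y from hp) (by omega)
              · simpa only [Function.update_of_ne h] using ha.before p hp
            · simp only at hp hp' ⊢
              rcases eq_or_ne p y with rfl | h
              · exact Or.inl hy
              · rw [Function.update_of_ne h] at hp
                have hpx : p ≠ x := by rintro rfl; simp at hp'
                rw [Function.update_of_ne hpx] at hp'
                rcases ha.seen p hp hp' with h4 | h4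
                · exact absurd (Fin.ext (h4.trans hx.symm)) hpx
                · exact Or.inr h4)
          (by
            have hlt : (Finset.univ.filter fun p => Function.update a.al x (some y) p = none).card <
                (Finset.univ.filter fun p => a.al p = none).card := by
              refine Finset.card_lt_card ⟨fun p hp => ?_, fun h => ?_⟩
              · rw [Finset.mem_filter] at hp ⊢
                have hpx : p ≠ x := by rintro rfl; simp at hp
                rw [Function.update_of_ne hpx] at hp
                exact hp
              · have := h (Finset.mem_filter.2 ⟨Finset.mem_univ x, hxl.2⟩)
                simp at this
            simp only [todo] at hb ⊢
            omega)
        refine ⟨a', h1, h2, fun ω s hs => ?_⟩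
        rw [ht]
        refine runs_while_true (htest s hs) (runs_ite (t := 4) (fun _ => ?_) fun hn => ?_)
        · refine runs_ite (t := 3) (fun hn => ?_) fun _ => ?_
          · exact absurd (by simpa [hey s hs] using hn) hyl
          · refine runs_seq (t := 1) (t' := 2) (runs_seti (runs_seq (t := 1) (t' := 1)
              (runs_setr (runs_seti ?_))))
            refine h3 ω _ ⟨fun p => ?_, fun p => ?_, ?_, ?_, ?_, ?_⟩
            · rcases eq_or_ne p y with rfl | h
              · simp [upd_apply, hs.y, hs.x, ← hy, ← hx, hs.r]
              · have h' : p.val ≠ y.val := fun h' => h (Fin.ext h')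
                simp [upd_apply, hs.y, ← hy, h', h, hs.r]
            · rcases eq_or_ne p x with rfl | h
              · simp [upd_apply, hs.y, hs.x, ← hy, ← hx, aliasCode]
              · have h' : p.val ≠ x.val := fun h' => h (Fin.ext h')
                simp [upd_apply, hs.x, ← hx, h', h, hs.al]
            · simp [upd_apply, hs.y]
            · simp [upd_apply, hs.y]
            · simp [upd_apply, hs.i]
            · simp [upd_apply, hs.N]
        · exact absurd (by simpa [(hex s hs).1, (hex s hs).2, aliasCode_neg] using hxl) hn
    · obtain ⟨a', h1, h2, h3⟩ := ih { a with i := a.i + 1, x := a.i + 1 }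
        ⟨ha.nonneg, ha.light, ha.mass, ha.y_le, ha.before, fun p hp hp' => by
          rcases ha.seen p hp hp' with h4 | h4
          · rw [show p = x from Fin.ext (h4.trans hx.symm)] at hp hp'
            exact absurd ⟨hp, hp'⟩ hxl
          · simp only
            omega, hiN, fun h => h, fun h => h⟩
        (by simp only [todo] at hb ⊢; omega)
      refine ⟨a', h1, h2, fun ω s hs => ?_⟩
      rw [ht]
      refine runs_while_true (htest s hs) (runs_ite (t := 4) (fun hn => ?_) fun _ => ?_)
      · exact absurd (by simpa [(hex s hs).1, (hex s hs).2, aliasCode_neg] using hn) hxl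
      · refine (runs_seq (t := 1) (t' := 1) (runs_seti (runs_seti ?_))).mono (by norm_num)
          fun _ h => h
        refine h3 ω _ ⟨hs.r, fun p => ?_, ?_, ?_, ?_, ?_⟩
        · simp [upd_apply, hs.al]
        · simp [upd_apply, hs.y]
        · simp [hs.i]
        · simp [upd_apply, hs.i]
        · simp [upd_apply, hs.N]

end
end KZCoreset

/-! ### Law of a draw from an alias table and of the tape -/

namespace KZCoreset
noncomputable section

open MeasureTheory

namespace AliasState
variable {N : ℕ} {w : Fin N → ℝ} {a : AliasState N}

/-- The cell that a number of `[0,1)` falls into. -/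
def slotOf (hN : 0 < N) (u : ℝ) : Fin N :=
  if h : ⌊(N : ℝ) * u⌋₊ < N then ⟨⌊(N : ℝ) * u⌋₊, h⟩ else ⟨0, hN⟩

/-- The index chosen by the random number `u`. -/
def pick (a : AliasState N) (hN : 0 < N) (u : ℝ) : Fin N :=
  if (N : ℝ) * u - (slotOf hN u).val < a.r (slotOf hN u) then slotOf hN u
  else (a.al (slotOf hN u)).getD (slotOf hN u)

theorem slotOf_spec (hN : 0 < N) {u : ℝ} (hu : u ∈ Set.Ico (0 : ℝ) 1) :
    ((slotOf hN u).val : ℝ) ≤ N * u ∧ N * u < (slotOf hN u).val + 1 ∧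
      ⌊(N : ℝ) * u⌋ = (slotOf hN u).val := by
  have hN' : (0 : ℝ) < N := by exact_mod_cast hN
  have h0 : 0 ≤ (N : ℝ) * u := mul_nonneg hN'.le hu.1
  have h1 : ⌊(N : ℝ) * u⌋₊ < N := by
    rw [Nat.floor_lt h0]
    nlinarith [hu.2]
  have h2 : (slotOf hN u).val = ⌊(N : ℝ) * u⌋₊ := by rw [slotOf, dif_pos h1]
  rw [h2]
  exact ⟨Nat.floor_le h0, Nat.lt_floor_add_one _, (Int.natCast_floor_eq_floor h0).symm⟩

theorem slotOf_eq (hN : 0 < N) {u : ℝ} {x : Fin N} (h1 : (x.val : ℝ) ≤ N * u)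
    (h2 : N * u < x.val + 1) : slotOf hN u = x := by
  have h : ⌊(N : ℝ) * u⌋₊ = x.val := by
    rw [Nat.floor_eq_iff ((Nat.cast_nonneg _).trans h1)]
    exact ⟨h1, h2⟩
  rw [slotOf, dif_pos (by rw [h]; exact x.2)]
  exact Fin.ext h

/-- The part of the `x`-th cell that yields `x`. -/
def own (a : AliasState N) (x : Fin N) : Set ℝ := Set.Ico (x.val / N) ((x.val + a.r x) / N)

/-- The part of the `x`-th cell that yields the alias of `x`. -/
def lent (a : AliasState N) (x : Fin N) : Set ℝ := Set.Ico ((x.val + a.r x) / N) ((x.val + 1) / N)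

theorem measurableSet_lent (a : AliasState N) (x : Fin N) : MeasurableSet (a.lent x) :=
  measurableSet_Ico

/-- The numbers that yield `p`. -/
def piece (a : AliasState N) (p : Fin N) : Set ℝ :=
  a.own p ∪ ⋃ x ∈ Finset.univ.filter fun x => a.al x = some p, a.lent x

theorem measurableSet_piece (p : Fin N) : MeasurableSet (a.piece p) :=
  measurableSet_Ico.union (Finset.measurableSet_biUnion _ fun _ _ => measurableSet_Ico)

theorem mem_own (hN : 0 < N) {x : Fin N} {u : ℝ} :
    u ∈ a.own x ↔ (x.val : ℝ) ≤ N * u ∧ N * u < x.val + a.r x := by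
  have hN' : (0 : ℝ) < N := by exact_mod_cast hN
  rw [own, Set.mem_Ico, div_le_iff₀' hN', lt_div_iff₀' hN']

theorem mem_lent (hN : 0 < N) {x : Fin N} {u : ℝ} :
    u ∈ a.lent x ↔ x.val + a.r x ≤ N * u ∧ N * u < x.val + 1 := by
  have hN' : (0 : ℝ) < N := by exact_mod_cast hN
  rw [lent, Set.mem_Ico, div_le_iff₀' hN', lt_div_iff₀' hN']

theorem le_one (h : a.Valid w) (h1 : ∀ p, a.al p = none → a.r p = 1) (p : Fin N) : a.r p ≤ 1 := by
  by_cases hp : a.al p = none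
  · exact (h1 p hp).le
  · exact (h.light p hp).le

/-- The integer part of `N u` selects the cell, and the fractional part is compared with its
threshold. A cell without alias has threshold one, so the second outcome cannot occur there. -/
theorem mem_piece (h : a.Valid w) (h1 : ∀ p, a.al p = none → a.r p = 1) (hN : 0 < N) {u : ℝ}
    (hu : u ∈ Set.Ico (0 : ℝ) 1) {p : Fin N} : u ∈ a.piece p ↔ a.pick hN u = p := by
  obtain ⟨h2, h3, -⟩ := slotOf_spec hN hu
  simp only [piece, Set.mem_union, Set.mem_iUnion, Finset.mem_filter, Finset.mem_univ, true_and,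
    mem_own hN, mem_lent hN, exists_prop, pick]
  constructor
  · rintro (⟨h4, h5⟩ | ⟨x, hx, h4, h5⟩)
    · rw [slotOf_eq hN h4 (h5.trans_le (by linarith [le_one h h1 p])), if_pos (by linarith)]
    · rw [slotOf_eq hN (by linarith [h.nonneg x]) h5, if_neg (by linarith), hx, Option.getD_some]
  · intro h4
    split_ifs at h4 with h5
    · left
      rw [← h4]
      exact ⟨h2, by linarith⟩
    · right
      push Not at h5
      cases hx : a.al (slotOf hN u) with
      | none => rw [h1 _ hx] at h5; linarith
      | some q =>
        rw [hx, Option.getD_some] at h4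
        exact ⟨slotOf hN u, by rw [hx, h4], by linarith, h3⟩

theorem piece_subset (h : a.Valid w) (h1 : ∀ p, a.al p = none → a.r p = 1) (hN : 0 < N)
    (p : Fin N) : a.piece p ⊆ Set.Ico 0 1 := by
  have hN' : (0 : ℝ) < N := by exact_mod_cast hN
  have key : ∀ (x : Fin N) (u : ℝ), (x.val : ℝ) ≤ N * u → N * u < x.val + 1 →
      u ∈ Set.Ico (0 : ℝ) 1 := by
    intro x u h2 h3
    have hx : (x.val : ℝ) + 1 ≤ N := by exact_mod_cast x.2
    have hx0 : (0 : ℝ) ≤ x.val := Nat.cast_nonneg _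
    constructor
    · by_contra hlt
      push Not at hlt
      nlinarith
    · by_contra hlt
      push Not at hlt
      nlinarith
  intro u hu
  simp only [piece, Set.mem_union, Set.mem_iUnion, Finset.mem_filter, Finset.mem_univ, true_and,
    mem_own hN, mem_lent hN, exists_prop] at hu
  rcases hu with ⟨h4, h5⟩ | ⟨x, hx, h4, h5⟩
  · exact key p u h4 (by linarith [le_one h h1 p])
  · exact key x u (by linarith [h.nonneg x]) h5

/-- The intervals yielding `p` are disjoint, with lengths `r p / N` in its own cell and `(1 - r x) /
N` in the cells aliased to it; their sum is the conserved quantity `Valid.mass`. -/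
theorem volume_piece (h : a.Valid w) (h1 : ∀ p, a.al p = none → a.r p = 1) (hN : 0 < N)
    (p : Fin N) : (volume.restrict (Set.Icc (0 : ℝ) 1)) (a.piece p) = ENNReal.ofReal (w p / N) := by
  have hN' : (0 : ℝ) < N := by exact_mod_cast hN
  rw [Measure.restrict_apply (measurableSet_piece p), Set.inter_eq_left.2
    ((piece_subset h h1 hN p).trans Set.Ico_subset_Icc_self), piece, measure_union _
      (Finset.measurableSet_biUnion _ fun x _ => a.measurableSet_lent x),
    measure_biUnion_finset (hd := ?_) (hm := fun x _ => a.measurableSet_lent x)]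
  · rw [← h.mass p, add_div, ENNReal.ofReal_add (div_nonneg (h.nonneg p) hN'.le)
      (div_nonneg (Finset.sum_nonneg fun x _ => ?_) hN'.le), Finset.sum_div,
      ENNReal.ofReal_sum_of_nonneg fun x _ => ?_, Finset.sum_filter]
    · congr 1
      · rw [own, Real.volume_Ico]
        congr 1
        ring
      · refine Finset.sum_congr rfl fun x _ => ?_
        split_ifs with hx
        · rw [lent, Real.volume_Ico]
          congr 1
          ring
        · simp
    · split_ifs
      · exact div_nonneg (sub_nonneg.2 (le_one h h1 x)) hN'.le
      · simp
    · split_ifs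
      · exact sub_nonneg.2 (le_one h h1 x)
      · simp
  · intro x _ y _ hxy
    refine Set.disjoint_left.2 fun u hu hu' => hxy ?_
    rw [mem_lent hN] at hu hu'
    rw [← slotOf_eq hN (u := u) (x := x) (by linarith [h.nonneg x]) hu.2,
      ← slotOf_eq hN (u := u) (x := y) (by linarith [h.nonneg y]) hu'.2]
  · rw [Set.disjoint_iUnion₂_right]
    intro x _
    refine Set.disjoint_left.2 fun u hu hu' => ?_
    rw [mem_lent hN] at hu'
    rw [mem_own hN] at hu
    have hx : p = x := by
      rw [← slotOf_eq hN (u := u) (x := p) hu.1 (by linarith [le_one h h1 p]),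
        ← slotOf_eq hN (u := u) (x := x) (by linarith [h.nonneg x]) hu'.2]
    subst hx
    linarith

end AliasState

theorem exists_sampler {N : ℕ} {o : Oracle} (hN : 0 < N) {w : Fin N → ℝ} (hw0 : ∀ p, 0 ≤ w p)
    (hw : ∑ p, w p = N) : ∃ a : AliasState N, a.Valid w ∧ (∀ p, a.al p = none → a.r p = 1) ∧
      ∀ ω s, AliasState.Stored ⟨w, fun _ => none, 0, 0, 0⟩ s →
        Runs o ω cAlias s (18 * N + 1) a.Stored := by
  obtain ⟨a, h1, h2, h3⟩ := exists_alias (o := o) hw (3 * N) ⟨w, fun _ => none, 0, 0, 0⟩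
    ⟨hw0, fun p hp => absurd rfl hp, fun p => by simp, Nat.zero_le _,
      fun p hp => absurd hp (Nat.not_lt_zero _), fun p _ _ => Nat.eq_zero_or_pos _, hN.le,
      fun h => h, fun h => h⟩ (by simp [AliasState.todo]; omega)
  refine ⟨a, h1, fun p hp => h1.eq_one hw h2 hp, fun ω s hs => (h3 ω s hs).mono (by omega)
    fun _ h => h⟩

theorem tapeLaw_box {ι : Type*} [Fintype ι] {π : ι → ℕ} (hπ : Function.Injective π)
    {A : ι → Set ℝ} (hA : ∀ i, MeasurableSet (A i)) :
    tapeLaw {ω | ∀ i, ω (π i) ∈ A i} = ∏ i, (volume.restrict (Set.Icc (0 : ℝ) 1)) (A i) := by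
  classical
  have : IsProbabilityMeasure (volume.restrict (Set.Icc (0 : ℝ) 1)) := ⟨by simp⟩
  have h1 : {ω : ℕ → ℝ | ∀ i, ω (π i) ∈ A i} =
      Set.pi (Finset.univ.image π : Finset ℕ) (Function.extend π A fun _ => Set.univ) := by
    ext ω
    simp [Set.mem_pi, hπ.extend_apply]
  rw [h1, tapeLaw, Measure.infinitePi_pi, Finset.prod_image hπ.injOn]
  · exact Finset.prod_congr rfl fun i _ => by rw [hπ.extend_apply]
  · intro j hj
    obtain ⟨i, -, rfl⟩ := Finset.mem_image.1 hj
    rw [hπ.extend_apply]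
    exact hA i

/-- The value `u = 1` would select the nonexistent cell `N`. The program halts there too, but its
output is specified only off this null set. -/
theorem tapeLaw_ae : ∀ᵐ ω ∂tapeLaw, ∀ i, ω i ∈ Set.Ico (0 : ℝ) 1 := by
  have : IsProbabilityMeasure (volume.restrict (Set.Icc (0 : ℝ) 1)) := ⟨by simp⟩
  rw [ae_all_iff]
  intro i
  have h1 := tapeLaw_box (π := fun _ : Unit => i) (fun _ _ _ => rfl) (A := fun _ => Set.Ico 0 1)
    fun _ => measurableSet_Ico
  have : IsProbabilityMeasure tapeLaw := by unfold tapeLaw; infer_instance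
  refine (mem_ae_iff_prob_eq_one (measurableSet_Ico.preimage (measurable_pi_apply i))).2 ?_
  have h2 : (fun ω : ℕ → ℝ => ω i) ⁻¹' Set.Ico 0 1 = {ω | ∀ _ : Unit, ω i ∈ Set.Ico (0 : ℝ) 1} := by
    ext ω; simp
  rw [h2, h1, Finset.univ_unique, Finset.prod_singleton, Measure.restrict_apply measurableSet_Ico,
    Set.inter_eq_left.2 Set.Ico_subset_Icc_self, Real.volume_Ico]
  simp

namespace Setup
open scoped Classical
variable {X : Type*} [MetricSpace X] (I : Setup X)

/-- If the samples are functions of different entries of the tape that have the right laws, then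
the output has the right law. -/
theorem law_of_samples {m : Label → ℕ} {c : Cmd} {π : I.Slot m → ℕ} (hπ : Function.Injective π)
    (Y : I.Slot m → ℝ → Fin I.n) (A : I.Slot m → Fin I.n → Set ℝ)
    (hA : ∀ s p, MeasurableSet (A s p))
    (hYA : ∀ s p, ∀ u ∈ Set.Ico (0 : ℝ) 1, u ∈ A s p ↔ Y s u = p)
    (hvol : ∀ s p, (volume.restrict (Set.Icc (0 : ℝ) 1)) (A s p) =
      ENNReal.ofReal (I.sampleProb s.1.1 p))
    (hrun : ∀ ω : ℕ → ℝ, (∀ i, ω i ∈ Set.Ico (0 : ℝ) 1) →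
      ∃ s' t', Exec (I.oracle m) ω c I.initMem s' t' ∧ (s'.out : Multiset (ℤ × ℝ)) =
        (I.output m fun s => Y s (ω (π s))).map fun x => (I.handle x.1, x.2))
    (S : Multiset ((Fin I.n ⊕ Fin I.k) × ℝ)) :
    tapeLaw {ω | ∃ s' t', Exec (I.oracle m) ω c I.initMem s' t' ∧
      (s'.out : Multiset (ℤ × ℝ)) = S.map fun x => (I.handle x.1, x.2)} =
    ENNReal.ofReal (I.prob m fun S' => S' = S) := by
  have hinj : Function.Injective fun x : (Fin I.n ⊕ Fin I.k) × ℝ => (I.handle x.1, x.2) := by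
    rintro ⟨x, r⟩ ⟨y, r'⟩ h
    simp only [Prod.mk.injEq] at h
    obtain ⟨h1, rfl⟩ := h
    congr 1
    rcases x with p | i <;> rcases y with q | j <;>
      simp only [handle, Sum.elim_inl, Sum.elim_inr] at h1
    · exact congrArg _ (Fin.ext (by omega))
    · have := p.2; omega
    · have := q.2; omega
    · exact congrArg _ (Fin.ext (by omega))
  -- Executions are deterministic, so up to a null set the event is a finite disjoint union of
  -- boxes, one for each tuple of samples with the prescribed output. No measurability of the
  -- execution itself is needed.
  have hev : {ω | ∃ s' t', Exec (I.oracle m) ω c I.initMem s' t' ∧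
      (s'.out : Multiset (ℤ × ℝ)) = S.map fun x => (I.handle x.1, x.2)} =ᵐ[tapeLaw]
      ⋃ y ∈ Finset.univ.filter fun y : I.Slot m → Fin I.n => I.output m y = S,
        {ω : ℕ → ℝ | ∀ s, ω (π s) ∈ A s (y s) ∩ Set.Ico 0 1} := by
    filter_upwards [tapeLaw_ae] with ω hω
    obtain ⟨s₀, t₀, h1, h2⟩ := hrun ω hω
    simp only [eq_iff_iff]
    change (_ ∈ {ω | _}) ↔ (ω ∈ ⋃ y ∈ _, _)
    simp only [Set.mem_ofPred_eq, Set.mem_iUnion, Finset.mem_filter, Finset.mem_univ, true_and,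
      exists_prop]
    constructor
    · rintro ⟨s', t', h3, h4⟩
      rw [← h1.unique h3, h2] at h4
      exact ⟨_, Multiset.map_injective hinj h4, fun s => ⟨(hYA _ _ _ (hω _)).2 rfl, hω _⟩⟩
    · rintro ⟨y, h3, h4⟩
      have h5 : (fun s => Y s (ω (π s))) = y := funext fun s => (hYA _ _ _ (hω _)).1 (h4 s).1
      refine ⟨s₀, t₀, h1, ?_⟩
      rw [h2, h5, h3]
  have hbox := fun y : I.Slot m → Fin I.n =>
    tapeLaw_box hπ (A := fun s => A s (y s) ∩ Set.Ico 0 1) fun s => (hA s _).inter measurableSet_Ico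
  have hvol' : ∀ s p, (volume.restrict (Set.Icc (0 : ℝ) 1)) (A s p ∩ Set.Ico 0 1) =
      ENNReal.ofReal (I.sampleProb s.1.1 p) := by
    intro s p
    rw [← hvol, ← Measure.restrict_congr_set Ico_ae_eq_Icc, Measure.restrict_apply (hA s p),
      Measure.restrict_apply ((hA s p).inter measurableSet_Ico), Set.inter_assoc, Set.inter_self]
  rw [measure_congr hev, measure_biUnion_finset]
  · simp only [hbox, hvol']
    have hP : I.prob m (fun S' => S' = S) =
        ∑ y ∈ Finset.univ.filter fun y : I.Slot m → Fin I.n => I.output m y = S, I.weight m y := by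
      rw [Finset.sum_filter, prob]
      exact Finset.sum_congr rfl fun y _ => by congr
    rw [hP, ENNReal.ofReal_sum_of_nonneg fun y _ => I.weight_nonneg m y]
    refine Finset.sum_congr rfl fun y _ => ?_
    rw [weight, ENNReal.ofReal_prod_of_nonneg fun s _ => I.sampleProb_nonneg _ _]
  · intro y _ y' _ hne
    refine Set.disjoint_left.2 fun ω hω hω' => hne (funext fun s => ?_)
    rw [← (hYA s _ _ (hω s).2).1 (hω s).1, (hYA s _ _ (hω' s).2).1 (hω' s).1]
  · intro y _
    have : {ω : ℕ → ℝ | ∀ s, ω (π s) ∈ A s (y s) ∩ Set.Ico 0 1} =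
        ⋂ s, (fun ω : ℕ → ℝ => ω (π s)) ⁻¹' (A s (y s) ∩ Set.Ico 0 1) := by
      ext ω; simp
    rw [this]
    exact MeasurableSet.iInter fun s =>
      ((hA s _).inter measurableSet_Ico).preimage (measurable_pi_apply _)

end Setup

end
end KZCoreset

/-! ### Enumeration of the groups and of their members -/

namespace KZCoreset
noncomputable section

namespace Setup
open scoped Classical
variable {X : Type*} [MetricSpace X] (I : Setup X) {m : Label → ℕ} {ω : ℕ → ℝ}

theorem labelOf_eq_iff {p q : Fin I.n} :
    I.labelOf p = I.labelOf q ↔ I.lvl p = I.lvl q ∧ I.band p = I.band q := by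
  unfold labelOf
  constructor
  · intro h
    split_ifs at h with h1 h2 h2
    · exact ⟨h1.trans h2.symm, by simpa using h⟩
    · simpa using h
  · rintro ⟨h1, h2⟩
    rw [h1, h2]

/-- The band of a sampled point satisfies `0 ≤ -band < width`, so the key determines level and band.
-/
theorem key_eq_iff {p q : Fin I.n} (hp : I.Sampled p) (hq : I.Sampled q) :
    I.key p = I.key q ↔ I.labelOf p = I.labelOf q := by
  have hb : ∀ r, I.Sampled r → 0 ≤ -I.band r ∧ -I.band r < I.width := by
    intro r hr
    refine ⟨by have := I.band_nonpos hr.1; omega, ?_⟩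
    rw [width, Int.lt_add_one_iff, Int.le_floor]
    push_cast
    linarith [hr.2.2]
  rw [labelOf_eq_iff]
  constructor
  · intro h
    have := mul_add_inj (hb p hp).1 (hb p hp).2 (hb q hq).1 (hb q hq).2
      (show I.lvl p * I.width + -I.band p = I.lvl q * I.width + -I.band q by
        simp only [key] at h; linarith)
    exact ⟨this.1, by omega⟩
  · rintro ⟨h1, h2⟩
    rw [key, key, h1, h2]

theorem hasKey_iff {p q : Fin I.n} (hp : I.Sampled p) :
    I.HasKey (I.key p) q ↔ q ∈ I.group (I.labelOf p) := by
  have hg := (I.mem_group_iff.2 ⟨hp, rfl⟩).1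
  constructor
  · rintro ⟨h1, h2⟩
    exact (I.mem_group_iff.2 ⟨h1, (I.key_eq_iff h1 hp).1 h2⟩).2
  · intro h
    obtain ⟨h1, h2⟩ := I.mem_group_iff.1 ⟨hg, h⟩
    exact ⟨h1, (I.key_eq_iff h1 hp).2 h2⟩

/-- The number of groups. -/
def numGroups : ℕ := (Finset.univ.filter I.First).card

theorem numGroups_le : I.numGroups ≤ I.n :=
  (Finset.card_filter_le _ _).trans (by simp)

theorem exists_rep (j : Fin I.numGroups) :
    ∃ p : Fin I.n, I.First p ∧ rankLt I.First p.val = j.val := by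
  obtain ⟨p, -, h1, h2⟩ := exists_rankLt_eq I.First le_rfl (c := j.val) (by omega)
    (by rw [rankLt_all]; exact_mod_cast j.2)
  exact ⟨p, h1, h2⟩

/-- The first point of the `j`-th group. -/
def rep (j : Fin I.numGroups) : Fin I.n := (I.exists_rep j).choose

theorem first_rep (j : Fin I.numGroups) : I.First (I.rep j) := (I.exists_rep j).choose_spec.1

theorem rank_rep (j : Fin I.numGroups) : rankLt I.First (I.rep j).val = j.val :=
  (I.exists_rep j).choose_spec.2

theorem sampled_rep (j : Fin I.numGroups) : I.Sampled (I.rep j) := (I.first_rep j).1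

/-- The label of the `j`-th group. -/
def groupAt (j : Fin I.numGroups) : Label := I.labelOf (I.rep j)

theorem rep_mem (j : Fin I.numGroups) : I.groupAt j ∈ I.groups ∧ I.rep j ∈ I.group (I.groupAt j) :=
  I.mem_group_iff.2 ⟨I.sampled_rep j, rfl⟩

/-- A group is represented by its member of rank zero: two representatives with the same key
coincide, and every nonempty group has one. -/
theorem groupAt_bijective :
    Function.Bijective fun j : Fin I.numGroups =>
      (⟨I.groupAt j, (I.rep_mem j).1⟩ : {g : Label // g ∈ I.groups}) := by
  constructor
  · intro j j' h
    simp only [Subtype.mk.injEq] at h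
    have hk := (I.key_eq_iff (I.sampled_rep j) (I.sampled_rep j')).2 h
    have h1 := (I.first_rep j).2
    have h2 := (I.first_rep j').2
    rw [← hk] at h2
    have h3 := rankLt_inj (I.HasKey (I.key (I.rep j))) ⟨I.sampled_rep j, rfl⟩
      ⟨I.sampled_rep j', hk.symm⟩ (h1.trans h2.symm)
    have h4 := I.rank_rep j
    rw [h3, I.rank_rep j'] at h4
    exact Fin.ext (by exact_mod_cast h4.symm)
  · rintro ⟨g, hg⟩
    obtain ⟨p, hp⟩ := I.group_nonempty ⟨g, hg⟩
    obtain ⟨hs, hl⟩ := I.mem_group_iff.1 ⟨hg, hp⟩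
    have hkp : I.HasKey (I.key p) p := ⟨hs, rfl⟩
    obtain ⟨q, -, h1, h2⟩ := exists_rankLt_eq (I.HasKey (I.key p)) le_rfl le_rfl
      ((rankLt_nonneg _ _).trans_lt (rankLt_lt _ hkp p.2))
    have hF : I.First q := ⟨h1.1, by rw [h1.2]; exact h2⟩
    have hlt := rankLt_lt I.First hF q.2
    rw [rankLt_all] at hlt
    obtain ⟨r, hr⟩ := Int.eq_ofNat_of_zero_le (rankLt_nonneg I.First q.val)
    have hr' : r < I.numGroups := by rw [hr] at hlt; exact_mod_cast hlt
    refine ⟨⟨r, hr'⟩, Subtype.ext ?_⟩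
    have h3 : I.rep ⟨r, hr'⟩ = q :=
      rankLt_inj I.First (I.first_rep _) hF ((I.rank_rep _).trans hr.symm)
    simp only [groupAt, h3]
    rw [← hl]
    exact (I.key_eq_iff h1.1 hs).1 h1.2

/-- Enumeration of the groups. -/
def groupEquiv : Fin I.numGroups ≃ {g : Label // g ∈ I.groups} := .ofBijective _ I.groupAt_bijective

theorem groupEquiv_val (j : Fin I.numGroups) : (I.groupEquiv j).1 = I.groupAt j := rfl

/-- The size of the `j`-th group. -/
def groupSize (j : Fin I.numGroups) : ℕ := (I.group (I.groupAt j)).card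

theorem groupSize_pos (j : Fin I.numGroups) : 0 < I.groupSize j :=
  Finset.card_pos.2 ⟨_, (I.rep_mem j).2⟩

theorem rank_all_group (j : Fin I.numGroups) :
    rankLt (I.HasKey (I.key (I.rep j))) I.n = I.groupSize j := by
  rw [rankLt_all, groupSize]
  congr 2
  ext p
  simp only [Finset.mem_filter, Finset.mem_univ, true_and, I.hasKey_iff (I.sampled_rep j)]
  rfl

theorem exists_member (j : Fin I.numGroups) (x : Fin (I.groupSize j)) :
    ∃ p : Fin I.n, p ∈ I.group (I.groupAt j) ∧
      rankLt (I.HasKey (I.key (I.rep j))) p.val = x.val := by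
  obtain ⟨p, -, h1, h2⟩ := exists_rankLt_eq (I.HasKey (I.key (I.rep j))) le_rfl (c := x.val)
    (by omega) (by rw [rank_all_group]; exact_mod_cast x.2)
  exact ⟨p, (I.hasKey_iff (I.sampled_rep j)).1 h1, h2⟩

/-- The `x`-th point of the `j`-th group. -/
def member (j : Fin I.numGroups) (x : Fin (I.groupSize j)) : Fin I.n := (I.exists_member j x).choose

theorem member_mem (j : Fin I.numGroups) (x : Fin (I.groupSize j)) :
    I.member j x ∈ I.group (I.groupAt j) := (I.exists_member j x).choose_spec.1

theorem rank_member (j : Fin I.numGroups) (x : Fin (I.groupSize j)) :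
    rankLt (I.HasKey (I.key (I.rep j))) (I.member j x).val = x.val :=
  (I.exists_member j x).choose_spec.2

theorem member_injective (j : Fin I.numGroups) : Function.Injective (I.member j) := by
  intro x y h
  have h1 := I.rank_member j x
  rw [h, I.rank_member j y] at h1
  exact Fin.ext (by exact_mod_cast h1.symm)

theorem image_member (j : Fin I.numGroups) :
    Finset.univ.image (I.member j) = I.group (I.groupAt j) := by
  refine Finset.eq_of_subset_of_card_le (fun p hp => ?_) ?_
  · obtain ⟨x, -, rfl⟩ := Finset.mem_image.1 hp
    exact I.member_mem j x
  · rw [Finset.card_image_of_injective _ (I.member_injective j), Finset.card_univ,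
      Fintype.card_fin]
    rfl

theorem cost_groupAt_pos (j : Fin I.numGroups) : 0 < I.cost (I.group (I.groupAt j)) I.A :=
  Finset.sum_pos' (fun p _ => I.dz_nonneg p I.A) ⟨_, (I.rep_mem j).2, (I.sampled_rep j).1⟩

/-- The mass of the `x`-th point of the `j`-th group in the alias table. -/
def mass (j : Fin I.numGroups) (x : Fin (I.groupSize j)) : ℝ :=
  I.groupSize j * I.dz (I.member j x) I.A / I.cost (I.group (I.groupAt j)) I.A

theorem mass_nonneg (j : Fin I.numGroups) (x : Fin (I.groupSize j)) : 0 ≤ I.mass j x :=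
  div_nonneg (mul_nonneg (Nat.cast_nonneg _) (I.dz_nonneg _ _)) (I.cost_groupAt_pos j).le

theorem sum_mass (j : Fin I.numGroups) : ∑ x, I.mass j x = I.groupSize j := by
  have h := I.cost_groupAt_pos j
  have h1 : ∑ x, I.dz (I.member j x) I.A = I.cost (I.group (I.groupAt j)) I.A := by
    rw [cost, ← image_member, Finset.sum_image (I.member_injective j).injOn]
  simp only [mass]
  rw [← Finset.sum_div, ← Finset.mul_sum, h1]
  field_simp

theorem sampleProb_member (j : Fin I.numGroups) (x : Fin (I.groupSize j)) :
    I.sampleProb (I.groupAt j) (I.member j x) = I.mass j x / I.groupSize j := by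
  have h := I.cost_groupAt_pos j
  have h' : (0 : ℝ) < I.groupSize j := by exact_mod_cast I.groupSize_pos j
  rw [sampleProb, if_pos (I.member_mem j x), mass]
  field_simp

/-- Disjointness of the groups makes the construction of all alias tables linear in `n`. -/
theorem sum_groupSize_le : ∑ j, I.groupSize j ≤ I.n := by
  have h1 : ∀ j, I.groupSize j = ∑ p : Fin I.n, if p ∈ I.group (I.groupAt j) then 1 else 0 := by
    intro j
    rw [groupSize, Finset.sum_boole, Finset.filter_mem_eq_inter, Finset.univ_inter, Nat.cast_id]
  simp only [h1]
  rw [Finset.sum_comm]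
  calc _ ≤ ∑ _p : Fin I.n, 1 := Finset.sum_le_sum fun p _ => ?_
    _ = I.n := by simp
  rw [Finset.sum_boole, Nat.cast_id, Finset.card_le_one]
  intro j hj j' hj'
  rw [Finset.mem_filter] at hj hj'
  refine I.groupEquiv.injective (Subtype.ext ?_)
  rw [groupEquiv_val, groupEquiv_val, ← I.eq_labelOf (I.rep_mem j).1 hj.2,
    ← I.eq_labelOf (I.rep_mem j').1 hj'.2]

theorem exists_table (o : Oracle) (j : Fin I.numGroups) :
    ∃ a : AliasState (I.groupSize j), a.Valid (I.mass j) ∧ (∀ p, a.al p = none → a.r p = 1) ∧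
      ∀ ω s, AliasState.Stored ⟨I.mass j, fun _ => none, 0, 0, 0⟩ s →
        Runs o ω cAlias s (18 * I.groupSize j + 1) a.Stored :=
  exists_sampler (I.groupSize_pos j) (I.mass_nonneg j) (I.sum_mass j)

/-- The alias table of the `j`-th group. -/
def table (o : Oracle) (j : Fin I.numGroups) : AliasState (I.groupSize j) :=
  (I.exists_table o j).choose

/-- The point of the `j`-th group chosen by a random number. -/
def choice (o : Oracle) (j : Fin I.numGroups) (u : ℝ) : Fin I.n :=
  I.member j ((I.table o j).pick (I.groupSize_pos j) u)

/-- The random numbers that choose the point `p` of the `j`-th group. -/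
def region (o : Oracle) (j : Fin I.numGroups) (p : Fin I.n) : Set ℝ :=
  ⋃ x ∈ Finset.univ.filter fun x => I.member j x = p, (I.table o j).piece x

theorem region_member (o : Oracle) (j : Fin I.numGroups) (x : Fin (I.groupSize j)) :
    I.region o j (I.member j x) = (I.table o j).piece x := by
  have : (Finset.univ.filter fun y => I.member j y = I.member j x) = {x} := by
    ext y
    simp [(I.member_injective j).eq_iff]
  rw [region, this]
  simp

theorem region_eq_empty (o : Oracle) (j : Fin I.numGroups) {p : Fin I.n}
    (hp : p ∉ I.group (I.groupAt j)) : I.region o j p = ∅ := by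
  have : (Finset.univ.filter fun y => I.member j y = p) = ∅ := by
    refine Finset.filter_eq_empty_iff.2 fun x _ h => hp ?_
    rw [← h]
    exact I.member_mem j x
  rw [region, this]
  simp

theorem exists_member_eq {j : Fin I.numGroups} {p : Fin I.n} (hp : p ∈ I.group (I.groupAt j)) :
    ∃ x, I.member j x = p := by
  rw [← image_member] at hp
  obtain ⟨x, -, hx⟩ := Finset.mem_image.1 hp
  exact ⟨x, hx⟩

theorem measurableSet_region (o : Oracle) (j : Fin I.numGroups) (p : Fin I.n) :
    MeasurableSet (I.region o j p) :=
  Finset.measurableSet_biUnion _ fun x _ => AliasState.measurableSet_piece x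

theorem mem_region (o : Oracle) (j : Fin I.numGroups) (p : Fin I.n) {u : ℝ}
    (hu : u ∈ Set.Ico (0 : ℝ) 1) : u ∈ I.region o j p ↔ I.choice o j u = p := by
  obtain ⟨h1, h2, -⟩ := (I.exists_table o j).choose_spec
  by_cases hp : p ∈ I.group (I.groupAt j)
  · obtain ⟨x, rfl⟩ := I.exists_member_eq hp
    rw [region_member, choice, (I.member_injective j).eq_iff]
    exact AliasState.mem_piece h1 h2 (I.groupSize_pos j) hu
  · rw [I.region_eq_empty o j hp]
    refine ⟨fun h => h.elim, fun h => hp ?_⟩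
    rw [← h]
    exact I.member_mem _ _

theorem volume_region (o : Oracle) (j : Fin I.numGroups) (p : Fin I.n) :
    (MeasureTheory.volume.restrict (Set.Icc (0 : ℝ) 1)) (I.region o j p) =
      ENNReal.ofReal (I.sampleProb (I.groupAt j) p) := by
  obtain ⟨h1, h2, -⟩ := (I.exists_table o j).choose_spec
  by_cases hp : p ∈ I.group (I.groupAt j)
  · obtain ⟨x, rfl⟩ := I.exists_member_eq hp
    rw [region_member, sampleProb_member]
    exact AliasState.volume_piece h1 h2 (I.groupSize_pos j) x
  · rw [I.region_eq_empty o j hp, sampleProb, if_neg hp]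
    simp

end Setup

end
end KZCoreset

/-! ### Program: sampling from one group -/

namespace KZCoreset
noncomputable section

section Program

/-- Output the centers. -/
def cCenters : Cmd := .for 2 eK (.emit (.addi eN (ivar 2)) (.cast (.geti 12 (ivar 2))))

/-- The member of the current group with a given index. -/
abbrev eMember (x : Exp .int) : Exp .int := .geti 9 (.addi (.muli eKeyVar eN) x)

/-- Initialize the alias table of the current group. -/
def cFill : Cmd :=
  .for 19 (ivar 22) <|
    .seq (.setr 9 (ivar 19) (.divr (.mulr (.cast (ivar 22)) (.getr 2 (eMember (ivar 19))))
      (.getr 8 eKeyVar)))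
    (.seti 13 (ivar 19) (.const (-1)))

/-- Replace the current cell by its alias if necessary. -/
def cChoose : Cmd :=
  .ite (.ltr (.subr (.mulr (.cast (ivar 22)) (rvar 10)) (.cast (ivar 15))) (.getr 9 (ivar 15)))
    .skip (setv 15 (.geti 13 (ivar 15)))

/-- Draw the samples from the current group. -/
def cSample : Cmd :=
  .for 19 (ivar 20) <|
    .seq (.draw 10 (.const 0)) <|
    .seq (setv 15 (.floor (.mulr (.cast (ivar 22)) (rvar 10)))) <|
    .seq cChoose <|
    .emit (eMember (ivar 15))
      (.divr (.getr 8 eKeyVar) (.mulr (.cast (ivar 20)) (.getr 2 (eMember (ivar 15)))))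

/-- Look up the data of the current group. -/
def cLookup : Cmd :=
  .seq (setv 23 (.geti 10 (ivar 18))) <|
  .seq (setv 16 (.subi (.muli (.geti 4 (ivar 23)) (ivar 7)) (.geti 5 (ivar 23)))) <|
  .seq (setv 22 (.geti 8 eKeyVar)) <|
  .ite (.lti (.geti 4 (ivar 23)) (ivar 6))
    (setv 20 (.quotaMain (.geti 4 (ivar 23)) (.geti 5 (ivar 23))))
    (setv 20 (.quotaOuter (.geti 5 (ivar 23))))

/-- Process the current group. -/
def cGroup : Cmd :=
  .seq cLookup <| .seq cFill <|
  .seq (.seq (setv 14 (.const 0)) (.seq (setv 15 (.const 0)) (setv 21 (.const 0)))) <|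
  .seq cAlias cSample

/-- The sampling algorithm. -/
def cMain : Cmd :=
  .seq cAssign <| .seq cBounds <| .seq cLevels <| .seq cGroups <| .seq cCenters <|
    .for 18 (ivar 11) cGroup

end Program

namespace Setup
open scoped Classical
variable {X : Type*} [MetricSpace X] (I : Setup X) {m : Label → ℕ} {ω : ℕ → ℝ}

/-- All data of the groups have been computed. -/
structure Prepared (s : Mem) : Prop where
  input : I.Input s
  assigned : I.Assigned I.n s
  bounds : I.Bounds s
  leveled : I.Leveled I.n s
  grouped : I.Grouped I.n s

variable {I}

theorem Prepared.keeps {s s' : Mem} {wi wr : List ℕ} (h : I.Prepared s) (hk : Keeps wi wr s s')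
    (hi : ∀ a ∈ wi, a = 2 ∨ 13 ≤ a ∧ a ≠ 17) (hr : ∀ a ∈ wr, 9 ≤ a) : I.Prepared s' := by
  have hi' : ∀ a, ¬ (a = 2 ∨ 13 ≤ a ∧ a ≠ 17) → a ∉ wi := fun a ha h => ha (hi a h)
  have hr' : ∀ a, ¬ 9 ≤ a → a ∉ wr := fun a ha h => ha (hr a h)
  refine ⟨h.input.keeps hk ?_ ?_, h.assigned.keeps hk ⟨?_, ?_⟩ ⟨?_, ?_⟩,
    h.bounds.keeps hk ⟨?_, ?_⟩ ⟨?_, ?_⟩, h.leveled.keeps hk ?_ ⟨?_, ?_⟩,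
    h.grouped.keeps hk ⟨?_, ?_, ?_, ?_, ?_, ?_⟩ ?_⟩
  all_goals first | exact hi' _ (by norm_num) | exact hr' _ (by norm_num)

theorem Prepared.member {s : Mem} (h : I.Prepared s) {j : Fin I.numGroups}
    (hkey : s.ints 16 0 = I.key (I.rep j)) (x : Fin (I.groupSize j)) :
    s.ints 9 (s.ints 16 0 * s.ints 0 0 + x.val) = (I.member j x).val := by
  have h1 := (I.hasKey_iff (I.sampled_rep j)).2 (I.member_mem j x)
  have h2 := h.grouped.mem (I.member j x) (I.member j x).2 h1.1
  rw [h1.2, rank_member] at h2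
  rw [hkey, h.input.n]
  exact h2

theorem Prepared.cost {s : Mem} (h : I.Prepared s) {j : Fin I.numGroups}
    (hkey : s.ints 16 0 = I.key (I.rep j)) :
    s.reals 8 (s.ints 16 0) = I.cost (I.group (I.groupAt j)) I.A := by
  rw [hkey, h.grouped.cost, sumLt_all, ← Finset.sum_filter, Setup.cost]
  refine Finset.sum_congr (Finset.ext fun p => ?_) fun _ _ => rfl
  simp only [Finset.mem_filter, Finset.mem_univ, true_and, I.hasKey_iff (I.sampled_rep j)]
  rfl

theorem Prepared.dz {s : Mem} (h : I.Prepared s) (p : Fin I.n) : s.reals 2 p.val = I.dz p I.A :=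
  h.assigned.dz p p.2

variable (I)

/-- The output of the centers. -/
def centersOut : Multiset (ℤ × ℝ) :=
  ∑ i : Fin I.k, {((I.n : ℤ) + i.val, (I.restCount i : ℝ))}

/-- The output of a sample from the `j`-th group. -/
def sampleOut (m : Label → ℕ) (j : Fin I.numGroups) (p : Fin I.n) : ℤ × ℝ :=
  (p.val, I.cost (I.group (I.groupAt j)) I.A / ((m (I.groupAt j) : ℝ) * I.dz p I.A))

/-- The output of the samples from the `j`-th group, which use the tape from a given position. -/
def groupOut (m : Label → ℕ) (ω : ℕ → ℝ) (j : Fin I.numGroups) (start : ℕ) : Multiset (ℤ × ℝ) :=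
  ∑ l : Fin (m (I.groupAt j)),
    {I.sampleOut m j (I.choice (I.oracle m) j (ω (start + l.val)))}

variable {I}

theorem restCount_eq (i : Fin I.k) :
    rankLt (fun p => ¬ I.Sampled p ∧ I.σ p = i) I.n = I.restCount i := by
  rw [rankLt_all, restCount]
  congr 2
  ext p
  simp only [cluster, Finset.mem_filter, Finset.mem_univ, true_and, ← I.mem_rest, rest]
  exact and_comm

theorem runs_centers {s : Mem} (hs : I.Prepared s) (hout : s.out = []) :
    Runs (I.oracle m) ω cCenters s (2 + I.k * 3) fun s' => s'.pos = s.pos ∧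
      (s'.out : Multiset (ℤ × ℝ)) = I.centersOut := by
  refine Runs.mono (runs_for (v := 2) I.k (by simp [Cmd.wi])
    (fun q t => t.pos = s.pos ∧ (t.out : Multiset (ℤ × ℝ)) =
      sumLt (fun i : Fin I.k => ({((I.n : ℤ) + i.val, (I.restCount i : ℝ))} : Multiset (ℤ × ℝ))) q)
    (fun _ => 1) (fun _ _ _ h => h) ?_ ⟨rfl, by simp [hout]⟩ ?_) (le_of_eq ?_) fun t h => ?_
  · intro t ht
    simp only [iv_geti, iv_const]
    rw [ht.ints 0 (by simp [Cmd.wi])]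
    exact hs.input.k
  · intro q hq t h1 h2 h3
    have ht := hs.keeps h3 (by simp [Cmd.wi]) (by simp [Cmd.wr])
    lift q to Fin I.k using hq
    refine runs_emit ⟨h1.1, ?_⟩
    rw [sumLt_succ, ← h1.2]
    simp only [iv_addi, iv_geti, iv_const, rv_cast, ht.input.n, h2, ht.grouped.rest, restCount_eq]
    rw [← Multiset.cons_coe, ← Multiset.singleton_add, add_comm]
    simp
  · simp
  · rw [sumLt_all] at h
    exact h

theorem runs_lookup {s : Mem} (hs : I.Prepared s) {j : Fin I.numGroups} (hj : s.ints 18 0 = j.val) :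
    Runs (I.oracle m) ω cLookup s 5 fun s' => s'.ints 16 0 = I.key (I.rep j) ∧
      s'.ints 22 0 = I.groupSize j ∧ s'.ints 20 0 = m (I.groupAt j) := by
  have h10 : s.ints 10 j.val = (I.rep j).val := by
    have := hs.grouped.first (I.rep j) (I.rep j).2 (I.first_rep j)
    rwa [I.rank_rep j] at this
  have h4 := hs.leveled.lvl (I.rep j) (I.rep j).2
  have h5 := hs.grouped.band (I.rep j) (I.rep j).2
  have h8 : s.ints 8 (I.key (I.rep j)) = I.groupSize j := by
    rw [hs.grouped.count, rank_all_group]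
  have hk : I.lvl (I.rep j) * I.width - I.band (I.rep j) = I.key (I.rep j) := rfl
  refine runs_seq (t := 1) (t' := 4) (runs_seti (runs_seq (t := 1) (t' := 3) (runs_seti
    (runs_seq (t := 1) (t' := 2) (runs_seti (runs_ite (t := 1) (fun hb => runs_seti ?_)
      fun hb => runs_seti ?_))))))
  · simp [upd_apply, hj, h10, h4, hs.bounds.top] at hb
    simp [upd_apply, hj, h10, h4, h5, h8, hs.bounds.width, hk, oracle, groupAt, labelOf, hb.ne]
  · simp [upd_apply, hj, h10, h4, hs.bounds.top] at hb
    have he := le_antisymm (I.lvl_le (I.rep j)) hb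
    rw [he] at hk
    simp [upd_apply, hj, h10, h4, h5, h8, hs.bounds.width, hk, oracle, groupAt, labelOf, he]

theorem runs_fill {s : Mem} (hs : I.Prepared s) {j : Fin I.numGroups}
    (hkey : s.ints 16 0 = I.key (I.rep j)) (hN : s.ints 22 0 = I.groupSize j) :
    Runs (I.oracle m) ω cFill s (2 + I.groupSize j * 4) fun s' =>
      ∀ x : Fin (I.groupSize j), s'.reals 9 x.val = I.mass j x ∧ s'.ints 13 x.val = -1 := by
  refine Runs.mono (runs_for (v := 19) (I.groupSize j) (by simp [Cmd.wi])
    (fun q t => ∀ x : Fin (I.groupSize j), x.val < q →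
      t.reals 9 x.val = I.mass j x ∧ t.ints 13 x.val = -1)
    (fun _ => 2) (fun q t x h => by simpa [upd_apply] using h) ?_
    (fun x hx => absurd hx (Nat.not_lt_zero _)) ?_) (le_of_eq ?_) fun t h x => h x x.2
  · intro t ht
    simp only [iv_geti, iv_const]
    rw [ht.ints 22 (by simp [Cmd.wi])]
    exact hN
  · intro q hq t h1 h2 h3
    have ht := hs.keeps h3 (by simp [Cmd.wi]) (by simp [Cmd.wr])
    lift q to Fin (I.groupSize j) using hq
    have hkey' : t.ints 16 0 = I.key (I.rep j) := by rw [h3.ints 16 (by simp [Cmd.wi]), hkey]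
    have hN' : t.ints 22 0 = I.groupSize j := by rw [h3.ints 22 (by simp [Cmd.wi]), hN]
    have e1 := ht.member hkey' q
    have e2 := ht.cost hkey'
    refine runs_seq (t := 1) (t' := 1) (runs_setr (runs_seti ?_))
    refine forall_lt_succ_iff.2 ⟨fun x hx => ?_, ?_, ?_⟩
    · have : x.val ≠ q.val := by omega
      simp [upd_apply, h2, this, h1 x hx]
    · simp [h2, e1, e2, hN', ht.dz, mass]
    · simp [h2]
  · simp

/-- Termination holds for every `u`, as the time bound must hold on every tape; the value is claimed
only for `u` in `[0, 1)`. -/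
theorem runs_choose {s : Mem} {o : Oracle} {j : Fin I.numGroups} {u : ℝ}
    (hN : s.ints 22 0 = I.groupSize j)
    (htab : ∀ x : Fin (I.groupSize j), s.reals 9 x.val = (I.table o j).r x ∧
      s.ints 13 x.val = aliasCode ((I.table o j).al x))
    (hu : s.reals 10 0 = u) (hx : s.ints 15 0 = ⌊(I.groupSize j : ℝ) * u⌋) :
    Runs o ω cChoose s 2 fun s' => u ∈ Set.Ico (0 : ℝ) 1 →
      s'.ints 15 0 = ((I.table o j).pick (I.groupSize_pos j) u).val := by
  obtain ⟨-, h1, -⟩ := (I.exists_table o j).choose_spec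
  refine runs_ite (t := 1) (fun hb => runs_skip fun hu' => ?_) fun hb => runs_seti fun hu' => ?_
  · obtain ⟨-, -, h4⟩ := AliasState.slotOf_spec (I.groupSize_pos j) hu'
    simp only [holds_ltr, rv_subr, rv_mulr, rv_cast, iv_geti, iv_const, rv_getr, hN, hu, hx, h4,
      (htab _).1, Int.cast_natCast] at hb
    rw [AliasState.pick, if_pos hb, hx, h4]
  · obtain ⟨-, -, h4⟩ := AliasState.slotOf_spec (I.groupSize_pos j) hu'
    simp only [holds_ltr, rv_subr, rv_mulr, rv_cast, iv_geti, iv_const, rv_getr, hN, hu, hx, h4,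
      (htab _).1, Int.cast_natCast] at hb
    rw [AliasState.pick, if_neg hb]
    simp only [iv_geti, iv_const, upd_self, hx, h4, (htab _).2]
    cases hal : (I.table o j).al (AliasState.slotOf (I.groupSize_pos j) u) with
    | none =>
      obtain ⟨-, h5, -⟩ := AliasState.slotOf_spec (I.groupSize_pos j) hu'
      have h6 : (I.table o j).r _ = 1 := h1 _ hal
      rw [h6] at hb
      exact absurd (by linarith) hb
    | some q => rfl

theorem runs_sample {s : Mem} (hs : I.Prepared s) {j : Fin I.numGroups}
    (hkey : s.ints 16 0 = I.key (I.rep j)) (hN : s.ints 22 0 = I.groupSize j)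
    (hm : s.ints 20 0 = m (I.groupAt j))
    (htab : ∀ x : Fin (I.groupSize j), s.reals 9 x.val = (I.table (I.oracle m) j).r x ∧
      s.ints 13 x.val = aliasCode ((I.table (I.oracle m) j).al x)) :
    Runs (I.oracle m) ω cSample s (2 + m (I.groupAt j) * 7) fun s' =>
      s'.pos = s.pos + m (I.groupAt j) ∧ ((∀ i, ω i ∈ Set.Ico (0 : ℝ) 1) →
        (s'.out : Multiset (ℤ × ℝ)) = s.out + I.groupOut m ω j s.pos) := by
  refine Runs.mono (runs_for (v := 19) (m (I.groupAt j)) (by simp [Cmd.wi, cChoose])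
    (fun q t => t.pos = s.pos + q ∧ ((∀ i, ω i ∈ Set.Ico (0 : ℝ) 1) →
      (t.out : Multiset (ℤ × ℝ)) = s.out + sumLt (fun l : Fin (m (I.groupAt j)) =>
        ({I.sampleOut m j (I.choice (I.oracle m) j (ω (s.pos + l.val)))} : Multiset (ℤ × ℝ))) q))
    (fun _ => 5) (fun q t x h => h) ?_ ⟨rfl, by simp⟩ ?_) (le_of_eq ?_) fun t h => ?_
  · intro t ht
    simp only [iv_geti, iv_const]
    rw [ht.ints 20 (by simp [Cmd.wi, cChoose])]
    exact hm
  · intro q hq t h1 h2 h3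
    have ht := hs.keeps h3 (by simp [Cmd.wi, cChoose]) (by simp [Cmd.wr, cChoose])
    lift q to Fin (m (I.groupAt j)) using hq
    have e20 := h3.ints 20 (by simp [Cmd.wi, cChoose])
    have e16 := h3.ints 16 (by simp [Cmd.wi, cChoose])
    have e22 := h3.ints 22 (by simp [Cmd.wi, cChoose])
    have e13 := h3.ints 13 (by simp [Cmd.wi, cChoose])
    have e9 := h3.reals 9 (by simp [Cmd.wr, cChoose])
    refine runs_seq (t := 1) (t' := 4) (runs_draw (runs_seq (t := 1) (t' := 3) (runs_seti
      (runs_seq (t := 2) (t' := 1) ?_))))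
    refine ((runs_choose (u := ω t.pos) (j := j) ?_ ?_ ?_ ?_).quiet rfl).mono le_rfl ?_
    · simp [upd_apply, e22, hN]
    · intro x
      simpa [upd_apply, e9, e13] using htab x
    · simp
    · simp [e22, hN]
    · rintro t' ⟨h4, h5, h6, h7⟩
      have k1 : Keeps (19 :: [15]) [10] t t' := by
        refine Keeps.trans ⟨fun a ha => ?_, fun a ha => ?_⟩
          (h5.mono (by simp [Cmd.wi, cChoose]) (by simp [Cmd.wr, cChoose]))
        · exact upd_ne _ (by rintro rfl; simp at ha) _ _
        · exact upd_ne _ (by rintro rfl; simp at ha) _ _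
      have ht' := ht.keeps k1 (by simp) (by simp)
      have k16 : t'.ints 16 0 = I.key (I.rep j) := by rw [k1.ints 16 (by simp), e16, hkey]
      have k20 : t'.ints 20 0 = m (I.groupAt j) := by rw [k1.ints 20 (by simp), e20, hm]
      refine runs_emit ⟨?_, fun hω => ?_⟩
      · simp only [h7, h1.1]
        ring
      · have e1 := ht'.member k16 ((I.table (I.oracle m) j).pick (I.groupSize_pos j) (ω t.pos))
        rw [← h4 (hω _)] at e1
        have e2 := ht'.cost k16
        simp only [iv_geti, iv_addi, iv_muli, iv_const, rv_divr, rv_mulr, rv_cast, rv_getr, e1, e2,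
          k20, ht'.dz, h6, Int.cast_natCast]
        rw [sumLt_succ, ← add_assoc, ← h1.2 hω, ← Multiset.cons_coe, ← Multiset.singleton_add,
          add_comm, ← h1.1]
        rfl
  · simp
  · rw [sumLt_all] at h
    exact h

end Setup

end
end KZCoreset

/-! ### The whole program: running time and law of the output -/

namespace KZCoreset
noncomputable section

namespace Setup
open scoped Classical
variable {X : Type*} [MetricSpace X] {I : Setup X} {m : Label → ℕ} {ω : ℕ → ℝ}

theorem runs_group {s : Mem} (hs : I.Prepared s) {j : Fin I.numGroups} (hj : s.ints 18 0 = j.val) :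
    Runs (I.oracle m) ω cGroup s (13 + I.groupSize j * 22 + m (I.groupAt j) * 7) fun s' =>
      s'.pos = s.pos + m (I.groupAt j) ∧ ((∀ i, ω i ∈ Set.Ico (0 : ℝ) 1) →
        (s'.out : Multiset (ℤ × ℝ)) = s.out + I.groupOut m ω j s.pos) := by
  rw [show 13 + I.groupSize j * 22 + m (I.groupAt j) * 7 = 5 + ((2 + I.groupSize j * 4) +
    (3 + ((18 * I.groupSize j + 1) + (2 + m (I.groupAt j) * 7)))) by ring]
  refine runs_seq (((runs_lookup hs hj).quiet rfl).mono le_rfl ?_)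
  rintro s₁ ⟨⟨a1, a2, a3⟩, a4, a5, a6⟩
  have hs₁ := hs.keeps a4 (by simp [Cmd.wi, cLookup]) (by simp [Cmd.wr, cLookup])
  refine runs_seq (((runs_fill hs₁ a1 a2).quiet rfl).mono le_rfl ?_)
  rintro s₂ ⟨b1, b4, b5, b6⟩
  have hs₂ := hs₁.keeps b4 (by simp [Cmd.wi, cFill, Cmd.for]) (by simp [Cmd.wr, cFill, Cmd.for])
  have b16 := b4.ints 16 (by simp [Cmd.wi, cFill, Cmd.for])
  have b22 := b4.ints 22 (by simp [Cmd.wi, cFill, Cmd.for])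
  have b20 := b4.ints 20 (by simp [Cmd.wi, cFill, Cmd.for])
  refine runs_seq (runs_seq (t := 1) (t' := 2) (runs_seti (runs_seq (t := 1) (t' := 1)
    (runs_seti (runs_seti ?_)))))
  set s₃ : Mem := _ with hs₃
  change Runs _ _ _ s₃ _ _
  have c4 : Keeps [14, 15, 21] [] s₂ s₃ := by
    refine ⟨fun a ha => ?_, fun _ _ => rfl⟩
    simp only [List.mem_cons, List.not_mem_nil, or_false, not_or] at ha
    simp only [hs₃]
    rw [upd_ne _ ha.2.2, upd_ne _ ha.2.1, upd_ne _ ha.1]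
  have hs₃' := hs₂.keeps c4 (by simp) (by simp)
  obtain ⟨d1, d2, d3⟩ := (I.exists_table (I.oracle m) j).choose_spec
  refine runs_seq (((d3 ω s₃ ⟨fun x => (b1 x).1, fun x => ?_, ?_, ?_, ?_, ?_⟩).quiet rfl).mono
    le_rfl ?_)
  · rw [c4.ints 13 (by simp), (b1 x).2]
    rfl
  · simp [hs₃, upd_apply]
  · simp [hs₃, upd_apply]
  · simp [hs₃]
  · rw [c4.ints 22 (by simp), b22, a2]
  · rintro s₄ ⟨e1, e4, e5, e6⟩
    have hs₄ := hs₃'.keeps e4 (by simp [Cmd.wi, cAlias]) (by simp [Cmd.wr, cAlias])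
    refine (runs_sample hs₄ (j := j) ?_ e1.N ?_ fun x => ⟨e1.r x, e1.al x⟩).mono le_rfl ?_
    · rw [e4.ints 16 (by simp [Cmd.wi, cAlias]), c4.ints 16 (by simp), b16, a1]
    · rw [e4.ints 20 (by simp [Cmd.wi, cAlias]), c4.ints 20 (by simp), b20, a3]
    · have hp : s₄.pos = s.pos := e6.trans (b6.trans a6)
      have ho : s₄.out = s.out := e5.trans (b5.trans a5)
      rintro s₅ ⟨f1, f2⟩
      rw [hp] at f1 f2
      rw [ho] at f2
      exact ⟨f1, f2⟩

variable (I) in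
/-- The position of the tape at which the samples of the `q`-th group begin. -/
def startPos (m : Label → ℕ) (q : ℕ) : ℕ := sumLt (fun j => m (I.groupAt j)) q

variable (I) in
/-- The number of executed steps. -/
def steps (m : Label → ℕ) : ℕ :=
  (2 + I.n * (9 + 5 * I.k)) + (4 + ((2 + I.n * 7) + ((2 + I.n * 11) + ((2 + I.k * 3) +
    (2 + ∑ j : Fin I.numGroups, (13 + I.groupSize j * 22 + m (I.groupAt j) * 7 + 2))))))

theorem runs_main (hties : I.TiesToFirst) :
    Runs (I.oracle m) ω cMain I.initMem (I.steps m) fun s' =>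
      (∀ i, ω i ∈ Set.Ico (0 : ℝ) 1) → (s'.out : Multiset (ℤ × ℝ)) =
        I.centersOut + ∑ j, I.groupOut m ω j (I.startPos m j.val) := by
  have hz : ∀ a j, a ≠ 0 → I.initMem.ints a j = 0 ∧ I.initMem.reals a j = 0 := by
    intro a j ha
    simp [initMem, upd_apply, ha]
  have hI : I.Input I.initMem := by
    constructor <;> simp [initMem, upd_apply]
  refine runs_seq (((runs_assign hties hI fun j => ⟨(hz 3 j (by norm_num)).2,
    (hz 17 j (by norm_num)).1⟩).quiet rfl).mono le_rfl ?_)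
  rintro s₁ ⟨a1, a2, a3, a4⟩
  have hI₁ := hI.keeps a2 (by decide) (by decide)
  refine runs_seq (((runs_bounds hI₁).quiet rfl).mono le_rfl ?_)
  rintro s₂ ⟨b1, b2, b3, b4⟩
  have hI₂ := hI₁.keeps b2 (by decide) (by decide)
  have hA₂ := a1.keeps b2 (by decide) (by decide)
  refine runs_seq (((runs_levels hI₂ hA₂ b1 fun j => ⟨?_, ?_⟩).quiet rfl).mono le_rfl ?_)
  · rw [b2.reals 6 (by decide), a2.reals 6 (by decide), (hz 6 j (by norm_num)).2]
  · rw [b2.reals 7 (by decide), a2.reals 7 (by decide), (hz 7 j (by norm_num)).2]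
  rintro s₃ ⟨c1, c2, c3, c4⟩
  have hI₃ := hI₂.keeps c2 (by decide) (by decide)
  have hA₃ := hA₂.keeps c2 (by decide) (by decide)
  have hB₃ := b1.keeps c2 (by decide) (by decide)
  refine runs_seq (((runs_groups hI₃ hA₃ hB₃ c1 (fun j => ⟨?_, ?_, ?_⟩) ?_).quiet rfl).mono
    le_rfl ?_)
  · rw [c2.ints 8 (by decide), b2.ints 8 (by decide), a2.ints 8 (by decide),
      (hz 8 j (by norm_num)).1]
  · rw [c2.ints 12 (by decide), b2.ints 12 (by decide), a2.ints 12 (by decide),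
      (hz 12 j (by norm_num)).1]
  · rw [c2.reals 8 (by decide), b2.reals 8 (by decide), a2.reals 8 (by decide),
      (hz 8 j (by norm_num)).2]
  · rw [c2.ints 11 (by decide), b2.ints 11 (by decide), a2.ints 11 (by decide),
      (hz 11 0 (by norm_num)).1]
  rintro s₄ ⟨d1, d2, d3, d4⟩
  have hP : I.Prepared s₄ := ⟨hI₃.keeps d2 (by decide) (by decide),
    hA₃.keeps d2 (by decide) (by decide), hB₃.keeps d2 (by decide) (by decide),
    c1.keeps d2 (by decide) (by decide), d1⟩
  refine runs_seq (((runs_centers hP (d3.trans (c3.trans (b3.trans a3)))).keeps).mono le_rfl ?_)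
  rintro s₅ ⟨⟨e1, e2⟩, e3⟩
  have hP₅ := hP.keeps e3 (by simp [Cmd.wi, cCenters, Cmd.for]) (by simp [Cmd.wr, cCenters, Cmd.for])
  have hpos : s₅.pos = 0 := e1.trans (d4.trans (c4.trans (b4.trans a4)))
  refine Runs.mono (runs_for (v := 18) I.numGroups (by decide)
    (fun q t => t.pos = I.startPos m q ∧ ((∀ i, ω i ∈ Set.Ico (0 : ℝ) 1) →
      (t.out : Multiset (ℤ × ℝ)) = I.centersOut +
        sumLt (fun j : Fin I.numGroups => I.groupOut m ω j (I.startPos m j.val)) q))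
    -- The cost of a round is needed for all natural numbers; beyond the number of groups the value
    -- is irrelevant.
    (fun q => if h : q < I.numGroups then
      13 + I.groupSize ⟨q, h⟩ * 22 + m (I.groupAt ⟨q, h⟩) * 7 else 0)
    (fun q t x h => h) ?_ ⟨by simp [hpos, startPos], by simp [e2]⟩ ?_) (le_of_eq ?_) fun t h => ?_
  · intro t ht
    simp only [iv_geti, iv_const]
    rw [ht.ints 11 (by decide), hP₅.grouped.num, rankLt_all]
    rfl
  · intro q hq t h1 h2 h3
    have ht := hP₅.keeps h3 (by decide) (by decide)
    rw [dif_pos hq]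
    lift q to Fin I.numGroups using hq
    refine (runs_group ht h2).mono le_rfl ?_
    rintro t' ⟨h4, h5⟩
    rw [h1.1] at h4 h5
    refine ⟨?_, fun hω => ?_⟩
    · rw [h4, startPos, startPos, sumLt_succ]
    · rw [h5 hω, h1.2 hω, sumLt_succ, add_assoc]
  · congr 1
    rw [← Fin.sum_univ_eq_sum_range (fun q => (if h : q < I.numGroups then
      13 + I.groupSize ⟨q, h⟩ * 22 + m (I.groupAt ⟨q, h⟩) * 7 else 0) + 2)]
    simp
  · intro hω
    rw [h.2 hω, sumLt_all]

theorem sum_groups (f : Label → ℕ) : ∑ j : Fin I.numGroups, f (I.groupAt j) = ∑ g ∈ I.groups, f g := by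
  rw [← Finset.sum_coe_sort I.groups f]
  exact I.groupEquiv.sum_comp fun g => f g.1

/-- There are at most `n` groups with at most `n` members in total, and `k ≥ 1` absorbs both the
terms linear in `n` and the constants. -/
theorem steps_le : I.steps m ≤ 100 * (I.n * I.k + (I.k + ∑ g ∈ I.groups, m g)) := by
  have h1 := I.sum_groupSize_le
  have h2 := I.numGroups_le
  have h3 := sum_groups (I := I) m
  have h4 := I.one_le_k
  have h5 : I.n ≤ I.n * I.k := Nat.le_mul_of_pos_right _ h4
  have h6 : ∑ j : Fin I.numGroups, (13 + I.groupSize j * 22 + m (I.groupAt j) * 7 + 2) =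
      I.numGroups * 15 + (∑ j, I.groupSize j) * 22 + (∑ g ∈ I.groups, m g) * 7 := by
    simp only [Finset.sum_add_distrib, ← Finset.sum_mul, h3, Finset.sum_const, Finset.card_univ,
      Fintype.card_fin, smul_eq_mul]
    ring
  rw [steps, h6, mul_add, show I.n * (5 * I.k) = 5 * (I.n * I.k) by ring]
  omega

/-- The entry of the tape that is used by a sample. -/
def tapePos (s : I.Slot m) : ℕ := I.startPos m (I.groupEquiv.symm s.1).val + s.2.val

theorem startPos_add_le {j j' : Fin I.numGroups} (h : j < j') :
    I.startPos m j.val + m (I.groupAt j) ≤ I.startPos m j'.val := by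
  have h1 : I.startPos m j.val + m (I.groupAt j) = I.startPos m (j.val + 1) :=
    (sumLt_succ _ _).symm
  rw [h1]
  unfold startPos sumLt
  refine Finset.sum_le_sum fun i _ => ?_
  have : j.val + 1 ≤ j'.val := h
  split_ifs <;> omega

/-- Consecutive groups read disjoint intervals of the tape. This is the source of independence in
`law_of_samples`. -/
theorem tapePos_injective : Function.Injective (tapePos : I.Slot m → ℕ) := by
  have key : ∀ s s' : I.Slot m, I.groupEquiv.symm s.1 < I.groupEquiv.symm s'.1 →
      tapePos s < tapePos s' := by
    intro s s' h
    have h1 := startPos_add_le (m := m) h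
    have h2 : (I.groupAt (I.groupEquiv.symm s.1)) = s.1.1 := by
      rw [← groupEquiv_val, Equiv.apply_symm_apply]
    rw [h2] at h1
    have := s.2.2
    unfold tapePos
    omega
  intro s s' h
  rcases lt_trichotomy (I.groupEquiv.symm s.1) (I.groupEquiv.symm s'.1) with h1 | h1 | h1
  · exact absurd h (key _ _ h1).ne
  · obtain ⟨g, l⟩ := s
    obtain ⟨g', l'⟩ := s'
    obtain rfl := I.groupEquiv.symm.injective h1
    simp only [tapePos, Nat.add_left_cancel_iff] at h
    rw [Fin.ext h]
  · exact absurd h (key _ _ h1).ne'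

theorem output_eq (ω : ℕ → ℝ) :
    ((I.output m fun s => I.choice (I.oracle m) (I.groupEquiv.symm s.1) (ω (tapePos s))).map
      fun x => (I.handle x.1, x.2)) =
    I.centersOut + ∑ j, I.groupOut m ω j (I.startPos m j.val) := by
  have hsum : ∀ {ι : Type} [Fintype ι] (f : ι → ℤ × ℝ),
      (Finset.univ : Finset ι).val.map f = ∑ i, ({f i} : Multiset (ℤ × ℝ)) := by
    intro ι _ f
    have h := Multiset.sum_map_singleton ((Finset.univ : Finset ι).val.map f)
    rw [Multiset.map_map] at h
    exact h.symm
  rw [output, Multiset.map_add, Multiset.map_map, Multiset.map_map, hsum, hsum, Fintype.sum_sigma,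
    ← I.groupEquiv.sum_comp]
  simp only [tapePos, Equiv.symm_apply_apply, Function.comp_apply]
  rfl

theorem implementedWithin_cMain (hties : I.TiesToFirst) :
    I.ImplementedWithin m cMain (100 * (I.n * I.k + (I.k + ∑ g ∈ I.groups, m g))) := by
  refine ⟨fun ω _ => ?_, ?_⟩
  · obtain ⟨s', t', h1, h2, -⟩ := runs_main (m := m) (ω := ω) hties
    exact ⟨s', t', h1, h2.trans steps_le⟩
  · have hl : ∀ s : I.Slot m, I.groupAt (I.groupEquiv.symm s.1) = s.1.1 := fun s => by
      rw [← groupEquiv_val, Equiv.apply_symm_apply]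
    refine I.law_of_samples tapePos_injective
      (fun s => I.choice (I.oracle m) (I.groupEquiv.symm s.1))
      (fun s => I.region (I.oracle m) (I.groupEquiv.symm s.1))
      (fun s p => I.measurableSet_region _ _ _) (fun s p u hu => I.mem_region _ _ _ hu)
      (fun s p => by rw [volume_region, hl]) fun ω hω => ?_
    obtain ⟨s', t', h1, -, h2⟩ := runs_main (m := m) (ω := ω) hties
    exact ⟨s', t', h1, by rw [h2 hω, output_eq]⟩

end Setup

end
end KZCoreset

theorem theorem3p2 :
    ∃ (C₀ : ℝ) (B T : ℕ) (prog : KZCoreset.Cmd), 0 < C₀ ∧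
      ∀ c : ℝ, 1 ≤ c → ∃ K : ℝ, 0 < K ∧
        ∀ (X : Type*) [MetricSpace X] (I : KZCoreset.Setup X), I.IsApprox c →
          (∀ g ∈ I.groups, IsLeast {m : ℕ | I.Adequate C₀ g m} (I.Γ C₀ g)) ∧
          9 / 10 ≤ I.prob (I.quota C₀ B) (fun S => I.IsCoreset (K * I.ε) S) ∧
          (∀ ω, ((I.output (I.quota C₀ B) ω).card : ℝ) ≤
            (I.k : ℝ) + (2 : ℝ) ^ ((B : ℝ) * I.z) * ∑ g ∈ I.groups, (I.Γ C₀ g : ℝ)) ∧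
          (I.TiesToFirst → I.ImplementedWithin (I.quota C₀ B) prog
            (T * (I.n * I.k + (I.k + ∑ g ∈ I.groups, I.quota C₀ B g)))) := by
  exact ⟨1, 30, 100, KZCoreset.cMain, one_pos, fun c hc => ⟨40000 * c, by positivity,
    fun X _ I happ => ⟨fun g _ => I.isLeast_Γ 1 g, I.prob_isCoreset hc happ, I.card_output_le,
      fun hties => KZCoreset.Setup.implementedWithin_cMain hties⟩⟩⟩
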